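/- **Weights and blocks.** Fix a field $k$ and a number line whose vertices are indexed by a set $I\subseteq\mathbb Z$ of consecutive integers (finite or infinite). A *weight* is a labelling of the vertices by $\circ,\times,\vee,\wedge$ such that, outside some finite set of vertices, no two vertices are labelled $\vee,\wedge$ in that order from left to right. The *Bruhat order* $\le$ on weights is generated by swapping a $\vee$ with a $\wedge$ to the right of it, the weight in which the $\vee$ has moved to the right being the larger one. Write $\lambda\sim\mu$ if $\lambda\le\nu\ge\mu$ for some weight $\nu$; the $\sim$-classes are called *blocks*. **Diagrams.** A *cup diagram* consists of finitely many cups below the number line, each joining two vertices, and of rays going down from some vertices, without intersections. It is *oriented* by a weight $\lambda$ if the vertices not on cups or rays are labelled $\circ$ or $\times$, the two ends of each cup are labelled by one $\vee$ and one $\wedge$, all vertices on rays are labelled $\vee$ or $\wedge$, and no two vertices on rays are labelled $\vee,\wedge$ in that order from left to right. *Cap diagrams* are the mirror images of cup diagrams in the number line, and $c^*$ denotes the mirror image of $c$. For a weight $\alpha$ let $\underline\alpha$ be the unique cup diagram oriented by $\alpha$ in which the left end of every cup is labelled $\vee$, and let $\overline\alpha=(\underline\alpha)^*$. Write $\alpha\subset\lambda$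 (or $\lambda\supset\alpha$) if $\alpha\sim\lambda$ and $\underline\alpha$ is oriented by $\lambda$. If $\alpha\subset\lambda\supset\beta$, gluing $\underline\alpha$ below and $\overline\beta$ above $\lambda$ gives an *oriented circle diagram* $(\underline\alpha\lambda\overline\beta)$. **The algebra $K_\Lambda$.** Let $\Lambda$ be a block with finitely many elements. Then $K_\Lambda$ is the $k$-vector space with basis the $(\underline\alpha\lambda\overline\beta)$ for $\alpha,\lambda,\beta\in\Lambda$ with $\alpha\subset\lambda\supset\beta$, and the following multiplication. (a) *Closed diagrams.* Let the number line be finite and let $a\lambda b$, $c\mu d$ be oriented circle diagrams without rays, with $\lambda\sim\mu$. If $c\ne b^*$, then $(a\lambda b)(c\mu d)=0$. If $c=b^*$, draw $a\lambda b$ under $c\mu d$ and repeatedly replace a cap of $b$ and its mirror image in $c$, chosen so that they can be connected without crossings, by two vertical segments. Call a circle of type $1$ if its leftmost vertex is labelled $\vee$ and of type $x$ otherwise. Each such step merges two circles or splits one circle, and the circles involved are re-oriented by the rules $1\otimes1\mapsto1$, $1\otimes x\mapsto x$, $x\otimes1\mapsto x$, $x\otimes x\mapsto0$ for a merge and $1\mapsto1\otimes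 x+x\otimes1$, $x\mapsto x\otimes x$ for a split; the other circles keep their orientation. When no cap of $b$ is left, identify the two number lines. The product is the sum of the resulting diagrams $(a\nu d)$. (b) *Finite number line.* Let $p$ and $q$ be the numbers of $\wedge$'s and $\vee$'s in the weights of $\Lambda$. The closure $\mathrm{cl}(\lambda)$ is obtained from $\lambda$ by adding $p$ vertices labelled $\vee$ at the left end and $q$ vertices labelled $\wedge$ at the right end of the number line; put $\mathrm{cl}(\underline\alpha\lambda\overline\beta)=\underline{\mathrm{cl}(\alpha)}\,\mathrm{cl}(\lambda)\,\overline{\mathrm{cl}(\beta)}$. To multiply two basis vectors of $K_\Lambda$, multiply their closures as in (a), discard the diagrams whose weight is not of the form $\mathrm{cl}(\nu)$ with $\nu\in\Lambda$, and apply $\mathrm{cl}^{-1}$ to the rest. (c) *Infinite number line.* Choose a finite set $J\subset I$ of consecutive integers such that outside $J$ all weights of $\Lambda$ agree and no two vertices are labelled $\vee,\wedge$ in that order from left to right. The restrictions to $J$ of the weights of $\Lambda$ form a block $\Gamma$ in bijection with $\Lambda$, and the multiplication of $K_\Lambda$ is transported from $K_\Gamma$ by this bijection. **Cellular algebras.**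 An associative unital $k$-algebra $H$ is *cellular* with cell datum $(\Lambda,M,C,*)$ if 1. $\Lambda$ is a partially ordered set and $M(\lambda)$ is a finite set for each $\lambda\in\Lambda$; 2. $C:\dot\bigcup_{\lambda}M(\lambda)\times M(\lambda)\to H$, $(\alpha,\beta)\mapsto C^\lambda_{\alpha,\beta}$, is injective and its image is a basis of $H$; 3. $*:H\to H$ is an algebra anti-automorphism with $(C^\lambda_{\alpha,\beta})^*=C^\lambda_{\beta,\alpha}$; 4. for all $\mu\in\Lambda$ and $x\in H$ there are scalars $r_x(\gamma',\gamma)$, for $\gamma',\gamma\in M(\mu)$, with $xC^\mu_{\gamma,\delta}-\sum_{\gamma'\in M(\mu)}r_x(\gamma',\gamma)C^\mu_{\gamma',\delta}\in H(>\mu)$ for all $\gamma,\delta\in M(\mu)$, where $H(>\mu)$ is the span of the $C^\nu_{\gamma'',\delta''}$ with $\nu>\mu$ and $\gamma'',\delta''\in M(\nu)$. **Statement.** Let $\Lambda$ be a block with $|\Lambda|<\infty$, partially ordered by the Bruhat order. Then $K_\Lambda$ is an associative unital algebra, and it is cellular with cell datum $(\Lambda,M,C,*)$, where $M(\lambda)=\{\alpha\in\Lambda:\alpha\subset\lambda\}$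 for $\lambda\in\Lambda$, $C^\lambda_{\alpha,\beta}=(\underline\alpha\lambda\overline\beta)$ for $\alpha,\beta\in M(\lambda)$, and $*$ is the linear map with $(\underline\alpha\lambda\overline\beta)^*=(\underline\beta\lambda\overline\alpha)$. -/

import Mathlib

namespace ArcAlgebra

/-! ### Weights, Bruhat order, blocks -/

/-- The four labels: `nought` (`∘`), `cross` (`×`), `down` (`∨`), `up` (`∧`). -/
inductive Label
  | nought
  | cross
  | down
  | up
  deriving DecidableEq

instance : Fintype Label where
  elems := {Label.nought, Label.cross, Label.down, Label.up}
  complete l := by cases l <;> decide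

open scoped Classical

/-- A weight on the number line with vertex set `I ⊆ ℤ` (a set of consecutive integers).  The label
of an integer that is not a vertex carries no information and is set to `nought`. -/
@[ext]
structure Weight (I : Set ℤ) where
  label : ℤ → Label
  label_off : ∀ i, i ∉ I → label i = Label.nought
  tame : ∃ F : Finset ℤ, ∀ i j, i < j → i ∉ F → j ∉ F →
    ¬ (label i = Label.down ∧ label j = Label.up)

/-- `mu` arises from `lam` by swapping a `∨` with a `∧` further to the right, so that the `∨`
moves to the right. -/
def SwapUp {I : Set ℤ} (lam mu : Weight I) : Prop :=
  ∃ i j, i < j ∧ lam.label i = Label.down ∧ lam.label j = Label.up ∧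
    mu.label i = Label.up ∧ mu.label j = Label.down ∧
    ∀ k, k ≠ i → k ≠ j → mu.label k = lam.label k

/-- At the first vertex where the two weights differ, `lam` has `∨` and `mu` has `∧`. -/
def FirstDiff {I : Set ℤ} (lam mu : Weight I) : Prop :=
  ∃ i, (∀ j, j < i → lam.label j = mu.label j) ∧
    lam.label i = Label.down ∧ mu.label i = Label.up

theorem FirstDiff.trans {I : Set ℤ} {a b c : Weight I} (h : FirstDiff a b) (h' : FirstDiff b c) :
    FirstDiff a c := by
  obtain ⟨i, hi, ha, hb⟩ := h
  obtain ⟨i', hi', hb', hc⟩ := h'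
  rcases lt_trichotomy i i' with hlt | heq | hlt
  · exact ⟨i, fun j hj => (hi j hj).trans (hi' j (hj.trans hlt)), ha, (hi' i hlt).symm.trans hb⟩
  · subst heq
    rw [hb] at hb'
    cases hb'
  · exact ⟨i', fun j hj => (hi j (hj.trans hlt)).trans (hi' j hj), (hi i' hlt).trans hb', hc⟩

theorem firstDiff_of_transGen {I : Set ℤ} {a b : Weight I} (h : Relation.TransGen SwapUp a b) :
    FirstDiff a b := by
  have key : ∀ {x y : Weight I}, SwapUp x y → FirstDiff x y := by
    rintro x y ⟨i, j, hij, hi, -, hi', -, hk⟩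
    exact ⟨i, fun l hl => (hk l (by omega) (by omega)).symm, hi, hi'⟩
  induction h with
  | single h => exact key h
  | tail _ h ih => exact ih.trans (key h)

/-- The Bruhat order: the partial order generated by the moves `SwapUp`. -/
instance {I : Set ℤ} : PartialOrder (Weight I) where
  le := Relation.ReflTransGen SwapUp
  le_refl _ := Relation.ReflTransGen.refl
  le_trans _ _ _ := Relation.ReflTransGen.trans
  le_antisymm a b hab hba := by
    rcases Relation.reflTransGen_iff_eq_or_transGen.1 hab with h | h
    · exact h.symm
    · obtain ⟨i, -, h1, h2⟩ := firstDiff_of_transGen (h.trans_left hba)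
      rw [h1] at h2
      cases h2

/-- `lam ∼ mu`: the two weights differ by a permutation of `∨`'s and `∧`'s, i.e. they have a common
upper bound in the Bruhat order. -/
def Linked {I : Set ℤ} (lam mu : Weight I) : Prop := ∃ nu : Weight I, lam ≤ nu ∧ mu ≤ nu

/-- The block (`∼`-class) of the weight `lam0`, with the Bruhat order. -/
abbrev Block {I : Set ℤ} (lam0 : Weight I) : Type := {lam : Weight I // Linked lam0 lam}

/-! ### Cup diagrams -/

/-- A cup diagram on the number line with vertex set `I`: `arc i` is the other end of the cup at the
vertex `i` (and `arc i = i` if there is no cup at `i`), and `ray` is the set of vertices at the top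
of a ray.  A cap diagram is encoded by the cup diagram that is its mirror image in the number
line. -/
@[ext]
structure CupDiagram (I : Set ℤ) where
  arc : ℤ → ℤ
  ray : Set ℤ
  arc_mem : ∀ i, arc i ≠ i → i ∈ I
  ray_mem : ∀ i, i ∈ ray → i ∈ I
  arc_arc : ∀ i, arc (arc i) = i
  arc_ray : ∀ i, i ∈ ray → arc i = i
  finite : {i | arc i ≠ i}.Finite
  nested : ∀ i k, i < k → k < arc i → k ∉ ray ∧ i < arc k ∧ arc k < arc i

/-- The gluing of `a` under `lam` is an oriented cup diagram (equivalently, the gluing of the mirror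
image of `a` on top of `lam` is an oriented cap diagram). -/
def IsOriented {I : Set ℤ} (a : CupDiagram I) (lam : Weight I) : Prop :=
  (∀ i, a.arc i = i → i ∉ a.ray → lam.label i = Label.nought ∨ lam.label i = Label.cross) ∧
  (∀ i, a.arc i ≠ i → (lam.label i = Label.down ∧ lam.label (a.arc i) = Label.up) ∨
    (lam.label i = Label.up ∧ lam.label (a.arc i) = Label.down)) ∧
  (∀ i, i ∈ a.ray → lam.label i = Label.down ∨ lam.label i = Label.up) ∧
  (∀ i j, i ∈ a.ray → j ∈ a.ray → i < j →
    ¬ (lam.label i = Label.down ∧ lam.label j = Label.up))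

/-- `∨` counts `1`, `∧` counts `-1`, and `∘`, `×` count `0`. -/
def Label.sign : Label → ℤ
  | Label.nought => 0
  | Label.cross => 0
  | Label.down => 1
  | Label.up => -1

/-- Number of `∨`'s minus number of `∧`'s at the vertices `i, i + 1, …, k`. -/
noncomputable def Weight.excess {I : Set ℤ} (lam : Weight I) (i k : ℤ) : ℤ :=
  ∑ x ∈ Finset.Icc i k, (lam.label x).sign

/-- The vertices `i < j` are joined when neighbouring pairs `∨ ∧` are joined successively: reading
from `i` to the right, `j` is the first place where there are as many `∧`'s as `∨`'s. -/
def Weight.IsCup {I : Set ℤ} (lam : Weight I) (i j : ℤ) : Prop :=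
  i < j ∧ lam.excess i j = 0 ∧ ∀ k, i ≤ k → k < j → 0 < lam.excess i k

namespace Weight

variable {I : Set ℤ} (lam : Weight I)

theorem excess_split {i k j : ℤ} (h1 : i ≤ k + 1) (h2 : k ≤ j) :
    lam.excess i j = lam.excess i k + lam.excess (k + 1) j := by
  unfold excess
  rw [← Finset.sum_union]
  · congr 1
    ext x
    simp only [Finset.mem_union, Finset.mem_Icc]
    omega
  · rw [Finset.disjoint_left]
    intro x
    simp only [Finset.mem_Icc]
    omega

theorem excess_self (i : ℤ) : lam.excess i i = (lam.label i).sign := by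
  simp [excess]

theorem IsCup.left {i j : ℤ} (h : lam.IsCup i j) : lam.label i = Label.down := by
  have := h.2.2 i le_rfl h.1
  rw [excess_self] at this
  cases hl : lam.label i <;> simp [hl, Label.sign] at this ⊢

theorem IsCup.right {i j : ℤ} (h : lam.IsCup i j) : lam.label j = Label.up := by
  have h1 := h.2.2 (j - 1) (by have := h.1; omega) (by omega)
  have h2 := lam.excess_split (i := i) (k := j - 1) (j := j) (by have := h.1; omega) (by omega)
  rw [h.2.1, sub_add_cancel, excess_self] at h2
  cases hl : lam.label j <;> simp [hl, Label.sign] at h2 ⊢ <;> omega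

theorem IsCup.right_unique {i j j' : ℤ} (h : lam.IsCup i j) (h' : lam.IsCup i j') : j = j' := by
  rcases lt_trichotomy j j' with hlt | heq | hlt
  · have := h'.2.2 j h.1.le hlt
    have := h.2.1
    omega
  · exact heq
  · have := h.2.2 j' h'.1.le hlt
    have := h'.2.1
    omega

theorem IsCup.left_unique {i i' j : ℤ} (h : lam.IsCup i j) (h' : lam.IsCup i' j) : i = i' := by
  have key : ∀ {i i' : ℤ}, lam.IsCup i j → lam.IsCup i' j → ¬ i < i' := by
    intro i i' h h' hlt
    have h1 := h.2.2 (i' - 1) (by omega) (by have := h'.1; omega)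
    have h2 := lam.excess_split (i := i) (k := i' - 1) (j := j) (by omega)
      (by have := h'.1; omega)
    rw [sub_add_cancel, h.2.1, h'.2.1] at h2
    omega
  exact le_antisymm (not_lt.1 (key h' h)) (not_lt.1 (key h h'))

/-- A `∨` whose running excess vanishes somewhere to the right is the left end of a cup. -/
theorem exists_isCup_right {i m : ℤ} (hi : lam.label i = Label.down) (him : i ≤ m)
    (hm : lam.excess i m ≤ 0) : ∃ j, j ≤ m ∧ lam.IsCup i j := by
  have hex : ∃ n : ℕ, lam.excess i (i + n) ≤ 0 := by
    refine ⟨(m - i).toNat, ?_⟩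
    rwa [Int.toNat_of_nonneg (by omega), add_sub_cancel]
  have hmin : ∀ k, i ≤ k → k < i + (Nat.find hex : ℤ) → 0 < lam.excess i k := by
    intro k hk hk'
    have := Nat.find_min hex (m := (k - i).toNat) (by omega)
    rw [Int.toNat_of_nonneg (by omega), add_sub_cancel] at this
    omega
  have hspec := Nat.find_spec hex
  have hle : (Nat.find hex : ℤ) ≤ m - i := by
    have : Nat.find hex ≤ (m - i).toNat := Nat.find_min' hex (by
      rwa [Int.toNat_of_nonneg (by omega), add_sub_cancel])
    omega
  set n := Nat.find hex with hn
  have hpos : 0 < n := by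
    rcases Nat.eq_zero_or_pos n with h0 | h0
    · rw [h0, Nat.cast_zero, add_zero, excess_self, hi] at hspec
      simp [Label.sign] at hspec
    · exact h0
  refine ⟨i + n, by omega, by omega, ?_, hmin⟩
  have h1 := hmin (i + n - 1) (by omega) (by omega)
  have h2 := lam.excess_split (i := i) (k := i + n - 1) (j := i + n) (by omega) (by omega)
  rw [sub_add_cancel, excess_self] at h2
  have h3 : -1 ≤ (lam.label (i + n)).sign := by
    cases lam.label (i + n) <;> simp [Label.sign]
  omega

/-- A `∧` whose running excess to the left vanishes somewhere is the right end of a cup. -/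
theorem exists_isCup_left {m j : ℤ} (hj : lam.label j = Label.up) (hmj : m ≤ j)
    (hm : 0 ≤ lam.excess m j) : ∃ i, m ≤ i ∧ lam.IsCup i j := by
  have hex : ∃ n : ℕ, 0 ≤ lam.excess (j - n) j := by
    refine ⟨(j - m).toNat, ?_⟩
    rwa [Int.toNat_of_nonneg (by omega), sub_sub_cancel]
  have hmin : ∀ k, k ≤ j → j - (Nat.find hex : ℤ) < k → lam.excess k j < 0 := by
    intro k hk hk'
    have := Nat.find_min hex (m := (j - k).toNat) (by omega)
    rw [Int.toNat_of_nonneg (by omega), sub_sub_cancel] at this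
    omega
  have hspec := Nat.find_spec hex
  have hle : (Nat.find hex : ℤ) ≤ j - m := by
    have : Nat.find hex ≤ (j - m).toNat := Nat.find_min' hex (by
      rwa [Int.toNat_of_nonneg (by omega), sub_sub_cancel])
    omega
  set n := Nat.find hex with hn
  have hpos : 0 < n := by
    rcases Nat.eq_zero_or_pos n with h0 | h0
    · rw [h0, Nat.cast_zero, sub_zero, excess_self, hj] at hspec
      simp [Label.sign] at hspec
    · exact h0
  have h0 : lam.excess (j - n) j = 0 := by
    have h1 := hmin (j - n + 1) (by omega) (by omega)
    have h2 := lam.excess_split (i := j - n) (k := j - n) (j := j) (by omega) (by omega)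
    rw [excess_self] at h2
    have h3 : (lam.label (j - n)).sign ≤ 1 := by
      cases lam.label (j - n) <;> simp [Label.sign]
    omega
  refine ⟨j - n, by omega, by omega, h0, ?_⟩
  intro k hk hk'
  have h1 := hmin (k + 1) (by omega) (by omega)
  have h2 := lam.excess_split (i := j - n) (k := k) (j := j) (by omega) (by omega)
  omega

/-- The other end of the cup at `i`, or `i` itself if there is none. -/
noncomputable def cupPartner (i : ℤ) : ℤ :=
  if h : ∃ j, lam.IsCup i j then h.choose
  else if h : ∃ j, lam.IsCup j i then h.choose
  else i

theorem IsCup.partner_left {i j : ℤ} (h : lam.IsCup i j) : lam.cupPartner i = j := by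
  have hex : ∃ j, lam.IsCup i j := ⟨j, h⟩
  rw [cupPartner, dif_pos hex]
  exact hex.choose_spec.right_unique lam h

theorem IsCup.partner_right {i j : ℤ} (h : lam.IsCup i j) : lam.cupPartner j = i := by
  have hno : ¬ ∃ l, lam.IsCup j l := by
    rintro ⟨l, hl⟩
    have h1 := hl.left
    rw [h.right] at h1
    cases h1
  have hex : ∃ i, lam.IsCup i j := ⟨i, h⟩
  rw [cupPartner, dif_neg hno, dif_pos hex]
  exact hex.choose_spec.left_unique lam h

theorem cupPartner_cases (i : ℤ) : lam.IsCup i (lam.cupPartner i) ∨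
    lam.IsCup (lam.cupPartner i) i ∨
    (lam.cupPartner i = i ∧ (∀ j, ¬ lam.IsCup i j) ∧ ∀ j, ¬ lam.IsCup j i) := by
  by_cases h1 : ∃ j, lam.IsCup i j
  · obtain ⟨j, hj⟩ := h1
    left
    rwa [hj.partner_left]
  · by_cases h2 : ∃ j, lam.IsCup j i
    · obtain ⟨j, hj⟩ := h2
      right; left
      rwa [hj.partner_right]
    · right; right
      refine ⟨?_, not_exists.1 h1, not_exists.1 h2⟩
      rw [cupPartner, dif_neg h1, dif_neg h2]

theorem cupPartner_cupPartner (i : ℤ) : lam.cupPartner (lam.cupPartner i) = i := by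
  rcases lam.cupPartner_cases i with h | h | h
  · exact h.partner_right
  · exact h.partner_left
  · rw [h.1, h.1]

theorem mem_of_label_ne {i : ℤ} (h : lam.label i ≠ Label.nought) : i ∈ I := by
  by_contra hi
  exact h (lam.label_off i hi)

/-- The cup diagram of a weight: its cups join the pairs `IsCup`, and there are rays at all
remaining vertices labelled `∨` or `∧`. -/
noncomputable def cupDiagram : CupDiagram I where
  arc := lam.cupPartner
  ray := {i | lam.cupPartner i = i ∧ (lam.label i = Label.down ∨ lam.label i = Label.up)}
  arc_mem i hi := by
    apply lam.mem_of_label_ne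
    rcases lam.cupPartner_cases i with h | h | h
    · rw [h.left]; simp
    · rw [h.right]; simp
    · exact absurd h.1 hi
  ray_mem i hi := by
    apply lam.mem_of_label_ne
    rcases hi.2 with h | h <;> rw [h] <;> simp
  arc_arc := lam.cupPartner_cupPartner
  arc_ray i hi := hi.1
  finite := by
    obtain ⟨F, hF⟩ := lam.tame
    refine (F ∪ F.image lam.cupPartner).finite_toSet.subset ?_
    intro i hi
    have key : i ∈ F ∨ lam.cupPartner i ∈ F := by
      by_contra hcon
      push Not at hcon
      rcases lam.cupPartner_cases i with h | h | h
      · exact hF _ _ h.1 hcon.1 hcon.2 ⟨h.left, h.right⟩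
      · exact hF _ _ h.1 hcon.2 hcon.1 ⟨h.left, h.right⟩
      · exact hi h.1
    simp only [Finset.coe_union, Finset.coe_image, Set.mem_union, Finset.mem_coe, Set.mem_image]
    rcases key with h | h
    · exact Or.inl h
    · exact Or.inr ⟨_, h, lam.cupPartner_cupPartner i⟩
  nested := by
    intro i k hik hki
    have hc : lam.IsCup i (lam.cupPartner i) := by
      rcases lam.cupPartner_cases i with h | h | h
      · exact h
      · have := h.1; omega
      · have := h.1; omega
    set j := lam.cupPartner i with hj
    have hA := hc.2.2 (k - 1) (by omega) (by omega)
    have hB := hc.2.2 k (by omega) (by omega)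
    have hA' := lam.excess_split (i := i) (k := k - 1) (j := j) (by omega) (by omega)
    have hB' := lam.excess_split (i := i) (k := k - 1) (j := k) (by omega) (by omega)
    rw [sub_add_cancel] at hA' hB'
    have h0 := hc.2.1
    have hdown : lam.label k = Label.down → ∃ l, l < j ∧ lam.IsCup k l := by
      intro hk
      obtain ⟨l, hl, hkl⟩ := lam.exists_isCup_right hk (m := j) (by omega) (by omega)
      refine ⟨l, lt_of_le_of_ne hl ?_, hkl⟩
      rintro rfl
      have := hkl.left_unique lam hc
      omega
    have hup : lam.label k = Label.up → ∃ l, i < l ∧ lam.IsCup l k := by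
      intro hk
      obtain ⟨l, hl, hkl⟩ := lam.exists_isCup_left hk (m := i) (by omega) (by omega)
      refine ⟨l, lt_of_le_of_ne hl ?_, hkl⟩
      rintro rfl
      have := hkl.right_unique lam hc
      omega
    rcases lam.cupPartner_cases k with h | h | h
    · obtain ⟨l, hl, hkl⟩ := hdown h.left
      have := h.right_unique lam hkl
      refine ⟨fun hr => ?_, ?_, ?_⟩
      · have := hr.1; have := h.1; omega
      · have := h.1; omega
      · omega
    · obtain ⟨l, hl, hkl⟩ := hup h.right
      have := h.left_unique lam hkl
      refine ⟨fun hr => ?_, ?_, ?_⟩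
      · have := hr.1; have := h.1; omega
      · omega
      · have := h.1; omega
    · refine ⟨fun hr => ?_, by omega, by omega⟩
      rcases hr.2 with hk | hk
      · obtain ⟨l, -, hkl⟩ := hdown hk
        exact h.2.1 l hkl
      · obtain ⟨l, -, hkl⟩ := hup hk
        exact h.2.2 l hkl

/-- `cupDiagram` has the property that characterises the cup diagram of a weight: gluing it under
the weight gives an oriented cup diagram all of whose cups are anti-clockwise. -/
theorem cupDiagram_spec : IsOriented lam.cupDiagram lam ∧
    ∀ i, i < lam.cupDiagram.arc i → lam.label i = Label.down := by
  refine ⟨⟨?_, ?_, fun i hi => hi.2, ?_⟩, ?_⟩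
  · intro i h1 h2
    have h3 : ¬ (lam.label i = Label.down ∨ lam.label i = Label.up) := fun h => h2 ⟨h1, h⟩
    cases hl : lam.label i <;> simp [hl] at h3 ⊢
  · intro i hi
    rcases lam.cupPartner_cases i with h | h | h
    · exact Or.inl ⟨h.left, h.right⟩
    · exact Or.inr ⟨h.right, h.left⟩
    · exact absurd h.1 hi
  · rintro i j hi hj hij ⟨h1, h2⟩
    by_cases hle : lam.excess i j ≤ 0
    · obtain ⟨l, -, hl⟩ := lam.exists_isCup_right h1 hij.le hle
      have := hl.partner_left
      have := hi.1
      have := hl.1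
      omega
    · obtain ⟨l, -, hl⟩ := lam.exists_isCup_left h2 hij.le (by omega)
      have := hl.partner_right
      have := hj.1
      have := hl.1
      omega
  · intro i hi
    rcases lam.cupPartner_cases i with h | h | h
    · exact h.left
    · have h1 := h.1
      have h2 : i < lam.cupPartner i := hi
      omega
    · have h1 := h.1
      have h2 : i < lam.cupPartner i := hi
      omega

end Weight

/-- `mu ⊂ lam`: the weights lie in the same block and the cup diagram of `mu`, glued under `lam`,
is an oriented cup diagram. -/
def Sub {I : Set ℤ} (mu lam : Weight I) : Prop := Linked mu lam ∧ IsOriented mu.cupDiagram lam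

/-! ### The surgery procedure

All number lines in this section are finite and all cup and cap diagrams are closed (no rays). -/

/-- The vertices of a diagram with two number lines: `(i, false)` is the vertex `i` on the bottom
line and `(i, true)` is the vertex `i` on the top line. -/
abbrev StackVertex (L : Finset ℤ) : Type := {i : ℤ // i ∈ L} × Bool

/-- A labelling of all vertices of a diagram with two number lines. -/
abbrev StackLabelling (L : Finset ℤ) : Type := StackVertex L → Label

/-- A diagram with two number lines: the cup diagram `a` below the bottom line, the mirror image of
`d` above the top line, and the middle section obtained from the mirror image of `b` under `b` by
cutting the pairs of cap and cup whose left end belongs to `cut`. -/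
structure Stack (L : Finset ℤ) where
  a : CupDiagram (L : Set ℤ)
  b : CupDiagram (L : Set ℤ)
  d : CupDiagram (L : Set ℤ)
  cut : Finset ℤ

namespace Stack

variable {L : Finset ℤ} (D : Stack L)

/-- `u` and `v` are the two ends of a cup or a cap of the diagram. -/
def Curved (u v : StackVertex L) : Prop :=
  u.2 = v.2 ∧ u.1 ≠ v.1 ∧
    ((u.2 = false ∧ D.a.arc u.1 = v.1) ∨ (u.2 = true ∧ D.d.arc u.1 = v.1) ∨
      (D.b.arc u.1 = v.1 ∧ min (u.1 : ℤ) v.1 ∉ D.cut))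

/-- `u` and `v` are the two ends of a vertical line segment in the middle section. -/
def Vertical (u v : StackVertex L) : Prop :=
  u.2 ≠ v.2 ∧ u.1 = v.1 ∧ D.b.arc u.1 ≠ u.1 ∧ min (u.1 : ℤ) (D.b.arc u.1) ∈ D.cut

/-- `u` and `v` lie on the same circle. -/
def SameCircle (u v : StackVertex L) : Prop :=
  Relation.EqvGen (fun x y => D.Curved x y ∨ D.Vertical x y) u v

/-- The labelling orients the diagram: each cup or cap has one end labelled `∨` and one end labelled
`∧`, and the two ends of each vertical segment carry the same label. -/
def Oriented (w : StackLabelling L) : Prop :=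
  (∀ u v, D.Curved u v → (w u = Label.down ∧ w v = Label.up) ∨
    (w u = Label.up ∧ w v = Label.down)) ∧
  ∀ u v, D.Vertical u v → w u = w v

/-- The circle through `u` is clockwise (of type `x`): its leftmost vertex is labelled `∧`.
A circle that is not clockwise is anti-clockwise (of type `1`). -/
def Clockwise (w : StackLabelling L) (u : StackVertex L) : Prop :=
  ∃ v, D.SameCircle u v ∧ (∀ v', D.SameCircle u v' → v.1 ≤ v'.1) ∧ w v = Label.up

/-- The diagram after cutting the cap and the cup with left end `i` and inserting two vertical
segments instead. -/
def surgery (i : ℤ) : Stack L := { D with cut := insert i D.cut }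

/-- One step of the surgery procedure, at the cap and cup with ends `i`, `j`: the oriented diagram
`(D, w)` produces the oriented diagram `(D.surgery i, w')`, according to
`1 ⊗ 1 ↦ 1`, `1 ⊗ x ↦ x`, `x ⊗ 1 ↦ x`, `x ⊗ x ↦ 0` if the cap and the cup lie on different circles
(which are merged), and `1 ↦ 1 ⊗ x + x ⊗ 1`, `x ↦ x ⊗ x` if they lie on the same circle (which is
split).  The other circles keep their orientations. -/
def Produces (i j : {i : ℤ // i ∈ L}) (w w' : StackLabelling L) : Prop :=
  (D.surgery i).Oriented w' ∧
  (∀ u, ¬ D.SameCircle (i, false) u → ¬ D.SameCircle (i, true) u → w' u = w u) ∧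
  if D.SameCircle (i, false) (i, true) then
    (if D.Clockwise w (i, false) then
      (D.surgery i).Clockwise w' (i, false) ∧ (D.surgery i).Clockwise w' (j, false)
    else
      ((D.surgery i).Clockwise w' (i, false) ∧ ¬ (D.surgery i).Clockwise w' (j, false)) ∨
      (¬ (D.surgery i).Clockwise w' (i, false) ∧ (D.surgery i).Clockwise w' (j, false)))
  else
    ¬ (D.Clockwise w (i, false) ∧ D.Clockwise w (i, true)) ∧
    ((D.surgery i).Clockwise w' (i, false) ↔
      (D.Clockwise w (i, false) ∨ D.Clockwise w (i, true)))

/-- `D.count l w w'` is the number of times that the labelling `w'` arises at the end when surgery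
is applied to `(D, w)` successively at the caps and cups with the ends listed in `l`. -/
noncomputable def count : Stack L → List ({i : ℤ // i ∈ L} × {i : ℤ // i ∈ L}) →
    StackLabelling L → StackLabelling L → ℕ
  | _, [], w, w' => if w = w' then 1 else 0
  | D, (i, j) :: l, w, w' =>
      ∑ w₁ : StackLabelling L, if D.Produces i j w w₁ then count (D.surgery i) l w₁ w' else 0

end Stack

/-- The pairs (left end, right end) of the cups of `b`, with increasing left ends.  In this order
each cap is outermost among the remaining ones when it is cut, so that it can be connected to its
mirror image without crossings. -/
noncomputable def CupDiagram.cupList {L : Finset ℤ} (b : CupDiagram (L : Set ℤ)) :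
    List ({i : ℤ // i ∈ L} × {i : ℤ // i ∈ L}) :=
  (L.sort (· ≤ ·)).filterMap fun i =>
    if h : i ∈ L ∧ b.arc i ∈ L ∧ i < b.arc i then some (⟨i, h.1⟩, ⟨b.arc i, h.2.1⟩) else none

/-- The labelling with `lam` on the bottom line and `mu` on the top line. -/
def stackLabelling {L : Finset ℤ} (lam mu : Weight (L : Set ℤ)) : StackLabelling L :=
  fun u => if u.2 then mu.label u.1 else lam.label u.1

/-- The coefficient of `(a nu d)` in the product `(a lam b) (c mu d)` of closed oriented circle
diagrams in Khovanov's algebra.  The product is zero unless `c` is the mirror image of `b`; otherwise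
`(a lam b)` is drawn under `(c mu d)`, surgery is applied until the middle section consists of
vertical segments, and the two number lines are identified.  (All caps `b`, `d` are encoded by their
mirror images.)  The result does not depend on the admissible order in which the caps are cut. -/
noncomputable def khovanovCoeff {L : Finset ℤ} (a : CupDiagram (L : Set ℤ))
    (lam : Weight (L : Set ℤ)) (b c : CupDiagram (L : Set ℤ)) (mu : Weight (L : Set ℤ))
    (d : CupDiagram (L : Set ℤ)) (nu : Weight (L : Set ℤ)) : ℕ :=
  if b = c then
    Stack.count ⟨a, b, d, ∅⟩ b.cupList (stackLabelling lam mu) (stackLabelling nu nu)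
  else 0

/-! ### Truncation and closure of weights -/

/-- The restriction of a weight to the vertices in `J`. -/
def Weight.restrict {I : Set ℤ} (lam : Weight I) (J : Finset ℤ) : Weight (J : Set ℤ) where
  label i := if i ∈ J then lam.label i else Label.nought
  label_off i hi := if_neg hi
  tame := ⟨J, fun i j _ hi _ h => by simp [hi] at h⟩

/-- `J` is the vertex set of a bounded weight block `Γ ≺ Λ`, for `Λ` the block of `lam0`, such that
every weight in `Λ` is the extension of its restriction to `J`, a weight in `Γ`.  If the number line
is itself finite, only `J = I` is admitted (then `Γ = Λ`). -/
def IsTruncation {I : Set ℤ} (lam0 : Weight I) (J : Finset ℤ) : Prop :=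
  (J : Set ℤ) ⊆ I ∧ (J : Set ℤ).OrdConnected ∧ (I.Finite → (J : Set ℤ) = I) ∧
  (∀ i j, i < j → i ∉ J → j ∉ J → ¬ (lam0.label i = Label.down ∧ lam0.label j = Label.up)) ∧
  ∀ lam : Block lam0, ∀ i, i ∉ J → lam.1.label i = lam0.label i

/-- A chosen truncation; one exists for every finite block on a set of consecutive integers. -/
noncomputable def truncLine {I : Set ℤ} (lam0 : Weight I) : Finset ℤ :=
  if h : ∃ J, IsTruncation lam0 J then h.choose else ∅

/-- The number of vertices in `J` that `lam` labels by `l`. -/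
def Weight.numLabel {I : Set ℤ} (lam : Weight I) (J : Finset ℤ) (l : Label) : ℕ :=
  (J.filter fun i => lam.label i = l).card

/-- `p` new vertices to the left of `J`. -/
noncomputable def newLeft (J : Finset ℤ) (p : ℕ) : Finset ℤ :=
  if h : J.Nonempty then Finset.Ico (J.min' h - p) (J.min' h) else ∅

/-- `q` new vertices to the right of `J`. -/
noncomputable def newRight (J : Finset ℤ) (q : ℕ) : Finset ℤ :=
  if h : J.Nonempty then Finset.Ioc (J.max' h) (J.max' h + q) else ∅

/-- The number line `J` with `p` new vertices on the left and `q` new vertices on the right. -/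
noncomputable def closedLine (J : Finset ℤ) (p q : ℕ) : Finset ℤ := newLeft J p ∪ J ∪ newRight J q

/-- The closure of a weight: the new vertices on the left are labelled `∨` and those on the right
are labelled `∧`. -/
noncomputable def Weight.closure {J : Finset ℤ} (lam : Weight (J : Set ℤ)) (p q : ℕ) :
    Weight (closedLine J p q : Set ℤ) where
  label i :=
    if i ∈ J then lam.label i
    else if i ∈ newLeft J p then Label.down
    else if i ∈ newRight J q then Label.up
    else Label.nought
  label_off i hi := by
    simp only [closedLine, Finset.coe_union, Set.mem_union, Finset.mem_coe, not_or] at hi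
    simp [hi.1.1, hi.1.2, hi.2]
  tame := by
    refine ⟨closedLine J p q, fun i j _ hi _ h => ?_⟩
    simp only [closedLine, Finset.mem_union, not_or] at hi
    simp [hi.1.1, hi.1.2, hi.2] at h

/-- The number `p` of `∧`'s in the truncations of the weights of the block. -/
noncomputable def truncUp {I : Set ℤ} (lam0 : Weight I) : ℕ :=
  lam0.numLabel (truncLine lam0) Label.up

/-- The number `q` of `∨`'s in the truncations of the weights of the block. -/
noncomputable def truncDown {I : Set ℤ} (lam0 : Weight I) : ℕ :=
  lam0.numLabel (truncLine lam0) Label.down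

/-- The closure of the truncation of a weight in the block of `lam0`. -/
noncomputable def cl {I : Set ℤ} {lam0 : Weight I} (lam : Block lam0) :
    Weight (closedLine (truncLine lam0) (truncUp lam0) (truncDown lam0) : Set ℤ) :=
  (lam.1.restrict (truncLine lam0)).closure (truncUp lam0) (truncDown lam0)

/-! ### The algebra of a block -/

/-- The index set of the basis of `K`: triples `alpha ⊂ lam ⊃ beta` of weights in the block. -/
@[ext]
structure BasisIdx {I : Set ℤ} (lam0 : Weight I) where
  alpha : Block lam0
  lam : Block lam0
  beta : Block lam0
  alpha_sub : Sub alpha.1 lam.1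
  beta_sub : Sub beta.1 lam.1

/-- The underlying vector space of the algebra of the block of `lam0`; the basis vector indexed by
`(alpha, lam, beta)` is the oriented circle diagram obtained from `lam` by gluing the cup diagram of
`alpha` below and the cap diagram of `beta` above. -/
abbrev K (k : Type*) [Field k] {I : Set ℤ} (lam0 : Weight I) : Type _ := BasisIdx lam0 →₀ k

section Multiplication

variable (k : Type*) [Field k] {I : Set ℤ} (lam0 : Weight I)

/-- The product of two basis vectors: close both diagrams, multiply in Khovanov's algebra modulo the
basis vectors whose weight is not a closure, and apply the inverse of the closure map. -/
noncomputable def mulBasis (x y : BasisIdx lam0) : K k lam0 :=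
  ∑ᶠ z : BasisIdx lam0,
    if z.alpha = x.alpha ∧ z.beta = y.beta then
      Finsupp.single z
        (khovanovCoeff (cl x.alpha).cupDiagram (cl x.lam) (cl x.beta).cupDiagram
          (cl y.alpha).cupDiagram (cl y.lam) (cl y.beta).cupDiagram (cl z.lam) : k)
    else 0

/-- The multiplication of `K`, extended bilinearly from basis vectors. -/
noncomputable def mul : K k lam0 →ₗ[k] K k lam0 →ₗ[k] K k lam0 :=
  Finsupp.linearCombination k fun x => Finsupp.linearCombination k fun y => mulBasis k lam0 x y

/-- Reflection of oriented circle diagrams in the number line, on index triples. -/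
def BasisIdx.flip : BasisIdx lam0 ≃ BasisIdx lam0 where
  toFun x := ⟨x.beta, x.lam, x.alpha, x.beta_sub, x.alpha_sub⟩
  invFun x := ⟨x.beta, x.lam, x.alpha, x.beta_sub, x.alpha_sub⟩
  left_inv _ := rfl
  right_inv _ := rfl

/-- The linear map `*`, which reflects each oriented circle diagram in the number line. -/
noncomputable def star : K k lam0 →ₗ[k] K k lam0 :=
  Finsupp.lmapDomain k k (BasisIdx.flip lam0)

/-- The index set `M(lam)` of weights `alpha` in the block with `alpha ⊂ lam`. -/
abbrev M (lam : Block lam0) : Type := {alpha : Block lam0 // Sub alpha.1 lam.1}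

/-- The basis vector `C^lam_{alpha, beta}`. -/
noncomputable def C (lam : Block lam0) (alpha beta : M lam0 lam) : K k lam0 :=
  Finsupp.single ⟨alpha.1, lam, beta.1, alpha.2, beta.2⟩ 1

end Multiplication

/-! ### Cellular algebras -/

/-- The vector space `H` over `k` with the multiplication `mul` is a cellular algebra in the sense of
Graham and Lehrer, with cell datum `(Lam, M, C, star)`: it is an associative unital algebra and the
axioms of a cell datum hold (in the convention where `H(> mu)` is the ideal attached to `mu`). -/
structure IsCellular {k H Lam : Type*} [Field k] [AddCommGroup H] [Module k H] [PartialOrder Lam]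
    (mul : H →ₗ[k] H →ₗ[k] H) (M : Lam → Type*) (C : (lam : Lam) → M lam → M lam → H)
    (star : H →ₗ[k] H) : Prop where
  assoc : ∀ x y z, mul (mul x y) z = mul x (mul y z)
  unital : ∃ e, ∀ x, mul e x = x ∧ mul x e = x
  finite : ∀ lam, Finite (M lam)
  injective : Function.Injective fun t : (Σ lam, M lam × M lam) => C t.1 t.2.1 t.2.2
  linearIndependent : LinearIndependent k fun t : (Σ lam, M lam × M lam) => C t.1 t.2.1 t.2.2
  span : Submodule.span k
    (Set.range fun t : (Σ lam, M lam × M lam) => C t.1 t.2.1 t.2.2) = ⊤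
  star_bijective : Function.Bijective star
  star_mul : ∀ x y, star (mul x y) = mul (star y) (star x)
  star_C : ∀ lam alpha beta, star (C lam alpha beta) = C lam beta alpha
  mul_C : ∀ (mu : Lam) (x : H), ∃ r : M mu → M mu → k, ∀ gamma delta : M mu,
    mul x (C mu gamma delta) - ∑ᶠ gamma' : M mu, r gamma' gamma • C mu gamma' delta ∈
      Submodule.span k {h : H | ∃ nu : Lam, mu < nu ∧ ∃ g d : M nu, h = C nu g d}

end ArcAlgebra

/-! The surgery procedure is translated into multiplication in commutative rings. Let `S` be the set
of vertices at which arcs end. An even number of vertices of `S` lies under each arc, so directions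
that alternate along `S` are opposite at the two ends of every arc of every diagram on `S`. The
circles of a diagram thereby become the cycles of a permutation (`sameCircle_iff`), and one surgery
multiplies this permutation by one transposition (`stackPerm_insert`). Merging and splitting circles
is merging and splitting cycles.

The tensor product of one copy of ℤ[x]/(x²) per circle is the quotient of ℤ[X_v] by `circleIdeal`.
An orientation becomes the product of the variables of its clockwise circles, and a surgery becomes
multiplication by `1` (merge) or by `X p + X q` (split), see `Ready.step`. Hence the product of `(a
lam b)` and `(b mu d)` is multiplication by one element `surgeryFactor a b d` (`khovanov_sum`), and
the structure constants, which are natural numbers, are coefficients of monomials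
(`khovanovCoeff_eq`).

Associativity of Khovanov's product is then an identity between products of two surgery factors
(`surgeryFactor_assoc`). Both sides arise from a diagram with three number lines by cutting the arcs
in its two gaps, in the two possible orders. The transpositions involved commute, and the outcome of
commuting surgeries does not depend on their order (`chain_perm`). Two number lines joined by
vertical segments act as one line because the flow has the right first return map
(`Returns.chain_eq`).

The type of a circle is defined by its leftmost vertex, but it can be read at any vertex as the
label plus the parity of the number of vertices of the circle further left on the same line
(`circleType_const`). So the labels of a circle alternate along each number line, and a finite check
on parities shows that a surgery never increases the partial sums of signs (`Ready.height_le`). By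
`le_of_heightOn_le` these partial sums describe the Bruhat order, so a product only involves weights
above those of both factors. Consequently the closed diagrams that are discarded in the definition
of the algebra multiply into discarded ones (`exists_cl_eq`), and associativity passes to the block
(`blockCoeff_assoc`). The same monotonicity gives the triangularity required of a cell datum.

What remains of the cell axiom is that the coefficient of `(a mu d)` in `(a lam b) (b mu d)` does
not depend on `d` (`blockCoeff_top`). This follows by comparing coefficients at `mu` in the
associativity law for `(a lam b)`, `(b mu mu)`, `(mu mu d)`, because `(a mu mu) (mu mu d)` contains
`(a mu d)` with coefficient `1` (`khovanovCoeff_leading`). The identity is the sum of the diagrams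
`(al al al)`, for which all surgeries are merges with anti-clockwise circles. The map `*` reverses
products since surgery is symmetric under exchanging the two lines. -/

namespace ArcAlgebra
open scoped Classical
open MvPolynomial

/-! ### Multiplying a permutation by a transposition -/

section Swap

variable {V : Type*} (τ : Equiv.Perm V)

/-- Any equivalence relation relating each point to its image contains the orbit relation. -/
theorem sameCycle_le {r : V → V → Prop} (hr : Equivalence r) (h : ∀ x, r x (τ x)) {u v : V}
    (huv : τ.SameCycle u v) : r u v := by
  obtain ⟨n, rfl⟩ := huv
  have hnat : ∀ (n : ℕ) x, r x ((τ ^ n) x) := by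
    intro n
    induction n with
    | zero => intro x; exact hr.refl x
    | succ n ih =>
      intro x
      rw [pow_succ', Equiv.Perm.mul_apply]
      exact hr.trans (ih x) (h _)
  obtain ⟨m, rfl | rfl⟩ := n.eq_nat_or_neg
  · simpa using hnat m u
  · have := hnat m ((τ ^ (-(m : ℤ))) u)
    rw [← zpow_natCast, ← Equiv.Perm.mul_apply, ← zpow_add, add_neg_cancel, zpow_zero] at this
    exact hr.symm this

theorem sameCycle_apply (x : V) : τ.SameCycle x (τ x) := ⟨1, by simp⟩

/-- The join of an equivalence relation with the pair `p`, `q`. -/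
def joinRel (E : V → V → Prop) (p q u v : V) : Prop :=
  E u v ∨ (E u p ∧ E q v) ∨ (E u q ∧ E p v)

theorem joinRel_equivalence {E : V → V → Prop} (hE : Equivalence E) (p q : V) :
    Equivalence (joinRel E p q) where
  refl x := Or.inl (hE.refl x)
  symm := by
    have hs : ∀ x y, E x y → E y x := fun x y => hE.symm
    rintro x y (h | ⟨h, h'⟩ | ⟨h, h'⟩)
    · exact Or.inl (hE.symm h)
    · exact Or.inr (Or.inr ⟨hE.symm h', hE.symm h⟩)
    · exact Or.inr (Or.inl ⟨hE.symm h', hE.symm h⟩)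
  trans := by
    have hs : ∀ {x y}, E x y → E y x := fun {x y} => hE.symm
    have ht : ∀ {x y z}, E x y → E y z → E x z := fun {x y z} => hE.trans
    rintro x y z (h | ⟨h, h'⟩ | ⟨h, h'⟩) (k | ⟨k, k'⟩ | ⟨k, k'⟩)
    · exact Or.inl (ht h k)
    · exact Or.inr (Or.inl ⟨ht h k, k'⟩)
    · exact Or.inr (Or.inr ⟨ht h k, k'⟩)
    · exact Or.inr (Or.inl ⟨h, ht h' k⟩)
    · exact Or.inr (Or.inl ⟨h, k'⟩)
    · exact Or.inl (ht h k')
    · exact Or.inr (Or.inr ⟨h, ht h' k⟩)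
    · exact Or.inl (ht h k')
    · exact Or.inr (Or.inr ⟨h, k'⟩)

theorem sameCycle_equivalence : Equivalence τ.SameCycle :=
  ⟨fun x => Equiv.Perm.SameCycle.refl τ x, fun h => h.symm, fun h h' => h.trans h'⟩

variable [DecidableEq V]

/-- By `sameCycle_le` only the generating steps matter: the new permutation agrees with `τ` except
that `p` and `q` have exchanged their images. -/
theorem sameCycle_mul_swap_join (p q : V) {u v : V} (h : (τ * Equiv.swap p q).SameCycle u v) :
    joinRel τ.SameCycle p q u v := by
  refine sameCycle_le _ (joinRel_equivalence (sameCycle_equivalence τ) p q) (fun x => ?_) h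
  rw [Equiv.Perm.mul_apply]
  by_cases hp : x = p
  · subst hp
    rw [Equiv.swap_apply_left]
    exact Or.inr (Or.inl ⟨Equiv.Perm.SameCycle.refl _ _, sameCycle_apply τ q⟩)
  by_cases hq : x = q
  · subst hq
    rw [Equiv.swap_apply_right]
    exact Or.inr (Or.inr ⟨Equiv.Perm.SameCycle.refl _ _, sameCycle_apply τ p⟩)
  · rw [Equiv.swap_apply_of_ne_of_ne hp hq]
    exact Or.inl (sameCycle_apply τ x)

theorem join_sameCycle_mul_swap (p q : V) {u v : V} (h : τ.SameCycle u v) :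
    joinRel (τ * Equiv.swap p q).SameCycle p q u v := by
  apply sameCycle_mul_swap_join (τ * Equiv.swap p q) p q
  rwa [mul_assoc, Equiv.swap_mul_self, mul_one]

/-- After its first step from `q` to `τ p`, the new orbit follows the old orbit of `p` for as long
as that orbit avoids the two points at which the permutations differ. -/
theorem mul_swap_pow_apply (p q : V) {n : ℕ}
    (h : ∀ k, 0 < k → k < n → (τ ^ k) p ≠ p ∧ (τ ^ k) p ≠ q) (k : ℕ) (h0 : 0 < k) (hk : k ≤ n) :
    ((τ * Equiv.swap p q) ^ k) q = (τ ^ k) p := by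
  induction k with
  | zero => omega
  | succ k ih =>
    rw [pow_succ', Equiv.Perm.mul_apply, pow_succ', Equiv.Perm.mul_apply]
    rcases Nat.eq_zero_or_pos k with rfl | hpos
    · simp
    · rw [ih hpos (by omega), Equiv.Perm.mul_apply,
        Equiv.swap_apply_of_ne_of_ne (h k hpos (by omega)).1 (h k hpos (by omega)).2]

/-- The new orbit of `q` runs through the whole old cycle of `p`, which does not contain `q`, and so
arrives at `p` when that cycle closes. -/
theorem sameCycle_mul_swap [Finite V] {p q : V} (h : ¬ τ.SameCycle p q) :
    (τ * Equiv.swap p q).SameCycle p q := by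
  have hex : ∃ n : ℕ, 0 < n ∧ (τ ^ n) p = p := ⟨orderOf τ, orderOf_pos τ, by simp [pow_orderOf_eq_one]⟩
  have hn := Nat.find_spec hex
  have hmin := fun k => Nat.find_min hex (m := k)
  set n := Nat.find hex
  have := mul_swap_pow_apply τ p q (n := n) (fun k h0 hk => ⟨fun he => hmin k hk ⟨h0, he⟩,
    fun he => h ⟨k, by simpa using he⟩⟩) n hn.1 le_rfl
  rw [hn.2] at this
  exact Equiv.Perm.SameCycle.symm ⟨n, by simpa using this⟩

/-- If `τ` first takes `p` to `q` in `n` steps, the new orbit of `q` consists of the `n` points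
after `p` up to `q`. It closes up there and misses `p`. -/
theorem not_sameCycle_mul_swap [Finite V] {p q : V} (hpq : p ≠ q) (h : τ.SameCycle p q) :
    ¬ (τ * Equiv.swap p q).SameCycle p q := by
  have hex : ∃ n : ℕ, (τ ^ n) p = q := h.exists_nat_pow_eq
  have hn := Nat.find_spec hex
  have hmin := fun k => Nat.find_min hex (m := k)
  set n := Nat.find hex
  have hn0 : 0 < n := by
    rcases Nat.eq_zero_or_pos n with h0 | h0
    · rw [h0] at hn; exact absurd hn (by simpa using hpq)
    · exact h0
  have hne : ∀ k, 0 < k → k < n → (τ ^ k) p ≠ p ∧ (τ ^ k) p ≠ q := by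
    -- A return to `p` at time `k` would bring the orbit to `q` already at time `n - k`.
    refine fun k h0 hk => ⟨fun he => hmin (n - k) (by omega) ?_, hmin k hk⟩
    have : (τ ^ n) p = (τ ^ (n - k)) ((τ ^ k) p) := by
      rw [← Equiv.Perm.mul_apply, ← pow_add, Nat.sub_add_cancel hk.le]
    rw [he, hn] at this
    exact this.symm
  have key := mul_swap_pow_apply τ p q hne
  intro hs
  obtain ⟨m, hm⟩ := hs.symm.exists_nat_pow_eq
  have hper : ((τ * Equiv.swap p q) ^ n) q = q := (key n hn0 le_rfl).trans hn
  have hmod : ((τ * Equiv.swap p q) ^ (m % n)) q = p := by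
    conv_lhs at hm => rw [← Nat.mod_add_div m n, pow_add, Equiv.Perm.mul_apply, pow_mul]
    rwa [Equiv.Perm.pow_apply_eq_self_of_apply_eq_self hper] at hm
  rcases Nat.eq_zero_or_pos (m % n) with h0 | h0
  · rw [h0] at hmod; exact hpq (by simpa using hmod.symm)
  · have h1 := key (m % n) h0 (Nat.mod_lt _ hn0).le
    rw [hmod] at h1
    exact (hne (m % n) h0 (Nat.mod_lt _ hn0)).1 h1.symm

/-- Merging two cycles. -/
theorem sameCycle_merge [Finite V] {p q : V} (h : ¬ τ.SameCycle p q) (u v : V) :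
    (τ * Equiv.swap p q).SameCycle u v ↔ joinRel τ.SameCycle p q u v := by
  refine ⟨sameCycle_mul_swap_join τ p q, ?_⟩
  have h1 := sameCycle_mul_swap τ h
  have hle : ∀ {x y}, τ.SameCycle x y → (τ * Equiv.swap p q).SameCycle x y := by
    intro x y hxy
    rcases join_sameCycle_mul_swap τ p q hxy with h | ⟨h, h'⟩ | ⟨h, h'⟩
    · exact h
    · exact h.trans (h1.trans h')
    · exact h.trans (h1.symm.trans h')
  rintro (h | ⟨h, h'⟩ | ⟨h, h'⟩)
  · exact hle h
  · exact (hle h).trans (h1.trans (hle h'))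
  · exact (hle h).trans (h1.symm.trans (hle h'))

/-- Splitting a cycle. -/
theorem sameCycle_split [Finite V] {p q : V} (hpq : p ≠ q) (h : τ.SameCycle p q) (u v : V) :
    τ.SameCycle u v ↔ joinRel (τ * Equiv.swap p q).SameCycle p q u v := by
  have := sameCycle_merge (τ * Equiv.swap p q) (not_sameCycle_mul_swap τ hpq h) u v
  rwa [mul_assoc, Equiv.swap_mul_self, mul_one] at this

end Swap

/-! ### The ring of a family of circles -/

section Ring

variable {V : Type*}

/-- The ideal generated by the squares of the variables and the differences of the variables on a
common circle. -/
noncomputable def circleIdeal (E : V → V → Prop) : Ideal (MvPolynomial V ℤ) :=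
  Ideal.span ({f | ∃ v, f = X v ^ 2} ∪ {f | ∃ u v, E u v ∧ f = X u - X v})

theorem X_sq_mem (E : V → V → Prop) (v : V) : (X v : MvPolynomial V ℤ) ^ 2 ∈ circleIdeal E :=
  Ideal.subset_span (Or.inl ⟨v, rfl⟩)

theorem X_sub_mem {E : V → V → Prop} {u v : V} (h : E u v) :
    (X u : MvPolynomial V ℤ) - X v ∈ circleIdeal E :=
  Ideal.subset_span (Or.inr ⟨u, v, h, rfl⟩)

/-- A ring homomorphism followed by multiplication with a fixed element is semilinear, so it
suffices to test generators. The factor `c` is what allows maps such as a split, which are not ring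
homomorphisms. -/
theorem map_mem_of_circleIdeal {W : Type*} {E : V → V → Prop} {J : Ideal (MvPolynomial W ℤ)}
    (φ : MvPolynomial V ℤ →+* MvPolynomial W ℤ) (c : MvPolynomial W ℤ)
    (h1 : ∀ v, c * φ (X v) ^ 2 ∈ J) (h2 : ∀ u v, E u v → c * (φ (X u) - φ (X v)) ∈ J)
    {f : MvPolynomial V ℤ} (hf : f ∈ circleIdeal E) : c * φ f ∈ J := by
  induction hf using Submodule.span_induction with
  | mem x hx =>
    rcases hx with ⟨v, rfl⟩ | ⟨u, v, huv, rfl⟩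
    · simpa using h1 v
    · simpa using h2 u v huv
  | zero => simp
  | add x y _ _ hx hy => rw [map_add, mul_add]; exact J.add_mem hx hy
  | smul r x _ hx =>
    rw [smul_eq_mul, map_mul, mul_left_comm]
    exact J.mul_mem_left _ hx

theorem rename_mem_circleIdeal {W : Type*} {E : V → V → Prop} {E' : W → W → Prop} (g : V → W)
    (h : ∀ u v, E u v → E' (g u) (g v)) {f : MvPolynomial V ℤ} (hf : f ∈ circleIdeal E) :
    rename g f ∈ circleIdeal E' := by
  have := map_mem_of_circleIdeal (J := circleIdeal E') (rename g : MvPolynomial V ℤ →ₐ[ℤ] _).toRingHom 1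
    (fun v => by simpa using X_sq_mem E' (g v)) (fun u v huv => by simpa using X_sub_mem (h u v huv)) hf
  simpa using this

variable [DecidableEq V]

/-- The image of `1` under one step of surgery: `1` for a merge and `1 ⊗ x + x ⊗ 1` for a split. -/
noncomputable def stepFactor (τ : Equiv.Perm V) (p q : V) : MvPolynomial V ℤ :=
  if τ.SameCycle p q then X p + X q else 1

/-- The image of `1` under the successive surgeries at the pairs listed. -/
noncomputable def chain : Equiv.Perm V → List (V × V) → MvPolynomial V ℤ
  | _, [] => 1
  | τ, (p, q) :: l => stepFactor τ p q * chain (τ * Equiv.swap p q) l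

/-- The product of the listed transpositions. -/
noncomputable def swaps (l : List (V × V)) : Equiv.Perm V := (l.map fun x => Equiv.swap x.1 x.2).prod

@[simp] theorem swaps_nil : swaps ([] : List (V × V)) = 1 := rfl

@[simp] theorem swaps_cons (x : V × V) (l : List (V × V)) :
    swaps (x :: l) = Equiv.swap x.1 x.2 * swaps l := by simp [swaps]

theorem chain_append (τ : Equiv.Perm V) (l l' : List (V × V)) :
    chain τ (l ++ l') = chain τ l * chain (τ * swaps l) l' := by
  induction l generalizing τ with
  | nil => simp [chain]
  | cons x l ih => simp [chain, ih, mul_assoc]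

/-- A surgery is well defined on the quotient rings. A merge only adds relations. A split loses the
relation X_p = X_q, but the factor X_p + X_q makes up for it, since (X_p + X_q)(X_p - X_q) is a
difference of two squares of variables. -/
theorem stepFactor_mul_mem [Finite V] {τ : Equiv.Perm V} {p q : V} (hpq : p ≠ q)
    {f : MvPolynomial V ℤ} (hf : f ∈ circleIdeal τ.SameCycle) :
    stepFactor τ p q * f ∈ circleIdeal (τ * Equiv.swap p q).SameCycle := by
  refine map_mem_of_circleIdeal (RingHom.id _) _ (fun v => Ideal.mul_mem_left _ _ (X_sq_mem _ v))
    (fun u v huv => ?_) hf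
  simp only [RingHom.id_apply]
  set E' := (τ * Equiv.swap p q).SameCycle with hE'
  unfold stepFactor
  split_ifs with h
  · have hsq : ((X p : MvPolynomial V ℤ) + X q) * (X p - X q) ∈ circleIdeal E' := by
      have : ((X p : MvPolynomial V ℤ) + X q) * (X p - X q) = X p ^ 2 - X q ^ 2 := by ring
      rw [this]
      exact sub_mem (X_sq_mem _ _) (X_sq_mem _ _)
    rcases (sameCycle_split τ hpq h u v).1 huv with h1 | ⟨h1, h2⟩ | ⟨h1, h2⟩
    · exact Ideal.mul_mem_left _ _ (X_sub_mem h1)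
    · have : ((X p : MvPolynomial V ℤ) + X q) * (X u - X v) =
        (X p + X q) * (X u - X p) + (X p + X q) * (X p - X q) + (X p + X q) * (X q - X v) := by ring
      rw [this]
      exact add_mem (add_mem (Ideal.mul_mem_left _ _ (X_sub_mem h1)) hsq)
        (Ideal.mul_mem_left _ _ (X_sub_mem h2))
    · have : ((X p : MvPolynomial V ℤ) + X q) * (X u - X v) =
        (X p + X q) * (X u - X q) - (X p + X q) * (X p - X q) + (X p + X q) * (X p - X v) := by ring
      rw [this]
      exact add_mem (sub_mem (Ideal.mul_mem_left _ _ (X_sub_mem h1)) hsq)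
        (Ideal.mul_mem_left _ _ (X_sub_mem h2))
  · rw [one_mul]
    exact X_sub_mem ((sameCycle_merge τ h u v).2 (Or.inl huv))

theorem chain_mul_mem [Finite V] {τ : Equiv.Perm V} {l : List (V × V)} (hl : ∀ x ∈ l, x.1 ≠ x.2)
    {f : MvPolynomial V ℤ} (hf : f ∈ circleIdeal τ.SameCycle) :
    chain τ l * f ∈ circleIdeal (τ * swaps l).SameCycle := by
  induction l generalizing τ f with
  | nil => simpa [chain] using hf
  | cons x l ih =>
    obtain ⟨p, q⟩ := x
    have h1 := stepFactor_mul_mem (hl (p, q) (by simp)) hf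
    have h2 := ih (fun x hx => hl x (by simp [hx])) h1
    rw [swaps_cons, ← mul_assoc, chain, mul_right_comm, mul_comm]
    simpa [mul_comm, mul_left_comm] using h2

/-- Two surgeries at disjoint places commute. -/
theorem stepFactor_comm [Finite V] {τ : Equiv.Perm V} {p q r s : V} (hpq : p ≠ q)
    (hrs : r ≠ s)
    (hcomm : τ * Equiv.swap p q * Equiv.swap r s = τ * Equiv.swap r s * Equiv.swap p q) :
    stepFactor τ p q * stepFactor (τ * Equiv.swap p q) r s -
      stepFactor τ r s * stepFactor (τ * Equiv.swap r s) p q ∈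
      circleIdeal (τ * Equiv.swap p q * Equiv.swap r s).SameCycle := by
  have hE := sameCycle_equivalence τ
  have hE1 := sameCycle_equivalence (τ * Equiv.swap p q)
  have hE2 := sameCycle_equivalence (τ * Equiv.swap r s)
  have hE3 := sameCycle_equivalence (τ * Equiv.swap p q * Equiv.swap r s)
  have step : ∀ (σ : Equiv.Perm V) (x y : V), x ≠ y →
      (σ.SameCycle x y → ¬ (σ * Equiv.swap x y).SameCycle x y ∧
        (∀ u v, (σ * Equiv.swap x y).SameCycle u v → σ.SameCycle u v) ∧
        ∀ u v, σ.SameCycle u v → joinRel (σ * Equiv.swap x y).SameCycle x y u v) ∧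
      (¬ σ.SameCycle x y → (σ * Equiv.swap x y).SameCycle x y ∧
        (∀ u v, σ.SameCycle u v → (σ * Equiv.swap x y).SameCycle u v) ∧
        ∀ u v, (σ * Equiv.swap x y).SameCycle u v → joinRel σ.SameCycle x y u v) := by
    refine fun σ x y hxy => ⟨fun h => ⟨not_sameCycle_mul_swap σ hxy h,
      fun u v huv => (sameCycle_split σ hxy h u v).2 (Or.inl huv),
      fun u v => (sameCycle_split σ hxy h u v).1⟩, fun h => ⟨sameCycle_mul_swap σ h,
      fun u v huv => (sameCycle_merge σ h u v).2 (Or.inl huv),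
      fun u v => (sameCycle_merge σ h u v).1⟩⟩
  have A1 := step τ p q hpq
  have A2 := step τ r s hrs
  have A3 := step (τ * Equiv.swap p q) r s hrs
  have A4 := step (τ * Equiv.swap r s) p q hpq
  rw [← hcomm] at A4
  unfold stepFactor
  -- From here on only the four equivalence relations count: initial, after the first or the second
  -- surgery alone, and final.
  generalize (τ * Equiv.swap p q * Equiv.swap r s).SameCycle = E3 at *
  generalize (τ * Equiv.swap p q).SameCycle = E1 at *
  generalize (τ * Equiv.swap r s).SameCycle = E2 at *
  generalize τ.SameCycle = E at *
  clear hcomm step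
  have hX : ∀ {u v}, E3 u v → (X u : MvPolynomial V ℤ) - X v ∈ circleIdeal E3 := X_sub_mem
  have key : E3 p r ∧ E3 q s ∨ E3 p s ∧ E3 q r →
      (X p : MvPolynomial V ℤ) + X q - (X r + X s) ∈ circleIdeal E3 := by
    rintro (⟨h, h'⟩ | ⟨h, h'⟩)
    · have := add_mem (hX h) (hX h')
      convert this using 1; ring
    · have := add_mem (hX h) (hX h')
      convert this using 1; ring
  have s3 : ∀ {x y}, E3 x y → E3 y x := fun {x y} => hE3.symm
  have t3 : ∀ {x y z}, E3 x y → E3 y z → E3 x z := fun {x y z} => hE3.trans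
  -- Of the sixteen patterns of splits and merges, ten are contradictory and four give the same
  -- product in both orders. The other two are "split, then merge" in both orders and "merge, then
  -- split" in both orders. There the factors X_p + X_q and X_r + X_s must be identified, because
  -- the final circles through `p`, `q` are those through `r`, `s`.
  by_cases a : E p q <;> by_cases b : E1 r s <;> by_cases c : E r s <;> by_cases d : E2 p q <;>
    simp only [a, b, c, d, if_true, if_false, not_true, not_false_iff, mul_one, one_mul, sub_self,
      Ideal.zero_mem, false_imp_iff, forall_const, true_and, and_true] at A1 A2 A3 A4 ⊢
  · rw [mul_comm, sub_self]; exact Ideal.zero_mem _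
  · exact absurd (A3.2.1 _ _ A4.1) A1.1
  · exact absurd (A1.2.1 _ _ b) c
  · exact absurd (A1.2.1 _ _ b) c
  · exact absurd (A4.2.1 _ _ A3.1) A2.1
  · apply key
    rcases A1.2.2 _ _ c with h | ⟨h, h'⟩ | ⟨h, h'⟩
    · exact absurd h b
    · have e := s3 (A3.2.1 _ _ h)
      exact Or.inl ⟨e, t3 (s3 A4.1) (t3 e A3.1)⟩
    · have e := s3 (A3.2.1 _ _ h)
      exact Or.inr ⟨t3 A4.1 (t3 e A3.1), e⟩
  · exact absurd (A2.2.1 _ _ a) d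
  · exact absurd (A2.2.1 _ _ d) a
  · have conv : ∀ {x}, E1 x p → x = r ∨ x = s → E3 r p ∨ E3 s p := by
      intro x hx hxr
      have hr3 := hE3.refl
      rcases A3.2.2 _ _ hx with h | ⟨h, h'⟩ | ⟨h, h'⟩
      · rcases hxr with rfl | rfl
        · exact Or.inl h
        · exact Or.inr h
      · exact Or.inr h'
      · exact Or.inl h'
    have conv' : ∀ {x}, E1 x q → x = r ∨ x = s → E3 r q ∨ E3 s q := by
      intro x hx hxr
      rcases A3.2.2 _ _ hx with h | ⟨h, h'⟩ | ⟨h, h'⟩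
      · rcases hxr with rfl | rfl
        · exact Or.inl h
        · exact Or.inr h
      · exact Or.inr h'
      · exact Or.inl h'
    have fin : (E3 r p ∨ E3 s p) → (E3 r q ∨ E3 s q) → E3 p r ∧ E3 q s ∨ E3 p s ∧ E3 q r := by
      rintro (h | h) (h' | h')
      · exact absurd (t3 (s3 h) h') A4.1
      · exact Or.inl ⟨s3 h, s3 h'⟩
      · exact Or.inr ⟨s3 h, s3 h'⟩
      · exact absurd (t3 (s3 h) h') A4.1
    have : E3 p r ∧ E3 q s ∨ E3 p s ∧ E3 q r := by
      rcases A1.2.2 _ _ b with h | ⟨h, h'⟩ | ⟨h, h'⟩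
      · exact absurd h c
      · exact fin (conv (A1.2.1 _ _ h) (Or.inl rfl)) (conv' (hE1.symm (A1.2.1 _ _ h')) (Or.inr rfl))
      · exact fin (conv (hE1.symm (A1.2.1 _ _ h')) (Or.inr rfl)) (conv' (A1.2.1 _ _ h) (Or.inl rfl))
    rw [← neg_sub]
    exact neg_mem (key this)
  · exact absurd (A4.2.1 _ _ A2.1) A3.1
  · exact absurd (A1.2.1 _ _ c) b
  · exact absurd (A1.2.1 _ _ c) b
  · exact absurd (A3.2.1 _ _ A1.1) A4.1

/-- The result of a sequence of pairwise commuting surgeries does not depend on their order. -/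
theorem chain_perm [Finite V] {l l' : List (V × V)} (h : l.Perm l') (τ : Equiv.Perm V)
    (hl : ∀ x ∈ l, x.1 ≠ x.2)
    (hc : ∀ x ∈ l, ∀ y ∈ l, Commute (Equiv.swap x.1 x.2) (Equiv.swap y.1 y.2)) :
    swaps l = swaps l' ∧ chain τ l - chain τ l' ∈ circleIdeal (τ * swaps l).SameCycle := by
  induction h generalizing τ with
  | nil => simp
  | cons x h ih =>
    rename_i l1 l2
    obtain ⟨h1, h2⟩ := ih (τ * Equiv.swap x.1 x.2) (fun y hy => hl y (by simp [hy]))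
      (fun y hy z hz => hc y (by simp [hy]) z (by simp [hz]))
    refine ⟨by rw [swaps_cons, swaps_cons, h1], ?_⟩
    rw [chain, chain, ← mul_sub, swaps_cons, ← mul_assoc]
    exact Ideal.mul_mem_left _ _ h2
  | swap x y l =>
    have hcomm := hc x (by simp) y (by simp)
    refine ⟨by rw [swaps_cons, swaps_cons, swaps_cons, swaps_cons, ← mul_assoc, ← mul_assoc,
      hcomm.eq], ?_⟩
    have hcomm' : τ * Equiv.swap y.1 y.2 * Equiv.swap x.1 x.2 =
        τ * Equiv.swap x.1 x.2 * Equiv.swap y.1 y.2 := by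
      rw [mul_assoc, mul_assoc, hcomm.eq]
    have h1 := stepFactor_comm (hl y (by simp)) (hl x (by simp)) hcomm'
    have h2 := chain_mul_mem (l := l) (fun z hz => hl z (by simp [hz])) h1
    rw [swaps_cons, swaps_cons, ← mul_assoc, ← mul_assoc]
    convert h2 using 1
    simp only [chain]
    rw [hcomm']
    ring
  | trans h1 h2 ih1 ih2 =>
    obtain ⟨a1, a2⟩ := ih1 τ hl hc
    obtain ⟨b1, b2⟩ := ih2 τ (fun x hx => hl x (h1.mem_iff.2 hx))
      (fun x hx y hy => hc x (h1.mem_iff.2 hx) y (h1.mem_iff.2 hy))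
    refine ⟨a1.trans b1, ?_⟩
    rw [← a1] at b2
    have := add_mem a2 b2
    rwa [sub_add_sub_cancel] at this

end Ring
end ArcAlgebra

namespace ArcAlgebra
open scoped Classical
open MvPolynomial

/-! ### The basis of the ring of a family of circles -/

section Mono

variable {V : Type*}

/-- A chosen element of the class of `v`. -/
noncomputable def rep (E : V → V → Prop) (v : V) : V := @Classical.epsilon V ⟨v⟩ (E v)

theorem rel_rep {E : V → V → Prop} (hE : Equivalence E) (v : V) : E v (rep E v) :=
  @Classical.epsilon_spec_aux V ⟨v⟩ (E v) ⟨v, hE.refl v⟩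

theorem class_eq {E : V → V → Prop} (hE : Equivalence E) {u v : V} (h : E u v) : E u = E v := by
  funext x
  exact propext ⟨fun hx => hE.trans (hE.symm h) hx, fun hx => hE.trans h hx⟩

/-- The representative is chosen from the class alone, not from the relation. Circles that survive a
surgery therefore keep their representative, and the untouched parts of monomials are literally
equal. -/
theorem rep_congr {E E' : V → V → Prop} {u v : V} (h : E u = E' v) : rep E u = rep E' v := by
  simp only [rep, h]

theorem rep_eq_iff {E : V → V → Prop} (hE : Equivalence E) {u v : V} :
    rep E u = rep E v ↔ E u v := by
  refine ⟨fun h => ?_, fun h => rep_congr (class_eq hE h)⟩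
  have h1 := rel_rep hE u
  rw [h] at h1
  exact hE.trans h1 (hE.symm (rel_rep hE v))

theorem rep_rep {E : V → V → Prop} (hE : Equivalence E) (v : V) : rep E (rep E v) = rep E v :=
  (rep_eq_iff hE).2 (hE.symm (rel_rep hE v))

theorem sum_single_apply (T : Finset V) (v : V) :
    (∑ u ∈ T, Finsupp.single u 1 : V →₀ ℕ) v = if v ∈ T then 1 else 0 := by
  simp [Finsupp.finsetSum_apply, Finsupp.single_apply]

variable [Fintype V]

/-- The representatives of the classes in `t`. -/
noncomputable def repSet (E : V → V → Prop) (t : V → Prop) : Finset V :=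
  Finset.univ.filter fun v => rep E v = v ∧ t v

/-- The product of the variables belonging to the classes in `t`. -/
noncomputable def mono (E : V → V → Prop) (t : V → Prop) : MvPolynomial V ℤ :=
  ∏ v ∈ repSet E t, X v

/-- Modulo the ideal each variable may be replaced by that of its representative, so any transversal
of the classes in `t` yields the same monomial. -/
theorem prod_sub_mono_mem {E : V → V → Prop} (hE : Equivalence E) {t : V → Prop}
    (ht : ∀ u v, E u v → t u → t v) {ι : Type*} (T : Finset ι) (g : ι → V)
    (hT : ∀ i ∈ T, t (g i)) (hex : ∀ u, t u → ∃ i ∈ T, E u (g i))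
    (hu : ∀ i ∈ T, ∀ j ∈ T, E (g i) (g j) → i = j) :
    ∏ i ∈ T, X (g i) - mono E t ∈ circleIdeal E := by
  rw [← Ideal.Quotient.eq, mono, map_prod, map_prod]
  refine Finset.prod_bij (fun i _ => rep E (g i)) ?_ ?_ ?_ ?_
  · intro i hi
    simp only [repSet, Finset.mem_filter, Finset.mem_univ, true_and]
    exact ⟨rep_rep hE _, ht _ _ (rel_rep hE _) (hT i hi)⟩
  · intro i hi j hj hij
    exact hu i hi j hj ((rep_eq_iff hE).1 hij)
  · intro v hv
    simp only [repSet, Finset.mem_filter, Finset.mem_univ, true_and] at hv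
    obtain ⟨i, hi, h⟩ := hex v hv.2
    refine ⟨i, hi, ?_⟩
    exact ((rep_eq_iff hE).2 (hE.symm h)).trans hv.1
  · intro i hi
    rw [Ideal.Quotient.eq]
    exact X_sub_mem (rel_rep hE _)

/-- The part of `mono` outside `U`. -/
noncomputable def monoOff (E : V → V → Prop) (t : V → Prop) (U : V → Prop) : MvPolynomial V ℤ :=
  ∏ v ∈ repSet E fun v => t v ∧ ¬ U v, X v

theorem monoOff_congr {E E' : V → V → Prop} {t t' U : V → Prop}
    (h : ∀ v, ¬ U v → E v = E' v ∧ (t v ↔ t' v)) : monoOff E t U = monoOff E' t' U := by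
  unfold monoOff repSet
  congr 1
  ext v
  simp only [Finset.mem_filter, Finset.mem_univ, true_and]
  constructor
  · rintro ⟨h1, h2, h3⟩
    exact ⟨by rw [← rep_congr (h v h3).1]; exact h1, (h v h3).2.1 h2, h3⟩
  · rintro ⟨h1, h2, h3⟩
    exact ⟨by rw [rep_congr (h v h3).1]; exact h1, (h v h3).2.2 h2, h3⟩

/-- The variable `X p` if `t p` holds, and `1` otherwise. -/
noncomputable def mark (t : V → Prop) (p : V) : MvPolynomial V ℤ := if t p then X p else 1

/-- This isolates the factors of the two circles that take part in a surgery: the untouched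
representatives together with the marked ones among `p`, `q` form a transversal. -/
theorem mono_two {E : V → V → Prop} (hE : Equivalence E) {t : V → Prop}
    (ht : ∀ u v, E u v → t u → t v) {p q : V} (hpq : ¬ E p q) :
    monoOff E t (fun v => E p v ∨ E q v) * (mark t p * mark t q) - mono E t ∈ circleIdeal E := by
  have hne : p ≠ q := fun h => hpq (h ▸ hE.refl p)
  have h1 : mark t p * mark t q = ∏ v ∈ ({p, q} : Finset V).filter t, X v := by
    rw [Finset.prod_filter, Finset.prod_pair hne]
    rfl
  have hdisj : Disjoint (repSet E fun v => t v ∧ ¬ (E p v ∨ E q v))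
      (({p, q} : Finset V).filter t) := by
    rw [Finset.disjoint_left]
    intro v hv hv'
    simp only [repSet, Finset.mem_filter, Finset.mem_univ, true_and, Finset.mem_insert,
      Finset.mem_singleton] at hv hv'
    rcases hv'.1 with rfl | rfl
    · exact hv.2.2 (Or.inl (hE.refl _))
    · exact hv.2.2 (Or.inr (hE.refl _))
  rw [h1, monoOff, ← Finset.prod_union hdisj]
  refine prod_sub_mono_mem hE ht _ (fun v => v) ?_ ?_ ?_
  · intro v hv
    simp only [repSet, Finset.mem_union, Finset.mem_filter, Finset.mem_univ, true_and] at hv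
    rcases hv with hv | hv
    · exact hv.2.1
    · exact hv.2
  · intro u hu
    by_cases h : E p u ∨ E q u
    · rcases h with h | h
      · exact ⟨p, by simp [ht _ _ (hE.symm h) hu], hE.symm h⟩
      · exact ⟨q, by simp [ht _ _ (hE.symm h) hu], hE.symm h⟩
    · refine ⟨rep E u, ?_, rel_rep hE u⟩
      simp only [repSet, Finset.mem_union, Finset.mem_filter, Finset.mem_univ, true_and]
      refine Or.inl ⟨rep_rep hE u, ht _ _ (rel_rep hE u) hu, fun h' => h ?_⟩
      rcases h' with h' | h'
      · exact Or.inl (hE.trans h' (hE.symm (rel_rep hE u)))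
      · exact Or.inr (hE.trans h' (hE.symm (rel_rep hE u)))
  · intro u hu v hv huv
    simp only [repSet, Finset.mem_union, Finset.mem_filter, Finset.mem_univ, true_and,
      Finset.mem_insert, Finset.mem_singleton] at hu hv
    rcases hu with ⟨hu, -, hu'⟩ | ⟨hu, -⟩ <;> rcases hv with ⟨hv, -, hv'⟩ | ⟨hv, -⟩
    · rw [← hu, ← hv]; exact (rep_eq_iff hE).2 huv
    · rcases hv with rfl | rfl
      · exact absurd (Or.inl (hE.symm huv)) hu'
      · exact absurd (Or.inr (hE.symm huv)) hu'
    · rcases hu with rfl | rfl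
      · exact absurd (Or.inl huv) hv'
      · exact absurd (Or.inr huv) hv'
    · rcases hu with rfl | rfl <;> rcases hv with rfl | rfl
      · rfl
      · exact absurd huv hpq
      · exact absurd (hE.symm huv) hpq
      · rfl

theorem mono_one {E : V → V → Prop} (hE : Equivalence E) {t : V → Prop}
    (ht : ∀ u v, E u v → t u → t v) (p : V) :
    monoOff E t (fun v => E p v) * mark t p - mono E t ∈ circleIdeal E := by
  have h1 : mark t p = ∏ v ∈ ({p} : Finset V).filter t, X v := by
    rw [Finset.prod_filter, Finset.prod_singleton]
    rfl
  have hdisj : Disjoint (repSet E fun v => t v ∧ ¬ E p v) (({p} : Finset V).filter t) := by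
    rw [Finset.disjoint_left]
    intro v hv hv'
    simp only [repSet, Finset.mem_filter, Finset.mem_univ, true_and,
      Finset.mem_singleton] at hv hv'
    obtain ⟨rfl, -⟩ := hv'
    exact hv.2.2 (hE.refl _)
  rw [h1, monoOff, ← Finset.prod_union hdisj]
  refine prod_sub_mono_mem hE ht _ (fun v => v) ?_ ?_ ?_
  · intro v hv
    simp only [repSet, Finset.mem_union, Finset.mem_filter, Finset.mem_univ, true_and] at hv
    rcases hv with hv | hv
    · exact hv.2.1
    · exact hv.2
  · intro u hu
    by_cases h : E p u
    · exact ⟨p, by simp [ht _ _ (hE.symm h) hu], hE.symm h⟩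
    · refine ⟨rep E u, ?_, rel_rep hE u⟩
      simp only [repSet, Finset.mem_union, Finset.mem_filter, Finset.mem_univ, true_and]
      exact Or.inl ⟨rep_rep hE u, ht _ _ (rel_rep hE u) hu,
        fun h' => h (hE.trans h' (hE.symm (rel_rep hE u)))⟩
  · intro u hu v hv huv
    simp only [repSet, Finset.mem_union, Finset.mem_filter, Finset.mem_univ, true_and,
      Finset.mem_singleton] at hu hv
    rcases hu with ⟨hu, -, hu'⟩ | ⟨rfl, -⟩ <;> rcases hv with ⟨hv, -, hv'⟩ | ⟨rfl, -⟩
    · rw [← hu, ← hv]; exact (rep_eq_iff hE).2 huv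
    · exact absurd (hE.symm huv) hu'
    · exact absurd huv hv'
    · rfl

/-- The coefficient of `mono E t` modulo `circleIdeal E`. -/
noncomputable def coeffAt (E : V → V → Prop) (t : V → Prop) (f : MvPolynomial V ℤ) : ℤ :=
  coeff (∑ v ∈ repSet E t, Finsupp.single v 1) (rename (rep E) f)

theorem coeffAt_sub (E : V → V → Prop) (t : V → Prop) (f g : MvPolynomial V ℤ) :
    coeffAt E t (f - g) = coeffAt E t f - coeffAt E t g := by
  simp [coeffAt]

theorem coeffAt_intCast_mul (E : V → V → Prop) (t : V → Prop) (n : ℤ) (f : MvPolynomial V ℤ) :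
    coeffAt E t ((n : MvPolynomial V ℤ) * f) = n * coeffAt E t f := by
  rw [coeffAt, map_mul, map_intCast, ← map_intCast (MvPolynomial.C (σ := V) (R := ℤ)), coeff_C_mul,
    Int.cast_id, coeffAt]

theorem coeffAt_sum (E : V → V → Prop) (t : V → Prop) {ι : Type*} (s : Finset ι)
    (f : ι → MvPolynomial V ℤ) : coeffAt E t (∑ i ∈ s, f i) = ∑ i ∈ s, coeffAt E t (f i) := by
  simp [coeffAt, coeff_sum]

/-- Renaming variables to representatives kills the differences, and the monomial whose coefficient
is taken is squarefree, so multiples of a square do not contribute. -/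
theorem coeffAt_eq_zero {E : V → V → Prop} (hE : Equivalence E) (t : V → Prop)
    {f : MvPolynomial V ℤ} (hf : f ∈ circleIdeal E) : coeffAt E t f = 0 := by
  -- The arbitrary multiplier `g` makes the statement stable under multiplication by ring elements.
  have key : ∀ g, coeff (∑ v ∈ repSet E t, Finsupp.single v 1) (g * rename (rep E) f) = 0 := by
    unfold circleIdeal at hf
    induction hf using Submodule.span_induction with
    | mem x hx =>
      intro g
      rcases hx with ⟨v, rfl⟩ | ⟨u, v, huv, rfl⟩
      · rw [map_pow, rename_X, pow_two, ← mul_assoc, coeff_mul_X']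
        split_ifs with h
        · rw [coeff_mul_X', if_neg]
          rw [Finsupp.mem_support_iff, not_not, Finsupp.tsub_apply, sum_single_apply]
          split_ifs <;> simp
        · rfl
      · rw [map_sub, rename_X, rename_X, (rep_eq_iff hE).2 huv, sub_self, mul_zero, coeff_zero]
    | zero => simp
    | add x y _ _ hx hy => intro g; rw [map_add, mul_add, coeff_add, hx, hy, add_zero]
    | smul r x _ hx => intro g; rw [smul_eq_mul, map_mul, ← mul_assoc, hx]
  have := key 1
  rwa [one_mul] at this

/-- The representatives are fixed by the renaming, so `mono E t'` stays a monomial. Its exponent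
records the representatives in `t'`, and these determine the invariant predicate `t'`. -/
theorem coeffAt_mono {E : V → V → Prop} (hE : Equivalence E) {t t' : V → Prop}
    (ht : ∀ u v, E u v → t u → t v) (ht' : ∀ u v, E u v → t' u → t' v) :
    coeffAt E t (mono E t') = if t = t' then 1 else 0 := by
  have h1 : rename (rep E) (mono E t') = monomial (∑ v ∈ repSet E t', Finsupp.single v 1) 1 := by
    rw [mono, map_prod, monomial_sum_one]
    refine Finset.prod_congr rfl fun v hv => ?_
    simp only [repSet, Finset.mem_filter] at hv
    rw [rename_X, hv.2.1, X]
  rw [coeffAt, h1, coeff_monomial]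
  refine if_congr ⟨fun h => ?_, fun h => by rw [h]⟩ rfl rfl
  have key : ∀ v, v ∈ repSet E t ↔ v ∈ repSet E t' := by
    intro v
    have := DFunLike.congr_fun h v
    rw [sum_single_apply, sum_single_apply] at this
    split_ifs at this <;> simp_all
  funext v
  have hv := key (rep E v)
  simp only [repSet, Finset.mem_filter, Finset.mem_univ, true_and, rep_rep hE] at hv
  have hr := rel_rep hE v
  exact propext ⟨fun h => ht' _ _ (hE.symm hr) (hv.1 (ht _ _ hr h)),
    fun h => ht _ _ (hE.symm hr) (hv.2 (ht' _ _ hr h))⟩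

end Mono
end ArcAlgebra

namespace ArcAlgebra
open scoped Classical
open MvPolynomial

/-! ### Vertices, arcs and parities -/

section Vertices

variable {L : Finset ℤ} {S : Set ℤ}

/-- The vertices of the number line `L`. -/
abbrev Vtx (L : Finset ℤ) : Type := {i : ℤ // i ∈ L}

/-- The cup diagrams whose cups have their ends at the vertices in `S`. -/
abbrev Arcs (L : Finset ℤ) (S : Set ℤ) : Type :=
  {c : CupDiagram (L : Set ℤ) // ∀ i, c.arc i ≠ i ↔ i ∈ S}

theorem arc_mem_line (c : CupDiagram (L : Set ℤ)) {i : ℤ} (hi : i ∈ L) : c.arc i ∈ L := by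
  by_cases h : c.arc i = i
  · rwa [h]
  · have := c.arc_mem (c.arc i) (by rw [c.arc_arc]; exact fun h' => h h'.symm)
    simpa using this

/-- The other end of the arc at a vertex. -/
def arcMap (a : Arcs L S) (i : Vtx L) : Vtx L := ⟨a.1.arc i, arc_mem_line a.1 i.2⟩

theorem coe_arcMap (a : Arcs L S) (i : Vtx L) : (arcMap a i : ℤ) = a.1.arc i := rfl

@[simp] theorem arcMap_arcMap (a : Arcs L S) (i : Vtx L) : arcMap a (arcMap a i) = i :=
  Subtype.ext (a.1.arc_arc i)

theorem arc_mem_supp (a : Arcs L S) {i : ℤ} : a.1.arc i ∈ S ↔ i ∈ S := by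
  rw [← a.2, ← a.2, a.1.arc_arc]
  exact ne_comm

theorem arcMap_ne {a : Arcs L S} {i : Vtx L} (h : (i : ℤ) ∈ S) : arcMap a i ≠ i :=
  fun h' => (a.2 i).2 h (congrArg Subtype.val h')

theorem arcMap_eq {a : Arcs L S} {i : Vtx L} (h : (i : ℤ) ∉ S) : arcMap a i = i := by
  have := mt (a.2 i).1 h
  rw [ne_eq, not_not] at this
  exact Subtype.ext this

/-- The parity of the number of vertices to the left of `x` that satisfy `P`. -/
noncomputable def parityLeft (L : Finset ℤ) (P : ℤ → Prop) (x : ℤ) : ZMod 2 :=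
  ∑ k ∈ L, if k < x ∧ P k then 1 else 0

/-- The vertices strictly under an arc are paired off by the arcs nested in it, so they contribute
an even number and only the left end itself counts. -/
theorem parityLeft_arc (a : Arcs L S) {P : ℤ → Prop} (hS : ∀ k, P k → k ∈ S) {i : ℤ}
    (hi : i ∈ L) (hlt : i < a.1.arc i)
    (hP : ∀ k ∈ L, i < k → k < a.1.arc i → (P k ↔ P (a.1.arc k))) :
    parityLeft L P (a.1.arc i) = parityLeft L P i + if P i then 1 else 0 := by
  have h0 : ∑ k ∈ L.filter (fun k => i < k ∧ k < a.1.arc i), (if P k then 1 else 0 : ZMod 2) = 0 := by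
    refine Finset.sum_involution (fun k _ => a.1.arc k) ?_ ?_ ?_ ?_
    · intro k hk
      simp only [Finset.mem_filter] at hk
      rw [if_congr (hP k hk.1 hk.2.1 hk.2.2).symm rfl rfl]
      split_ifs
      · rfl
      · simp
    · intro k hk hne
      have : P k := by by_contra h; simp [h] at hne
      exact (a.2 k).2 (hS k this)
    · intro k hk
      simp only [Finset.mem_filter] at hk ⊢
      have := a.1.nested i k hk.2.1 hk.2.2
      exact ⟨arc_mem_line _ hk.1, this.2.1, this.2.2⟩
    · intro k hk
      exact a.1.arc_arc k
  have h1 : (if P i then 1 else 0 : ZMod 2) = ∑ k ∈ L, if k = i ∧ P k then 1 else 0 := by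
    rw [Finset.sum_eq_single i]
    · simp
    · intro k _ hk; simp [hk]
    · intro h; exact absurd hi h
  rw [Finset.sum_filter] at h0
  have h2 : ∀ x y z : ZMod 2, z = 0 → x = y + z → x = y := fun x y z hz h => by
    rw [h, hz, add_zero]
  refine h2 _ _ _ h0 ?_
  rw [h1]
  unfold parityLeft
  rw [← Finset.sum_add_distrib, ← Finset.sum_add_distrib]
  clear h0 h1
  refine Finset.sum_congr rfl fun k _ => ?_
  rcases lt_trichotomy k i with h | h | h
  · have h' : k < a.1.arc i := h.trans hlt
    simp [h, h', h.ne, h.not_gt]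
  · subst h
    simp [hlt]
  · by_cases h' : k < a.1.arc i
    · simp [h, h', h.ne', h.not_gt]
    · simp [h, h', h.ne', h.not_gt]

/-- The alternating orientation: `alt L S i` means that the flow through the vertex `i` goes
down. -/
def alt (L : Finset ℤ) (S : Set ℤ) (i : ℤ) : Prop := parityLeft L (· ∈ S) i = 0

theorem zmod_two_cases (x : ZMod 2) : x = 0 ∨ x = 1 := by
  revert x; decide

/-- An even number of vertices of `S` lies under each arc. The alternating orientation depends on
`S` only, so it directs the arcs of all diagrams with support `S` at the same time. -/
theorem alt_arc (a : Arcs L S) {i : ℤ} (hi : i ∈ L) (hS : i ∈ S) :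
    alt L S (a.1.arc i) ↔ ¬ alt L S i := by
  have key : ∀ {j : ℤ}, j ∈ L → j ∈ S → j < a.1.arc j → (alt L S (a.1.arc j) ↔ ¬ alt L S j) := by
    intro j hj hjS hlt
    have := parityLeft_arc a (P := (· ∈ S)) (fun k hk => hk) hj hlt
      (fun k _ _ _ => (arc_mem_supp a).symm)
    unfold alt
    rw [this, if_pos hjS]
    rcases zmod_two_cases (parityLeft L (· ∈ S) j) with h | h <;> rw [h] <;> decide
  rcases lt_or_gt_of_ne ((a.2 i).2 hS) with h | h
  · have := key (j := a.1.arc i) (arc_mem_line _ hi) ((arc_mem_supp a).2 hS) (by rwa [a.1.arc_arc])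
    rw [a.1.arc_arc] at this
    tauto
  · exact key hi hS h

theorem alt_arcMap (a : Arcs L S) {i : Vtx L} (hS : (i : ℤ) ∈ S) :
    alt L S (arcMap a i) ↔ ¬ alt L S i := alt_arc a i.2 hS

/-- The flow on the circle diagram with lower arcs `a` and upper arcs `b`. -/
noncomputable def linePerm (a b : Arcs L S) : Equiv.Perm (Vtx L) where
  toFun i := if alt L S i then arcMap a i else arcMap b i
  invFun i := if alt L S i then arcMap b i else arcMap a i
  left_inv i := by
    by_cases hS : (i : ℤ) ∈ S
    · by_cases h : alt L S i
      · simp [h, alt_arcMap a hS]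
      · simp [h, alt_arcMap b hS]
    · by_cases h : alt L S i <;> simp [h, arcMap_eq hS]
  right_inv i := by
    by_cases hS : (i : ℤ) ∈ S
    · by_cases h : alt L S i
      · simp [h, alt_arcMap b hS]
      · simp [h, alt_arcMap a hS]
    · by_cases h : alt L S i <;> simp [h, arcMap_eq hS]

theorem linePerm_apply (a b : Arcs L S) (i : Vtx L) :
    linePerm a b i = if alt L S i then arcMap a i else arcMap b i := rfl

variable {Λ : Type*}

/-- A permutation on each of several number lines. -/
def layered {X : Type*} (e : Λ → Equiv.Perm X) : Equiv.Perm (X × Λ) where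
  toFun v := (e v.2 v.1, v.2)
  invFun v := ((e v.2).symm v.1, v.2)
  left_inv v := by simp
  right_inv v := by simp

@[simp] theorem layered_apply {X : Type*} (e : Λ → Equiv.Perm X) (v : X × Λ) :
    layered e v = (e v.2 v.1, v.2) := rfl

/-- The arc of `b` at `i` has been cut. -/
def IsCut (b : Arcs L S) (cut : Finset ℤ) (i : Vtx L) : Prop :=
  (i : ℤ) ∈ S ∧ min (i : ℤ) (b.1.arc i) ∈ cut

theorem isCut_arcMap (b : Arcs L S) (cut : Finset ℤ) (i : Vtx L) :
    IsCut b cut (arcMap b i) ↔ IsCut b cut i := by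
  unfold IsCut
  rw [coe_arcMap, arc_mem_supp, b.1.arc_arc, min_comm]

/-- The exchange of the targets of the flow at the arcs that have been cut. -/
noncomputable def gapFun (lo hi : Λ) (b : Arcs L S) (cut : Finset ℤ) (v : Vtx L × Λ) :
    Vtx L × Λ :=
  if v.2 = lo ∧ ¬ alt L S v.1 ∧ IsCut b cut v.1 then (arcMap b v.1, hi)
  else if v.2 = hi ∧ alt L S v.1 ∧ IsCut b cut v.1 then (arcMap b v.1, lo) else v

theorem gapFun_involutive {lo hi : Λ} (h : lo ≠ hi) (b : Arcs L S) (cut : Finset ℤ) :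
    Function.Involutive (gapFun lo hi b cut) := by
  rintro ⟨i, m⟩
  by_cases h1 : m = lo ∧ ¬ alt L S i ∧ IsCut b cut i
  · have h3 := alt_arcMap b h1.2.2.1
    have h4 := (isCut_arcMap b cut i).2 h1.2.2
    simp [gapFun, h1, h.symm, h3, h4]
  · by_cases h2 : m = hi ∧ alt L S i ∧ IsCut b cut i
    · have h3 := alt_arcMap b h2.2.2.1
      have h4 := (isCut_arcMap b cut i).2 h2.2.2
      simp [gapFun, h2, h3, h4]
    · simp only [gapFun, if_neg h1, if_neg h2]

/-- `gapFun` as a permutation. -/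
noncomputable def gapSwap {lo hi : Λ} (h : lo ≠ hi) (b : Arcs L S) (cut : Finset ℤ) :
    Equiv.Perm (Vtx L × Λ) := (gapFun_involutive h b cut).toPerm

theorem gapSwap_apply {lo hi : Λ} (h : lo ≠ hi) (b : Arcs L S) (cut : Finset ℤ) (v : Vtx L × Λ) :
    gapSwap h b cut v = gapFun lo hi b cut v := rfl

/-- The two points of the flow that are exchanged by surgery at the cup with ends `i`, `j`. -/
noncomputable def cutPair (S : Set ℤ) (lo hi : Λ) (x : Vtx L × Vtx L) :
    (Vtx L × Λ) × (Vtx L × Λ) :=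
  if alt L S x.1 then ((x.2, lo), (x.1, hi)) else ((x.1, lo), (x.2, hi))

theorem gapSwap_empty {lo hi : Λ} (h : lo ≠ hi) (b : Arcs L S) : gapSwap h b ∅ = 1 := by
  ext v : 1
  simp [gapSwap_apply, gapFun, IsCut]

/-- On the lower line the flow enters the arc of `b` at the end that is not `alt`, on the upper line
at the end that is `alt`. Cutting the arc makes both streams go straight through the gap instead,
which amounts to exchanging the targets of these two points. -/
theorem gapSwap_insert [DecidableEq Λ] {lo hi : Λ} (h : lo ≠ hi) (b : Arcs L S) {cut : Finset ℤ} {i : Vtx L}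
    (hlt : (i : ℤ) < b.1.arc i) (hcut : (i : ℤ) ∉ cut) :
    gapSwap h b (insert (i : ℤ) cut) = gapSwap h b cut *
      Equiv.swap (cutPair S lo hi (i, arcMap b i)).1 (cutPair S lo hi (i, arcMap b i)).2 := by
  have hS : (i : ℤ) ∈ S := (b.2 i).1 hlt.ne'
  have hS' : ((arcMap b i : Vtx L) : ℤ) ∈ S := (arc_mem_supp b).2 hS
  have hne : arcMap b i ≠ i := arcMap_ne hS
  have ha := alt_arcMap b hS
  have hc1 : ¬ IsCut b cut i := fun hc => hcut (by have := hc.2; rwa [min_eq_left hlt.le] at this)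
  have hc2 : ¬ IsCut b cut (arcMap b i) := by rwa [isCut_arcMap]
  have hc3 : IsCut b (insert (i : ℤ) cut) i := ⟨hS, by rw [min_eq_left hlt.le]; simp⟩
  have hc4 : IsCut b (insert (i : ℤ) cut) (arcMap b i) := by rwa [isCut_arcMap]
  have hother : ∀ k : Vtx L, k ≠ i → k ≠ arcMap b i →
      (IsCut b (insert (i : ℤ) cut) k ↔ IsCut b cut k) := by
    intro k hk hk'
    unfold IsCut
    rw [Finset.mem_insert]
    have : min (k : ℤ) (b.1.arc k) ≠ i := by
      intro he
      rcases min_choice (k : ℤ) (b.1.arc k) with h1 | h1 <;> rw [h1] at he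
      · exact hk (Subtype.ext he)
      · apply hk'
        apply Subtype.ext
        rw [coe_arcMap, ← he, b.1.arc_arc]
    simp [this]
  ext ⟨k, m⟩ : 1
  rw [Equiv.Perm.mul_apply, gapSwap_apply, gapSwap_apply]
  unfold cutPair
  by_cases hk : k = i
  · subst hk
    by_cases hal : alt L S k
    · by_cases hm : m = hi
      · subst hm
        simp [hal, gapFun, hc3, h, h.symm, ha, hc2]
      · rw [if_pos hal, Equiv.swap_apply_of_ne_of_ne (by simp [hne.symm]) (by simp [hm])]
        simp [hal, gapFun, hm]
    · by_cases hm : m = lo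
      · subst hm
        simp [hal, gapFun, hc3, h.symm, ha, hc2]
      · rw [if_neg hal, Equiv.swap_apply_of_ne_of_ne (by simp [hm]) (by simp [hne.symm])]
        simp [hal, gapFun, hm]
  · by_cases hk' : k = arcMap b i
    · subst hk'
      by_cases hal : alt L S i
      · by_cases hm : m = lo
        · subst hm
          simp [hal, gapFun, hc4, h.symm, ha, hc1]
        · rw [if_pos hal, Equiv.swap_apply_of_ne_of_ne (by simp [hm]) (by simp [hne])]
          simp [hal, gapFun, hm, ha]
      · by_cases hm : m = hi
        · subst hm
          simp [hal, gapFun, hc4, h, h.symm, ha, hc1]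
        · rw [if_neg hal, Equiv.swap_apply_of_ne_of_ne (by simp [hne]) (by simp [hm])]
          simp [hal, gapFun, hm, ha]
    · have hsw : (Equiv.swap (cutPair S lo hi (i, arcMap b i)).1
          (cutPair S lo hi (i, arcMap b i)).2) (k, m) = (k, m) := by
        unfold cutPair
        split_ifs <;> exact Equiv.swap_apply_of_ne_of_ne (by simp [hk, hk']) (by simp [hk, hk'])
      unfold cutPair at hsw
      rw [hsw]
      simp [gapFun, hother k hk hk']

end Vertices
end ArcAlgebra

namespace ArcAlgebra
open scoped Classical
open MvPolynomial

/-! ### The circles of a diagram with two number lines -/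

section TwoLines

variable {L : Finset ℤ} {S : Set ℤ}

/-- The diagram with two number lines given by the arcs `a`, `b`, `d`. -/
def stackOf (a b d : Arcs L S) (cut : Finset ℤ) : Stack L := ⟨a.1, b.1, d.1, cut⟩

/-- The flow on a diagram with two number lines. -/
noncomputable def stackPerm (a b d : Arcs L S) (cut : Finset ℤ) : Equiv.Perm (StackVertex L) :=
  layered (fun ε : Bool => if ε then linePerm b d else linePerm a b) *
    gapSwap (lo := false) (hi := true) (by decide) b cut

variable (a b d : Arcs L S) (cut : Finset ℤ)

theorem stackPerm_false (i : Vtx L) : stackPerm a b d cut (i, false) =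
    if alt L S i then (arcMap a i, false)
    else if IsCut b cut i then (i, true) else (arcMap b i, false) := by
  rw [stackPerm, Equiv.Perm.mul_apply, gapSwap_apply, gapFun]
  by_cases h1 : alt L S i
  · simp [h1, linePerm_apply]
  · by_cases h2 : IsCut b cut i
    · simp [h1, h2, linePerm_apply, alt_arcMap b h2.1]
    · simp [h1, h2, linePerm_apply]

theorem stackPerm_true (i : Vtx L) : stackPerm a b d cut (i, true) =
    if alt L S i then if IsCut b cut i then (i, false) else (arcMap b i, true)
    else (arcMap d i, true) := by
  rw [stackPerm, Equiv.Perm.mul_apply, gapSwap_apply, gapFun]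
  by_cases h1 : alt L S i
  · by_cases h2 : IsCut b cut i
    · simp [h1, h2, linePerm_apply, alt_arcMap b h2.1]
    · simp [h1, h2, linePerm_apply]
  · simp [h1, linePerm_apply]

theorem stackPerm_empty : stackPerm a b d ∅ =
    layered (fun ε : Bool => if ε then linePerm b d else linePerm a b) := by
  rw [stackPerm, gapSwap_empty, mul_one]

/-- Through this identity the dichotomy between merging and splitting circles becomes the one for a
permutation times a transposition. -/
theorem stackPerm_insert {i : Vtx L} (hlt : (i : ℤ) < b.1.arc i) (hcut : (i : ℤ) ∉ cut) :
    stackPerm a b d (insert (i : ℤ) cut) = stackPerm a b d cut *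
      Equiv.swap (cutPair S false true (i, arcMap b i)).1
        (cutPair S false true (i, arcMap b i)).2 := by
  rw [stackPerm, gapSwap_insert _ b hlt hcut, stackPerm, mul_assoc]

theorem curved_false {i j : Vtx L} : (stackOf a b d cut).Curved (i, false) (j, false) ↔
    i ≠ j ∧ (arcMap a i = j ∨ (arcMap b i = j ∧ ¬ IsCut b cut i)) := by
  unfold Stack.Curved stackOf IsCut
  simp only [← coe_arcMap, Subtype.ext_iff, ne_eq, true_and, Bool.false_eq_true, false_and, false_or]
  refine and_congr_right fun hij => or_congr_right (and_congr_right fun h => ?_)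
  rw [h]
  have : (i : ℤ) ∈ S := (b.2 i).1 (by rw [← coe_arcMap, h]; exact fun h => hij h.symm)
  simp [this]

theorem curved_true {i j : Vtx L} : (stackOf a b d cut).Curved (i, true) (j, true) ↔
    i ≠ j ∧ (arcMap d i = j ∨ (arcMap b i = j ∧ ¬ IsCut b cut i)) := by
  unfold Stack.Curved stackOf IsCut
  simp only [← coe_arcMap, Subtype.ext_iff, ne_eq, true_and, Bool.true_eq_false, false_and, false_or]
  refine and_congr_right fun hij => or_congr_right (and_congr_right fun h => ?_)
  rw [h]
  have : (i : ℤ) ∈ S := (b.2 i).1 (by rw [← coe_arcMap, h]; exact fun h => hij h.symm)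
  simp [this]

theorem vertical_iff {u v : StackVertex L} : (stackOf a b d cut).Vertical u v ↔
    u.2 ≠ v.2 ∧ u.1 = v.1 ∧ IsCut b cut u.1 := by
  unfold Stack.Vertical stackOf IsCut
  rw [b.2]

theorem Stack.sameCircle_equivalence (D : Stack L) : Equivalence D.SameCircle :=
  Relation.EqvGen.is_equivalence _

/-- The flow runs along every cup, cap and vertical segment in exactly one direction, so following
it joins the same vertices as the undirected pieces do. -/
theorem sameCircle_iff (u v : StackVertex L) :
    (stackOf a b d cut).SameCircle u v ↔ (stackPerm a b d cut).SameCycle u v := by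
  constructor
  · intro h
    induction h with
    | rel u v h =>
      obtain ⟨i, ε⟩ := u
      obtain ⟨j, ε'⟩ := v
      rcases h with h | h
      · have he : ε = ε' := h.1
        subst he
        cases ε
        · rw [curved_false] at h
          obtain ⟨hij, h | ⟨h, hc⟩⟩ := h
          · have hS : (i : ℤ) ∈ S := by
              by_contra hS; rw [arcMap_eq hS] at h; exact hij h
            have hal := alt_arcMap a hS
            by_cases hi : alt L S i
            · have := sameCycle_apply (stackPerm a b d cut) (i, false)
              rwa [stackPerm_false, if_pos hi, h] at this
            · have := sameCycle_apply (stackPerm a b d cut) (arcMap a i, false)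
              rw [stackPerm_false, if_pos (hal.2 hi), arcMap_arcMap, h] at this
              exact this.symm
          · have hS : (i : ℤ) ∈ S := by
              by_contra hS; rw [arcMap_eq hS] at h; exact hij h
            have hal := alt_arcMap b hS
            by_cases hi : alt L S i
            · have := sameCycle_apply (stackPerm a b d cut) (arcMap b i, false)
              rw [stackPerm_false, if_neg (by tauto), isCut_arcMap, if_neg hc, arcMap_arcMap,
                h] at this
              exact this.symm
            · have := sameCycle_apply (stackPerm a b d cut) (i, false)
              rwa [stackPerm_false, if_neg hi, if_neg hc, h] at this
        · rw [curved_true] at h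
          obtain ⟨hij, h | ⟨h, hc⟩⟩ := h
          · have hS : (i : ℤ) ∈ S := by
              by_contra hS; rw [arcMap_eq hS] at h; exact hij h
            have hal := alt_arcMap d hS
            by_cases hi : alt L S i
            · have := sameCycle_apply (stackPerm a b d cut) (arcMap d i, true)
              rw [stackPerm_true, if_neg (by tauto), arcMap_arcMap, h] at this
              exact this.symm
            · have := sameCycle_apply (stackPerm a b d cut) (i, true)
              rwa [stackPerm_true, if_neg hi, h] at this
          · have hS : (i : ℤ) ∈ S := by
              by_contra hS; rw [arcMap_eq hS] at h; exact hij h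
            have hal := alt_arcMap b hS
            by_cases hi : alt L S i
            · have := sameCycle_apply (stackPerm a b d cut) (i, true)
              rwa [stackPerm_true, if_pos hi, if_neg hc, h] at this
            · have := sameCycle_apply (stackPerm a b d cut) (arcMap b i, true)
              rw [stackPerm_true, if_pos (hal.2 hi), isCut_arcMap, if_neg hc, arcMap_arcMap,
                h] at this
              exact this.symm
      · rw [vertical_iff] at h
        obtain ⟨hne, he, hc⟩ := h
        simp only at hne he hc
        subst he
        have key : (stackPerm a b d cut).SameCycle (i, false) (i, true) := by
          by_cases hi : alt L S i
          · have := sameCycle_apply (stackPerm a b d cut) (i, true)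
            rw [stackPerm_true, if_pos hi, if_pos hc] at this
            exact this.symm
          · have := sameCycle_apply (stackPerm a b d cut) (i, false)
            rwa [stackPerm_false, if_neg hi, if_pos hc] at this
        cases ε <;> cases ε'
        · exact absurd rfl hne
        · exact key
        · exact key.symm
        · exact absurd rfl hne
    | refl u => exact Equiv.Perm.SameCycle.refl _ _
    | symm u v _ h => exact h.symm
    | trans u v w _ _ h h' => exact h.trans h'
  · refine sameCycle_le _ (Stack.sameCircle_equivalence _) ?_
    have hcur : ∀ {u v : StackVertex L}, (u.1 ≠ v.1 → (stackOf a b d cut).Curved u v) → u.2 = v.2 →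
        (stackOf a b d cut).SameCircle u v := by
      rintro ⟨i, ε⟩ ⟨j, ε'⟩ h h'
      simp only at h h'
      subst h'
      by_cases hij : i = j
      · subst hij; exact Relation.EqvGen.refl _
      · exact Relation.EqvGen.rel _ _ (Or.inl (h hij))
    rintro ⟨i, ε⟩
    cases ε
    · rw [stackPerm_false]
      split_ifs with h1 h2
      · exact hcur (fun h => (curved_false a b d cut).2 ⟨h, Or.inl rfl⟩) rfl
      · exact Relation.EqvGen.rel _ _ (Or.inr ((vertical_iff a b d cut).2 ⟨by simp, rfl, h2⟩))
      · exact hcur (fun h => (curved_false a b d cut).2 ⟨h, Or.inr ⟨rfl, h2⟩⟩) rfl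
    · rw [stackPerm_true]
      split_ifs with h1 h2
      · exact Relation.EqvGen.rel _ _ (Or.inr ((vertical_iff a b d cut).2 ⟨by simp, rfl, h2⟩))
      · exact hcur (fun h => (curved_true a b d cut).2 ⟨h, Or.inr ⟨rfl, h2⟩⟩) rfl
      · exact hcur (fun h => (curved_true a b d cut).2 ⟨h, Or.inl rfl⟩) rfl

/-- `cut` is ready for surgery at `i`: the caps cut so far are those with left end before `i`. -/
def Ready (b : Arcs L S) (cut : Finset ℤ) (i : Vtx L) : Prop :=
  (i : ℤ) < b.1.arc i ∧ ∀ k ∈ L, k < b.1.arc k → (k ∈ cut ↔ k < i)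

variable {a b d cut}

theorem Ready.notMem {i : Vtx L} (h : Ready b cut i) : (i : ℤ) ∉ cut :=
  fun h' => lt_irrefl _ ((h.2 i i.2 h.1).1 h')

theorem Ready.mem_supp {i : Vtx L} (h : Ready b cut i) : (i : ℤ) ∈ S := (b.2 i).1 h.1.ne'

theorem Ready.not_isCut {i : Vtx L} (h : Ready b cut i) : ¬ IsCut b cut i := by
  rintro ⟨-, h'⟩
  rw [min_eq_left h.1.le] at h'
  exact h.notMem h'

theorem Ready.isCut_insert {i : Vtx L} (h : Ready b cut i) : IsCut b (insert (i : ℤ) cut) i :=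
  ⟨h.mem_supp, by rw [min_eq_left h.1.le]; simp⟩

theorem Ready.sameCircle {i : Vtx L} (h : Ready b cut i) (ε : Bool) :
    (stackOf a b d cut).SameCircle (i, ε) (arcMap b i, ε) := by
  have hne : i ≠ arcMap b i := (arcMap_ne h.mem_supp).symm
  cases ε
  · exact Relation.EqvGen.rel _ _ (Or.inl ((curved_false a b d cut).2
      ⟨hne, Or.inr ⟨rfl, h.not_isCut⟩⟩))
  · exact Relation.EqvGen.rel _ _ (Or.inl ((curved_true a b d cut).2
      ⟨hne, Or.inr ⟨rfl, h.not_isCut⟩⟩))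

theorem sameCircle_of_isCut {i : Vtx L} (h : IsCut b cut i) (ε ε' : Bool) :
    (stackOf a b d cut).SameCircle (i, ε) (i, ε') := by
  by_cases he : ε = ε'
  · subst he; exact Relation.EqvGen.refl _
  · exact Relation.EqvGen.rel _ _ (Or.inr ((vertical_iff a b d cut).2 ⟨he, rfl, h⟩))

theorem joinRel_congr {V : Type*} {E : V → V → Prop} (hE : Equivalence E) {p q p' q' : V}
    (h : (E p p' ∧ E q q') ∨ (E p q' ∧ E q p')) (u v : V) :
    joinRel E p q u v ↔ joinRel E p' q' u v := by
  have hs : ∀ {x y}, E x y → E y x := fun {x y} => hE.symm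
  have ht : ∀ {x y z}, E x y → E y z → E x z := fun {x y z} => hE.trans
  unfold joinRel
  refine or_congr_right ?_
  rcases h with ⟨h, h'⟩ | ⟨h, h'⟩
  · constructor
    · rintro (⟨k, k'⟩ | ⟨k, k'⟩)
      · exact Or.inl ⟨ht k h, ht (hs h') k'⟩
      · exact Or.inr ⟨ht k h', ht (hs h) k'⟩
    · rintro (⟨k, k'⟩ | ⟨k, k'⟩)
      · exact Or.inl ⟨ht k (hs h), ht h' k'⟩
      · exact Or.inr ⟨ht k (hs h'), ht h k'⟩
  · constructor
    · rintro (⟨k, k'⟩ | ⟨k, k'⟩)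
      · exact Or.inr ⟨ht k h, ht (hs h') k'⟩
      · exact Or.inl ⟨ht k h', ht (hs h) k'⟩
    · rintro (⟨k, k'⟩ | ⟨k, k'⟩)
      · exact Or.inr ⟨ht k (hs h'), ht h k'⟩
      · exact Or.inl ⟨ht k (hs h), ht h' k'⟩

/-- Before the surgery the exchanged points may be replaced by the vertex `i` on the two lines,
since the cap and the cup are still present. -/
theorem cutPair_cases {i : Vtx L} {E : StackVertex L → StackVertex L → Prop}
    (hE : Equivalence E) (h1 : ∀ ε, E (i, ε) (arcMap b i, ε)) :
    (E (cutPair S false true (i, arcMap b i)).1 (i, false) ∧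
      E (cutPair S false true (i, arcMap b i)).2 (i, true)) := by
  unfold cutPair
  split_ifs
  · exact ⟨hE.symm (h1 _), hE.refl _⟩
  · exact ⟨hE.refl _, hE.symm (h1 _)⟩

/-- After the surgery they may be replaced by the two ends of the arc on the bottom line, since the
vertical segments are now present. -/
theorem cutPair_cases' {i : Vtx L} {E : StackVertex L → StackVertex L → Prop}
    (hE : Equivalence E) (h1 : ∀ k, k = i ∨ k = arcMap b i → E (k, false) (k, true)) :
    (E (cutPair S false true (i, arcMap b i)).1 (i, false) ∧
      E (cutPair S false true (i, arcMap b i)).2 (arcMap b i, false)) ∨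
    (E (cutPair S false true (i, arcMap b i)).1 (arcMap b i, false) ∧
      E (cutPair S false true (i, arcMap b i)).2 (i, false)) := by
  unfold cutPair
  split_ifs
  · exact Or.inr ⟨hE.refl _, hE.symm (h1 _ (Or.inl rfl))⟩
  · exact Or.inl ⟨hE.refl _, hE.symm (h1 _ (Or.inr rfl))⟩

theorem cutPair_ne {Λ : Type*} {lo hi : Λ} (h : lo ≠ hi) (x : Vtx L × Vtx L) :
    (cutPair S lo hi x).1 ≠ (cutPair S lo hi x).2 := by
  unfold cutPair
  split_ifs <;> simp [h]

/-- The circles after a surgery that merges two circles. -/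
theorem Ready.merge {i : Vtx L} (h : Ready b cut i)
    (hn : ¬ (stackOf a b d cut).SameCircle (i, false) (i, true)) (u v : StackVertex L) :
    (stackOf a b d (insert (i : ℤ) cut)).SameCircle u v ↔
      joinRel (stackOf a b d cut).SameCircle (i, false) (i, true) u v := by
  have hE := Stack.sameCircle_equivalence (stackOf a b d cut)
  have hp := cutPair_cases (b := b) hE h.sameCircle
  rw [← joinRel_congr hE (Or.inl hp)]
  have hn' : ¬ (stackPerm a b d cut).SameCycle (cutPair S false true (i, arcMap b i)).1
      (cutPair S false true (i, arcMap b i)).2 := by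
    rw [← sameCircle_iff]
    exact fun h' => hn (hE.trans (hE.symm hp.1) (hE.trans h' hp.2))
  rw [sameCircle_iff, stackPerm_insert a b d cut h.1 h.notMem, sameCycle_merge _ hn']
  unfold joinRel
  simp only [sameCircle_iff]

/-- The circles before and after a surgery that splits a circle. -/
theorem Ready.split {i : Vtx L} (h : Ready b cut i)
    (hn : (stackOf a b d cut).SameCircle (i, false) (i, true)) :
    ¬ (stackOf a b d (insert (i : ℤ) cut)).SameCircle (i, false) (arcMap b i, false) ∧
    ∀ u v : StackVertex L, (stackOf a b d cut).SameCircle u v ↔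
      joinRel (stackOf a b d (insert (i : ℤ) cut)).SameCircle (i, false) (arcMap b i, false) u v := by
  have hE := Stack.sameCircle_equivalence (stackOf a b d cut)
  have hE' := Stack.sameCircle_equivalence (stackOf a b d (insert (i : ℤ) cut))
  have hp := cutPair_cases (b := b) hE h.sameCircle
  have hp' := cutPair_cases' (b := b) (i := i) hE' (by
    rintro k (rfl | rfl)
    · exact sameCircle_of_isCut h.isCut_insert _ _
    · exact sameCircle_of_isCut ((isCut_arcMap _ _ _).2 h.isCut_insert) _ _)
  have hn' : (stackPerm a b d cut).SameCycle (cutPair S false true (i, arcMap b i)).1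
      (cutPair S false true (i, arcMap b i)).2 := by
    rw [← sameCircle_iff]
    exact hE.trans hp.1 (hE.trans hn (hE.symm hp.2))
  have hne := cutPair_ne (S := S) (L := L) (lo := false) (hi := true) (by decide) (i, arcMap b i)
  have key : ∀ u v, (stackOf a b d (insert (i : ℤ) cut)).SameCircle u v ↔ (stackPerm a b d cut *
      Equiv.swap (cutPair S false true (i, arcMap b i)).1
        (cutPair S false true (i, arcMap b i)).2).SameCycle u v := by
    intro u v
    rw [sameCircle_iff, stackPerm_insert a b d cut h.1 h.notMem]
  constructor
  · intro hs
    apply not_sameCycle_mul_swap _ hne hn'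
    rw [← key]
    rcases hp' with hp' | hp'
    · exact hE'.trans hp'.1 (hE'.trans hs (hE'.symm hp'.2))
    · exact hE'.trans hp'.1 (hE'.trans (hE'.symm hs) (hE'.symm hp'.2))
  · intro u v
    rw [← joinRel_congr hE' hp', sameCircle_iff, sameCycle_split _ hne hn']
    unfold joinRel
    simp only [key]

end TwoLines
end ArcAlgebra

namespace ArcAlgebra
open scoped Classical
open MvPolynomial

/-! ### Nesting of circles and types of orientations -/

section Types

variable {L : Finset ℤ} {S : Set ℤ}

theorem Stack.sameCircle_le {D : Stack L} {r : StackVertex L → StackVertex L → Prop}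
    (hr : Equivalence r) (h1 : ∀ u v, D.Curved u v → r u v) (h2 : ∀ u v, D.Vertical u v → r u v)
    {u v : StackVertex L} (h : D.SameCircle u v) : r u v := by
  induction h with
  | rel u v h => exact h.elim (h1 u v) (h2 u v)
  | refl u => exact hr.refl u
  | symm u v _ h => exact hr.symm h
  | trans u v w _ _ h h' => exact hr.trans h h'

/-- The vertex `k` of the line `ε` lies on the circle through `u`. -/
def OnCircle (S : Set ℤ) (D : Stack L) (u : StackVertex L) (ε : Bool) (k : ℤ) : Prop :=
  k ∈ S ∧ ∃ h : k ∈ L, D.SameCircle u (⟨k, h⟩, ε)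

/-- The parity of the number of vertices of the circle through `u` to the left of `v`, on the line
of `v`. -/
noncomputable def rank (S : Set ℤ) (D : Stack L) (u v : StackVertex L) : ZMod 2 :=
  parityLeft L (OnCircle S D u v.2) v.1

theorem rank_congr (D D' : Stack L) {u u' v : StackVertex L} (h : D.SameCircle u = D'.SameCircle u') :
    rank S D u v = rank S D' u' v := by
  unfold rank OnCircle
  rw [h]

/-- The caps that have been cut are those with left end before some threshold. -/
def Admissible (b : Arcs L S) (cut : Finset ℤ) : Prop :=
  ∃ x : ℤ, ∀ k ∈ L, k < b.1.arc k → (k ∈ cut ↔ k < x)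

variable {a b d : Arcs L S} {cut : Finset ℤ}

theorem Ready.admissible {i : Vtx L} (h : Ready b cut i) : Admissible b cut := ⟨i, h.2⟩

theorem Ready.admissible_insert {i : Vtx L} (h : Ready b cut i) :
    Admissible b (insert (i : ℤ) cut) := by
  refine ⟨i + 1, fun k hk hlt => ?_⟩
  rw [Finset.mem_insert, h.2 k hk hlt]
  omega

theorem curved_mem_supp {u v : StackVertex L} (h : (stackOf a b d cut).Curved u v) :
    (u.1 : ℤ) ∈ S ∧ (v.1 : ℤ) ∈ S := by
  have hne : (v.1 : ℤ) ≠ u.1 := fun h' => h.2.1 (Subtype.ext h'.symm)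
  obtain ⟨-, -, ⟨-, h⟩ | ⟨-, h⟩ | ⟨h, -⟩⟩ := h
  · exact ⟨(a.2 _).1 (h ▸ hne), h ▸ (arc_mem_supp a).2 ((a.2 _).1 (h ▸ hne))⟩
  · exact ⟨(d.2 _).1 (h ▸ hne), h ▸ (arc_mem_supp d).2 ((d.2 _).1 (h ▸ hne))⟩
  · exact ⟨(b.2 _).1 (h ▸ hne), h ▸ (arc_mem_supp b).2 ((b.2 _).1 (h ▸ hne))⟩

theorem sameCircle_supp {u v : StackVertex L} (h : (stackOf a b d cut).SameCircle u v) :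
    u = v ∨ ((u.1 : ℤ) ∈ S ∧ (v.1 : ℤ) ∈ S) := by
  refine Stack.sameCircle_le (r := fun u v => u = v ∨ ((u.1 : ℤ) ∈ S ∧ (v.1 : ℤ) ∈ S))
    ⟨fun _ => Or.inl rfl, ?_, ?_⟩ ?_ ?_ h
  · rintro x y (h | h)
    · exact Or.inl h.symm
    · exact Or.inr ⟨h.2, h.1⟩
  · rintro x y z (rfl | h) (rfl | h')
    · exact Or.inl rfl
    · exact Or.inr h'
    · exact Or.inr h
    · exact Or.inr ⟨h.1, h'.2⟩
  · exact fun u v h => Or.inr (curved_mem_supp h)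
  · intro u v h
    rw [vertical_iff] at h
    exact Or.inr ⟨h.2.2.1, h.2.1 ▸ h.2.2.1⟩

theorem onCircle_iff_of_sameCircle {u : StackVertex L} {i j : Vtx L} {ε : Bool}
    (h : (stackOf a b d cut).SameCircle (i, ε) (j, ε)) :
    OnCircle S (stackOf a b d cut) u ε i ↔ OnCircle S (stackOf a b d cut) u ε j := by
  have hE := Stack.sameCircle_equivalence (stackOf a b d cut)
  have hS : (i : ℤ) ∈ S ↔ (j : ℤ) ∈ S := by
    rcases sameCircle_supp h with h | h
    · rw [show i = j from congrArg Prod.fst h]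
    · exact ⟨fun _ => h.2, fun _ => h.1⟩
  unfold OnCircle
  rw [hS]
  exact and_congr_right fun _ => ⟨fun ⟨_, h'⟩ => ⟨j.2, hE.trans h' h⟩,
    fun ⟨_, h'⟩ => ⟨i.2, hE.trans h' (hE.symm h)⟩⟩

/-- Caps are cut in the order of their left ends, and an arc nested in another one has its left end
further right. -/
theorem uncut_inside (hadm : Admissible b cut) {i k : Vtx L} (hlt : (i : ℤ) < b.1.arc i)
    (hi : ¬ IsCut b cut i) (h1 : (i : ℤ) < k) (h2 : (k : ℤ) < b.1.arc i) : ¬ IsCut b cut k := by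
  obtain ⟨x, hx⟩ := hadm
  have hn := b.1.nested i k h1 h2
  rintro ⟨hk, hk'⟩
  have hix : ¬ (i : ℤ) < x := by
    rw [← hx i i.2 hlt]
    exact fun h' => hi ⟨(b.2 i).1 hlt.ne', by rwa [min_eq_left hlt.le]⟩
  rcases lt_or_ge (k : ℤ) (b.1.arc k) with h | h
  · rw [min_eq_left h.le, hx k k.2 h] at hk'
    omega
  · have hne := (b.2 k).2 hk
    rw [min_eq_right h, hx _ (arc_mem_line b.1 k.2) (by rw [b.1.arc_arc]; omega)] at hk'
    omega

/-- All arcs nested in a given cup or cap on its side of the line are intact. The vertices of the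
circle underneath therefore come in pairs, and the parity changes only by the end point itself, if
that lies on the circle. -/
theorem rank_curved (hadm : Admissible b cut) (u : StackVertex L) {v v' : StackVertex L}
    (h : (stackOf a b d cut).Curved v v') :
    rank S (stackOf a b d cut) u v' = rank S (stackOf a b d cut) u v +
      if (stackOf a b d cut).SameCircle u v then 1 else 0 := by
  set D := stackOf a b d cut with hD
  have hE := Stack.sameCircle_equivalence D
  have hon : ∀ (i : Vtx L) (ε : Bool), (i : ℤ) ∈ S → (OnCircle S D u ε i ↔ D.SameCircle u (i, ε)) := by
    intro i ε hi
    exact ⟨fun ⟨_, _, h⟩ => h, fun h => ⟨hi, i.2, h⟩⟩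
  have hmain : ∀ (e : Arcs L S) (ε : Bool) (i : Vtx L), (i : ℤ) < e.1.arc i →
      (∀ k : Vtx L, (i : ℤ) < k → (k : ℤ) < e.1.arc i → D.SameCircle (k, ε) (arcMap e k, ε)) →
      rank S D u (arcMap e i, ε) = rank S D u (i, ε) + if D.SameCircle u (i, ε) then 1 else 0 := by
    intro e ε i hlt hk
    have := parityLeft_arc e (P := OnCircle S D u ε) (fun k hk => hk.1) i.2 hlt
      (fun k hkL h1 h2 => onCircle_iff_of_sameCircle (i := ⟨k, hkL⟩) (j := arcMap e ⟨k, hkL⟩)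
        (hk ⟨k, hkL⟩ h1 h2))
    unfold rank
    rw [coe_arcMap, this, if_congr (hon i ε ((e.2 i).1 hlt.ne')) rfl rfl]
  have hboth : ∀ (e : Arcs L S) (ε : Bool) (i : Vtx L), (i : ℤ) ∈ S →
      (∀ k : Vtx L, (k = i ∨ k = arcMap e i ∨ (i : ℤ) < k ∧ (k : ℤ) < e.1.arc i ∨
        (e.1.arc i : ℤ) < k ∧ (k : ℤ) < i) → D.SameCircle (k, ε) (arcMap e k, ε)) →
      rank S D u (arcMap e i, ε) = rank S D u (i, ε) + if D.SameCircle u (i, ε) then 1 else 0 := by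
    intro e ε i hS hk
    rcases lt_or_gt_of_ne ((e.2 i).2 hS) with h | h
    · have := hmain e ε (arcMap e i) (by rw [coe_arcMap, e.1.arc_arc]; exact h) (by
        intro k h1 h2
        rw [coe_arcMap, e.1.arc_arc] at h2
        exact hk k (Or.inr (Or.inr (Or.inr ⟨h1, h2⟩))))
      rw [arcMap_arcMap] at this
      have hc : D.SameCircle u (arcMap e i, ε) ↔ D.SameCircle u (i, ε) :=
        ⟨fun h' => hE.trans h' (hE.symm (hk i (Or.inl rfl))), fun h' => hE.trans h' (hk i (Or.inl rfl))⟩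
      rw [this, if_congr hc rfl rfl, add_assoc]
      have : ∀ x : ZMod 2, x + x = 0 := by decide
      rw [this, add_zero]
    · exact hmain e ε i h (fun k h1 h2 => hk k (Or.inr (Or.inr (Or.inl ⟨h1, h2⟩))))
  obtain ⟨i, ε⟩ := v
  obtain ⟨j, ε'⟩ := v'
  have he : ε = ε' := h.1
  have hS := (curved_mem_supp h).1
  subst he
  simp only at hS
  have hcurve : ∀ (e : Arcs L S) (k : Vtx L),
      ((k : ℤ) ∈ S → D.Curved (k, ε) (arcMap e k, ε)) → D.SameCircle (k, ε) (arcMap e k, ε) := by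
    intro e k hk
    by_cases hkS : (k : ℤ) ∈ S
    · exact Relation.EqvGen.rel _ _ (Or.inl (hk hkS))
    · rw [arcMap_eq hkS]; exact hE.refl _
  have hbarc : arcMap b i = j → ¬ IsCut b cut i →
      (∀ k : Vtx L, ¬ IsCut b cut k → D.SameCircle (k, ε) (arcMap b k, ε)) →
      rank S D u (j, ε) = rank S D u (i, ε) + if D.SameCircle u (i, ε) then 1 else 0 := by
    rintro rfl hc hk
    refine hboth b ε i hS fun k hk' => hk k ?_
    rcases hk' with rfl | rfl | ⟨h1, h2⟩ | ⟨h1, h2⟩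
    · exact hc
    · rwa [isCut_arcMap]
    · exact uncut_inside hadm (h1.trans h2) hc h1 h2
    · refine uncut_inside hadm (i := arcMap b i) ?_ (by rwa [isCut_arcMap]) h1 ?_
      · rw [coe_arcMap, b.1.arc_arc]; omega
      · rwa [coe_arcMap, b.1.arc_arc]
  cases ε
  · rw [hD, curved_false] at h
    obtain ⟨-, rfl | ⟨h, hc⟩⟩ := h
    · refine hboth a false i hS fun k _ => hcurve a k fun hkS => ?_
      exact (curved_false a b d cut).2 ⟨(arcMap_ne hkS).symm, Or.inl rfl⟩
    · refine hbarc h hc fun k hk => hcurve b k fun hkS => ?_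
      exact (curved_false a b d cut).2 ⟨(arcMap_ne hkS).symm, Or.inr ⟨rfl, hk⟩⟩
  · rw [hD, curved_true] at h
    obtain ⟨-, rfl | ⟨h, hc⟩⟩ := h
    · refine hboth d true i hS fun k _ => hcurve d k fun hkS => ?_
      exact (curved_true a b d cut).2 ⟨(arcMap_ne hkS).symm, Or.inl rfl⟩
    · refine hbarc h hc fun k hk => hcurve b k fun hkS => ?_
      exact (curved_true a b d cut).2 ⟨(arcMap_ne hkS).symm, Or.inr ⟨rfl, hk⟩⟩

theorem parityLeft_eq_sum (P : ℤ → Prop) (x : ℤ) :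
    parityLeft L P x = ∑ k : Vtx L, if (k : ℤ) < x ∧ P k then 1 else 0 :=
  (Finset.sum_coe_sort L fun k => if k < x ∧ P k then (1 : ZMod 2) else 0).symm

/-- The vertices to the left of `i` on both lines carry a fixed-point-free involution on `S` that
preserves circles: go along the vertical segment where the arc of `b` is cut, and along the arc
where it is not. So the circle has an even number of vertices there, and the parities on the two
lines agree. -/
theorem rank_vertical_aux (hadm : Admissible b cut) (u : StackVertex L) {i : Vtx L}
    (hi : IsCut b cut i) : rank S (stackOf a b d cut) u (i, false) =
      rank S (stackOf a b d cut) u (i, true) := by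
  set D := stackOf a b d cut with hD
  have hE := Stack.sameCircle_equivalence D
  -- An uncut arc that passes over `i` would enclose the cut arc at `i`, although its left end comes
  -- earlier in the order of cutting.
  have harc : ∀ k : Vtx L, (k : ℤ) < i → ¬ IsCut b cut k → (b.1.arc k : ℤ) < i := by
    intro k hk hc
    by_cases hkS : (k : ℤ) ∈ S
    · by_contra hge
      have hne : b.1.arc k ≠ i := by
        intro he
        apply hc
        rw [← isCut_arcMap, show arcMap b k = i from Subtype.ext he]
        exact hi
      have hn := b.1.nested k i hk (by omega)
      obtain ⟨x, hx⟩ := hadm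
      have hkx : ¬ (k : ℤ) < x := by
        rw [← hx k k.2 (by omega)]
        exact fun h' => hc ⟨hkS, by rwa [min_eq_left (by omega)]⟩
      have hi' := hi.2
      rcases lt_or_ge (i : ℤ) (b.1.arc i) with h | h
      · rw [min_eq_left h.le, hx i i.2 h] at hi'
        omega
      · have hne := (b.2 i).2 hi.1
        rw [min_eq_right h, hx _ (arc_mem_line b.1 i.2) (by rw [b.1.arc_arc]; omega)] at hi'
        omega
    · have := congrArg Subtype.val (arcMap_eq (a := b) hkS)
      rw [coe_arcMap] at this
      rwa [this]
  have hcirc : ∀ (k : Vtx L) (ε : Bool), ¬ IsCut b cut k → D.SameCircle (k, ε) (arcMap b k, ε) := by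
    intro k ε hc
    by_cases hkS : (k : ℤ) ∈ S
    · cases ε
      · exact Relation.EqvGen.rel _ _ (Or.inl ((curved_false a b d cut).2
          ⟨(arcMap_ne hkS).symm, Or.inr ⟨rfl, hc⟩⟩))
      · exact Relation.EqvGen.rel _ _ (Or.inl ((curved_true a b d cut).2
          ⟨(arcMap_ne hkS).symm, Or.inr ⟨rfl, hc⟩⟩))
    · rw [arcMap_eq hkS]; exact hE.refl _
  have hsum : ∑ v ∈ Finset.univ.filter (fun v : StackVertex L => (v.1 : ℤ) < i),
      (if OnCircle S D u v.2 v.1 then 1 else 0 : ZMod 2) = 0 := by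
    refine Finset.sum_involution
      (fun v _ => if IsCut b cut v.1 then (v.1, !v.2) else (arcMap b v.1, v.2)) ?_ ?_ ?_ ?_
    · rintro ⟨k, ε⟩ -
      have : OnCircle S D u (if IsCut b cut k then (k, !ε) else (arcMap b k, ε)).2
          (if IsCut b cut k then (k, !ε) else (arcMap b k, ε)).1 ↔ OnCircle S D u ε k := by
        split_ifs with hc
        · have h1 := sameCircle_of_isCut (a := a) (d := d) hc ε (!ε)
          exact ⟨fun ⟨h, h', h''⟩ => ⟨h, h', hE.trans h'' (hE.symm h1)⟩,
            fun ⟨h, h', h''⟩ => ⟨h, h', hE.trans h'' h1⟩⟩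
        · exact (onCircle_iff_of_sameCircle (hcirc k ε hc)).symm
      simp only [this]
      split_ifs
      · rfl
      · simp
    · rintro ⟨k, ε⟩ - hne
      have hk : OnCircle S D u ε k := by by_contra h; simp [h] at hne
      simp only
      split_ifs
      · simp
      · simp [arcMap_ne hk.1]
    · rintro ⟨k, ε⟩ hk
      simp only [Finset.mem_filter, Finset.mem_univ, true_and] at hk ⊢
      split_ifs with hc
      · exact hk
      · exact harc k hk hc
    · rintro ⟨k, ε⟩ -
      by_cases hc : IsCut b cut k
      · simp [hc]
      · simp [hc, isCut_arcMap]
  rw [Finset.sum_filter, Fintype.sum_prod_type, Finset.sum_comm] at hsum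
  unfold rank
  rw [parityLeft_eq_sum, parityLeft_eq_sum]
  simp only [Fintype.sum_bool, ← ite_and] at hsum
  rw [add_comm] at hsum
  have : ∀ x y : ZMod 2, x + y = 0 → x = y := by decide
  exact this _ _ hsum

theorem rank_vertical (hadm : Admissible b cut) (u : StackVertex L) {v v' : StackVertex L}
    (h : (stackOf a b d cut).Vertical v v') : rank S (stackOf a b d cut) u v' =
      rank S (stackOf a b d cut) u v := by
  rw [vertical_iff] at h
  obtain ⟨i, ε⟩ := v
  obtain ⟨j, ε'⟩ := v'
  obtain ⟨hne, he, hc⟩ := h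
  simp only at hne he hc
  subst he
  have := rank_vertical_aux (a := a) (d := d) hadm u hc
  cases ε <;> cases ε'
  · rfl
  · exact this.symm
  · exact this
  · rfl

/-- All vertices of a circle lie on the same side of another circle. -/
theorem rank_const (hadm : Admissible b cut) {u v v' : StackVertex L}
    (h : (stackOf a b d cut).SameCircle v v') (hn : ¬ (stackOf a b d cut).SameCircle u v) :
    rank S (stackOf a b d cut) u v' = rank S (stackOf a b d cut) u v := by
  set D := stackOf a b d cut with hD
  have hE := Stack.sameCircle_equivalence D
  refine (Stack.sameCircle_le (D := D) (r := fun v v' => D.SameCircle v v' ∧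
    (¬ D.SameCircle u v → rank S D u v' = rank S D u v)) ⟨fun x => ⟨hE.refl x, fun _ => rfl⟩, ?_, ?_⟩
    ?_ ?_ h).2 hn
  · rintro x y ⟨h1, h2⟩
    exact ⟨hE.symm h1, fun h => (h2 fun h' => h (hE.trans h' h1)).symm⟩
  · rintro x y z ⟨h1, h2⟩ ⟨h3, h4⟩
    exact ⟨hE.trans h1 h3, fun h => (h4 fun h' => h (hE.trans h' (hE.symm h1))).trans (h2 h)⟩
  · intro x y hxy
    refine ⟨Relation.EqvGen.rel _ _ (Or.inl hxy), fun h => ?_⟩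
    rw [rank_curved hadm u hxy, if_neg h, add_zero]
  · intro x y hxy
    exact ⟨Relation.EqvGen.rel _ _ (Or.inr hxy), fun _ => rank_vertical hadm u hxy⟩

theorem rank_eq_zero_of_le {D : Stack L} {u v : StackVertex L}
    (h : ∀ v', D.SameCircle u v' → v.1 ≤ v'.1) : rank S D u v = 0 := by
  unfold rank parityLeft
  refine Finset.sum_eq_zero fun k _ => if_neg ?_
  rintro ⟨hlt, -, hk, hs⟩
  exact absurd (h _ hs) (not_le.2 hlt)

theorem Stack.exists_leftmost (_D : Stack L) (P : StackVertex L → Prop) {u : StackVertex L}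
    (hu : P u) : ∃ v, P v ∧ ∀ v', P v' → v.1 ≤ v'.1 := by
  obtain ⟨v, hv, hmin⟩ := Finset.exists_min_image (Finset.univ.filter P)
    (fun v : StackVertex L => v.1) ⟨u, by simpa using hu⟩
  exact ⟨v, by simpa using hv, fun v' hv' => hmin v' (by simpa using hv')⟩

/-- Of two circles, at most one lies inside the other. -/
theorem rank_nested (hadm : Admissible b cut) {u v : StackVertex L}
    (hn : ¬ (stackOf a b d cut).SameCircle u v) :
    rank S (stackOf a b d cut) u v = 0 ∨ rank S (stackOf a b d cut) v u = 0 := by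
  set D := stackOf a b d cut with hD
  have hE := Stack.sameCircle_equivalence D
  -- The circle containing the leftmost vertex of the two has no vertex of the other circle to its
  -- left, so it lies outside that one.
  obtain ⟨x, hx, hmin⟩ := D.exists_leftmost (fun x => D.SameCircle u x ∨ D.SameCircle v x)
    (Or.inl (hE.refl u))
  rcases hx with hx | hx
  · right
    rw [← rank_const hadm hx fun h => hn (hE.symm h)]
    exact rank_eq_zero_of_le fun v' hv' => hmin v' (Or.inr hv')
  · left
    rw [← rank_const hadm hx hn]
    exact rank_eq_zero_of_le fun v' hv' => hmin v' (Or.inl hv')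

/-- `0` for `∨` and `1` for `∧`. -/
def Label.val : Label → ZMod 2
  | Label.up => 1
  | _ => 0

/-- The type of the orientation of the circle through `u`: `0` for anti-clockwise and `1` for
clockwise. -/
noncomputable def circleType (S : Set ℤ) (D : Stack L) (w : StackLabelling L) (u : StackVertex L) :
    ZMod 2 := (w u).val + rank S D u u

/-- The labelling orients the diagram, and the vertices outside the arcs carry no arrow. -/
def Good (S : Set ℤ) (D : Stack L) (w : StackLabelling L) : Prop :=
  D.Oriented w ∧ ∀ u : StackVertex L, (u.1 : ℤ) ∉ S → w u = Label.nought ∨ w u = Label.cross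

theorem rank_congr_left (D : Stack L) {u u' : StackVertex L} (h : D.SameCircle u u')
    (v : StackVertex L) : rank S D u v = rank S D u' v :=
  rank_congr D D (class_eq D.sameCircle_equivalence h)

/-- Along a cup or cap the label changes, and so does the parity, because the circle counts its own
end point. Along a vertical segment neither changes. This turns the global definition by the
leftmost vertex into a local one. -/
theorem circleType_const (hadm : Admissible b cut) {w : StackLabelling L}
    (hw : (stackOf a b d cut).Oriented w) {u v : StackVertex L}
    (h : (stackOf a b d cut).SameCircle u v) :
    circleType S (stackOf a b d cut) w u = circleType S (stackOf a b d cut) w v := by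
  set D := stackOf a b d cut with hD
  refine Stack.sameCircle_le (D := D) (r := fun u v => circleType S D w u = circleType S D w v)
    ⟨fun _ => rfl, fun h => h.symm, fun h h' => h.trans h'⟩ ?_ ?_ h
  · intro u v huv
    have hs : D.SameCircle u v := Relation.EqvGen.rel _ _ (Or.inl huv)
    unfold circleType
    rw [← rank_congr_left D hs v, rank_curved hadm u huv,
      if_pos (D.sameCircle_equivalence.refl u)]
    rcases hw.1 u v huv with ⟨h1, h2⟩ | ⟨h1, h2⟩ <;> rw [h1, h2] <;> simp only [Label.val] <;>
      generalize rank S _ u u = x <;> revert x <;> decide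
  · intro u v huv
    have hs : D.SameCircle u v := Relation.EqvGen.rel _ _ (Or.inr huv)
    unfold circleType
    rw [← rank_congr_left D hs v, rank_vertical hadm u huv, hw.2 u v huv]

theorem Oriented.label_cases {w : StackLabelling L} (hw : (stackOf a b d cut).Oriented w)
    {u : StackVertex L} (hu : (u.1 : ℤ) ∈ S) : w u = Label.down ∨ w u = Label.up := by
  obtain ⟨i, ε⟩ := u
  cases ε
  · rcases hw.1 (i, false) (arcMap a i, false)
      ((curved_false a b d cut).2 ⟨(arcMap_ne hu).symm, Or.inl rfl⟩) with h | h
    · exact Or.inl h.1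
    · exact Or.inr h.1
  · rcases hw.1 (i, true) (arcMap d i, true)
      ((curved_true a b d cut).2 ⟨(arcMap_ne hu).symm, Or.inl rfl⟩) with h | h
    · exact Or.inl h.1
    · exact Or.inr h.1

/-- At the leftmost vertex the parity vanishes and the type is the label itself. Vertices off `S`
form circles by themselves, without an arrow. -/
theorem Good.clockwise_iff (hadm : Admissible b cut) {w : StackLabelling L}
    (hw : Good S (stackOf a b d cut) w) (u : StackVertex L) :
    (stackOf a b d cut).Clockwise w u ↔
      (u.1 : ℤ) ∈ S ∧ circleType S (stackOf a b d cut) w u = 1 := by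
  set D := stackOf a b d cut with hD
  have hE := D.sameCircle_equivalence
  constructor
  · rintro ⟨v, huv, hmin, hv⟩
    have hvS : (v.1 : ℤ) ∈ S := by
      by_contra h
      rcases hw.2 v h with h' | h' <;> rw [h'] at hv <;> cases hv
    refine ⟨?_, ?_⟩
    · rcases sameCircle_supp huv with rfl | h
      · exact hvS
      · exact h.1
    · rw [circleType_const hadm hw.1 huv, circleType, rank_eq_zero_of_le
        (fun v' hv' => hmin v' (hE.trans huv hv')), hv]
      rfl
  · rintro ⟨hS, ht⟩
    obtain ⟨v, hv, hmin⟩ := D.exists_leftmost (D.SameCircle u) (hE.refl u)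
    refine ⟨v, hv, hmin, ?_⟩
    have hvS : (v.1 : ℤ) ∈ S := by
      rcases sameCircle_supp hv with rfl | h
      · exact hS
      · exact h.2
    rw [circleType_const hadm hw.1 hv, circleType, rank_eq_zero_of_le
      (fun v' hv' => hmin v' (hE.trans hv hv')), add_zero] at ht
    rcases Oriented.label_cases hw.1 hvS with h | h
    · rw [h] at ht; simp [Label.val] at ht
    · exact h

end Types
end ArcAlgebra

namespace ArcAlgebra
open scoped Classical
open MvPolynomial

/-! ### One step of the surgery procedure -/

section Step

variable {L : Finset ℤ} {S : Set ℤ} {a b d : Arcs L S} {cut : Finset ℤ}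

/-- The arrow with value `x`. -/
def arrow (x : ZMod 2) : Label := if x = 0 then Label.down else Label.up

@[simp] theorem val_arrow (x : ZMod 2) : (arrow x).val = x := by
  revert x; decide

theorem arrow_val {l : Label} (h : l = Label.down ∨ l = Label.up) : arrow l.val = l := by
  rcases h with rfl | rfl <;> rfl

theorem arrow_add_one (x : ZMod 2) : (arrow x = Label.down ∧ arrow (x + 1) = Label.up) ∨
    (arrow x = Label.up ∧ arrow (x + 1) = Label.down) := by
  revert x; decide

theorem stackOf_surgery (a b d : Arcs L S) (cut : Finset ℤ) (i : Vtx L) :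
    (stackOf a b d cut).surgery i = stackOf a b d (insert (i : ℤ) cut) := rfl

/-- The labelling that agrees with `w` except on the circles through `u` and `v`, which get the
types `x` and `y`. -/
noncomputable def relabel (S : Set ℤ) (D : Stack L) (w : StackLabelling L) (u v : StackVertex L)
    (x y : ZMod 2) : StackLabelling L := fun z =>
  if D.SameCircle u z then arrow (x + rank S D z z)
  else if D.SameCircle v z then arrow (y + rank S D z z) else w z

theorem isCut_insert_cases {i k : Vtx L} (h : IsCut b (insert (i : ℤ) cut) k) :
    k = i ∨ k = arcMap b i ∨ IsCut b cut k := by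
  obtain ⟨hS, h⟩ := h
  rcases Finset.mem_insert.1 h with h | h
  · rcases min_choice (k : ℤ) (b.1.arc k) with h1 | h1 <;> rw [h1] at h
    · exact Or.inl (Subtype.ext h)
    · right; left
      apply Subtype.ext
      rw [coe_arcMap, ← h, b.1.arc_arc]
  · exact Or.inr (Or.inr ⟨hS, h⟩)

theorem Ready.sameCircle_insert {i : Vtx L} (h : Ready b cut i) (ε ε' : Bool) :
    (stackOf a b d (insert (i : ℤ) cut)).SameCircle (i, ε) (i, ε') :=
  sameCircle_of_isCut h.isCut_insert _ _

theorem Ready.sameCircle_insert' {i : Vtx L} (h : Ready b cut i) (ε ε' : Bool) :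
    (stackOf a b d (insert (i : ℤ) cut)).SameCircle (arcMap b i, ε) (arcMap b i, ε') :=
  sameCircle_of_isCut ((isCut_arcMap _ _ _).2 h.isCut_insert) _ _

theorem sameCircle_mem_supp {u v : StackVertex L} (h : (stackOf a b d cut).SameCircle u v)
    (hu : (u.1 : ℤ) ∈ S) : (v.1 : ℤ) ∈ S := by
  rcases sameCircle_supp h with rfl | h
  · exact hu
  · exact h.2

/-- The touched circles are labelled by type plus parity, and the parity changes along cups and caps
and is constant along vertical segments. Elsewhere the pieces were already there before the surgery,
so `w` orients them. The types must agree when both ends of the arc end up on one circle. -/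
theorem Ready.relabel_good {i : Vtx L} (hr : Ready b cut i) {w : StackLabelling L}
    (hw : Good S (stackOf a b d cut) w) {x y : ZMod 2}
    (hxy : (stackOf a b d (insert (i : ℤ) cut)).SameCircle (i, false) (arcMap b i, false) → x = y) :
    Good S (stackOf a b d (insert (i : ℤ) cut))
      (relabel S (stackOf a b d (insert (i : ℤ) cut)) w (i, false) (arcMap b i, false) x y) := by
  have hadm := hr.admissible_insert
  set D' := stackOf a b d (insert (i : ℤ) cut) with hD'
  have hE := D'.sameCircle_equivalence
  refine ⟨⟨?_, ?_⟩, ?_⟩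
  · intro u v huv
    have hs : D'.SameCircle u v := Relation.EqvGen.rel _ _ (Or.inl huv)
    have hcl := fun z => (⟨fun h => hE.trans h hs, fun h => hE.trans h (hE.symm hs)⟩ :
      D'.SameCircle z u ↔ D'.SameCircle z v)
    have hrk : rank S D' v v = rank S D' u u + 1 := by
      rw [← rank_congr_left D' hs v, rank_curved hadm u huv, if_pos (hE.refl u)]
    simp only [relabel, ← hcl]
    split_ifs with h1 h2
    · rw [hrk, ← add_assoc]; exact arrow_add_one _
    · rw [hrk, ← add_assoc]; exact arrow_add_one _
    · refine hw.1.1 u v ?_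
      obtain ⟨g1, g2, g3⟩ := huv
      refine ⟨g1, g2, g3.imp_right (Or.imp_right fun g => ⟨g.1, fun h => g.2 ?_⟩)⟩
      exact Finset.mem_insert_of_mem h
  · intro u v huv
    have hs : D'.SameCircle u v := Relation.EqvGen.rel _ _ (Or.inr huv)
    have hcl := fun z => (⟨fun h => hE.trans h hs, fun h => hE.trans h (hE.symm hs)⟩ :
      D'.SameCircle z u ↔ D'.SameCircle z v)
    have hrk : rank S D' v v = rank S D' u u := by
      rw [← rank_congr_left D' hs v, rank_vertical hadm u huv]
    simp only [relabel, ← hcl, hrk]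
    split_ifs with h1 h2
    · rfl
    · rfl
    · rw [hD', vertical_iff] at huv
      refine hw.1.2 u v ((vertical_iff a b d cut).2 ⟨huv.1, huv.2.1, ?_⟩)
      obtain ⟨k, ε⟩ := u
      rcases isCut_insert_cases huv.2.2 with h | h | h
      · simp only at h; subst h
        exact absurd (hr.sameCircle_insert _ _) h1
      · simp only at h; subst h
        exact absurd (hr.sameCircle_insert' _ _) h2
      · exact h
  · intro u hu
    have h1 : ¬ D'.SameCircle (i, false) u := fun h => hu (sameCircle_mem_supp h hr.mem_supp)
    have h2 : ¬ D'.SameCircle (arcMap b i, false) u :=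
      fun h => hu (sameCircle_mem_supp h ((arc_mem_supp b).2 hr.mem_supp))
    rw [relabel, if_neg h1, if_neg h2]
    exact hw.2 u hu

theorem relabel_type_left {D : Stack L} (w : StackLabelling L) (u v : StackVertex L)
    (x y : ZMod 2) : circleType S D (relabel S D w u v x y) u = x := by
  rw [circleType, relabel, if_pos (D.sameCircle_equivalence.refl u), val_arrow, add_assoc]
  have : ∀ z : ZMod 2, z + z = 0 := by decide
  rw [this, add_zero]

theorem relabel_type_right {D : Stack L} (w : StackLabelling L) (u v : StackVertex L)
    {x y : ZMod 2} (hxy : D.SameCircle u v → x = y) :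
    circleType S D (relabel S D w u v x y) v = y := by
  have : ∀ z : ZMod 2, z + z = 0 := by decide
  by_cases h : D.SameCircle u v
  · rw [circleType, relabel, if_pos h, val_arrow, add_assoc, this, add_zero, hxy h]
  · rw [circleType, relabel, if_neg h, if_pos (D.sameCircle_equivalence.refl v), val_arrow,
      add_assoc, this, add_zero]

/-- The type of a circle determines all labels on it, so an orientation with prescribed labels
elsewhere is known from its types on the two touched circles. -/
theorem eq_relabel (hadm : Admissible b cut) {w w' : StackLabelling L} {u v : StackVertex L}
    (hu : (u.1 : ℤ) ∈ S) (hv : (v.1 : ℤ) ∈ S) (hw' : Good S (stackOf a b d cut) w')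
    (hoff : ∀ z, ¬ (stackOf a b d cut).SameCircle u z → ¬ (stackOf a b d cut).SameCircle v z →
      w' z = w z) :
    w' = relabel S (stackOf a b d cut) w u v (circleType S (stackOf a b d cut) w' u)
      (circleType S (stackOf a b d cut) w' v) := by
  have h2 : ∀ y z : ZMod 2, y + z + z = y := by decide
  funext z
  unfold relabel
  split_ifs with h h'
  · rw [circleType_const hadm hw'.1 h, circleType, h2,
      arrow_val (Oriented.label_cases hw'.1 (sameCircle_mem_supp h hu))]
  · rw [circleType_const hadm hw'.1 h', circleType, h2,
      arrow_val (Oriented.label_cases hw'.1 (sameCircle_mem_supp h' hv))]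
  · exact hoff z h h'

/-- The two circles that take part in a surgery, before and after. -/
theorem Ready.touched_iff {i : Vtx L} (hr : Ready b cut i) (u : StackVertex L) :
    ((stackOf a b d cut).SameCircle (i, false) u ∨ (stackOf a b d cut).SameCircle (i, true) u) ↔
    ((stackOf a b d (insert (i : ℤ) cut)).SameCircle (i, false) u ∨
      (stackOf a b d (insert (i : ℤ) cut)).SameCircle (arcMap b i, false) u) := by
  have hE := (stackOf a b d cut).sameCircle_equivalence
  have hE' := (stackOf a b d (insert (i : ℤ) cut)).sameCircle_equivalence
  by_cases hc : (stackOf a b d cut).SameCircle (i, false) (i, true)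
  · obtain ⟨-, h2⟩ := hr.split hc
    constructor
    · intro h
      have : (stackOf a b d cut).SameCircle (i, false) u := h.elim id fun h => hE.trans hc h
      rcases (h2 _ _).1 this with h | ⟨-, h⟩ | ⟨-, h⟩
      · exact Or.inl h
      · exact Or.inr h
      · exact Or.inl h
    · rintro (h | h)
      · exact Or.inl ((h2 _ _).2 (Or.inl h))
      · exact Or.inl ((h2 _ _).2 (Or.inr (Or.inl ⟨hE'.refl _, h⟩)))
  · have h2 := hr.merge hc
    constructor
    · rintro (h | h)
      · exact Or.inl ((h2 _ _).2 (Or.inl h))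
      · exact Or.inl ((h2 _ _).2 (Or.inr (Or.inl ⟨hE.refl _, h⟩)))
    · have hj : (stackOf a b d (insert (i : ℤ) cut)).SameCircle (i, false) (arcMap b i, false) :=
        (h2 _ _).2 (Or.inl (hr.sameCircle false))
      intro h
      have : (stackOf a b d (insert (i : ℤ) cut)).SameCircle (i, false) u :=
        h.elim id fun h => hE'.trans hj h
      rcases (h2 _ _).1 this with h | ⟨-, h⟩ | ⟨-, h⟩
      · exact Or.inl h
      · exact Or.inr h
      · exact Or.inl h

/-- The circles away from a surgery do not change. -/
theorem Ready.class_eq_of_not_touched {i : Vtx L} (hr : Ready b cut i) {u : StackVertex L}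
    (hu : ¬ ((stackOf a b d (insert (i : ℤ) cut)).SameCircle (i, false) u ∨
      (stackOf a b d (insert (i : ℤ) cut)).SameCircle (arcMap b i, false) u)) :
    (stackOf a b d cut).SameCircle u = (stackOf a b d (insert (i : ℤ) cut)).SameCircle u := by
  have hE := (stackOf a b d cut).sameCircle_equivalence
  have hE' := (stackOf a b d (insert (i : ℤ) cut)).sameCircle_equivalence
  have hu' := mt (hr.touched_iff u).1 hu
  funext v
  apply propext
  by_cases hc : (stackOf a b d cut).SameCircle (i, false) (i, true)
  · rw [(hr.split hc).2]
    refine ⟨?_, Or.inl⟩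
    rintro (h | ⟨h, -⟩ | ⟨h, -⟩)
    · exact h
    · exact absurd (Or.inl (hE'.symm h)) hu
    · exact absurd (Or.inr (hE'.symm h)) hu
  · rw [hr.merge hc]
    refine ⟨Or.inl, ?_⟩
    rintro (h | ⟨h, -⟩ | ⟨h, -⟩)
    · exact h
    · exact absurd (Or.inl (hE.symm h)) hu'
    · exact absurd (Or.inr (hE.symm h)) hu'

theorem clockwise_congr {D D' : Stack L} {w w' : StackLabelling L} {u : StackVertex L}
    (h : D.SameCircle u = D'.SameCircle u) (hw : ∀ v, D.SameCircle u v → w v = w' v) :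
    D.Clockwise w u ↔ D'.Clockwise w' u := by
  unfold Stack.Clockwise
  rw [← h]
  exact exists_congr fun v => and_congr_right fun hv => by rw [hw v hv]

theorem clockwise_of_sameCircle (D : Stack L) (w : StackLabelling L) {u v : StackVertex L}
    (h : D.SameCircle u v) : D.Clockwise w u ↔ D.Clockwise w v := by
  unfold Stack.Clockwise
  rw [class_eq D.sameCircle_equivalence h]

/-- The outcome of a surgery step in terms of types of circles. -/
theorem Ready.produces_iff {i : Vtx L} (hr : Ready b cut i) {w : StackLabelling L}
    (hw : Good S (stackOf a b d cut) w) (w' : StackLabelling L) :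
    (stackOf a b d cut).Produces i (arcMap b i) w w' ↔
    ∃ x y : ZMod 2, w' = relabel S (stackOf a b d (insert (i : ℤ) cut)) w (i, false)
        (arcMap b i, false) x y ∧
      if (stackOf a b d cut).SameCircle (i, false) (i, true) then
        (if (stackOf a b d cut).Clockwise w (i, false) then x = 1 ∧ y = 1 else x + y = 1)
      else
        ¬ ((stackOf a b d cut).Clockwise w (i, false) ∧ (stackOf a b d cut).Clockwise w (i, true)) ∧
        x = y ∧ (x = 1 ↔ ((stackOf a b d cut).Clockwise w (i, false) ∨
          (stackOf a b d cut).Clockwise w (i, true))) := by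
  have hadm := hr.admissible_insert
  have hiS := hr.mem_supp
  have hjS : ((arcMap b i : Vtx L) : ℤ) ∈ S := (arc_mem_supp b).2 hr.mem_supp
  have hmerge : ¬ (stackOf a b d cut).SameCircle (i, false) (i, true) →
      (stackOf a b d (insert (i : ℤ) cut)).SameCircle (i, false) (arcMap b i, false) :=
    fun hc => (hr.merge hc _ _).2 (Or.inl (hr.sameCircle false))
  have hsplit := fun hc => (hr.split (a := a) (d := d) hc).1
  have htouch := hr.touched_iff (a := a) (d := d)
  set D := stackOf a b d cut with hD
  unfold Stack.Produces
  rw [hD, stackOf_surgery, ← hD]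
  set D' := stackOf a b d (insert (i : ℤ) cut) with hD'
  have gen : ∀ w' : StackLabelling L, Good S D' w' →
      (D'.Clockwise w' (i, false) ↔ circleType S D' w' (i, false) = 1) ∧
      (D'.Clockwise w' (arcMap b i, false) ↔ circleType S D' w' (arcMap b i, false) = 1) := by
    intro w' hw'
    rw [hw'.clockwise_iff hadm, hw'.clockwise_iff hadm]
    simp only [hiS, hjS, true_and]
    exact ⟨Iff.rfl, Iff.rfl⟩
  have hz : ∀ x y : ZMod 2, (x = 1 ∧ ¬ y = 1 ∨ ¬ x = 1 ∧ y = 1) ↔ x + y = 1 := by decide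
  constructor
  · rintro ⟨h1, h2, h3⟩
    have hoff : ∀ z, ¬ D'.SameCircle (i, false) z → ¬ D'.SameCircle (arcMap b i, false) z →
        w' z = w z := by
      intro z hz1 hz2
      have := mt (htouch z).1 (not_or.2 ⟨hz1, hz2⟩)
      exact h2 z (not_or.1 this).1 (not_or.1 this).2
    have hg : Good S D' w' := by
      refine ⟨h1, fun u hu => ?_⟩
      rw [hoff u (fun h => hu (sameCircle_mem_supp h hiS)) (fun h => hu (sameCircle_mem_supp h hjS))]
      exact hw.2 u hu
    obtain ⟨g1, g2⟩ := gen w' hg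
    refine ⟨_, _, eq_relabel hadm (u := (i, false)) (v := (arcMap b i, false)) hiS hjS hg hoff, ?_⟩
    split_ifs at h3 ⊢ with hc hcw
    · exact ⟨g1.1 h3.1, g2.1 h3.2⟩
    · rw [g1, g2] at h3
      exact (hz _ _).1 h3
    · rw [g1] at h3
      exact ⟨h3.1, circleType_const hadm h1 (hmerge hc), h3.2⟩
  · rintro ⟨x, y, rfl, h⟩
    have hxy : D'.SameCircle (i, false) (arcMap b i, false) → x = y := by
      intro hs
      by_cases hc : D.SameCircle (i, false) (i, true)
      · exact absurd hs (hsplit hc)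
      · rw [if_neg hc] at h
        exact h.2.1
    have hg := hr.relabel_good hw hxy
    obtain ⟨g1, g2⟩ := gen _ hg
    rw [relabel_type_left] at g1
    rw [relabel_type_right _ _ _ hxy] at g2
    refine ⟨hg.1, ?_, ?_⟩
    · intro u h1 h2
      have := mt (htouch u).2 (not_or.2 ⟨h1, h2⟩)
      rw [not_or] at this
      rw [relabel, if_neg this.1, if_neg this.2]
    · split_ifs at h ⊢ with hc hcw
      · exact ⟨g1.2 h.1, g2.2 h.2⟩
      · rw [g1, g2]
        exact (hz _ _).2 h
      · rw [g1]
        exact ⟨h.1, h.2.2⟩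

theorem Ready.produces_good {i : Vtx L} (hr : Ready b cut i) {w w' : StackLabelling L}
    (hw : Good S (stackOf a b d cut) w) (h : (stackOf a b d cut).Produces i (arcMap b i) w w') :
    Good S (stackOf a b d (insert (i : ℤ) cut)) w' := by
  obtain ⟨x, y, rfl, h'⟩ := (hr.produces_iff hw w').1 h
  refine hr.relabel_good hw fun hs => ?_
  by_cases hc : (stackOf a b d cut).SameCircle (i, false) (i, true)
  · exact absurd hs (hr.split hc).1
  · rw [if_neg hc] at h'
    exact h'.2.1

/-- The element of the ring of circles given by an orientation. -/
noncomputable def stackMono (D : Stack L) (w : StackLabelling L) :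
    MvPolynomial (StackVertex L) ℤ := mono D.SameCircle (D.Clockwise w)

end Step
end ArcAlgebra

namespace ArcAlgebra
open scoped Classical
open MvPolynomial

/-! ### The surgery procedure in the ring of circles -/

section Procedure

variable {L : Finset ℤ} {S : Set ℤ} {a b d : Arcs L S} {cut : Finset ℤ}

theorem sameCycle_stackPerm (a b d : Arcs L S) (cut : Finset ℤ) :
    (stackPerm a b d cut).SameCycle = (stackOf a b d cut).SameCircle := by
  funext u v
  exact propext (sameCircle_iff a b d cut u v).symm

theorem clockwise_invariant (D : Stack L) (w : StackLabelling L) (u v : StackVertex L)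
    (h : D.SameCircle u v) (hu : D.Clockwise w u) : D.Clockwise w v :=
  (clockwise_of_sameCircle D w h).1 hu

theorem Ready.clockwise_relabel {i : Vtx L} (hr : Ready b cut i) {w : StackLabelling L}
    (hw : Good S (stackOf a b d cut) w) {x y : ZMod 2}
    (hxy : (stackOf a b d (insert (i : ℤ) cut)).SameCircle (i, false) (arcMap b i, false) → x = y) :
    ((stackOf a b d (insert (i : ℤ) cut)).Clockwise (relabel S (stackOf a b d (insert (i : ℤ) cut)) w
      (i, false) (arcMap b i, false) x y) (i, false) ↔ x = 1) ∧
    ((stackOf a b d (insert (i : ℤ) cut)).Clockwise (relabel S (stackOf a b d (insert (i : ℤ) cut)) w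
      (i, false) (arcMap b i, false) x y) (arcMap b i, false) ↔ y = 1) := by
  have hg := hr.relabel_good hw hxy
  have hiS := hr.mem_supp
  have hjS : ((arcMap b i : Vtx L) : ℤ) ∈ S := (arc_mem_supp b).2 hr.mem_supp
  rw [hg.clockwise_iff hr.admissible_insert, hg.clockwise_iff hr.admissible_insert,
    relabel_type_left, relabel_type_right _ _ _ hxy]
  simp [hiS, hjS]

theorem Ready.monoOff_relabel {i : Vtx L} (hr : Ready b cut i) (w : StackLabelling L)
    (x y : ZMod 2) {U : StackVertex L → Prop}
    (hU : ∀ v, U v ↔ ((stackOf a b d (insert (i : ℤ) cut)).SameCircle (i, false) v ∨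
      (stackOf a b d (insert (i : ℤ) cut)).SameCircle (arcMap b i, false) v)) :
    monoOff (stackOf a b d (insert (i : ℤ) cut)).SameCircle ((stackOf a b d (insert (i : ℤ) cut)).Clockwise
      (relabel S (stackOf a b d (insert (i : ℤ) cut)) w (i, false) (arcMap b i, false) x y)) U =
    monoOff (stackOf a b d cut).SameCircle ((stackOf a b d cut).Clockwise w) U := by
  refine monoOff_congr fun v hv => ?_
  rw [hU] at hv
  have hc := hr.class_eq_of_not_touched hv
  refine ⟨hc.symm, clockwise_congr hc.symm fun z hz => ?_⟩
  have hE' := (stackOf a b d (insert (i : ℤ) cut)).sameCircle_equivalence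
  rw [not_or] at hv
  rw [relabel, if_neg fun h => hv.1 (hE'.trans h (hE'.symm hz)),
    if_neg fun h => hv.2 (hE'.trans h (hE'.symm hz))]

/-- One step of surgery is the multiplication by `stepFactor`. -/
theorem Ready.step {i : Vtx L} (hr : Ready b cut i) {w : StackLabelling L}
    (hw : Good S (stackOf a b d cut) w) :
    (∑ w₁ : StackLabelling L, if (stackOf a b d cut).Produces i (arcMap b i) w w₁ then
        stackMono (stackOf a b d (insert (i : ℤ) cut)) w₁ else 0) -
      stepFactor (stackPerm a b d cut) (cutPair S false true (i, arcMap b i)).1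
        (cutPair S false true (i, arcMap b i)).2 * stackMono (stackOf a b d cut) w ∈
      circleIdeal (stackOf a b d (insert (i : ℤ) cut)).SameCircle := by
  have hprod := hr.produces_iff hw
  have hoff := fun x y => hr.monoOff_relabel (a := a) (d := d) w x y
    (U := fun v => (stackOf a b d (insert (i : ℤ) cut)).SameCircle (i, false) v ∨
      (stackOf a b d (insert (i : ℤ) cut)).SameCircle (arcMap b i, false) v) (fun v => Iff.rfl)
  have hcl := fun x y => hr.clockwise_relabel hw (x := x) (y := y)
  have htouch := hr.touched_iff (a := a) (d := d)
  have hmerge := hr.merge (a := a) (d := d)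
  have hsplit := fun hc => (hr.split (a := a) (d := d) hc).1
  have hp0q0 := hr.sameCircle (a := a) (d := d) false
  have hp0p1' := hr.sameCircle_insert (a := a) (d := d) false true
  have hE := (stackOf a b d cut).sameCircle_equivalence
  have hE' := (stackOf a b d (insert (i : ℤ) cut)).sameCircle_equivalence
  have hpair := cutPair_cases (b := b) hE hr.sameCircle
  have hpair' := cutPair_cases' (b := b) (i := i) hE' (by
    rintro k (rfl | rfl)
    · exact hr.sameCircle_insert _ _
    · exact hr.sameCircle_insert' _ _)
  have hmul : ∀ f ∈ circleIdeal (stackOf a b d cut).SameCircle,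
      stepFactor (stackPerm a b d cut) (cutPair S false true (i, arcMap b i)).1
        (cutPair S false true (i, arcMap b i)).2 * f ∈
        circleIdeal (stackOf a b d (insert (i : ℤ) cut)).SameCircle := by
    intro f hf
    rw [← sameCycle_stackPerm] at hf
    rw [← sameCycle_stackPerm, stackPerm_insert a b d cut hr.1 hr.notMem]
    exact stepFactor_mul_mem (cutPair_ne (by decide) _) hf
  unfold stepFactor at *
  rw [sameCycle_stackPerm] at *
  unfold stackMono
  have hinv := clockwise_invariant (stackOf a b d cut) w
  have hinv' := fun x y => clockwise_invariant (stackOf a b d (insert (i : ℤ) cut))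
    (relabel S (stackOf a b d (insert (i : ℤ) cut)) w (i, false) (arcMap b i, false) x y)
  have hsame : (stackOf a b d cut).SameCircle (cutPair S false true (i, arcMap b i)).1
      (cutPair S false true (i, arcMap b i)).2 ↔
      (stackOf a b d cut).SameCircle (i, false) (i, true) :=
    ⟨fun h => hE.trans (hE.symm hpair.1) (hE.trans h hpair.2),
      fun h => hE.trans hpair.1 (hE.trans h (hE.symm hpair.2))⟩
  have hX : (X (cutPair S false true (i, arcMap b i)).1 : MvPolynomial (StackVertex L) ℤ) +
      X (cutPair S false true (i, arcMap b i)).2 - (X (i, false) + X (arcMap b i, false)) ∈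
      circleIdeal (stackOf a b d (insert (i : ℤ) cut)).SameCircle := by
    rcases hpair' with ⟨h, h'⟩ | ⟨h, h'⟩
    · convert add_mem (X_sub_mem h) (X_sub_mem h') using 1; ring
    · convert add_mem (X_sub_mem h) (X_sub_mem h') using 1; ring
  have hp01 := X_sub_mem hp0p1'
  have hsq := X_sq_mem (stackOf a b d (insert (i : ℤ) cut)).SameCircle (i, false)
  have hsq' := X_sq_mem (stackOf a b d (insert (i : ℤ) cut)).SameCircle (arcMap b i, false)
  rw [if_congr hsame rfl rfl] at *
  -- In the quotient ring each case of the surgery rule becomes an identity that is a linear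
  -- combination of the relations collected above.
  obtain ⟨φ, hφ⟩ : ∃ φ : MvPolynomial (StackVertex L) ℤ →+* MvPolynomial (StackVertex L) ℤ ⧸
      circleIdeal (stackOf a b d (insert (i : ℤ) cut)).SameCircle,
      ∀ f, f ∈ circleIdeal (stackOf a b d (insert (i : ℤ) cut)).SameCircle ↔ φ f = 0 :=
    ⟨Ideal.Quotient.mk _, fun f => Ideal.Quotient.eq_zero_iff_mem.symm⟩
  by_cases hc : (stackOf a b d cut).SameCircle (i, false) (i, true)
  · simp only [if_pos hc] at *
    have hn := hsplit hc
    have h1 := mono_one hE hinv (i, false)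
    have hU : (fun v => (stackOf a b d cut).SameCircle (i, false) v) =
        fun v => (stackOf a b d (insert (i : ℤ) cut)).SameCircle (i, false) v ∨
          (stackOf a b d (insert (i : ℤ) cut)).SameCircle (arcMap b i, false) v := by
      funext v
      rw [← htouch v]
      exact propext ⟨Or.inl, fun h => h.elim id fun h => hE.trans hc h⟩
    rw [hU] at h1
    have h1' := hmul _ h1
    have h2 := fun x y => mono_two hE' (hinv' x y) hn
    simp only [hoff, mark, (hcl _ _ fun h => absurd h hn).1, (hcl _ _ fun h => absurd h hn).2] at h1' h2
    generalize monoOff (stackOf a b d cut).SameCircle _ _ = O at h1' h2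
    by_cases hcw : (stackOf a b d cut).Clockwise w (i, false)
    · have hsum : ∀ w', (stackOf a b d cut).Produces i (arcMap b i) w w' ↔
          w' = relabel S (stackOf a b d (insert (i : ℤ) cut)) w (i, false) (arcMap b i, false) 1 1 := by
        intro w'
        rw [hprod]
        simp only [if_pos hcw]
        exact ⟨by rintro ⟨x, y, rfl, rfl, rfl⟩; rfl, fun h => ⟨1, 1, h, rfl, rfl⟩⟩
      simp only [hsum, Finset.sum_ite_eq', Finset.mem_univ, if_true]
      have h3 := h2 1 1
      simp only [if_true, if_pos hcw] at h3 h1'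
      rw [hφ] at h1' h3 hX hsq ⊢
      simp only [map_mul, map_add, map_sub, map_pow] at h1' h3 hX hsq ⊢
      -- This is the rule x ↦ x ⊗ x: in (X_i + X_j) X_i the square vanishes and X_i X_j remains.
      linear_combination h1' - h3 - φ O * φ (X (i, false)) * hX - φ O * hsq
    · have hsum : ∀ w', (stackOf a b d cut).Produces i (arcMap b i) w w' ↔
          (w' = relabel S (stackOf a b d (insert (i : ℤ) cut)) w (i, false) (arcMap b i, false) 1 0 ∨
          w' = relabel S (stackOf a b d (insert (i : ℤ) cut)) w (i, false) (arcMap b i, false) 0 1) := by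
        intro w'
        rw [hprod]
        simp only [if_neg hcw]
        have hz : ∀ x y : ZMod 2, x + y = 1 ↔ (x = 1 ∧ y = 0) ∨ (x = 0 ∧ y = 1) := by decide
        simp only [hz]
        constructor
        · rintro ⟨x, y, rfl, ⟨rfl, rfl⟩ | ⟨rfl, rfl⟩⟩
          · exact Or.inl rfl
          · exact Or.inr rfl
        · rintro (h | h)
          · exact ⟨1, 0, h, Or.inl ⟨rfl, rfl⟩⟩
          · exact ⟨0, 1, h, Or.inr ⟨rfl, rfl⟩⟩
      -- The two summands of 1 ↦ 1 ⊗ x + x ⊗ 1 are different labellings, so both are counted.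
      have hne : relabel S (stackOf a b d (insert (i : ℤ) cut)) w (i, false) (arcMap b i, false) 1 0 ≠
          relabel S (stackOf a b d (insert (i : ℤ) cut)) w (i, false) (arcMap b i, false) 0 1 := by
        intro h
        have := congrArg (fun w => circleType S (stackOf a b d (insert (i : ℤ) cut)) w (i, false)) h
        simp only [relabel_type_left] at this
        exact absurd this (by decide)
      rw [Finset.sum_congr rfl (fun w' _ => if_congr (hsum w') rfl rfl), ← Finset.sum_filter,
        Finset.filter_or, Finset.filter_eq', Finset.filter_eq', if_pos (Finset.mem_univ _),
        if_pos (Finset.mem_univ _), Finset.sum_union (by simpa using hne), Finset.sum_singleton,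
        Finset.sum_singleton]
      have h3 := h2 1 0
      have h4 := h2 0 1
      simp only [if_true, if_neg hcw, zero_ne_one, if_false] at h3 h4 h1'
      rw [hφ] at h1' h3 h4 hX ⊢
      simp only [map_mul, map_add, map_sub, map_one] at h1' h3 h4 hX ⊢
      linear_combination h1' - h3 - h4 - φ O * hX
  · simp only [if_neg hc] at *
    have hs : (stackOf a b d (insert (i : ℤ) cut)).SameCircle (i, false) (arcMap b i, false) :=
      (hmerge hc _ _).2 (Or.inl hp0q0)
    have h1 := mono_two hE hinv hc
    have hU : (fun v => (stackOf a b d cut).SameCircle (i, false) v ∨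
        (stackOf a b d cut).SameCircle (i, true) v) =
        fun v => (stackOf a b d (insert (i : ℤ) cut)).SameCircle (i, false) v ∨
          (stackOf a b d (insert (i : ℤ) cut)).SameCircle (arcMap b i, false) v := by
      funext v
      exact propext (htouch v)
    have hU' : (fun v => (stackOf a b d (insert (i : ℤ) cut)).SameCircle (i, false) v) =
        fun v => (stackOf a b d (insert (i : ℤ) cut)).SameCircle (i, false) v ∨
          (stackOf a b d (insert (i : ℤ) cut)).SameCircle (arcMap b i, false) v := by
      funext v
      exact propext ⟨Or.inl, fun h => h.elim id fun h => hE'.trans hs h⟩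
    rw [hU] at h1
    have h1' := hmul _ h1
    have h3 := fun x => mono_one hE' (hinv' x x) (i, false)
    rw [hU'] at h3
    simp only [hoff, mark, (hcl _ _ fun _ => rfl).1] at h1' h3
    generalize monoOff (stackOf a b d cut).SameCircle _ _ = O at h1' h3
    by_cases hboth : (stackOf a b d cut).Clockwise w (i, false) ∧
        (stackOf a b d cut).Clockwise w (i, true)
    · have hsum : ∀ w', ¬ (stackOf a b d cut).Produces i (arcMap b i) w w' := by
        intro w' h
        rw [hprod] at h
        obtain ⟨x, y, -, h, -⟩ := h
        exact h hboth
      simp only [hsum, if_false, Finset.sum_const_zero]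
      simp only [if_pos hboth.1, if_pos hboth.2] at h1'
      rw [hφ] at h1' hp01 hsq ⊢
      simp only [map_mul, map_one, map_pow, map_zero, map_sub] at h1' hp01 hsq ⊢
      -- This is the rule x ⊗ x ↦ 0: after the merge the two variables agree, so their product is a
      -- square.
      linear_combination h1' - φ O * hsq + φ O * φ (X (i, false)) * hp01
    · obtain ⟨T, hT⟩ : ∃ T : ZMod 2, T = 1 ↔ ((stackOf a b d cut).Clockwise w (i, false) ∨
          (stackOf a b d cut).Clockwise w (i, true)) := by
        by_cases h : (stackOf a b d cut).Clockwise w (i, false) ∨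
          (stackOf a b d cut).Clockwise w (i, true)
        · exact ⟨1, by simp [h]⟩
        · exact ⟨0, by simp [h]⟩
      have hsum : ∀ w', (stackOf a b d cut).Produces i (arcMap b i) w w' ↔
          w' = relabel S (stackOf a b d (insert (i : ℤ) cut)) w (i, false) (arcMap b i, false) T T := by
        intro w'
        rw [hprod]
        have hz : ∀ x y : ZMod 2, (x = 1 ↔ y = 1) ↔ x = y := by decide
        simp only [hboth, not_false_iff, true_and, ← hT, hz]
        constructor
        · rintro ⟨x, y, rfl, rfl, rfl⟩; rfl
        · intro h; exact ⟨_, _, h, rfl, rfl⟩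
      simp only [hsum, Finset.sum_ite_eq', Finset.mem_univ, if_true]
      have h4 := h3 T
      simp only [hT] at h4
      rw [hφ] at h1' h4 hp01 ⊢
      by_cases c1 : (stackOf a b d cut).Clockwise w (i, false) <;>
      by_cases c2 : (stackOf a b d cut).Clockwise w (i, true)
      · exact absurd ⟨c1, c2⟩ hboth
      all_goals
        simp only [c1, c2, if_true, if_false, or_true, true_or, or_self, map_mul, map_sub, mul_one,
          one_mul] at h1' h4 hp01 ⊢
        first
        | linear_combination h1' - h4
        | linear_combination h1' - h4 + φ O * hp01

/-- The listed cups can be cut in the given order, after which all cups are cut. -/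
def ReadyList (b : Arcs L S) : Finset ℤ → List (Vtx L × Vtx L) → Prop
  | cut, [] => ∀ k ∈ L, k < b.1.arc k → k ∈ cut
  | cut, (i, j) :: l => Ready b cut i ∧ j = arcMap b i ∧ ReadyList b (insert (i : ℤ) cut) l

/-- The left ends of the cups that have been cut at the end. -/
def finalCut : Finset ℤ → List (Vtx L × Vtx L) → Finset ℤ
  | cut, [] => cut
  | cut, (i, _) :: l => finalCut (insert (i : ℤ) cut) l

theorem stackPerm_finalCut {l : List (Vtx L × Vtx L)} (hl : ReadyList b cut l) :
    stackPerm a b d (finalCut cut l) =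
      stackPerm a b d cut * swaps (l.map (cutPair S false true)) := by
  induction l generalizing cut with
  | nil => simp [finalCut]
  | cons x l ih =>
    obtain ⟨i, j⟩ := x
    obtain ⟨hr, rfl, hl⟩ := hl
    rw [finalCut, ih hl, stackPerm_insert a b d cut hr.1 hr.notMem, List.map_cons, swaps_cons,
      mul_assoc]

/-- The outcome of the surgery procedure in the ring of circles. -/
theorem sum_count_mul_stackMono {l : List (Vtx L × Vtx L)} (hl : ReadyList b cut l)
    {w : StackLabelling L} (hw : Good S (stackOf a b d cut) w) :
    (∑ w' : StackLabelling L, ((stackOf a b d cut).count l w w' : MvPolynomial (StackVertex L) ℤ) *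
        stackMono (stackOf a b d (finalCut cut l)) w') -
      chain (stackPerm a b d cut) (l.map (cutPair S false true)) * stackMono (stackOf a b d cut) w ∈
      circleIdeal (stackOf a b d (finalCut cut l)).SameCircle := by
  induction l generalizing cut w with
  | nil => simp [Stack.count, finalCut, chain]
  | cons x l ih =>
    obtain ⟨i, j⟩ := x
    obtain ⟨hr, rfl, hl⟩ := hl
    have h1 : (∑ w' : StackLabelling L,
        ((stackOf a b d cut).count ((i, arcMap b i) :: l) w w' : MvPolynomial (StackVertex L) ℤ) *
          stackMono (stackOf a b d (finalCut cut ((i, arcMap b i) :: l))) w') =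
        ∑ w₁ : StackLabelling L, if (stackOf a b d cut).Produces i (arcMap b i) w w₁ then
          ∑ w' : StackLabelling L, ((stackOf a b d (insert (i : ℤ) cut)).count l w₁ w' :
            MvPolynomial (StackVertex L) ℤ) *
            stackMono (stackOf a b d (finalCut (insert (i : ℤ) cut) l)) w' else 0 := by
      simp only [Stack.count, finalCut, stackOf_surgery, Nat.cast_sum, Finset.sum_mul]
      rw [Finset.sum_comm]
      refine Finset.sum_congr rfl fun w₁ _ => ?_
      split_ifs <;> simp
    have h2 : (∑ w₁ : StackLabelling L, if (stackOf a b d cut).Produces i (arcMap b i) w w₁ then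
          ∑ w' : StackLabelling L, ((stackOf a b d (insert (i : ℤ) cut)).count l w₁ w' :
            MvPolynomial (StackVertex L) ℤ) *
            stackMono (stackOf a b d (finalCut (insert (i : ℤ) cut) l)) w' else 0) -
        chain (stackPerm a b d (insert (i : ℤ) cut)) (l.map (cutPair S false true)) *
        (∑ w₁ : StackLabelling L, if (stackOf a b d cut).Produces i (arcMap b i) w w₁ then
          stackMono (stackOf a b d (insert (i : ℤ) cut)) w₁ else 0) ∈
        circleIdeal (stackOf a b d (finalCut (insert (i : ℤ) cut) l)).SameCircle := by
      rw [Finset.mul_sum, ← Finset.sum_sub_distrib]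
      refine Ideal.sum_mem _ fun w₁ _ => ?_
      split_ifs with h
      · exact ih hl (hr.produces_good hw h)
      · simp
    have h3 := hr.step hw
    have h4 : chain (stackPerm a b d (insert (i : ℤ) cut)) (l.map (cutPair S false true)) * _ ∈
        circleIdeal (stackPerm a b d (insert (i : ℤ) cut) *
          swaps (l.map (cutPair S false true))).SameCycle :=
      chain_mul_mem (τ := stackPerm a b d (insert (i : ℤ) cut)) (l := l.map (cutPair S false true))
      (fun x hx => by
        obtain ⟨y, -, rfl⟩ := List.mem_map.1 hx
        exact cutPair_ne (by decide) y) (by rw [sameCycle_stackPerm]; exact h3)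
    rw [← stackPerm_finalCut hl, sameCycle_stackPerm] at h4
    have h5 := add_mem h2 h4
    rw [h1, finalCut, List.map_cons, chain, ← stackPerm_insert a b d cut hr.1 hr.notMem]
    convert h5 using 1
    ring

end Procedure
end ArcAlgebra

namespace ArcAlgebra
open scoped Classical
open MvPolynomial

/-! ### Khovanov's multiplication in the ring of circles -/

section Lines

variable {L : Finset ℤ} {S : Set ℤ}

/-- The invariant for the induction: every cup is either cut already or has its left end still in
the increasing list `s`, and the left ends of cut cups precede all of `s`. -/
theorem readyList_filterMap (b : Arcs L S) (s : List ℤ) (hs : s.Pairwise (· < ·)) (cut : Finset ℤ)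
    (hsL : ∀ k ∈ s, k ∈ L) (h1 : ∀ k ∈ L, k < b.1.arc k → k ∈ cut ∨ k ∈ s)
    (h2 : ∀ k ∈ L, k < b.1.arc k → k ∈ cut → ∀ x ∈ s, k < x) :
    ReadyList b cut (s.filterMap fun i =>
      if h : i ∈ L ∧ b.1.arc i ∈ L ∧ i < b.1.arc i then some (⟨i, h.1⟩, ⟨b.1.arc i, h.2.1⟩)
      else none) := by
  induction s generalizing cut with
  | nil =>
    intro k hk hlt
    rcases h1 k hk hlt with h | h
    · exact h
    · cases h
  | cons i s ih =>
    rw [List.pairwise_cons] at hs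
    by_cases h : i ∈ L ∧ b.1.arc i ∈ L ∧ i < b.1.arc i
    · rw [List.filterMap_cons_some (b := (⟨i, h.1⟩, ⟨b.1.arc i, h.2.1⟩)) (by rw [dif_pos h])]
      refine ⟨⟨h.2.2, fun k hk hlt => ⟨fun hc => h2 k hk hlt hc i (by simp), fun hc => ?_⟩⟩, rfl, ?_⟩
      · rcases h1 k hk hlt with h' | h'
        · exact h'
        · rcases List.mem_cons.1 h' with rfl | h'
          · exact absurd hc (lt_irrefl _)
          · exact absurd (hs.1 k h') (not_lt.2 (le_of_lt hc))
      · refine ih hs.2 _ (fun k hk => hsL k (by simp [hk])) ?_ ?_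
        · intro k hk hlt
          rcases h1 k hk hlt with h' | h'
          · exact Or.inl (by simp [h'])
          · rcases List.mem_cons.1 h' with rfl | h'
            · exact Or.inl (by simp)
            · exact Or.inr h'
        · intro k hk hlt hc x hx
          rcases Finset.mem_insert.1 hc with rfl | hc
          · exact hs.1 x hx
          · exact h2 k hk hlt hc x (by simp [hx])
    · rw [List.filterMap_cons_none (by rw [dif_neg h])]
      refine ih hs.2 _ (fun k hk => hsL k (by simp [hk])) ?_ ?_
      · intro k hk hlt
        rcases h1 k hk hlt with h' | h'
        · exact Or.inl h'
        · rcases List.mem_cons.1 h' with rfl | h'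
          · exact absurd ⟨hk, arc_mem_line b.1 hk, hlt⟩ h
          · exact Or.inr h'
      · exact fun k hk hlt hc x hx => h2 k hk hlt hc x (by simp [hx])

theorem readyList_cupList (b : Arcs L S) : ReadyList b ∅ b.1.cupList := by
  refine readyList_filterMap b _ ?_ _ (by simp) (fun k hk _ => Or.inr (by simpa using hk)) (by simp)
  exact (Finset.sortedLT_sort L).pairwise

theorem mem_finalCut {b : Arcs L S} {cut : Finset ℤ} {l : List (Vtx L × Vtx L)}
    (hl : ReadyList b cut l) {k : ℤ} (hk : k ∈ L) (hlt : k < b.1.arc k) : k ∈ finalCut cut l := by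
  induction l generalizing cut with
  | nil => exact hl k hk hlt
  | cons x l ih =>
    obtain ⟨i, j⟩ := x
    exact ih hl.2.2

/-- The caps of the diagram after all surgeries. -/
noncomputable def fullCut (b : Arcs L S) : Finset ℤ := finalCut ∅ b.1.cupList

theorem isCut_fullCut (b : Arcs L S) {i : Vtx L} (hi : (i : ℤ) ∈ S) : IsCut b (fullCut b) i := by
  refine ⟨hi, ?_⟩
  have hr := readyList_cupList b
  rcases lt_or_gt_of_ne ((b.2 i).2 hi) with h | h
  · rw [min_eq_right h.le]
    exact mem_finalCut hr (arc_mem_line b.1 i.2) (by rwa [b.1.arc_arc])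
  · rw [min_eq_left h.le]
    exact mem_finalCut hr i.2 h

variable (a b d : Arcs L S)

/-- Two vertices lie on the same circle of the circle diagram with arcs `a` and `b`. -/
def lineRel : Vtx L → Vtx L → Prop := (linePerm a b).SameCycle

theorem lineRel_equivalence : Equivalence (lineRel a b) := sameCycle_equivalence _

theorem sameCycle_layered {X Λ : Type*} (e : Λ → Equiv.Perm X) (u v : X × Λ) :
    (layered e).SameCycle u v ↔ u.2 = v.2 ∧ (e u.2).SameCycle u.1 v.1 := by
  constructor
  · intro h
    refine sameCycle_le (layered e) (r := fun u v => u.2 = v.2 ∧ (e u.2).SameCycle u.1 v.1)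
      ⟨fun x => ⟨rfl, Equiv.Perm.SameCycle.refl _ _⟩, ?_, ?_⟩ ?_ h
    · rintro x y ⟨h1, h2⟩
      exact ⟨h1.symm, by rw [← h1]; exact h2.symm⟩
    · rintro x y z ⟨h1, h2⟩ ⟨h3, h4⟩
      exact ⟨h1.trans h3, h2.trans (by rw [h1]; exact h4)⟩
    · exact fun x => ⟨rfl, sameCycle_apply _ _⟩
  · obtain ⟨x, m⟩ := u
    obtain ⟨y, m'⟩ := v
    rintro ⟨rfl, h⟩
    refine sameCycle_le (e m) (r := fun x y => (layered e).SameCycle (x, m) (y, m))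
      ⟨fun x => Equiv.Perm.SameCycle.refl _ _, fun h => h.symm, fun h h' => h.trans h'⟩ ?_ h
    exact fun x => sameCycle_apply (layered e) (x, m)

theorem sameCircle_empty (u v : StackVertex L) : (stackOf a b d ∅).SameCircle u v ↔
    u.2 = v.2 ∧ if u.2 then lineRel b d u.1 v.1 else lineRel a b u.1 v.1 := by
  rw [sameCircle_iff, stackPerm_empty, sameCycle_layered]
  refine and_congr_right fun _ => ?_
  split_ifs <;> rfl

variable {a b d}

/-- Once all caps are cut, the flow projected to a single line either stays in place, along a
vertical segment, or follows an arc of `a` or `d` as the flow of the circle diagram with these arcs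
does. -/
theorem lineRel_of_sameCircle {u v : StackVertex L}
    (h : (stackOf a b d (fullCut b)).SameCircle u v) : lineRel a d u.1 v.1 := by
  rw [sameCircle_iff] at h
  have hE := lineRel_equivalence a d
  refine sameCycle_le _ (r := fun u v : StackVertex L => lineRel a d u.1 v.1)
    ⟨fun x => hE.refl _, fun h => hE.symm h, fun h h' => hE.trans h h'⟩ ?_ h
  rintro ⟨i, ε⟩
  have hi := sameCycle_apply (linePerm a d) i
  rw [linePerm_apply] at hi
  cases ε
  · rw [stackPerm_false]
    split_ifs with h1 h2
    · rwa [if_pos h1] at hi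
    · exact hE.refl _
    · by_cases hS : (i : ℤ) ∈ S
      · exact absurd (isCut_fullCut b hS) h2
      · rw [arcMap_eq hS]; exact hE.refl _
  · rw [stackPerm_true]
    split_ifs with h1 h2
    · exact hE.refl _
    · by_cases hS : (i : ℤ) ∈ S
      · exact absurd (isCut_fullCut b hS) h2
      · rw [arcMap_eq hS]; exact hE.refl _
    · rwa [if_neg h1] at hi

/-- The converse needs the vertical segments to pass between the two lines. They exist only at
vertices of `S`; elsewhere the two copies of a vertex remain apart. -/
theorem sameCircle_of_lineRel {u v : StackVertex L} (hu : (u.1 : ℤ) ∈ S)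
    (h : lineRel a d u.1 v.1) : (stackOf a b d (fullCut b)).SameCircle u v := by
  have hE := (stackOf a b d (fullCut b)).sameCircle_equivalence
  have hvert : ∀ (i : Vtx L) (ε ε' : Bool), (i : ℤ) ∈ S →
      (stackOf a b d (fullCut b)).SameCircle (i, ε) (i, ε') :=
    fun i ε ε' hi => sameCircle_of_isCut (isCut_fullCut b hi) ε ε'
  have key := sameCycle_le _ (r := fun i j : Vtx L => i = j ∨ (i : ℤ) ∈ S ∧ (j : ℤ) ∈ S ∧
    (stackOf a b d (fullCut b)).SameCircle (i, false) (j, false)) ⟨fun x => Or.inl rfl, ?_, ?_⟩ ?_ h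
  · obtain ⟨i, ε⟩ := u
    obtain ⟨j, ε'⟩ := v
    rcases key with h | ⟨h1, h2, h3⟩
    · simp only at h; subst h
      exact hvert _ _ _ hu
    · exact hE.trans (hvert i _ _ h1) (hE.trans h3 (hvert j _ _ h2))
  · rintro x y (h | ⟨h1, h2, h3⟩)
    · exact Or.inl h.symm
    · exact Or.inr ⟨h2, h1, hE.symm h3⟩
  · rintro x y z (rfl | ⟨h1, h2, h3⟩) (rfl | ⟨h4, h5, h6⟩)
    · exact Or.inl rfl
    · exact Or.inr ⟨h4, h5, h6⟩
    · exact Or.inr ⟨h1, h2, h3⟩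
    · exact Or.inr ⟨h1, h5, hE.trans h3 h6⟩
  · intro i
    by_cases hS : (i : ℤ) ∈ S
    · rw [linePerm_apply]
      split_ifs with hi
      · refine Or.inr ⟨hS, (arc_mem_supp a).2 hS, ?_⟩
        exact Relation.EqvGen.rel _ _ (Or.inl ((curved_false a b d _).2
          ⟨(arcMap_ne hS).symm, Or.inl rfl⟩))
      · have hS' : ((arcMap d i : Vtx L) : ℤ) ∈ S := (arc_mem_supp d).2 hS
        refine Or.inr ⟨hS, hS', hE.trans (hvert i _ true hS) (hE.trans ?_ (hvert _ true _ hS'))⟩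
        exact Relation.EqvGen.rel _ _ (Or.inl ((curved_true a b d _).2
          ⟨(arcMap_ne hS).symm, Or.inl rfl⟩))
    · left
      rw [linePerm_apply, arcMap_eq hS, arcMap_eq hS, ite_self]

/-- The circle through `u` in the circle diagram `a lam b` is clockwise. -/
def lineClockwise (a b : Arcs L S) (lam : Weight (L : Set ℤ)) (u : Vtx L) : Prop :=
  ∃ v, lineRel a b u v ∧ (∀ v', lineRel a b u v' → v ≤ v') ∧ lam.label v = Label.up

theorem lineClockwise_invariant (lam : Weight (L : Set ℤ)) (u v : Vtx L) (h : lineRel a b u v)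
    (hu : lineClockwise a b lam u) : lineClockwise a b lam v := by
  unfold lineClockwise at *
  rwa [← class_eq (lineRel_equivalence a b) h]

/-- The element of the ring of circles given by an oriented circle diagram. -/
noncomputable def lineMono (a b : Arcs L S) (lam : Weight (L : Set ℤ)) : MvPolynomial (Vtx L) ℤ :=
  mono (lineRel a b) (lineClockwise a b lam)

/-- The ideal of the circle diagram with arcs `a` and `b`. -/
noncomputable def lineIdeal (a b : Arcs L S) : Ideal (MvPolynomial (Vtx L) ℤ) :=
  circleIdeal (lineRel a b)

/-- The image of `1 ⊗ 1` under Khovanov's multiplication. -/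
noncomputable def surgeryFactor (a b d : Arcs L S) : MvPolynomial (Vtx L) ℤ :=
  rename Prod.fst (chain (stackPerm a b d ∅) (b.1.cupList.map (cutPair S false true)))

theorem rename_fst_mem {f : MvPolynomial (StackVertex L) ℤ}
    (hf : f ∈ circleIdeal (stackOf a b d (fullCut b)).SameCircle) :
    rename Prod.fst f ∈ lineIdeal a d :=
  rename_mem_circleIdeal _ (fun _ _ => lineRel_of_sameCircle) hf

theorem surgeryFactor_aux {f : MvPolynomial (StackVertex L) ℤ}
    (hf : f ∈ circleIdeal (stackOf a b d ∅).SameCircle) :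
    surgeryFactor a b d * rename Prod.fst f ∈ lineIdeal a d := by
  rw [surgeryFactor, ← map_mul]
  apply rename_fst_mem
  rw [← sameCycle_stackPerm, fullCut, stackPerm_finalCut (readyList_cupList b)]
  refine chain_mul_mem ?_ (by rwa [sameCycle_stackPerm])
  intro x hx
  obtain ⟨y, -, rfl⟩ := List.mem_map.1 hx
  exact cutPair_ne (by decide) y

/-- Relations for the lower diagram remain relations after multiplication, so in iterated products
an intermediate result may be replaced by any congruent polynomial. -/
theorem surgeryFactor_mul_mem_left {f : MvPolynomial (Vtx L) ℤ} (hf : f ∈ lineIdeal a b) :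
    surgeryFactor a b d * f ∈ lineIdeal a d := by
  have h := surgeryFactor_aux (a := a) (b := b) (d := d) (f := rename (fun i => (i, false)) f)
    (rename_mem_circleIdeal _ (fun u v huv => (sameCircle_empty a b d _ _).2 ⟨rfl, by simpa using huv⟩) hf)
  rw [rename_rename] at h
  rwa [show (Prod.fst ∘ fun i : Vtx L => (i, false)) = id from rfl, rename_id_apply] at h

theorem surgeryFactor_mul_mem_right {f : MvPolynomial (Vtx L) ℤ} (hf : f ∈ lineIdeal b d) :
    surgeryFactor a b d * f ∈ lineIdeal a d := by
  have h := surgeryFactor_aux (a := a) (b := b) (d := d) (f := rename (fun i => (i, true)) f)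
    (rename_mem_circleIdeal _ (fun u v huv => (sameCircle_empty a b d _ _).2 ⟨rfl, by simpa using huv⟩) hf)
  rw [rename_rename] at h
  rwa [show (Prod.fst ∘ fun i : Vtx L => (i, true)) = id from rfl, rename_id_apply] at h

/-- A weight is determined by the labels of the vertices. -/
theorem weight_ext {lam mu : Weight (L : Set ℤ)} (h : ∀ i : Vtx L, lam.label i = mu.label i) :
    lam = mu := by
  ext i
  by_cases hi : i ∈ L
  · exact h ⟨i, hi⟩
  · rw [lam.label_off i (by simpa using hi), mu.label_off i (by simpa using hi)]

noncomputable instance : Fintype (Weight (L : Set ℤ)) :=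
  Fintype.ofInjective (fun (lam : Weight (L : Set ℤ)) (i : Vtx L) => lam.label i)
    fun _ _ h => weight_ext fun i => congrFun h i

theorem stackLabelling_false (lam mu : Weight (L : Set ℤ)) (i : Vtx L) :
    stackLabelling lam mu (i, false) = lam.label i := rfl

theorem stackLabelling_true (lam mu : Weight (L : Set ℤ)) (i : Vtx L) :
    stackLabelling lam mu (i, true) = mu.label i := rfl

theorem stackLabelling_diag_injective :
    Function.Injective fun nu : Weight (L : Set ℤ) => stackLabelling nu nu := by
  intro nu nu' h
  exact weight_ext fun i => congrFun h (i, false)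

/-- The weight with given labels. -/
def weightOf (f : Vtx L → Label) : Weight (L : Set ℤ) where
  label i := if h : i ∈ L then f ⟨i, h⟩ else Label.nought
  label_off i hi := dif_neg (by simpa using hi)
  tame := ⟨L, fun i j _ hi _ h => by simp [hi] at h⟩

theorem weightOf_label (f : Vtx L → Label) (i : Vtx L) : (weightOf f).label i = f i := by
  simp [weightOf]

theorem isOriented_off {a : Arcs L S} {lam : Weight (L : Set ℤ)} (ha : a.1.ray = ∅)
    (h : IsOriented a.1 lam) {i : ℤ} (hi : i ∉ S) :
    lam.label i = Label.nought ∨ lam.label i = Label.cross := by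
  refine h.1 i ?_ (by rw [ha]; exact Set.notMem_empty i)
  by_contra h'
  exact hi ((a.2 i).1 h')

/-- A relation that is respected by all surgery steps is respected by the whole procedure. -/
theorem count_rel {R : StackLabelling L → StackLabelling L → Prop} (hrefl : ∀ w, R w w)
    (htrans : ∀ w w' w'', R w w' → R w' w'' → R w w'')
    (hstep : ∀ (cut : Finset ℤ) (i : Vtx L) (w w' : StackLabelling L), Ready b cut i →
      Good S (stackOf a b d cut) w → Good S (stackOf a b d (insert (i : ℤ) cut)) w' →
      (stackOf a b d cut).Produces i (arcMap b i) w w' → R w w')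
    {cut : Finset ℤ} {l : List (Vtx L × Vtx L)} (hl : ReadyList b cut l) {w w' : StackLabelling L}
    (hw : Good S (stackOf a b d cut) w) (h : (stackOf a b d cut).count l w w' ≠ 0) :
    Good S (stackOf a b d (finalCut cut l)) w' ∧ R w w' := by
  induction l generalizing cut w with
  | nil =>
    simp only [Stack.count, ne_eq, ite_eq_right_iff, one_ne_zero, imp_false, not_not] at h
    subst h
    exact ⟨hw, hrefl w⟩
  | cons x l ih =>
    obtain ⟨i, j⟩ := x
    obtain ⟨hr, rfl, hl⟩ := hl
    simp only [Stack.count] at h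
    obtain ⟨w₁, -, h1⟩ := Finset.exists_ne_zero_of_sum_ne_zero h
    have hp : (stackOf a b d cut).Produces i (arcMap b i) w w₁ := by
      by_contra hp; rw [if_neg hp] at h1; exact h1 rfl
    rw [if_pos hp] at h1
    have hg := hr.produces_good hw hp
    obtain ⟨g1, g2⟩ := ih hl hg h1
    exact ⟨g1, htrans _ _ _ (hstep _ _ _ _ hr hw hg hp) g2⟩

theorem good_stackLabelling (ha : a.1.ray = ∅) (hd : d.1.ray = ∅) {lam mu : Weight (L : Set ℤ)}
    (h1 : IsOriented a.1 lam) (h2 : IsOriented b.1 lam) (h3 : IsOriented b.1 mu)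
    (h4 : IsOriented d.1 mu) : Good S (stackOf a b d ∅) (stackLabelling lam mu) := by
  refine ⟨⟨?_, ?_⟩, ?_⟩
  · have key : ∀ (e : Arcs L S) (nu : Weight (L : Set ℤ)), IsOriented e.1 nu → ∀ i j : Vtx L,
        i ≠ j → arcMap e i = j → (nu.label i = Label.down ∧ nu.label j = Label.up) ∨
          (nu.label i = Label.up ∧ nu.label j = Label.down) := by
      rintro e nu he i _ hij rfl
      exact he.2.1 i fun h => hij (Subtype.ext h.symm)
    rintro ⟨i, ε⟩ ⟨j, ε'⟩ h
    have he : ε = ε' := h.1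
    subst he
    cases ε
    · rw [curved_false] at h
      obtain ⟨hij, h | ⟨h, -⟩⟩ := h
      · exact key a lam h1 i j hij h
      · exact key b lam h2 i j hij h
    · rw [curved_true] at h
      obtain ⟨hij, h | ⟨h, -⟩⟩ := h
      · exact key d mu h4 i j hij h
      · exact key b mu h3 i j hij h
  · intro u v h
    rw [vertical_iff] at h
    exact absurd h.2.2.2 (by simp)
  · rintro ⟨i, ε⟩ hi
    cases ε
    · exact isOriented_off ha h1 hi
    · exact isOriented_off hd h4 hi

end Lines
end ArcAlgebra

namespace ArcAlgebra
open scoped Classical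
open MvPolynomial

/-! ### The product of two closed diagrams as multiplication by the surgery factor. -/

section Lines

variable {L : Finset ℤ} {S : Set ℤ} {a b d : Arcs L S}

theorem count_off {cut : Finset ℤ} {l : List (Vtx L × Vtx L)} (hl : ReadyList b cut l)
    {w w' : StackLabelling L} (hw : Good S (stackOf a b d cut) w)
    (h : (stackOf a b d cut).count l w w' ≠ 0) :
    Good S (stackOf a b d (finalCut cut l)) w' ∧
      ∀ u : StackVertex L, (u.1 : ℤ) ∉ S → w' u = w u := by
  refine count_rel (R := fun w w' => ∀ u : StackVertex L, (u.1 : ℤ) ∉ S → w' u = w u)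
    (fun _ _ _ => rfl) (fun _ _ _ h h' u hu => (h' u hu).trans (h u hu)) ?_ hl hw h
  intro cut i w w' hr _ _ hp u hu
  exact hp.2.1 u (fun h => hu (sameCircle_mem_supp h hr.mem_supp))
    (fun h => hu (sameCircle_mem_supp h hr.mem_supp))

/-- At the end each vertex of `S` lies on a vertical segment, so the two lines carry equal labels
there. Off `S` surgery changes nothing, and there the two factors agree by assumption. Hence the
number lines can be identified. -/
theorem count_diag (ha : a.1.ray = ∅) (hd : d.1.ray = ∅) {lam mu : Weight (L : Set ℤ)}
    (h1 : IsOriented a.1 lam) (h2 : IsOriented b.1 lam) (h3 : IsOriented b.1 mu)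
    (h4 : IsOriented d.1 mu) (hoff : ∀ i, i ∉ S → lam.label i = mu.label i) {w' : StackLabelling L}
    (h : (stackOf a b d ∅).count b.1.cupList (stackLabelling lam mu) w' ≠ 0) :
    Good S (stackOf a b d (fullCut b)) w' ∧ ∃ nu : Weight (L : Set ℤ),
      (∀ i, i ∉ S → nu.label i = lam.label i) ∧ stackLabelling nu nu = w' := by
  obtain ⟨hg, hw⟩ := count_off (readyList_cupList b) (good_stackLabelling ha hd h1 h2 h3 h4) h
  refine ⟨hg, weightOf fun i => w' (i, false), ?_, ?_⟩
  · intro i hi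
    by_cases hiL : i ∈ L
    · rw [weightOf_label _ ⟨i, hiL⟩, hw _ hi]
      rfl
    · rw [(weightOf _).label_off i (by simpa using hiL), lam.label_off i (by simpa using hiL)]
  · funext ⟨i, ε⟩
    have : stackLabelling (weightOf fun i => w' (i, false)) (weightOf fun i => w' (i, false)) (i, ε) =
        w' (i, false) := by
      cases ε
      · rw [stackLabelling_false, weightOf_label]
      · rw [stackLabelling_true, weightOf_label]
    rw [this]
    cases ε
    · rfl
    · by_cases hi : (i : ℤ) ∈ S
      · refine hg.1.2 _ _ ((vertical_iff _ _ _ _).2 ⟨by simp, rfl, isCut_fullCut b hi⟩)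
      · rw [hw _ hi, hw _ hi]
        exact hoff i hi

theorem clockwise_empty_false (lam mu : Weight (L : Set ℤ)) (i : Vtx L) :
    (stackOf a b d ∅).Clockwise (stackLabelling lam mu) (i, false) ↔ lineClockwise a b lam i := by
  unfold Stack.Clockwise lineClockwise
  constructor
  · rintro ⟨⟨j, ε⟩, h1, h2, h3⟩
    obtain ⟨h, h1⟩ := (sameCircle_empty _ _ _ _ _).1 h1
    simp only at h; subst h
    exact ⟨j, by simpa using h1, fun j' hj' => h2 (j', false) ((sameCircle_empty _ _ _ _ _).2
      ⟨rfl, by simpa using hj'⟩), h3⟩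
  · rintro ⟨j, h1, h2, h3⟩
    refine ⟨(j, false), (sameCircle_empty _ _ _ _ _).2 ⟨rfl, by simpa using h1⟩, ?_, h3⟩
    rintro ⟨j', ε⟩ hj'
    obtain ⟨h, h4⟩ := (sameCircle_empty _ _ _ _ _).1 hj'
    simp only at h; subst h
    exact h2 j' (by simpa using h4)

theorem clockwise_empty_true (lam mu : Weight (L : Set ℤ)) (i : Vtx L) :
    (stackOf a b d ∅).Clockwise (stackLabelling lam mu) (i, true) ↔ lineClockwise b d mu i := by
  unfold Stack.Clockwise lineClockwise
  constructor
  · rintro ⟨⟨j, ε⟩, h1, h2, h3⟩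
    obtain ⟨h, h1⟩ := (sameCircle_empty _ _ _ _ _).1 h1
    simp only at h; subst h
    exact ⟨j, by simpa using h1, fun j' hj' => h2 (j', true) ((sameCircle_empty _ _ _ _ _).2
      ⟨rfl, by simpa using hj'⟩), h3⟩
  · rintro ⟨j, h1, h2, h3⟩
    refine ⟨(j, true), (sameCircle_empty _ _ _ _ _).2 ⟨rfl, by simpa using h1⟩, ?_, h3⟩
    rintro ⟨j', ε⟩ hj'
    obtain ⟨h, h4⟩ := (sameCircle_empty _ _ _ _ _).1 hj'
    simp only at h; subst h
    exact h2 j' (by simpa using h4)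

theorem clockwise_full {nu : Weight (L : Set ℤ)}
    (hg : Good S (stackOf a b d (fullCut b)) (stackLabelling nu nu)) (u : StackVertex L) :
    (stackOf a b d (fullCut b)).Clockwise (stackLabelling nu nu) u ↔ lineClockwise a d nu u.1 := by
  have hlab : ∀ v : StackVertex L, stackLabelling nu nu v = nu.label v.1 := by
    rintro ⟨i, ε⟩; cases ε <;> rfl
  unfold Stack.Clockwise lineClockwise
  have hsupp : ∀ v : StackVertex L, nu.label v.1 = Label.up → (v.1 : ℤ) ∈ S := by
    intro v hv
    by_contra h
    rcases hg.2 v h with h' | h' <;> rw [hlab, hv] at h' <;> cases h'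
  constructor
  · rintro ⟨v, h1, h2, h3⟩
    rw [hlab] at h3
    have huS := sameCircle_mem_supp ((stackOf a b d (fullCut b)).sameCircle_equivalence.symm h1)
      (hsupp v h3)
    exact ⟨v.1, lineRel_of_sameCircle h1,
      fun v' hv' => h2 (v', false) (sameCircle_of_lineRel huS hv'), h3⟩
  · rintro ⟨v, h1, h2, h3⟩
    have hvS := hsupp (v, u.2) h3
    have hE := (stackOf a b d (fullCut b)).sameCircle_equivalence
    refine ⟨(v, u.2), hE.symm (sameCircle_of_lineRel (u := (v, u.2)) (v := u) hvS
      ((lineRel_equivalence a d).symm h1)), fun v' hv' => h2 _ (lineRel_of_sameCircle hv'), ?_⟩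
    rw [hlab]
    exact h3

/-- Before any surgery the circles are those of the lower diagram and those of the upper one, so the
representatives of both together form a transversal. -/
theorem stackMono_empty (lam mu : Weight (L : Set ℤ)) :
    rename (fun i => (i, false)) (lineMono a b lam) * rename (fun i => (i, true)) (lineMono b d mu) -
      stackMono (stackOf a b d ∅) (stackLabelling lam mu) ∈
      circleIdeal (stackOf a b d ∅).SameCircle := by
  have hE := (stackOf a b d ∅).sameCircle_equivalence
  have := prod_sub_mono_mem hE (clockwise_invariant (stackOf a b d ∅) (stackLabelling lam mu))
    ((repSet (lineRel a b) (lineClockwise a b lam)).disjSum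
      (repSet (lineRel b d) (lineClockwise b d mu)))
    (Sum.elim (fun i => (i, false)) fun i => (i, true)) ?_ ?_ ?_
  · rw [Finset.prod_disjSum] at this
    simpa [stackMono, lineMono, mono, map_prod] using this
  · rintro (i | i) hi
    · simp only [Finset.inl_mem_disjSum, repSet, Finset.mem_filter] at hi
      exact (clockwise_empty_false lam mu i).2 hi.2.2
    · simp only [Finset.inr_mem_disjSum, repSet, Finset.mem_filter] at hi
      exact (clockwise_empty_true lam mu i).2 hi.2.2
  · rintro ⟨i, ε⟩ hi
    cases ε
    · rw [clockwise_empty_false] at hi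
      have hr := rel_rep (lineRel_equivalence a b) i
      refine ⟨Sum.inl (rep (lineRel a b) i), ?_, (sameCircle_empty _ _ _ _ _).2 ⟨rfl, by simpa using hr⟩⟩
      simp only [Finset.inl_mem_disjSum, repSet, Finset.mem_filter, Finset.mem_univ, true_and]
      exact ⟨rep_rep (lineRel_equivalence a b) i, lineClockwise_invariant _ _ _ hr hi⟩
    · rw [clockwise_empty_true] at hi
      have hr := rel_rep (lineRel_equivalence b d) i
      refine ⟨Sum.inr (rep (lineRel b d) i), ?_, (sameCircle_empty _ _ _ _ _).2 ⟨rfl, by simpa using hr⟩⟩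
      simp only [Finset.inr_mem_disjSum, repSet, Finset.mem_filter, Finset.mem_univ, true_and]
      exact ⟨rep_rep (lineRel_equivalence b d) i, lineClockwise_invariant _ _ _ hr hi⟩
  · rintro (i | i) hi (j | j) hj h
    all_goals
      simp only [Finset.inl_mem_disjSum, Finset.inr_mem_disjSum, repSet, Finset.mem_filter,
        Finset.mem_univ, true_and] at hi hj
      rw [sameCircle_empty] at h
      simp only [Sum.elim_inl, Sum.elim_inr, Bool.false_eq_true, if_false, if_true, true_and,
        reduceCtorEq, false_and] at h
    · rw [← hi.1, ← hj.1, (rep_eq_iff (lineRel_equivalence a b)).2 h]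
    · rw [← hi.1, ← hj.1, (rep_eq_iff (lineRel_equivalence b d)).2 h]

/-- Projection to one line is injective on the classes of clockwise circles: the only circles it
could identify are isolated vertices off `S`, which carry no variable. -/
theorem stackMono_full {nu : Weight (L : Set ℤ)}
    (hg : Good S (stackOf a b d (fullCut b)) (stackLabelling nu nu)) :
    rename Prod.fst (stackMono (stackOf a b d (fullCut b)) (stackLabelling nu nu)) - lineMono a d nu ∈
      lineIdeal a d := by
  have hE := lineRel_equivalence a d
  have := prod_sub_mono_mem hE (lineClockwise_invariant (a := a) (b := d) nu)
    (repSet (stackOf a b d (fullCut b)).SameCircle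
      ((stackOf a b d (fullCut b)).Clockwise (stackLabelling nu nu))) Prod.fst ?_ ?_ ?_
  · rw [stackMono, mono, map_prod]
    simp only [rename_X]
    exact this
  · intro u hu
    simp only [repSet, Finset.mem_filter] at hu
    exact (clockwise_full hg u).1 hu.2.2
  · intro i hi
    have hE' := (stackOf a b d (fullCut b)).sameCircle_equivalence
    have hc := (clockwise_full hg (i, false)).2 hi
    have hr := rel_rep hE' (i, false)
    refine ⟨rep _ (i, false), ?_, lineRel_of_sameCircle hr⟩
    simp only [repSet, Finset.mem_filter, Finset.mem_univ, true_and]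
    exact ⟨rep_rep hE' _, clockwise_invariant _ _ _ _ hr hc⟩
  · intro u hu v hv h
    have hE' := (stackOf a b d (fullCut b)).sameCircle_equivalence
    simp only [repSet, Finset.mem_filter, Finset.mem_univ, true_and] at hu hv
    have hadm : (u.1 : ℤ) ∈ S := by
      by_contra hS
      obtain ⟨x, hx, -, hx'⟩ := hu.2
      rcases sameCircle_supp hx with rfl | h
      · rcases hg.2 _ hS with h | h <;> rw [hx'] at h <;> cases h
      · exact hS h.1
    rw [← hu.1, ← hv.1]
    exact (rep_eq_iff hE').2 (sameCircle_of_lineRel hadm h)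

/-- Khovanov's multiplication is the multiplication by `surgeryFactor`. -/
theorem khovanov_sum (ha : a.1.ray = ∅) (hd : d.1.ray = ∅) {lam mu : Weight (L : Set ℤ)}
    (h1 : IsOriented a.1 lam) (h2 : IsOriented b.1 lam) (h3 : IsOriented b.1 mu)
    (h4 : IsOriented d.1 mu) (hoff : ∀ i, i ∉ S → lam.label i = mu.label i) :
    (∑ nu : Weight (L : Set ℤ), (khovanovCoeff a.1 lam b.1 b.1 mu d.1 nu : MvPolynomial (Vtx L) ℤ) *
        lineMono a d nu) - surgeryFactor a b d * (lineMono a b lam * lineMono b d mu) ∈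
      lineIdeal a d := by
  have hgood := good_stackLabelling (b := b) ha hd h1 h2 h3 h4
  have hdiag := fun w' => count_diag (w' := w') ha hd h1 h2 h3 h4 hoff
  have hsum := rename_fst_mem (sum_count_mul_stackMono (readyList_cupList b) hgood)
  have hsum' : rename Prod.fst (∑ w' : StackLabelling L, ((stackOf a b d ∅).count b.1.cupList
      (stackLabelling lam mu) w' : MvPolynomial (StackVertex L) ℤ) *
        stackMono (stackOf a b d (fullCut b)) w') =
      ∑ nu : Weight (L : Set ℤ), (khovanovCoeff a.1 lam b.1 b.1 mu d.1 nu : MvPolynomial (Vtx L) ℤ) *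
        rename Prod.fst (stackMono (stackOf a b d (fullCut b)) (stackLabelling nu nu)) := by
    -- Only labellings that agree on both lines occur with nonzero coefficient, so the sum may be
    -- taken over weights.
    rw [map_sum, ← Finset.sum_subset (Finset.subset_univ
      (Finset.univ.image fun nu : Weight (L : Set ℤ) => stackLabelling nu nu)),
      Finset.sum_image fun _ _ _ _ h => stackLabelling_diag_injective h]
    · refine Finset.sum_congr rfl fun nu _ => ?_
      rw [map_mul, map_natCast, khovanovCoeff, if_pos rfl]
      rfl
    · intro w' _ hw'
      by_cases h0 : (stackOf a b d ∅).count b.1.cupList (stackLabelling lam mu) w' = 0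
      · rw [h0, Nat.cast_zero, zero_mul, map_zero]
      · obtain ⟨nu, -, hnu⟩ := (hdiag w' h0).2
        subst hnu
        exact absurd (Finset.mem_image_of_mem (fun nu => stackLabelling nu nu)
          (Finset.mem_univ nu)) hw'
  have hfin : (∑ nu : Weight (L : Set ℤ), (khovanovCoeff a.1 lam b.1 b.1 mu d.1 nu :
        MvPolynomial (Vtx L) ℤ) *
        rename Prod.fst (stackMono (stackOf a b d (fullCut b)) (stackLabelling nu nu))) -
      (∑ nu : Weight (L : Set ℤ), (khovanovCoeff a.1 lam b.1 b.1 mu d.1 nu : MvPolynomial (Vtx L) ℤ) *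
        lineMono a d nu) ∈ lineIdeal a d := by
    rw [← Finset.sum_sub_distrib]
    refine Ideal.sum_mem _ fun nu _ => ?_
    rw [← mul_sub]
    by_cases h0 : khovanovCoeff a.1 lam b.1 b.1 mu d.1 nu = 0
    · rw [h0, Nat.cast_zero, zero_mul]; exact Ideal.zero_mem _
    · refine Ideal.mul_mem_left _ _ (stackMono_full (hdiag _ ?_).1)
      rwa [khovanovCoeff, if_pos rfl] at h0
  have hstart := surgeryFactor_aux (stackMono_empty (a := a) (b := b) (d := d) lam mu)
  rw [map_sub, map_mul] at hsum hstart
  change rename Prod.fst (∑ w' : StackLabelling L, ((stackOf a b d ∅).count b.1.cupList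
      (stackLabelling lam mu) w' : MvPolynomial (StackVertex L) ℤ) *
        stackMono (stackOf a b d (fullCut b)) w') - surgeryFactor a b d * _ ∈ _ at hsum
  rw [hsum'] at hsum
  rw [rename_rename, rename_rename,
    show (Prod.fst ∘ fun i : Vtx L => (i, false)) = id from rfl,
    show (Prod.fst ∘ fun i : Vtx L => (i, true)) = id from rfl, rename_id_apply, rename_id_apply] at hstart
  have := sub_mem (sub_mem hsum hfin) hstart
  convert this using 1
  ring

end Lines
end ArcAlgebra

namespace ArcAlgebra
open scoped Classical
open MvPolynomial

/-! ### Associativity of Khovanov's multiplication -/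

section Returns

variable {V W : Type*} [DecidableEq V] [DecidableEq W]

/-- Iterating `τ` from a point of `W ⊆ V`, the orbit returns to `W` after one or two steps, and
the map of first return is `τ'`. -/
def Returns (g : W → V) (τ' : Equiv.Perm W) (τ : Equiv.Perm V) : Prop :=
  ∀ w, τ (g w) = g (τ' w) ∨ ((∀ w', τ (g w) ≠ g w') ∧ τ (τ (g w)) = g (τ' w))

/-- An orbit leaves `W` for at most one step, so strong induction on the length of a path, removing
one or two steps at a time, turns it into a path for the return map. -/
theorem Returns.sameCycle_iff [Finite V] {g : W → V} (hg : Function.Injective g)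
    {τ' : Equiv.Perm W} {τ : Equiv.Perm V} (h : Returns g τ' τ) (x y : W) :
    τ.SameCycle (g x) (g y) ↔ τ'.SameCycle x y := by
  constructor
  · intro hxy
    obtain ⟨n, hn⟩ := hxy.exists_nat_pow_eq
    clear hxy
    induction n using Nat.strong_induction_on generalizing x with
    | _ n ih =>
      rcases n with _ | n
      · rw [pow_zero, Equiv.Perm.one_apply] at hn
        rw [hg hn]
      · rw [pow_succ, Equiv.Perm.mul_apply] at hn
        rcases h x with h1 | ⟨h1, h2⟩
        · rw [h1] at hn
          exact (sameCycle_apply τ' x).trans (ih n (by omega) _ hn)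
        · rcases n with _ | n
          · rw [pow_zero, Equiv.Perm.one_apply] at hn
            exact absurd hn (h1 y)
          · rw [pow_succ, Equiv.Perm.mul_apply, h2] at hn
            exact (sameCycle_apply τ' x).trans (ih n (by omega) _ hn)
  · intro hxy
    refine sameCycle_le τ' (r := fun x y => τ.SameCycle (g x) (g y))
      ⟨fun _ => Equiv.Perm.SameCycle.refl _ _, fun h => h.symm, fun h h' => h.trans h'⟩ ?_ hxy
    intro w
    rcases h w with h1 | ⟨-, h2⟩
    · rw [← h1]; exact sameCycle_apply τ _
    · rw [← h2]; exact (sameCycle_apply τ _).trans (sameCycle_apply τ _)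

/-- A transposition of two points of `W` does not affect the points visited during excursions, so it
passes to the first return map. -/
theorem Returns.mul_swap {g : W → V} (hg : Function.Injective g) {τ' : Equiv.Perm W}
    {τ : Equiv.Perm V} (h : Returns g τ' τ) (p q : W) :
    Returns g (τ' * Equiv.swap p q) (τ * Equiv.swap (g p) (g q)) := by
  intro w
  have hsw : Equiv.swap (g p) (g q) (g w) = g (Equiv.swap p q w) := (hg.map_swap p q w).symm
  simp only [Equiv.Perm.mul_apply, hsw]
  rcases h (Equiv.swap p q w) with h1 | ⟨h1, h2⟩
  · exact Or.inl h1
  · refine Or.inr ⟨h1, ?_⟩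
    rw [Equiv.swap_apply_of_ne_of_ne (h1 p) (h1 q), h2]

/-- Each step factor depends only on whether two points of `W` lie in one cycle, which the return
map decides. Surgeries on a large diagram can thus be computed on a smaller one. -/
theorem Returns.chain_eq [Finite V] {g : W → V} (hg : Function.Injective g) {τ' : Equiv.Perm W}
    {τ : Equiv.Perm V} (h : Returns g τ' τ) (l : List (W × W)) :
    chain τ (l.map (Prod.map g g)) = rename g (chain τ' l) := by
  induction l generalizing τ τ' with
  | nil => simp [chain]
  | cons x l ih =>
    obtain ⟨p, q⟩ := x
    simp only [List.map_cons, Prod.map_apply, chain, map_mul]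
    rw [ih (h.mul_swap hg p q)]
    congr 1
    simp only [stepFactor, h.sameCycle_iff hg]
    split_ifs <;> simp

end Returns

/-! ### Diagrams with three number lines and the order in which the two gaps are cut. -/

section ThreeLines

variable {L : Finset ℤ} {S : Set ℤ} (a b c d : Arcs L S)

/-- The list of pairs of points of the flow that are exchanged when the arcs of `b` are cut. -/
noncomputable def cutList {Λ : Type*} (lo hi : Λ) (b : Arcs L S) :
    List ((Vtx L × Λ) × (Vtx L × Λ)) := b.1.cupList.map (cutPair S lo hi)

theorem readyList_mem {b : Arcs L S} {cut : Finset ℤ} {l : List (Vtx L × Vtx L)}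
    (hl : ReadyList b cut l) {x : Vtx L × Vtx L} (hx : x ∈ l) :
    (x.1 : ℤ) ∈ S ∧ x.2 = arcMap b x.1 := by
  induction l generalizing cut with
  | nil => cases hx
  | cons y l ih =>
    obtain ⟨hr, hj, hl⟩ := hl
    rcases List.mem_cons.1 hx with rfl | hx
    · exact ⟨hr.mem_supp, hj⟩
    · exact ih hl hx

/-- In normal form the lower point of an exchanged pair flows upwards and the upper one flows
downwards. This is what keeps the pairs from the two gaps disjoint on the middle line. -/
theorem cutPair_eq {Λ : Type*} (lo hi : Λ) {b : Arcs L S} {x : Vtx L × Vtx L} (hx : x ∈ b.1.cupList) :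
    ∃ n : Vtx L, (n : ℤ) ∈ S ∧ ¬ alt L S n ∧ alt L S (arcMap b n) ∧
      cutPair S lo hi x = ((n, lo), (arcMap b n, hi)) := by
  obtain ⟨h1, h2⟩ := readyList_mem (readyList_cupList b) hx
  have h3 := alt_arcMap b h1
  unfold cutPair
  split_ifs with h
  · exact ⟨x.2, by rw [h2]; exact (arc_mem_supp b).2 h1, by rw [h2]; tauto, by simpa [h2] using h,
      by simp [h2]⟩
  · exact ⟨x.1, h1, h, h3.2 h, by simp [h2]⟩

theorem gapSwap_finalCut {Λ : Type*} [DecidableEq Λ] {lo hi : Λ} (h : lo ≠ hi) {b : Arcs L S}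
    {cut : Finset ℤ} {l : List (Vtx L × Vtx L)} (hl : ReadyList b cut l) :
    gapSwap h b (finalCut cut l) = gapSwap h b cut * swaps (l.map (cutPair S lo hi)) := by
  induction l generalizing cut with
  | nil => simp [finalCut]
  | cons x l ih =>
    obtain ⟨i, j⟩ := x
    obtain ⟨hr, rfl, hl⟩ := hl
    rw [finalCut, ih hl, gapSwap_insert h b hr.1 hr.notMem, List.map_cons, swaps_cons, mul_assoc]

theorem swaps_cutList {Λ : Type*} [DecidableEq Λ] {lo hi : Λ} (h : lo ≠ hi) (b : Arcs L S) :
    swaps (cutList lo hi b) = gapSwap h b (fullCut b) := by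
  rw [fullCut, gapSwap_finalCut h (readyList_cupList b), gapSwap_empty, one_mul, cutList]

theorem gapFun_fullCut {Λ : Type*} (lo hi : Λ) (b : Arcs L S) {i : Vtx L} (m : Λ)
    (hi' : (i : ℤ) ∈ S) :
    gapFun lo hi b (fullCut b) (i, m) = if m = lo ∧ ¬ alt L S i then (arcMap b i, hi)
      else if m = hi ∧ alt L S i then (arcMap b i, lo) else (i, m) := by
  simp [gapFun, isCut_fullCut b hi']

theorem gapFun_of_notMem {Λ : Type*} (lo hi : Λ) (b : Arcs L S) (cut : Finset ℤ) (v : Vtx L × Λ)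
    (hv : (v.1 : ℤ) ∉ S) : gapFun lo hi b cut v = v := by
  simp [gapFun, IsCut, hv]

/-- The flow on three number lines. -/
noncomputable def triplePerm : Equiv.Perm (Vtx L × Fin 3) :=
  layered ![linePerm a b, linePerm b c, linePerm c d]

theorem rename_chain_eq {V W : Type*} [Finite V] [DecidableEq V] [DecidableEq W] {X : Type*}
    {g : W → V} (hg : Function.Injective g)
    {τ' : Equiv.Perm W} {τ : Equiv.Perm V} (h : Returns g τ' τ) {l' : List (V × V)}
    {l : List (W × W)} (hl : l' = l.map (Prod.map g g)) {p : V → X} {p' : W → X} (hp : p ∘ g = p') :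
    rename p (chain τ l') = rename p' (chain τ' l) := by
  rw [hl, h.chain_eq hg, rename_rename, hp]

/-- As long as the upper gap is uncut the top line is separate, so the lower two lines are invariant
and every return takes one step. -/
theorem lower_factor :
    rename Prod.fst (chain (triplePerm a b c d) (cutList 0 1 b)) = surgeryFactor a b c := by
  refine rename_chain_eq (g := fun v : StackVertex L => (v.1, if v.2 then 1 else 0)) ?_ ?_ ?_ rfl
  · rintro ⟨i, ε⟩ ⟨j, ε'⟩ h
    cases ε <;> cases ε' <;> simp_all
  · rintro ⟨i, ε⟩
    left
    rw [stackPerm_empty]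
    cases ε <;> simp [triplePerm]
  · rw [cutList, List.map_map]
    refine List.map_congr_left fun x _ => ?_
    simp only [cutPair, Function.comp]
    split_ifs <;> simp

theorem upper_factor :
    rename Prod.fst (chain (triplePerm a b c d) (cutList 1 2 c)) = surgeryFactor b c d := by
  refine rename_chain_eq (g := fun v : StackVertex L => (v.1, if v.2 then 2 else 1)) ?_ ?_ ?_ rfl
  · rintro ⟨i, ε⟩ ⟨j, ε'⟩ h
    cases ε <;> cases ε' <;> simp_all
  · rintro ⟨i, ε⟩
    left
    rw [stackPerm_empty]
    cases ε <;> simp [triplePerm]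
  · rw [cutList, List.map_map]
    refine List.map_congr_left fun x _ => ?_
    simp only [cutPair, Function.comp]
    split_ifs <;> simp

/-- With the lower gap cut, lines `0` and `1` act as one line with arcs `a` below and `c` above. A
vertex of this line is represented by the copy from which the flow leaves along an arc: on line `0`
if it flows down, on line `1` if it flows up. After that arc the flow meets the copy that is not
chosen and crosses the gap, so the return takes two steps. The points exchanged by cutting `c` are
among the chosen copies. -/
theorem outer_upper_factor :
    rename Prod.fst (chain (triplePerm a b c d * swaps (cutList 0 1 b)) (cutList 1 2 c)) =
      surgeryFactor a c d := by
  rw [swaps_cutList (by decide)]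
  refine rename_chain_eq (g := fun v : StackVertex L =>
    (v.1, if v.2 then 2 else if alt L S v.1 then 0 else 1)) ?_ ?_ ?_ rfl
  · rintro ⟨i, ε⟩ ⟨j, ε'⟩ h
    simp only [Prod.mk.injEq] at h
    obtain ⟨rfl, h⟩ := h
    by_cases hi : alt L S i <;> cases ε <;> cases ε' <;> simp_all
  · rintro ⟨i, ε⟩
    rw [stackPerm_empty]
    simp only [Equiv.Perm.mul_apply, triplePerm, gapSwap_apply]
    by_cases hS : (i : ℤ) ∈ S
    · have hA := alt_arcMap a hS
      have hB := alt_arcMap b hS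
      have hC := alt_arcMap c hS
      have hD := alt_arcMap d hS
      have hAS : ((arcMap a i : Vtx L) : ℤ) ∈ S := (arc_mem_supp a).2 hS
      have hCS : ((arcMap c i : Vtx L) : ℤ) ∈ S := (arc_mem_supp c).2 hS
      have hBA := alt_arcMap b hAS
      have hBC := alt_arcMap b hCS
      rw [gapFun_fullCut _ _ _ _ hS]
      cases ε
      · right
        by_cases hi : alt L S i
        · refine ⟨?_, ?_⟩
          · rintro ⟨j, ε'⟩ h
            simp only [hi] at h
            cases ε' <;> simp [linePerm_apply, hi] at h
            obtain ⟨rfl, h⟩ := h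
            exact absurd hi (hA.1 h)
          · simp [hi, linePerm_apply, gapFun_fullCut _ _ _ _ hAS, hA, hBA]
        · refine ⟨?_, ?_⟩
          · rintro ⟨j, ε'⟩ h
            cases ε' <;> simp [linePerm_apply, hi] at h
            obtain ⟨rfl, h⟩ := h
            exact h (hC.2 hi)
          · simp [hi, linePerm_apply, gapFun_fullCut _ _ _ _ hCS, hC, hBC]
      · left
        simp [linePerm_apply]
    · rw [gapFun_of_notMem _ _ _ _ _ hS]
      left
      cases ε <;> by_cases hi : alt L S i <;> simp [linePerm_apply, arcMap_eq hS, hi]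
  · rw [cutList, List.map_map]
    refine List.map_congr_left fun x hx => ?_
    obtain ⟨h1, h2⟩ := readyList_mem (readyList_cupList c) hx
    have h3 := alt_arcMap c h1
    simp only [cutPair, Function.comp]
    split_ifs with h
    · simp [h2, h3, h]
    · simp [h]

/-- The mirror image: with the upper gap cut, lines `1` and `2` act as one line with arcs `b` below
and `d` above, and a vertex is represented on line `1` if it flows down and on line `2` if it flows
up. -/
theorem outer_lower_factor :
    rename Prod.fst (chain (triplePerm a b c d * swaps (cutList 1 2 c)) (cutList 0 1 b)) =
      surgeryFactor a b d := by
  rw [swaps_cutList (by decide)]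
  refine rename_chain_eq (g := fun v : StackVertex L =>
    (v.1, if v.2 then if alt L S v.1 then 1 else 2 else 0)) ?_ ?_ ?_ rfl
  · rintro ⟨i, ε⟩ ⟨j, ε'⟩ h
    simp only [Prod.mk.injEq] at h
    obtain ⟨rfl, h⟩ := h
    by_cases hi : alt L S i <;> cases ε <;> cases ε' <;> simp_all
  · rintro ⟨i, ε⟩
    rw [stackPerm_empty]
    simp only [Equiv.Perm.mul_apply, triplePerm, gapSwap_apply]
    by_cases hS : (i : ℤ) ∈ S
    · have hB := alt_arcMap b hS
      have hC := alt_arcMap c hS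
      have hD := alt_arcMap d hS
      have hBS : ((arcMap b i : Vtx L) : ℤ) ∈ S := (arc_mem_supp b).2 hS
      have hDS : ((arcMap d i : Vtx L) : ℤ) ∈ S := (arc_mem_supp d).2 hS
      have hCB := alt_arcMap c hBS
      have hCD := alt_arcMap c hDS
      rw [gapFun_fullCut _ _ _ _ hS]
      cases ε
      · left
        simp [linePerm_apply]
      · right
        by_cases hi : alt L S i
        · refine ⟨?_, ?_⟩
          · rintro ⟨j, ε'⟩ h
            cases ε' <;> simp [linePerm_apply, hi] at h
            obtain ⟨rfl, h⟩ := h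
            exact hB.1 h hi
          · simp [hi, linePerm_apply, gapFun_fullCut _ _ _ _ hBS, hB, hCB]
        · refine ⟨?_, ?_⟩
          · rintro ⟨j, ε'⟩ h
            cases ε' <;> simp [linePerm_apply, hi] at h
            obtain ⟨rfl, h⟩ := h
            exact h (hD.2 hi)
          · simp [hi, linePerm_apply, gapFun_fullCut _ _ _ _ hDS, hD, hCD]
    · rw [gapFun_of_notMem _ _ _ _ _ hS]
      left
      cases ε <;> by_cases hi : alt L S i <;> simp [linePerm_apply, arcMap_eq hS, hi]
  · rw [cutList, List.map_map]
    refine List.map_congr_left fun x hx => ?_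
    obtain ⟨h1, h2⟩ := readyList_mem (readyList_cupList b) hx
    have h3 := alt_arcMap b h1
    simp only [cutPair, Function.comp]
    split_ifs with h
    · simp [h]
    · simp [h2, h3, h]

end ThreeLines
end ArcAlgebra

namespace ArcAlgebra
open scoped Classical
open MvPolynomial

/-! ### Independence of the order of the gaps. -/

section ThreeLines

variable {L : Finset ℤ} {S : Set ℤ} (a b c d : Arcs L S)

theorem commute_swap {V : Type*} [DecidableEq V] {p q r s : V} (h : (p = r ∧ q = s) ∨
    (p ≠ r ∧ p ≠ s ∧ q ≠ r ∧ q ≠ s)) : Commute (Equiv.swap p q) (Equiv.swap r s) := by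
  rcases h with ⟨rfl, rfl⟩ | ⟨h1, h2, h3, h4⟩
  · exact Commute.refl _
  · have := Equiv.swap_apply_apply (Equiv.swap p q) r s
    rw [Equiv.swap_apply_of_ne_of_ne h1.symm h3.symm, Equiv.swap_apply_of_ne_of_ne h2.symm h4.symm,
      eq_mul_inv_iff_mul_eq] at this
    exact this.symm

theorem arcMap_injective (a : Arcs L S) : Function.Injective (arcMap a) :=
  (show Function.Involutive (arcMap a) from arcMap_arcMap a).injective

/-- The two ways of cutting the arcs of both gaps agree. -/
theorem surgeryFactor_assoc : surgeryFactor a b c * surgeryFactor a c d -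
    surgeryFactor b c d * surgeryFactor a b d ∈ lineIdeal a d := by
  -- On the middle line the pairs from `b` use vertices that are `alt` and those from `c` vertices
  -- that are not. Hence distinct transpositions are disjoint and all of them commute.
  have hmem : ∀ x ∈ cutList (0 : Fin 3) 1 b ++ cutList 1 2 c, ∃ (e : Arcs L S) (n : Vtx L),
      ((e = b ∧ x = ((n, 0), (arcMap b n, 1))) ∨ (e = c ∧ x = ((n, 1), (arcMap c n, 2)))) ∧
      ¬ alt L S n ∧ alt L S (arcMap e n) := by
    intro x hx
    rcases List.mem_append.1 hx with hx | hx
    · obtain ⟨y, hy, rfl⟩ := List.mem_map.1 hx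
      obtain ⟨n, h1, h2, h3, h4⟩ := cutPair_eq (0 : Fin 3) 1 hy
      exact ⟨b, n, Or.inl ⟨rfl, h4⟩, h2, h3⟩
    · obtain ⟨y, hy, rfl⟩ := List.mem_map.1 hx
      obtain ⟨n, h1, h2, h3, h4⟩ := cutPair_eq (1 : Fin 3) 2 hy
      exact ⟨c, n, Or.inr ⟨rfl, h4⟩, h2, h3⟩
  have hne : ∀ x ∈ cutList (0 : Fin 3) 1 b ++ cutList 1 2 c, x.1 ≠ x.2 := by
    intro x hx
    obtain ⟨e, n, ⟨-, rfl⟩ | ⟨-, rfl⟩, -⟩ := hmem x hx <;> simp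
  have hcomm : ∀ x ∈ cutList (0 : Fin 3) 1 b ++ cutList 1 2 c,
      ∀ y ∈ cutList (0 : Fin 3) 1 b ++ cutList 1 2 c,
      Commute (Equiv.swap x.1 x.2) (Equiv.swap y.1 y.2) := by
    intro x hx y hy
    obtain ⟨e, n, he, hn, hn'⟩ := hmem x hx
    obtain ⟨e', m, he', hm, hm'⟩ := hmem y hy
    have hnm : n ≠ arcMap e' m := fun h => hn (h ▸ hm')
    have hmn : m ≠ arcMap e n := fun h => hm (h ▸ hn')
    apply commute_swap
    rcases he with ⟨he, rfl⟩ | ⟨he, rfl⟩ <;> rcases he' with ⟨he', rfl⟩ | ⟨he', rfl⟩ <;>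
      subst he <;> subst he'
    · by_cases h : n = m
      · subst h; simp
      · right
        simp [h, (arcMap_injective _).eq_iff]
    · right
      simp [hmn.symm]
    · right
      simp [hnm]
    · by_cases h : n = m
      · subst h; simp
      · right
        simp [h, (arcMap_injective _).eq_iff]
  have key := (chain_perm (List.perm_append_comm (l₁ := cutList (0 : Fin 3) 1 b)
    (l₂ := cutList 1 2 c)) (triplePerm a b c d) hne hcomm).2
  have hE := lineRel_equivalence a d
  have := rename_mem_circleIdeal (E' := lineRel a d) Prod.fst (fun u v huv => ?_) key
  · rwa [map_sub, chain_append, chain_append, map_mul, map_mul, lower_factor, upper_factor,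
      outer_upper_factor, outer_lower_factor] at this
  -- With both gaps cut, the flow projected to one line is stationary or runs along an arc of `a` or
  -- `d`.
  · refine sameCycle_le _ (r := fun u v : Vtx L × Fin 3 => lineRel a d u.1 v.1)
      ⟨fun x => hE.refl _, fun h => hE.symm h, fun h h' => hE.trans h h'⟩ ?_ huv
    rintro ⟨i, m⟩
    rw [show swaps (cutList (0 : Fin 3) 1 b ++ cutList 1 2 c) =
      swaps (cutList 0 1 b) * swaps (cutList 1 2 c) by simp [swaps],
      swaps_cutList (by decide), swaps_cutList (by decide)]
    simp only [Equiv.Perm.mul_apply, triplePerm, gapSwap_apply]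
    by_cases hS : (i : ℤ) ∈ S
    · have hi := sameCycle_apply (linePerm a d) i
      rw [linePerm_apply] at hi
      have hB := alt_arcMap b hS
      have hC := alt_arcMap c hS
      have hBS : ((arcMap b i : Vtx L) : ℤ) ∈ S := (arc_mem_supp b).2 hS
      have hCS : ((arcMap c i : Vtx L) : ℤ) ∈ S := (arc_mem_supp c).2 hS
      rw [gapFun_fullCut _ _ _ _ hS]
      by_cases hal : alt L S i
      · rw [if_pos hal] at hi
        fin_cases m
        · simp [hal, gapFun_fullCut _ _ _ _ hS, linePerm_apply]
          exact hi
        · simp [hal, gapFun_fullCut _ _ _ _ hS, linePerm_apply, hB]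
          exact hE.refl _
        · simp [hal, gapFun_fullCut _ _ _ _ hCS, linePerm_apply, hC]
          exact hE.refl _
      · rw [if_neg hal] at hi
        fin_cases m
        · simp [hal, gapFun_fullCut _ _ _ _ hS, linePerm_apply, hB]
          exact hE.refl _
        · simp [hal, gapFun_fullCut _ _ _ _ hCS, linePerm_apply, hC]
          exact hE.refl _
        · simp [hal, gapFun_fullCut _ _ _ _ hS, linePerm_apply]
          exact hi
    · rw [gapFun_of_notMem _ _ _ _ (i, m) hS, gapFun_of_notMem _ _ _ _ (i, m) hS]
      have : ∀ (e f : Arcs L S), linePerm e f i = i := fun e f => by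
        rw [linePerm_apply, arcMap_eq hS, arcMap_eq hS, ite_self]
      fin_cases m <;> simp [this] <;> exact hE.refl _

end ThreeLines

/-! ### Structure constants as coefficients, and associativity for closed diagrams. -/

section Coefficients

variable {L : Finset ℤ} {S : Set ℤ} {a b c d : Arcs L S}

/-- The weight `nu` orients the circle diagram with arcs `a` and `d`, and agrees with `ref` off the
arcs. -/
def Compat (ref : Weight (L : Set ℤ)) (a d : Arcs L S) (nu : Weight (L : Set ℤ)) : Prop :=
  IsOriented a.1 nu ∧ IsOriented d.1 nu ∧ ∀ i, i ∉ S → nu.label i = ref.label i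

theorem isOriented_label {a : Arcs L S} {nu : Weight (L : Set ℤ)} (h : IsOriented a.1 nu) {i : ℤ}
    (hi : i ∈ S) : (nu.label i = Label.down ∧ nu.label (a.1.arc i) = Label.up) ∨
    (nu.label i = Label.up ∧ nu.label (a.1.arc i) = Label.down) :=
  h.2.1 i ((a.2 i).2 hi)

theorem exists_leftmost (a d : Arcs L S) (u : Vtx L) :
    ∃ v, lineRel a d u v ∧ ∀ v', lineRel a d u v' → v ≤ v' := by
  obtain ⟨v, hv, hmin⟩ := Finset.exists_min_image (Finset.univ.filter (lineRel a d u)) id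
    ⟨u, by simpa using (lineRel_equivalence a d).refl u⟩
  exact ⟨v, by simpa using hv, fun v' hv' => hmin v' (by simpa using hv')⟩

theorem lineRel_mem_supp {u v : Vtx L} (h : lineRel a d u v) : (u : ℤ) ∈ S ↔ (v : ℤ) ∈ S := by
  refine sameCycle_le _ (r := fun u v : Vtx L => (u : ℤ) ∈ S ↔ (v : ℤ) ∈ S)
    ⟨fun _ => Iff.rfl, fun h => h.symm, fun h h' => h.trans h'⟩ (fun x => ?_) h
  rw [linePerm_apply]
  split_ifs
  · exact (arc_mem_supp a).symm
  · exact (arc_mem_supp d).symm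

/-- The label at the leftmost vertex of a circle determines all others, since labels change along
every arc; off the arcs both weights agree with `ref`. So distinct oriented diagrams give distinct
monomials. -/
theorem Compat.eq_of_clockwise {ref nu nu' : Weight (L : Set ℤ)} (h : Compat ref a d nu)
    (h' : Compat ref a d nu') (hc : lineClockwise a d nu = lineClockwise a d nu') : nu = nu' := by
  have hE := lineRel_equivalence a d
  refine weight_ext fun u => ?_
  by_cases hu : (u : ℤ) ∈ S
  · obtain ⟨v, hv, hmin⟩ := exists_leftmost a d u
    have hvS := (lineRel_mem_supp hv).1 hu
    have hiff : ∀ mu : Weight (L : Set ℤ), lineClockwise a d mu u ↔ mu.label v = Label.up := by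
      intro mu
      constructor
      · rintro ⟨v', h1, h2, h3⟩
        rwa [le_antisymm (hmin v' h1) (h2 v hv)]
      · exact fun h => ⟨v, hv, hmin, h⟩
    have h1 : nu.label v = nu'.label v := by
      have := (hiff nu).symm.trans ((Iff.of_eq (congrFun hc u)).trans (hiff nu'))
      rcases isOriented_label h.1 hvS with h2 | h2 <;> rcases isOriented_label h'.1 hvS with h3 | h3 <;>
        rw [h2.1, h3.1] at this ⊢ <;> simp at this
    have key : ∀ (e : Arcs L S), IsOriented e.1 nu → IsOriented e.1 nu' → ∀ x : Vtx L, (x : ℤ) ∈ S →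
        (nu.label x = nu'.label x ↔ nu.label (arcMap e x) = nu'.label (arcMap e x)) := by
      intro e h1 h2 x hx
      rw [coe_arcMap]
      rcases isOriented_label h1 hx with h2 | h2 <;> rcases isOriented_label ‹IsOriented e.1 nu'› hx with h3 | h3 <;>
        simp [h2, h3]
    refine (sameCycle_le _ (r := fun x y : Vtx L => nu.label x = nu'.label x ↔ nu.label y = nu'.label y)
      ⟨fun _ => Iff.rfl, fun h => h.symm, fun h h' => h.trans h'⟩ (fun x => ?_) hv).2 h1
    by_cases hx : (x : ℤ) ∈ S
    · rw [linePerm_apply]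
      split_ifs
      · exact key a h.1 h'.1 x hx
      · exact key d h.2.1 h'.2.1 x hx
    · rw [linePerm_apply, arcMap_eq hx, arcMap_eq hx, ite_self]
  · rw [h.2.2 _ hu, h'.2.2 _ hu]

theorem isOriented_of_good {cut : Finset ℤ} (ha : a.1.ray = ∅) (hd : d.1.ray = ∅)
    {nu : Weight (L : Set ℤ)} (hg : Good S (stackOf a b d cut) (stackLabelling nu nu)) :
    IsOriented a.1 nu ∧ IsOriented d.1 nu := by
  have hoff : ∀ i, i ∉ S → nu.label i = Label.nought ∨ nu.label i = Label.cross := by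
    intro i hi
    by_cases hiL : i ∈ L
    · exact hg.2 (⟨i, hiL⟩, false) hi
    · exact Or.inl (nu.label_off i (by simpa using hiL))
  have hL : ∀ (e : Arcs L S) {i : ℤ}, e.1.arc i ≠ i → i ∈ L := fun e i hi => by
    simpa using e.1.arc_mem i hi
  constructor
  · refine ⟨fun i hi _ => hoff i fun h => (a.2 i).2 h hi, fun i hi => ?_, by simp [ha], by simp [ha]⟩
    exact hg.1.1 (⟨i, hL a hi⟩, false) (arcMap a ⟨i, hL a hi⟩, false)
      ((curved_false _ _ _ _).2 ⟨fun h => hi (congrArg Subtype.val h).symm, Or.inl rfl⟩)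
  · refine ⟨fun i hi _ => hoff i fun h => (d.2 i).2 h hi, fun i hi => ?_, by simp [hd], by simp [hd]⟩
    exact hg.1.1 (⟨i, hL d hi⟩, true) (arcMap d ⟨i, hL d hi⟩, true)
      ((curved_true _ _ _ _).2 ⟨fun h => hi (congrArg Subtype.val h).symm, Or.inl rfl⟩)

/-- The terms of a product are again oriented diagrams with the common labels off the arcs, so
products can be iterated. -/
theorem compat_of_coeff_ne_zero (ha : a.1.ray = ∅) (hd : d.1.ray = ∅)
    {ref lam mu nu : Weight (L : Set ℤ)} (h1 : Compat ref a b lam) (h2 : Compat ref b d mu)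
    (h : khovanovCoeff a.1 lam b.1 b.1 mu d.1 nu ≠ 0) : Compat ref a d nu := by
  rw [khovanovCoeff, if_pos rfl] at h
  obtain ⟨hg, nu', hnu', heq⟩ := count_diag (b := b) ha hd h1.1 h1.2.1 h2.1 h2.2.1
    (fun i hi => (h1.2.2 i hi).trans (h2.2.2 i hi).symm) h
  obtain rfl := stackLabelling_diag_injective heq
  obtain ⟨h3, h4⟩ := isOriented_of_good ha hd hg
  exact ⟨h3, h4, fun i hi => (hnu' i hi).trans (h1.2.2 i hi)⟩

theorem Compat.lineClockwise_eq_iff {ref nu nu' : Weight (L : Set ℤ)} (h : Compat ref a d nu)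
    (h' : Compat ref a d nu') : lineClockwise a d nu = lineClockwise a d nu' ↔ nu = nu' :=
  ⟨h.eq_of_clockwise h', fun h => by rw [h]⟩

theorem coeffAt_congr {a d : Arcs L S} {t : Vtx L → Prop} {f g : MvPolynomial (Vtx L) ℤ}
    (h : f - g ∈ lineIdeal a d) : coeffAt (lineRel a d) t f = coeffAt (lineRel a d) t g := by
  have := coeffAt_eq_zero (lineRel_equivalence a d) t h
  rw [coeffAt_sub] at this
  omega

theorem Compat.coeffAt_lineMono {ref nu nu' : Weight (L : Set ℤ)} (h : Compat ref a d nu)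
    (h' : Compat ref a d nu') : coeffAt (lineRel a d) (lineClockwise a d nu) (lineMono a d nu') =
      if nu = nu' then 1 else 0 := by
  rw [lineMono, coeffAt_mono (lineRel_equivalence a d) (lineClockwise_invariant nu)
    (lineClockwise_invariant nu')]
  simp only [h.lineClockwise_eq_iff h']

/-- The monomials of compatible weights are linearly independent modulo the ideal. Incompatible
weights could share a monomial with a compatible one, hence the condition on the support of `n`. -/
theorem Compat.coeffAt_sum {ref nu : Weight (L : Set ℤ)} (h : Compat ref a d nu)
    {n : Weight (L : Set ℤ) → ℕ} (hn : ∀ mu, n mu ≠ 0 → Compat ref a d mu) :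
    coeffAt (lineRel a d) (lineClockwise a d nu)
      (∑ mu, (n mu : MvPolynomial (Vtx L) ℤ) * lineMono a d mu) = n nu := by
  rw [ArcAlgebra.coeffAt_sum, Finset.sum_eq_single nu]
  · rw [show ((n nu : ℕ) : MvPolynomial (Vtx L) ℤ) = ((n nu : ℤ) : MvPolynomial (Vtx L) ℤ) by simp,
      coeffAt_intCast_mul, h.coeffAt_lineMono h, if_pos rfl, mul_one]
  · intro mu _ hmu
    rw [show ((n mu : ℕ) : MvPolynomial (Vtx L) ℤ) = ((n mu : ℤ) : MvPolynomial (Vtx L) ℤ) by simp,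
      coeffAt_intCast_mul]
    by_cases h0 : n mu = 0
    · simp [h0]
    · rw [h.coeffAt_lineMono (hn mu h0), if_neg (Ne.symm hmu), mul_zero]
  · simp

/-- The structure constants in terms of the ring of circles. -/
theorem khovanovCoeff_eq (ha : a.1.ray = ∅) (hd : d.1.ray = ∅)
    {ref lam mu nu : Weight (L : Set ℤ)} (h1 : Compat ref a b lam) (h2 : Compat ref b d mu)
    (h3 : Compat ref a d nu) : (khovanovCoeff a.1 lam b.1 b.1 mu d.1 nu : ℤ) =
      coeffAt (lineRel a d) (lineClockwise a d nu)
        (surgeryFactor a b d * (lineMono a b lam * lineMono b d mu)) := by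
  rw [← coeffAt_congr (khovanov_sum ha hd h1.1 h1.2.1 h2.1 h2.2.1
    fun i hi => (h1.2.2 i hi).trans (h2.2.2 i hi).symm),
    h3.coeffAt_sum fun mu' h => compat_of_coeff_ne_zero ha hd h1 h2 h]

/-- Associativity of Khovanov's multiplication. -/
theorem khovanov_assoc (ha : a.1.ray = ∅) (hb : b.1.ray = ∅) (hc : c.1.ray = ∅) (hd : d.1.ray = ∅)
    {ref lam mu rho nu : Weight (L : Set ℤ)}
    (h1 : Compat ref a b lam) (h2 : Compat ref b c mu) (h3 : Compat ref c d rho)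
    (h4 : Compat ref a d nu) :
    ∑ kap, khovanovCoeff a.1 lam b.1 b.1 mu c.1 kap * khovanovCoeff a.1 kap c.1 c.1 rho d.1 nu =
    ∑ kap, khovanovCoeff b.1 mu c.1 c.1 rho d.1 kap * khovanovCoeff a.1 lam b.1 b.1 kap d.1 nu := by
  have hoff : ∀ {x y : Weight (L : Set ℤ)} {e f e' f' : Arcs L S}, Compat ref e f x →
      Compat ref e' f' y → ∀ i, i ∉ S → x.label i = y.label i :=
    fun h h' i hi => (h.2.2 i hi).trans (h'.2.2 i hi).symm
  -- The sum over intermediate weights is the inner product written out in the ring. It is replaced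
  -- by the congruent product with a surgery factor, which leaves two factors times three monomials.
  -- The other bracketing is treated in the same way, and the two agree by `surgeryFactor_assoc`.
  have hL : ((∑ kap, khovanovCoeff a.1 lam b.1 b.1 mu c.1 kap *
      khovanovCoeff a.1 kap c.1 c.1 rho d.1 nu : ℕ) : ℤ) =
      coeffAt (lineRel a d) (lineClockwise a d nu) (surgeryFactor a c d *
        (surgeryFactor a b c * (lineMono a b lam * lineMono b c mu)) * lineMono c d rho) := by
    have h5 := surgeryFactor_mul_mem_left (d := d)
      (khovanov_sum ha hc h1.1 h1.2.1 h2.1 h2.2.1 (hoff h1 h2))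
    rw [← coeffAt_congr (g := surgeryFactor a c d * (surgeryFactor a b c *
      (lineMono a b lam * lineMono b c mu)) * lineMono c d rho)
      (f := surgeryFactor a c d * (∑ kap, (khovanovCoeff a.1 lam b.1 b.1 mu c.1 kap :
        MvPolynomial (Vtx L) ℤ) * lineMono a c kap) * lineMono c d rho), Finset.mul_sum,
      Finset.sum_mul, coeffAt_sum, Nat.cast_sum]
    · refine Finset.sum_congr rfl fun kap _ => ?_
      by_cases h0 : khovanovCoeff a.1 lam b.1 b.1 mu c.1 kap = 0
      · simp [h0, coeffAt]
      · have h6 := compat_of_coeff_ne_zero ha hc h1 h2 h0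
        rw [Nat.cast_mul, khovanovCoeff_eq ha hd h6 h3 h4, ← coeffAt_intCast_mul]
        congr 1
        push_cast
        ring
    · rw [← sub_mul, ← mul_sub]
      exact Ideal.mul_mem_right _ _ h5
  have hR : ((∑ kap, khovanovCoeff b.1 mu c.1 c.1 rho d.1 kap *
      khovanovCoeff a.1 lam b.1 b.1 kap d.1 nu : ℕ) : ℤ) =
      coeffAt (lineRel a d) (lineClockwise a d nu) (surgeryFactor a b d *
        (surgeryFactor b c d * (lineMono b c mu * lineMono c d rho)) * lineMono a b lam) := by
    have h5 := surgeryFactor_mul_mem_right (a := a)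
      (khovanov_sum hb hd h2.1 h2.2.1 h3.1 h3.2.1 (hoff h2 h3))
    rw [← coeffAt_congr (g := surgeryFactor a b d * (surgeryFactor b c d *
      (lineMono b c mu * lineMono c d rho)) * lineMono a b lam)
      (f := surgeryFactor a b d * (∑ kap, (khovanovCoeff b.1 mu c.1 c.1 rho d.1 kap :
        MvPolynomial (Vtx L) ℤ) * lineMono b d kap) * lineMono a b lam), Finset.mul_sum,
      Finset.sum_mul, coeffAt_sum, Nat.cast_sum]
    · refine Finset.sum_congr rfl fun kap _ => ?_
      by_cases h0 : khovanovCoeff b.1 mu c.1 c.1 rho d.1 kap = 0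
      · simp [h0, coeffAt]
      · have h6 := compat_of_coeff_ne_zero hb hd h2 h3 h0
        rw [Nat.cast_mul, khovanovCoeff_eq ha hd h1 h6 h4, ← coeffAt_intCast_mul]
        congr 1
        push_cast
        ring
    · rw [← sub_mul, ← mul_sub]
      exact Ideal.mul_mem_right _ _ h5
  have := coeffAt_congr (t := lineClockwise a d nu) (a := a) (d := d)
    (f := surgeryFactor a c d * (surgeryFactor a b c * (lineMono a b lam * lineMono b c mu)) *
      lineMono c d rho)
    (g := surgeryFactor a b d * (surgeryFactor b c d * (lineMono b c mu * lineMono c d rho)) *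
      lineMono a b lam) ?_
  · rw [← hL, ← hR] at this
    exact_mod_cast this
  · have h6 := Ideal.mul_mem_right (lineMono a b lam * lineMono b c mu * lineMono c d rho) _
      (surgeryFactor_assoc a b c d)
    convert h6 using 1
    ring

end Coefficients
end ArcAlgebra

namespace ArcAlgebra
open scoped Classical
open MvPolynomial

/-! ### Reflection -/

section Flip

variable {L : Finset ℤ} {S : Set ℤ}

/-- Exchange of the two number lines. -/
def flipVertex : Equiv.Perm (StackVertex L) :=
  Function.Involutive.toPerm (fun u => (u.1, !u.2)) fun u => by simp

@[simp] theorem flipVertex_apply (u : StackVertex L) : flipVertex u = (u.1, !u.2) := rfl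

/-- Exchange of the labels of the two number lines. -/
def flipLabelling : Equiv.Perm (StackLabelling L) :=
  Function.Involutive.toPerm (fun w u => w (flipVertex u)) fun w => by funext u; simp

@[simp] theorem flipLabelling_apply (w : StackLabelling L) (u : StackVertex L) :
    flipLabelling w u = w (flipVertex u) := rfl

/-- The reflection of a diagram with two number lines. -/
def Stack.flip (D : Stack L) : Stack L := ⟨D.d, D.b, D.a, D.cut⟩

theorem Stack.curved_flip (D : Stack L) (u v : StackVertex L) :
    D.flip.Curved (flipVertex u) (flipVertex v) ↔ D.Curved u v := by
  obtain ⟨i, ε⟩ := u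
  obtain ⟨j, ε'⟩ := v
  cases ε <;> cases ε' <;> simp [Stack.Curved, Stack.flip]

theorem Stack.vertical_flip (D : Stack L) (u v : StackVertex L) :
    D.flip.Vertical (flipVertex u) (flipVertex v) ↔ D.Vertical u v := by
  obtain ⟨i, ε⟩ := u
  obtain ⟨j, ε'⟩ := v
  cases ε <;> cases ε' <;> simp [Stack.Vertical, Stack.flip]

theorem Stack.sameCircle_flip_aux (D : Stack L) {u v : StackVertex L} (h : D.SameCircle u v) :
    D.flip.SameCircle (flipVertex u) (flipVertex v) := by
  have hE := D.flip.sameCircle_equivalence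
  refine Stack.sameCircle_le (r := fun u v => D.flip.SameCircle (flipVertex u) (flipVertex v))
    ⟨fun _ => hE.refl _, fun h => hE.symm h, fun h h' => hE.trans h h'⟩ ?_ ?_ h
  · exact fun u v h => Relation.EqvGen.rel _ _ (Or.inl ((D.curved_flip u v).2 h))
  · exact fun u v h => Relation.EqvGen.rel _ _ (Or.inr ((D.vertical_flip u v).2 h))

theorem Stack.sameCircle_flip (D : Stack L) (u v : StackVertex L) :
    D.flip.SameCircle u v ↔ D.SameCircle (flipVertex u) (flipVertex v) := by
  constructor
  · exact fun h => D.flip.sameCircle_flip_aux h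
  · intro h
    have := D.sameCircle_flip_aux h
    simpa using this

theorem Stack.clockwise_flip (D : Stack L) (w : StackLabelling L) (u : StackVertex L) :
    D.flip.Clockwise (flipLabelling w) u ↔ D.Clockwise w (flipVertex u) := by
  unfold Stack.Clockwise
  simp only [Stack.sameCircle_flip]
  rw [← flipVertex.exists_congr_right (q := fun v => D.SameCircle (flipVertex u) v ∧
    (∀ v', D.SameCircle (flipVertex u) v' → v.1 ≤ v'.1) ∧ w v = Label.up)]
  refine exists_congr fun v => and_congr_right fun _ => and_congr_left fun _ => ?_
  rw [← flipVertex.forall_congr_right (q := fun v' => D.SameCircle (flipVertex u) v' →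
    (flipVertex v).1 ≤ v'.1)]
  rfl

theorem Stack.oriented_flip_aux (D : Stack L) {w : StackLabelling L} (h : D.Oriented w) :
    D.flip.Oriented (flipLabelling w) := by
  constructor
  · intro u v huv
    refine h.1 _ _ ((D.curved_flip _ _).1 ?_)
    simpa using huv
  · intro u v huv
    refine h.2 _ _ ((D.vertical_flip _ _).1 ?_)
    simpa using huv

theorem Stack.oriented_flip (D : Stack L) (w : StackLabelling L) :
    D.flip.Oriented (flipLabelling w) ↔ D.Oriented w := by
  refine ⟨fun h => ?_, D.oriented_flip_aux⟩
  have h2 := D.flip.oriented_flip_aux h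
  rwa [show flipLabelling (flipLabelling w) = w by funext u; simp] at h2

variable {a b d : Arcs L S} {cut : Finset ℤ}

/-- The rules read types after surgery on the bottom line only. This is harmless because each end of
the cut arc lies on the same circle as its copy on the top line. The rules themselves are symmetric
in the two lines. -/
theorem Ready.produces_flip {i : Vtx L} (hr : Ready b cut i) (w w' : StackLabelling L) :
    (stackOf d b a cut).Produces i (arcMap b i) (flipLabelling w) (flipLabelling w') ↔
      (stackOf a b d cut).Produces i (arcMap b i) w w' := by
  have hf : stackOf d b a cut = (stackOf a b d cut).flip := rfl
  have hf' : (stackOf a b d cut).flip.surgery i = ((stackOf a b d cut).surgery i).flip := rfl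
  set D := stackOf a b d cut with hD
  have hc1 : (D.surgery i).Clockwise w' (i, true) ↔ (D.surgery i).Clockwise w' (i, false) :=
    clockwise_of_sameCircle _ _ (hr.sameCircle_insert true false)
  have hc2 : (D.surgery i).Clockwise w' (arcMap b i, true) ↔
      (D.surgery i).Clockwise w' (arcMap b i, false) :=
    clockwise_of_sameCircle _ _ (hr.sameCircle_insert' true false)
  have hs : D.SameCircle (i, true) (i, false) ↔ D.SameCircle (i, false) (i, true) :=
    ⟨D.sameCircle_equivalence.symm, D.sameCircle_equivalence.symm⟩
  have hc3 : D.SameCircle (i, false) (i, true) → (D.Clockwise w (i, true) ↔ D.Clockwise w (i, false)) :=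
    fun h => (clockwise_of_sameCircle D w h).symm
  rw [hf]
  unfold Stack.Produces
  simp only [hf', Stack.oriented_flip, Stack.clockwise_flip, Stack.sameCircle_flip, flipVertex_apply,
    Bool.not_false, Bool.not_true, hc1, hc2, hs]
  refine and_congr_right fun _ => and_congr ?_ ?_
  · rw [← flipVertex.forall_congr_right (q := fun u => ¬ D.SameCircle (i, false) u →
      ¬ D.SameCircle (i, true) u → w' u = w u)]
    refine forall_congr' fun u => ?_
    simp only [flipVertex_apply, flipLabelling_apply]
    tauto
  · split_ifs with h1 h2 h3 h3
    · rfl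
    · exact absurd ((hc3 h1).1 h2) h3
    · exact absurd ((hc3 h1).2 h3) h2
    · rfl
    · exact and_congr (not_congr and_comm) (iff_congr Iff.rfl or_comm)

theorem count_flip {l : List (Vtx L × Vtx L)} (hl : ReadyList b cut l) (w w' : StackLabelling L) :
    (stackOf d b a cut).count l (flipLabelling w) (flipLabelling w') =
      (stackOf a b d cut).count l w w' := by
  induction l generalizing cut w with
  | nil => simp [Stack.count]
  | cons x l ih =>
    obtain ⟨i, j⟩ := x
    obtain ⟨hr, rfl, hl⟩ := hl
    simp only [Stack.count]
    rw [← Equiv.sum_comp flipLabelling]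
    refine Finset.sum_congr rfl fun w₁ _ => ?_
    rw [stackOf_surgery, stackOf_surgery, if_congr (hr.produces_flip w w₁) (ih hl w₁) rfl]

/-- This makes reflection reverse products. -/
theorem khovanovCoeff_flip (a d : Arcs L S) {b c : Arcs L S} (lam mu nu : Weight (L : Set ℤ)) :
    khovanovCoeff d.1 mu b.1 c.1 lam a.1 nu = khovanovCoeff a.1 lam c.1 b.1 mu d.1 nu := by
  unfold khovanovCoeff
  by_cases h : b = c
  · subst h
    rw [if_pos rfl, if_pos rfl]
    have := count_flip (a := a) (d := d) (readyList_cupList b) (stackLabelling lam mu)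
      (stackLabelling nu nu)
    rw [show flipLabelling (stackLabelling lam mu) = stackLabelling mu lam by
      funext ⟨i, ε⟩; cases ε <;> rfl, show flipLabelling (stackLabelling nu nu) = stackLabelling nu nu by
      funext ⟨i, ε⟩; cases ε <;> rfl] at this
    exact this
  · rw [if_neg fun h' => h (Subtype.ext h'), if_neg fun h' => h (Subtype.ext h'.symm)]

end Flip
end ArcAlgebra

namespace ArcAlgebra
open scoped Classical
open MvPolynomial

/-! ### Surgery and the Bruhat order -/

section Monotone

/-- The sign `(-1) ^ z`. -/
def parSign (z : ZMod 2) : ℤ := if z = 0 then 1 else -1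

/-- The representative `0` or `1` of a parity. -/
def parVal (z : ZMod 2) : ℤ := if z = 0 then 0 else 1

/-- The signs at the points satisfying `P` alternate, starting with that of `t`, so their sum is
zero or the first sign according to the parity of their number. -/
theorem sum_alternating {α : Type*} [LinearOrder α] (P : α → Prop) (t : ZMod 2) (T : Finset α) :
    ∑ k ∈ T, (if P k then parSign (t + ∑ j ∈ T, if j < k ∧ P j then 1 else 0) else 0) =
      parSign t * parVal (∑ j ∈ T, if P j then 1 else 0) := by
  induction T using Finset.induction_on_max with
  | empty => simp [parVal]
  | insert m T hm ih =>
    have hmT : m ∉ T := fun h => lt_irrefl _ (hm m h)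
    rw [Finset.sum_insert hmT]
    have h1 : ∑ k ∈ T, (if P k then parSign (t + ∑ j ∈ insert m T, if j < k ∧ P j then 1 else 0)
        else 0) = ∑ k ∈ T, (if P k then parSign (t + ∑ j ∈ T, if j < k ∧ P j then 1 else 0) else 0) := by
      refine Finset.sum_congr rfl fun k hk => ?_
      rw [Finset.sum_insert hmT, if_neg (fun h : m < k ∧ P m => lt_asymm h.1 (hm k hk)), zero_add]
    have h2 : ∑ j ∈ insert m T, (if j < m ∧ P j then 1 else 0 : ZMod 2) =
        ∑ j ∈ T, if P j then 1 else 0 := by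
      rw [Finset.sum_insert hmT, if_neg (fun h : m < m ∧ P m => lt_irrefl _ h.1), zero_add]
      refine Finset.sum_congr rfl fun k hk => ?_
      simp [hm k hk]
    rw [h1, h2, ih, Finset.sum_insert hmT]
    split_ifs
    · generalize (∑ j ∈ T, if P j then 1 else 0 : ZMod 2) = z
      clear h1 h2 ih
      revert t z
      decide
    · simp

theorem sign_of_val {l : Label} (h : l = Label.down ∨ l = Label.up) : l.sign = parSign l.val := by
  rcases h with rfl | rfl <;> rfl

variable {L : Finset ℤ} {S : Set ℤ} {a b d : Arcs L S} {cut : Finset ℤ}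

/-- The number of `∨`'s minus the number of `∧`'s up to `x` on the line `ε`. -/
def height (w : StackLabelling L) (ε : Bool) (x : ℤ) : ℤ :=
  ∑ k : Vtx L, if (k : ℤ) ≤ x then (w (k, ε)).sign else 0

/-- The parity of the number of vertices of the circle through `u` up to `x` on the line `ε`. -/
noncomputable def circlePar (D : Stack L) (u : StackVertex L) (ε : Bool) (x : ℤ) : ZMod 2 :=
  ∑ k : Vtx L, if (k : ℤ) ≤ x ∧ D.SameCircle u (k, ε) then 1 else 0

/-- Since the type is constant on a circle and the parity counts the preceding vertices, the labels
of the circle alternate along each line and the first one is given by the type. -/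
theorem Good.circle_sum (hadm : Admissible b cut) {w : StackLabelling L}
    (hw : Good S (stackOf a b d cut) w) {u : StackVertex L} (hu : (u.1 : ℤ) ∈ S) (ε : Bool) (x : ℤ) :
    ∑ k : Vtx L, (if (k : ℤ) ≤ x ∧ (stackOf a b d cut).SameCircle u (k, ε) then (w (k, ε)).sign else 0) =
      parSign (circleType S (stackOf a b d cut) w u) *
        parVal (circlePar (stackOf a b d cut) u ε x) := by
  set D := stackOf a b d cut with hD
  have key := sum_alternating (fun k : Vtx L => D.SameCircle u (k, ε)) (circleType S D w u)
    (Finset.univ.filter fun k : Vtx L => (k : ℤ) ≤ x)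
  simp only [Finset.sum_filter, ite_and] at key
  simp only [circlePar, ite_and]
  rw [← key]
  refine Finset.sum_congr rfl fun k _ => ?_
  split_ifs with h1 h2
  · have hk : (k : ℤ) ∈ S := sameCircle_mem_supp h2 hu
    rw [sign_of_val (Oriented.label_cases hw.1 hk)]
    congr 1
    have h3 := circleType_const hadm hw.1 h2
    rw [h3, circleType, add_assoc]
    have h4 : rank S D (k, ε) (k, ε) =
        ∑ j : Vtx L, if (j : ℤ) ≤ x then if j < k then if D.SameCircle u (j, ε) then 1 else 0 else 0 else 0 := by
      rw [rank, parityLeft_eq_sum]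
      refine Finset.sum_congr rfl fun j _ => ?_
      have h5 : OnCircle S D (k, ε) ε j ↔ D.SameCircle u (j, ε) := by
        rw [OnCircle]
        constructor
        · rintro ⟨-, _, h⟩
          exact D.sameCircle_equivalence.trans h2 h
        · intro h
          exact ⟨sameCircle_mem_supp h hu, j.2,
            D.sameCircle_equivalence.trans (D.sameCircle_equivalence.symm h2) h⟩
      simp only [h5, Subtype.coe_lt_coe]
      by_cases hjk : j < k
      · have : (j : ℤ) ≤ x := (Subtype.coe_le_coe.2 hjk.le).trans h1
        simp [hjk, this]
      · simp [hjk]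
    rw [h4]
    have : ∀ z y : ZMod 2, z = z + (y + y) := by decide
    exact this _ _
  · rfl
  · rfl

theorem circlePar_join {D D' : Stack L} {u v u' : StackVertex L}
    (h : ∀ z, D'.SameCircle u' z ↔ D.SameCircle u z ∨ D.SameCircle v z)
    (hn : ¬ D.SameCircle u v) (ε : Bool) (x : ℤ) :
    circlePar D' u' ε x = circlePar D u ε x + circlePar D v ε x := by
  unfold circlePar
  rw [← Finset.sum_add_distrib]
  refine Finset.sum_congr rfl fun k _ => ?_
  have hE := D.sameCircle_equivalence
  have hd : ¬ (D.SameCircle u (k, ε) ∧ D.SameCircle v (k, ε)) :=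
    fun h => hn (hE.trans h.1 (hE.symm h.2))
  simp only [h]
  by_cases h1 : D.SameCircle u (k, ε) <;> by_cases h2 : D.SameCircle v (k, ε) <;> simp_all

theorem sum_sign_join {D D' : Stack L} {u v u' : StackVertex L}
    (h : ∀ z, D'.SameCircle u' z ↔ D.SameCircle u z ∨ D.SameCircle v z)
    (hn : ¬ D.SameCircle u v) (w : StackLabelling L) (ε : Bool) (x : ℤ) :
    ∑ k : Vtx L, (if (k : ℤ) ≤ x ∧ D'.SameCircle u' (k, ε) then (w (k, ε)).sign else 0) =
    ∑ k : Vtx L, (if (k : ℤ) ≤ x ∧ D.SameCircle u (k, ε) then (w (k, ε)).sign else 0) +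
    ∑ k : Vtx L, (if (k : ℤ) ≤ x ∧ D.SameCircle v (k, ε) then (w (k, ε)).sign else 0) := by
  rw [← Finset.sum_add_distrib]
  refine Finset.sum_congr rfl fun k _ => ?_
  have hE := D.sameCircle_equivalence
  have hd : ¬ (D.SameCircle u (k, ε) ∧ D.SameCircle v (k, ε)) :=
    fun h => hn (hE.trans h.1 (hE.symm h.2))
  simp only [h]
  by_cases h1 : D.SameCircle u (k, ε) <;> by_cases h2 : D.SameCircle v (k, ε) <;> simp_all

/-- The circles touched by a surgery that merges two circles. -/
theorem Ready.merge_circle {i : Vtx L} (h : Ready b cut i)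
    (hn : ¬ (stackOf a b d cut).SameCircle (i, false) (i, true)) (z : StackVertex L) :
    (stackOf a b d (insert (i : ℤ) cut)).SameCircle (i, false) z ↔
      (stackOf a b d cut).SameCircle (i, false) z ∨ (stackOf a b d cut).SameCircle (i, true) z := by
  have hE := (stackOf a b d cut).sameCircle_equivalence
  rw [h.merge hn]
  unfold joinRel
  constructor
  · rintro (h | ⟨-, h⟩ | ⟨h, -⟩)
    · exact Or.inl h
    · exact Or.inr h
    · exact absurd h hn
  · rintro (h | h)
    · exact Or.inl h
    · exact Or.inr (Or.inl ⟨hE.refl _, h⟩)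

/-- The circle touched by a surgery that splits it. -/
theorem Ready.split_circle {i : Vtx L} (h : Ready b cut i)
    (hn : (stackOf a b d cut).SameCircle (i, false) (i, true)) (z : StackVertex L) :
    (stackOf a b d cut).SameCircle (i, false) z ↔
      (stackOf a b d (insert (i : ℤ) cut)).SameCircle (i, false) z ∨
        (stackOf a b d (insert (i : ℤ) cut)).SameCircle (arcMap b i, false) z := by
  have hE := (stackOf a b d (insert (i : ℤ) cut)).sameCircle_equivalence
  obtain ⟨h1, h2⟩ := h.split hn
  rw [h2]
  unfold joinRel
  constructor
  · rintro (h | ⟨-, h⟩ | ⟨h, -⟩)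
    · exact Or.inl h
    · exact Or.inr h
    · exact absurd h h1
  · rintro (h | h)
    · exact Or.inl h
    · exact Or.inr (Or.inl ⟨hE.refl _, h⟩)

/-- A surgery step does not increase the heights. -/
theorem Ready.height_le {i : Vtx L} (hr : Ready b cut i) {w w' : StackLabelling L}
    (hw : Good S (stackOf a b d cut) w) (hw' : Good S (stackOf a b d (insert (i : ℤ) cut)) w')
    (hp : (stackOf a b d cut).Produces i (arcMap b i) w w') (ε : Bool) (x : ℤ) :
    height w' ε x ≤ height w ε x := by
  have hadm := hr.admissible
  have hadm' := hr.admissible_insert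
  set D := stackOf a b d cut with hD
  set D' := stackOf a b d (insert (i : ℤ) cut) with hD'
  have hiS := hr.mem_supp
  have hjS : ((arcMap b i : Vtx L) : ℤ) ∈ S := (arc_mem_supp b).2 hiS
  -- Labels off the touched circles do not change, so only the partial sums over the touched circles
  -- have to be compared.
  have hsum : ∀ (P : StackVertex L → Prop), (∀ z, ¬ P z → w' z = w z) →
      ∑ k : Vtx L, (if (k : ℤ) ≤ x ∧ P (k, ε) then (w' (k, ε)).sign else 0) ≤
        ∑ k : Vtx L, (if (k : ℤ) ≤ x ∧ P (k, ε) then (w (k, ε)).sign else 0) →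
      height w' ε x ≤ height w ε x := by
    intro P hP hle
    have : height w' ε x - height w ε x =
        ∑ k : Vtx L, (if (k : ℤ) ≤ x ∧ P (k, ε) then (w' (k, ε)).sign else 0) -
        ∑ k : Vtx L, (if (k : ℤ) ≤ x ∧ P (k, ε) then (w (k, ε)).sign else 0) := by
      unfold height
      rw [← Finset.sum_sub_distrib, ← Finset.sum_sub_distrib]
      refine Finset.sum_congr rfl fun k _ => ?_
      by_cases h1 : (k : ℤ) ≤ x <;> by_cases h2 : P (k, ε) <;> simp [h1, h2]
      rw [hP _ h2, sub_self]
    linarith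
  obtain ⟨-, hoff, hrule⟩ := hp
  have hsurg : D.surgery i = D' := rfl
  rw [hsurg, hw'.clockwise_iff hadm', hw'.clockwise_iff hadm', hw.clockwise_iff hadm,
    hw.clockwise_iff hadm] at hrule
  simp only [hiS, hjS, true_and] at hrule
  by_cases hc : D.SameCircle (i, false) (i, true)
  · have hsp := hr.split_circle hc
    have hn := (hr.split hc).1
    refine hsum (D.SameCircle (i, false)) (fun z hz => hoff z hz fun h => hz
      (D.sameCircle_equivalence.trans hc h)) ?_
    rw [hw.circle_sum hadm hiS, sum_sign_join hsp hn, hw'.circle_sum hadm' hiS,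
      hw'.circle_sum hadm' hjS, circlePar_join hsp hn]
    rw [if_pos hc] at hrule
    -- The partial sums depend only on the types and on the parities of the numbers of vertices on
    -- the circles, so finitely many cases remain.
    revert hrule
    generalize circleType S D w (i, false) = t
    generalize circleType S D' w' (i, false) = t1
    generalize circleType S D' w' (arcMap b i, false) = t2
    generalize circlePar D' (i, false) ε x = z1
    generalize circlePar D' (arcMap b i, false) ε x = z2
    revert t t1 t2 z1 z2
    decide
  · have hsp := hr.merge_circle hc
    refine hsum (D'.SameCircle (i, false)) (fun z hz => hoff z (fun h => hz ((hsp z).2 (Or.inl h)))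
      fun h => hz ((hsp z).2 (Or.inr h))) ?_
    rw [hw'.circle_sum hadm' hiS, sum_sign_join hsp hc, hw.circle_sum hadm hiS,
      hw.circle_sum hadm hiS, circlePar_join hsp hc]
    rw [if_neg hc] at hrule
    revert hrule
    generalize circleType S D w (i, false) = t1
    generalize circleType S D w (i, true) = t2
    generalize circleType S D' w' (i, false) = t
    generalize circlePar D (i, false) ε x = z1
    generalize circlePar D (i, true) ε x = z2
    revert t t1 t2 z1 z2
    decide

theorem height_le_of_count {l : List (Vtx L × Vtx L)} (hl : ReadyList b cut l)
    {w w' : StackLabelling L} (hw : Good S (stackOf a b d cut) w)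
    (h : (stackOf a b d cut).count l w w' ≠ 0) (ε : Bool) (x : ℤ) : height w' ε x ≤ height w ε x :=
  (count_rel (R := fun w w' => ∀ ε x, height w' ε x ≤ height w ε x) (fun _ _ _ => le_rfl)
    (fun _ _ _ h h' ε x => (h' ε x).trans (h ε x))
    (fun _ _ _ _ hr hw hw' hp => hr.height_le hw hw' hp) hl hw h).2 ε x

/-- The number of `∨`'s minus the number of `∧`'s up to `x`. -/
def weightHeight (lam : Weight (L : Set ℤ)) (x : ℤ) : ℤ :=
  ∑ k : Vtx L, if (k : ℤ) ≤ x then (lam.label k).sign else 0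

/-- The final labelling shows `nu` on both lines, so comparison with the initial labelling bounds it
by `lam` below and by `mu` above. -/
theorem weightHeight_le_of_coeff (ha : a.1.ray = ∅) (hd : d.1.ray = ∅)
    {lam mu nu : Weight (L : Set ℤ)} (h1 : IsOriented a.1 lam) (h2 : IsOriented b.1 lam)
    (h3 : IsOriented b.1 mu) (h4 : IsOriented d.1 mu)
    (h : khovanovCoeff a.1 lam b.1 b.1 mu d.1 nu ≠ 0) (x : ℤ) :
    weightHeight nu x ≤ weightHeight lam x ∧ weightHeight nu x ≤ weightHeight mu x := by
  rw [khovanovCoeff, if_pos rfl] at h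
  have := height_le_of_count (readyList_cupList b) (good_stackLabelling ha hd h1 h2 h3 h4) h
  exact ⟨this false x, this true x⟩

end Monotone
end ArcAlgebra

namespace ArcAlgebra
open scoped Classical
open MvPolynomial

/-! ### The unit and the leading coefficients -/

section Unit

variable {L : Finset ℤ} {S : Set ℤ} {a b d : Arcs L S} {cut : Finset ℤ}

/-- With the same arcs below and above the bottom line, the cup and the uncut cap at `i` form a
circle with two vertices, which does not reach the top line. So every surgery is a merge. -/
theorem Ready.not_sameCircle_of_eq {i : Vtx L} (hr : Ready a cut i) :
    ¬ (stackOf a a d cut).SameCircle (i, false) (i, true) := by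
  intro h
  have key := Stack.sameCircle_le
    (r := fun u v : StackVertex L => (u = (i, false) ∨ u = (arcMap a i, false)) ↔
      (v = (i, false) ∨ v = (arcMap a i, false)))
    ⟨fun _ => Iff.rfl, fun h => h.symm, fun h h' => h.trans h'⟩ ?_ ?_ h
  · simp at key
  · rintro ⟨j, ε⟩ ⟨k, ε'⟩ h
    have he : ε = ε' := h.1
    subst he
    cases ε
    · rw [curved_false] at h
      have hk : arcMap a j = k := h.2.elim id And.left
      subst hk
      simp only [Prod.mk.injEq, and_true, (arcMap_injective a).eq_iff]
      constructor
      · rintro (rfl | rfl)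
        · exact Or.inr rfl
        · simp
      · rintro (rfl | rfl)
        · simp
        · exact Or.inl rfl
    · simp
  · rintro ⟨j, ε⟩ ⟨k, ε'⟩ h
    obtain ⟨-, h2, h3⟩ := (vertical_iff _ _ _ _).1 h
    simp only at h2 h3
    subst h2
    have h4 : j ≠ i := by rintro rfl; exact hr.not_isCut h3
    have h5 : j ≠ arcMap a i := by
      rintro rfl; exact hr.not_isCut ((isCut_arcMap _ _ _).1 h3)
    simp [h4, h5]

theorem chain_eq_one {l : List (Vtx L × Vtx L)} (hl : ReadyList a cut l) :
    chain (stackPerm a a d cut) (l.map (cutPair S false true)) = 1 := by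
  induction l generalizing cut with
  | nil => rfl
  | cons x l ih =>
    obtain ⟨i, j⟩ := x
    obtain ⟨hr, rfl, hl⟩ := hl
    simp only [List.map_cons, chain]
    rw [← stackPerm_insert _ _ _ _ hr.1 hr.notMem, ih hl, mul_one, stepFactor, if_neg]
    rw [sameCycle_stackPerm]
    have hE := (stackOf a a d cut).sameCircle_equivalence
    obtain ⟨h1, h2⟩ := cutPair_cases (b := a) hE hr.sameCircle
    exact fun h => hr.not_sameCircle_of_eq (d := d) (hE.trans (hE.symm h1) (hE.trans h h2))

theorem surgeryFactor_self : surgeryFactor a a d = 1 := by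
  rw [surgeryFactor, chain_eq_one (readyList_cupList a), map_one]

/-- Each circle consists of a cup and its mirror image. Its leftmost vertex is the left end of the
cup, labelled `∨`, so no circle is clockwise. -/
theorem lineMono_self {al : Weight (L : Set ℤ)} (ha : a.1.ray = ∅) (h : IsOriented a.1 al)
    (hleft : ∀ i, i < a.1.arc i → al.label i = Label.down) : lineMono a a al = 1 := by
  unfold lineMono mono
  rw [Finset.prod_eq_one]
  intro u hu
  simp only [repSet, Finset.mem_filter] at hu
  obtain ⟨v, huv, hmin, hv⟩ := hu.2.2
  exfalso
  have hvS : (v : ℤ) ∈ S := by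
    by_contra h'
    rcases isOriented_off ha h h' with h' | h' <;> rw [hv] at h' <;> cases h'
  have hrel : lineRel a a v (arcMap a v) := by
    have := sameCycle_apply (linePerm a a) v
    rwa [linePerm_apply, ite_self] at this
  have h1 : v ≤ arcMap a v := hmin _ ((lineRel_equivalence a a).trans huv hrel)
  have h2 := hleft v (lt_of_le_of_ne h1 fun h => (a.2 v).2 hvS h.symm)
  rw [hv] at h2
  cases h2

/-- The circle diagram `(a al a)` with anti-clockwise circles acts as identity. -/
theorem khovanovCoeff_unit_left (ha : a.1.ray = ∅) (hd : d.1.ray = ∅)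
    {ref al mu nu : Weight (L : Set ℤ)} (hal : Compat ref a a al)
    (hleft : ∀ i, i < a.1.arc i → al.label i = Label.down) (hmu : Compat ref a d mu)
    (hnu : Compat ref a d nu) :
    khovanovCoeff a.1 al a.1 a.1 mu d.1 nu = if nu = mu then 1 else 0 := by
  have h := khovanovCoeff_eq ha hd hal hmu hnu
  rw [surgeryFactor_self, lineMono_self ha hal.1 hleft, one_mul, one_mul, hnu.coeffAt_lineMono hmu] at h
  split_ifs at h ⊢ <;> exact_mod_cast h

theorem Compat.symm {ref nu : Weight (L : Set ℤ)} (h : Compat ref a d nu) : Compat ref d a nu :=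
  ⟨h.2.1, h.1, h.2.2⟩

theorem khovanovCoeff_unit_right (ha : a.1.ray = ∅) (hd : d.1.ray = ∅)
    {ref de mu nu : Weight (L : Set ℤ)} (hde : Compat ref d d de)
    (hleft : ∀ i, i < d.1.arc i → de.label i = Label.down) (hmu : Compat ref a d mu)
    (hnu : Compat ref a d nu) :
    khovanovCoeff a.1 mu d.1 d.1 de d.1 nu = if nu = mu then 1 else 0 := by
  rw [← khovanovCoeff_flip, khovanovCoeff_unit_left hd ha hde hleft hmu.symm hnu.symm]

end Unit

/-! ### Leading coefficients equal to one. -/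

section Leading

variable {L : Finset ℤ} {S : Set ℤ} {a b d : Arcs L S} {cut : Finset ℤ}

/-- Equal labels on the two lines are compatible with all vertical segments, and cutting only
removes conditions on caps and cups. -/
theorem Good.of_empty {mu : Weight (L : Set ℤ)}
    (h : Good S (stackOf a b d ∅) (stackLabelling mu mu)) :
    Good S (stackOf a b d cut) (stackLabelling mu mu) := by
  refine ⟨⟨fun u v huv => h.1.1 u v ?_, ?_⟩, h.2⟩
  · refine ⟨huv.1, huv.2.1, ?_⟩
    rcases huv.2.2 with h | h | h
    · exact Or.inl h
    · exact Or.inr (Or.inl h)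
    · exact Or.inr (Or.inr ⟨h.1, by simp [stackOf]⟩)
  · rintro ⟨i, ε⟩ ⟨j, ε'⟩ huv
    have : i = j := huv.2.1
    subst this
    cases ε <;> cases ε' <;> rfl

theorem rank_join {D D' : Stack L} {u v u' : StackVertex L}
    (h : ∀ z, D'.SameCircle u' z ↔ D.SameCircle u z ∨ D.SameCircle v z)
    (hn : ¬ D.SameCircle u v) (z : StackVertex L) :
    rank S D' u' z = rank S D u z + rank S D v z := by
  unfold rank
  rw [parityLeft_eq_sum, parityLeft_eq_sum, parityLeft_eq_sum, ← Finset.sum_add_distrib]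
  refine Finset.sum_congr rfl fun k _ => ?_
  have hE := D.sameCircle_equivalence
  have hd : ¬ (D.SameCircle u (k, z.2) ∧ D.SameCircle v (k, z.2)) :=
    fun h => hn (hE.trans h.1 (hE.symm h.2))
  simp only [OnCircle, h, k.2, exists_true_left, Subtype.coe_eta]
  by_cases h1 : D.SameCircle u (k, z.2) <;> by_cases h2 : D.SameCircle v (k, z.2) <;> simp_all

/-- To the left of the cup that is about to be cut, both lines look the same. -/
theorem Ready.rank_eq {i : Vtx L} (hr : Ready b cut i) (u : StackVertex L) :
    rank S (stackOf a b d cut) u (i, false) = rank S (stackOf a b d cut) u (i, true) := by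
  unfold rank
  rw [parityLeft_eq_sum, parityLeft_eq_sum]
  refine Finset.sum_congr rfl fun k _ => ?_
  have hE := (stackOf a b d cut).sameCircle_equivalence
  refine if_congr (and_congr_right fun hk => and_congr_right fun hkS => ?_) rfl rfl
  have hcut : IsCut b cut k := by
    refine ⟨hkS, ?_⟩
    rcases lt_or_gt_of_ne ((b.2 k).2 hkS) with h | h
    · rw [min_eq_right h.le]
      exact (hr.2 _ (arc_mem_line b.1 k.2) (by rwa [b.1.arc_arc])).2 (h.trans hk)
    · rw [min_eq_left h.le]
      exact (hr.2 _ k.2 h).2 hk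
  exact exists_congr fun h => ⟨fun h' => hE.trans h' (sameCircle_of_isCut hcut _ _),
    fun h' => hE.trans h' (sameCircle_of_isCut hcut _ _)⟩

/-- The parities at both ends of the cup that has just been cut. -/
theorem Ready.rank_insert {i : Vtx L} (hr : Ready b cut i) (u : StackVertex L) :
    rank S (stackOf a b d (insert (i : ℤ) cut)) u (arcMap b i, false) =
      rank S (stackOf a b d (insert (i : ℤ) cut)) u (i, false) +
        if (stackOf a b d (insert (i : ℤ) cut)).SameCircle u (i, false) then 1 else 0 := by
  have hE := (stackOf a b d (insert (i : ℤ) cut)).sameCircle_equivalence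
  unfold rank
  have := parityLeft_arc b (P := OnCircle S (stackOf a b d (insert (i : ℤ) cut)) u false)
    (fun k hk => hk.1) i.2 hr.1 ?_
  · simp only [coe_arcMap]
    rw [this]
    congr 1
    simp only [OnCircle, hr.mem_supp, i.2, exists_true_left, true_and, Subtype.coe_eta]
  · intro k hk h1 h2
    by_cases hkS : k ∈ S
    · have hncut : ¬ IsCut b (insert (i : ℤ) cut) ⟨k, hk⟩ := by
        intro h
        rcases isCut_insert_cases h with h | h | h
        · exact h1.ne (congrArg Subtype.val h).symm
        · exact h2.ne (congrArg Subtype.val h)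
        · exact uncut_inside hr.admissible hr.1 hr.not_isCut (k := ⟨k, hk⟩) h1 h2 h
      have hs : (stackOf a b d (insert (i : ℤ) cut)).SameCircle (⟨k, hk⟩, false)
          (arcMap b ⟨k, hk⟩, false) := Relation.EqvGen.rel _ _ (Or.inl ((curved_false _ _ _ _).2
            ⟨(arcMap_ne hkS).symm, Or.inr ⟨rfl, hncut⟩⟩))
      exact onCircle_iff_of_sameCircle hs
    · have : b.1.arc k = k := congrArg Subtype.val (arcMap_eq (a := b) (i := ⟨k, hk⟩) hkS)
      rw [this]

/-- Surgery at an anti-clockwise cup and its mirror image produces the same labelling again. -/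
theorem Ready.produces_self {mu : Weight (L : Set ℤ)} {i : Vtx L} (hr : Ready b cut i)
    (hb : IsOriented b.1 mu) (hdown : mu.label i = Label.down)
    (hg : Good S (stackOf a b d ∅) (stackLabelling mu mu)) :
    (stackOf a b d cut).Produces i (arcMap b i) (stackLabelling mu mu) (stackLabelling mu mu) := by
  have hw := hg.of_empty (cut := cut)
  have hw' := hg.of_empty (cut := insert (i : ℤ) cut)
  have hadm := hr.admissible
  have hadm' := hr.admissible_insert
  have hup : mu.label (arcMap b i) = Label.up := by
    rcases isOriented_label hb hr.mem_supp with h | h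
    · exact h.2
    · rw [hdown] at h; cases h.1
  set w := stackLabelling mu mu
  set D := stackOf a b d cut with hD
  set D' := stackOf a b d (insert (i : ℤ) cut) with hD'
  have hiS := hr.mem_supp
  have hjS : ((arcMap b i : Vtx L) : ℤ) ∈ S := (arc_mem_supp b).2 hiS
  have hv0 : (w (i, false)).val = 0 := by
    rw [show w (i, false) = mu.label i from rfl, hdown]; rfl
  have hv1 : (w (i, true)).val = 0 := by
    rw [show w (i, true) = mu.label i from rfl, hdown]; rfl
  have hv2 : (w (arcMap b i, false)).val = 1 := by
    rw [show w (arcMap b i, false) = mu.label (arcMap b i) from rfl, hup]; rfl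
  refine ⟨hw'.1, fun _ _ _ => rfl, ?_⟩
  have hsurg : D.surgery i = D' := rfl
  rw [hsurg, hw'.clockwise_iff hadm', hw'.clockwise_iff hadm', hw.clockwise_iff hadm,
    hw.clockwise_iff hadm]
  simp only [hiS, hjS, true_and, circleType, hv0, hv1, hv2, zero_add]
  by_cases hc : D.SameCircle (i, false) (i, true)
  · have hsp := hr.split_circle hc
    have hn := (hr.split hc).1
    have h1 := rank_join (S := S) hsp hn (i, false)
    have h2 := hr.rank_insert (a := a) (d := d) (i, false)
    have h3 := hr.rank_insert (a := a) (d := d) (arcMap b i, false)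
    have h4 := rank_nested hadm' hn
    rw [if_pos (D'.sameCircle_equivalence.refl _)] at h2
    rw [if_neg fun h => hn (D'.sameCircle_equivalence.symm h), add_zero] at h3
    rw [if_pos hc]
    rw [← hD'] at h2 h3
    rw [h1, h3]
    rw [h2] at h4
    -- With `z1`, `z2` the parities at `i` of the two new circles, the old circle has type `z1 + z2`
    -- and the new ones have types `z1` and `1 + z2`. The rule fails only for `z1 = 0`, `z2 = 1`,
    -- where each new circle would lie inside the other.
    revert h4
    generalize rank S D' (i, false) (i, false) = z1
    generalize rank S D' (arcMap b i, false) (i, false) = z2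
    clear h1 h2 h3
    revert z1 z2
    decide
  · have hsp := hr.merge_circle hc
    have h1 := rank_join (S := S) hsp hc (i, false)
    have h2 := hr.rank_eq (a := a) (d := d) (i, false)
    have h3 := hr.rank_eq (a := a) (d := d) (i, true)
    have h4 := rank_nested hadm hc
    rw [← hD] at h2 h3
    rw [if_neg hc, h1, h3]
    rw [← h2, h3] at h4
    -- The types are `z1`, `z2` before and `z1 + z2` after the merge. The rule fails only for `z1 =
    -- z2 = 1`, which is again excluded by nesting.
    revert h4
    generalize rank S D (i, false) (i, false) = z1
    generalize rank S D (i, true) (i, true) = z2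
    clear h1 h2 h3
    revert z1 z2
    decide

theorem sum_sign_injective {f g : Vtx L → ℤ}
    (h : ∀ x : ℤ, ∑ k : Vtx L, (if (k : ℤ) ≤ x then f k else 0) =
      ∑ k : Vtx L, if (k : ℤ) ≤ x then g k else 0) (k : Vtx L) : f k = g k := by
  have h1 := h k
  have h2 := h (k - 1)
  have h3 : ∀ f : Vtx L → ℤ, ∑ l : Vtx L, (if (l : ℤ) ≤ k then f l else 0) =
      (∑ l : Vtx L, if (l : ℤ) ≤ k - 1 then f l else 0) + f k := by
    intro f
    have : f k = ∑ l : Vtx L, if l = k then f l else 0 := by simp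
    rw [this, ← Finset.sum_add_distrib]
    refine Finset.sum_congr rfl fun l _ => ?_
    rcases lt_trichotomy (l : ℤ) k with hl | hl | hl
    · have : l ≠ k := fun h' => hl.ne (congrArg Subtype.val h')
      simp [this, hl.le, Int.le_sub_one_iff.2 hl]
    · have : l = k := Subtype.ext hl
      subst this; simp
    · have : l ≠ k := fun h' => hl.ne' (congrArg Subtype.val h')
      simp [this, hl.not_ge, show ¬ (l : ℤ) ≤ k - 1 by omega]
  have h4 := h3 f
  have h5 := h3 g
  omega

theorem eq_of_height_le {w w' : StackLabelling L} (hle : ∀ ε x, height w ε x = height w' ε x)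
    (hg : ∀ u : StackVertex L, (u.1 : ℤ) ∈ S → w u = Label.down ∨ w u = Label.up)
    (hg' : ∀ u : StackVertex L, (u.1 : ℤ) ∈ S → w' u = Label.down ∨ w' u = Label.up)
    (hoff : ∀ u : StackVertex L, (u.1 : ℤ) ∉ S → w u = w' u) : w = w' := by
  funext ⟨i, ε⟩
  by_cases hi : (i : ℤ) ∈ S
  · have h := sum_sign_injective (f := fun k => (w (k, ε)).sign) (g := fun k => (w' (k, ε)).sign)
      (hle ε) i
    rcases hg (i, ε) hi with h1 | h1 <;> rcases hg' (i, ε) hi with h2 | h2 <;>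
      simp only [h1, h2] at h ⊢ <;> exact absurd h (by decide)
  · exact hoff _ hi

/-- Heights never increase, so a sequence of labellings that returns to its start has constant
heights and is therefore constant. The constant sequence is allowed by `Ready.produces_self`, so
there is exactly one. -/
theorem count_self {mu : Weight (L : Set ℤ)} (hb : IsOriented b.1 mu)
    (hleft : ∀ i, i < b.1.arc i → mu.label i = Label.down)
    (hg : Good S (stackOf a b d ∅) (stackLabelling mu mu)) {l : List (Vtx L × Vtx L)}
    (hl : ReadyList b cut l) :
    (stackOf a b d cut).count l (stackLabelling mu mu) (stackLabelling mu mu) = 1 := by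
  induction l generalizing cut with
  | nil => simp [Stack.count]
  | cons x l ih =>
    obtain ⟨i, j⟩ := x
    obtain ⟨hr, rfl, hl⟩ := hl
    simp only [Stack.count]
    rw [Finset.sum_eq_single (stackLabelling mu mu),
      if_pos (hr.produces_self hb (hleft i hr.1) hg), stackOf_surgery, ih hl]
    · intro w₁ _ hne
      rw [ite_eq_right_iff]
      intro hp
      by_contra h0
      apply hne
      have hw := hg.of_empty (cut := cut)
      have hw₁ := hr.produces_good hw hp
      rw [stackOf_surgery] at h0
      have h1 := hr.height_le hw hw₁ hp
      have h2 := height_le_of_count hl hw₁ h0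
      refine eq_of_height_le (S := S) (fun ε x => le_antisymm (h1 ε x) (h2 ε x))
        (fun u hu => Oriented.label_cases hw₁.1 hu) (fun u hu => Oriented.label_cases hw.1 hu) ?_
      intro u hu
      exact hp.2.1 u (fun h => hu (sameCircle_mem_supp h hr.mem_supp))
        (fun h => hu (sameCircle_mem_supp h hr.mem_supp))
    · simp

theorem khovanovCoeff_leading (ha : a.1.ray = ∅) (hd : d.1.ray = ∅) {mu : Weight (L : Set ℤ)}
    (h1 : IsOriented a.1 mu) (h2 : IsOriented b.1 mu) (h3 : IsOriented d.1 mu)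
    (hleft : ∀ i, i < b.1.arc i → mu.label i = Label.down) :
    khovanovCoeff a.1 mu b.1 b.1 mu d.1 mu = 1 := by
  rw [khovanovCoeff, if_pos rfl]
  exact count_self h2 hleft (good_stackLabelling ha hd h1 h2 h2 h3) (readyList_cupList b)

end Leading
end ArcAlgebra

namespace ArcAlgebra
open scoped Classical
open MvPolynomial

/-! ### The Bruhat order and blocks -/

section Bruhat

variable {I : Set ℤ}

/-- The label is `∨` or `∧`. -/
def Label.IsArrow (l : Label) : Prop := l = Label.down ∨ l = Label.up

/-- The two labels are both arrows, or they agree. -/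
def Label.Sim (l l' : Label) : Prop := l = l' ∨ (l.IsArrow ∧ l'.IsArrow)

theorem Label.sim_equivalence : Equivalence Label.Sim where
  refl _ := Or.inl rfl
  symm := by rintro x y (rfl | h); exacts [Or.inl rfl, Or.inr ⟨h.2, h.1⟩]
  trans := by
    rintro x y z (rfl | h) (rfl | h')
    exacts [Or.inl rfl, Or.inr h', Or.inr h, Or.inr ⟨h.1, h'.2⟩]

theorem Label.eq_of_sim {l l' : Label} (h : l.Sim l') (hs : l.sign = l'.sign) : l = l' := by
  rcases h with h | ⟨rfl | rfl, rfl | rfl⟩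
  · exact h
  all_goals first | rfl | exact absurd hs (by decide)

theorem Label.sim_sign {l l' : Label} (h : l.Sim l') (hs : l.sign < l'.sign) :
    l = Label.up ∧ l' = Label.down := by
  rcases h with rfl | ⟨rfl | rfl, rfl | rfl⟩
  · exact absurd hs (lt_irrefl _)
  · exact absurd hs (by decide)
  · exact absurd hs (by decide)
  · exact ⟨rfl, rfl⟩
  · exact absurd hs (by decide)

/-- The two weights differ at vertices in `F` only, by a permutation of `∨`'s and `∧`'s. -/
def SimilarOn (F : Finset ℤ) (lam mu : Weight I) : Prop :=
  (∀ i, i ∉ F → lam.label i = mu.label i) ∧ (∀ i, (lam.label i).Sim (mu.label i)) ∧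
    ∑ i ∈ F, (lam.label i).sign = ∑ i ∈ F, (mu.label i).sign

theorem SimilarOn.refl (F : Finset ℤ) (lam : Weight I) : SimilarOn F lam lam :=
  ⟨fun _ _ => rfl, fun _ => Or.inl rfl, rfl⟩

theorem SimilarOn.symm {F : Finset ℤ} {lam mu : Weight I} (h : SimilarOn F lam mu) :
    SimilarOn F mu lam :=
  ⟨fun i hi => (h.1 i hi).symm, fun i => Label.sim_equivalence.symm (h.2.1 i), h.2.2.symm⟩

theorem SimilarOn.trans {F : Finset ℤ} {lam mu nu : Weight I} (h : SimilarOn F lam mu)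
    (h' : SimilarOn F mu nu) : SimilarOn F lam nu :=
  ⟨fun i hi => (h.1 i hi).trans (h'.1 i hi), fun i => Label.sim_equivalence.trans (h.2.1 i) (h'.2.1 i),
    h.2.2.trans h'.2.2⟩

theorem SimilarOn.mono {F F' : Finset ℤ} (hF : F ⊆ F') {lam mu : Weight I} (h : SimilarOn F lam mu) :
    SimilarOn F' lam mu := by
  refine ⟨fun i hi => h.1 i fun h' => hi (hF h'), h.2.1, ?_⟩
  rw [← Finset.sum_sdiff hF, ← Finset.sum_sdiff hF, h.2.2, add_left_inj]
  refine Finset.sum_congr rfl fun i hi => ?_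
  rw [h.1 i (Finset.mem_sdiff.1 hi).2]

theorem SwapUp.similarOn {lam mu : Weight I} (h : SwapUp lam mu) : ∃ F, SimilarOn F lam mu := by
  obtain ⟨i, j, hij, h1, h2, h3, h4, h5⟩ := h
  refine ⟨{i, j}, fun k hk => ?_, fun k => ?_, ?_⟩
  · simp only [Finset.mem_insert, Finset.mem_singleton, not_or] at hk
    exact (h5 k hk.1 hk.2).symm
  · by_cases hi : k = i
    · subst hi; exact Or.inr ⟨Or.inl h1, Or.inr h3⟩
    · by_cases hj : k = j
      · subst hj; exact Or.inr ⟨Or.inr h2, Or.inl h4⟩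
      · exact Or.inl (h5 k hi hj).symm
  · rw [Finset.sum_pair hij.ne, Finset.sum_pair hij.ne, h1, h2, h3, h4]
    rfl

theorem similarOn_of_le {lam mu : Weight I} (h : lam ≤ mu) : ∃ F, SimilarOn F lam mu := by
  have h' : Relation.ReflTransGen SwapUp lam mu := h
  clear h
  induction h' with
  | refl => exact ⟨∅, SimilarOn.refl _ _⟩
  | tail _ h ih =>
    obtain ⟨F, hF⟩ := ih
    obtain ⟨F', hF'⟩ := h.similarOn
    exact ⟨F ∪ F', (hF.mono Finset.subset_union_left).trans (hF'.mono Finset.subset_union_right)⟩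

theorem Linked.similarOn {lam mu : Weight I} (h : Linked lam mu) : ∃ F, SimilarOn F lam mu := by
  obtain ⟨nu, h1, h2⟩ := h
  obtain ⟨F, hF⟩ := similarOn_of_le h1
  obtain ⟨F', hF'⟩ := similarOn_of_le h2
  exact ⟨F ∪ F', (hF.mono Finset.subset_union_left).trans
    (hF'.mono Finset.subset_union_right).symm⟩

theorem exists_weight (lam : Weight I) (F : Finset ℤ) (f : ℤ → Label)
    (hf : ∀ i ∈ F, i ∉ I → f i = Label.nought) :
    ∃ mu : Weight I, (∀ i ∈ F, mu.label i = f i) ∧ ∀ i, i ∉ F → mu.label i = lam.label i := by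
  obtain ⟨T, hT⟩ := lam.tame
  refine ⟨⟨fun i => if i ∈ F then f i else lam.label i, fun i hi => ?_, T ∪ F, ?_⟩, ?_, ?_⟩
  · split_ifs with h
    · exact hf i h hi
    · exact lam.label_off i hi
  · intro i j hij hi hj
    simp only [Finset.mem_union, not_or] at hi hj
    rw [if_neg hi.2, if_neg hj.2]
    exact hT i j hij hi.1 hj.1
  · exact fun i hi => if_pos hi
  · exact fun i hi => if_neg hi

/-- The exchange of a `∨` and a `∧` to its right. -/
theorem exists_swapUp (lam : Weight I) {i j : ℤ} (hij : i < j) (hi : lam.label i = Label.down)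
    (hj : lam.label j = Label.up) : ∃ mu : Weight I, SwapUp lam mu ∧ mu.label i = Label.up ∧
      mu.label j = Label.down ∧ ∀ k, k ≠ i → k ≠ j → mu.label k = lam.label k := by
  obtain ⟨mu, h1, h2⟩ := exists_weight lam {i, j} (fun k => if k = i then Label.up else Label.down) (by
    intro k hk hkI
    simp only [Finset.mem_insert, Finset.mem_singleton] at hk
    rcases hk with rfl | rfl
    · exact absurd (lam.mem_of_label_ne (by rw [hi]; simp)) hkI
    · exact absurd (lam.mem_of_label_ne (by rw [hj]; simp)) hkI)
  have h3 : mu.label i = Label.up := by rw [h1 i (by simp), if_pos rfl]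
  have h4 : mu.label j = Label.down := by rw [h1 j (by simp), if_neg hij.ne']
  have h5 : ∀ k, k ≠ i → k ≠ j → mu.label k = lam.label k := fun k hk hk' => h2 k (by simp [hk, hk'])
  exact ⟨mu, ⟨i, j, hij, hi, hj, h3, h4, h5⟩, h3, h4, h5⟩

theorem SwapUp.lt {lam mu : Weight I} (h : SwapUp lam mu) : lam < mu := by
  refine lt_of_le_of_ne (Relation.ReflTransGen.single h) ?_
  rintro rfl
  obtain ⟨i, j, -, h1, -, h2, -⟩ := h
  rw [h1] at h2
  cases h2

theorem finite_agree (lam : Weight I) (F : Finset ℤ) :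
    {mu : Weight I | ∀ i, i ∉ F → mu.label i = lam.label i}.Finite := by
  refine Set.Finite.of_injOn (f := fun (mu : Weight I) (i : F) => mu.label i) (t := Set.univ)
    (fun _ _ => Set.mem_univ _) ?_ Set.finite_univ
  intro mu hmu nu hnu h
  ext i
  by_cases hi : i ∈ F
  · exact congrFun h ⟨i, hi⟩
  · rw [hmu i hi, hnu i hi]

/-- The number of `∨`'s minus the number of `∧`'s in `F` up to `x`. -/
def heightOn (F : Finset ℤ) (lam : Weight I) (x : ℤ) : ℤ :=
  ∑ k ∈ F, if k ≤ x then (lam.label k).sign else 0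

theorem heightOn_succ (F : Finset ℤ) (lam : Weight I) (x : ℤ) :
    heightOn F lam x = heightOn F lam (x - 1) + if x ∈ F then (lam.label x).sign else 0 := by
  unfold heightOn
  have : (if x ∈ F then (lam.label x).sign else 0) = ∑ k ∈ F, if k = x then (lam.label k).sign else 0 := by
    rw [Finset.sum_ite_eq']
  rw [this, ← Finset.sum_add_distrib]
  refine Finset.sum_congr rfl fun k _ => ?_
  rcases lt_trichotomy k x with h | h | h
  · simp [h.le, h.ne, Int.le_sub_one_iff.2 h]
  · subst h; simp
  · simp [h.not_ge, h.ne', show ¬ k ≤ x - 1 by omega]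

theorem heightOn_total {F : Finset ℤ} (lam : Weight I) {x : ℤ} (hx : ∀ k ∈ F, k ≤ x) :
    heightOn F lam x = ∑ k ∈ F, (lam.label k).sign :=
  Finset.sum_congr rfl fun k hk => if_pos (hx k hk)

theorem heightOn_eq_of_agree {F : Finset ℤ} {lam mu : Weight I} {x : ℤ}
    (h : ∀ k ∈ F, k ≤ x → lam.label k = mu.label k) : heightOn F lam x = heightOn F mu x := by
  refine Finset.sum_congr rfl fun k hk => ?_
  split_ifs with h'
  · rw [h k hk h']
  · rfl

/-- Moving a `∨` from `i` to `j` lowers the partial sums by two between these places and nowhere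
else. -/
theorem heightOn_swap {F : Finset ℤ} {lam mu : Weight I} {i j : ℤ} (hij : i < j) (hi : i ∈ F) (hj : j ∈ F)
    (h1 : lam.label i = Label.down) (h2 : lam.label j = Label.up) (h3 : mu.label i = Label.up)
    (h4 : mu.label j = Label.down) (h5 : ∀ k, k ≠ i → k ≠ j → mu.label k = lam.label k) (x : ℤ) :
    heightOn F mu x = heightOn F lam x - if i ≤ x ∧ x < j then 2 else 0 := by
  have : heightOn F mu x - heightOn F lam x =
      ∑ k ∈ F, ((if k = i then if i ≤ x then -2 else 0 else 0) + if k = j then if j ≤ x then 2 else 0 else 0) := by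
    unfold heightOn
    rw [← Finset.sum_sub_distrib]
    refine Finset.sum_congr rfl fun k _ => ?_
    by_cases hki : k = i
    · subst hki
      rw [h1, h3]
      by_cases hx : k ≤ x <;> simp [hx, hij.ne, Label.sign]
    · by_cases hkj : k = j
      · subst hkj
        rw [h2, h4]
        by_cases hx : k ≤ x <;> simp [hx, hij.ne', Label.sign]
      · rw [h5 k hki hkj]
        simp [hki, hkj]
  rw [Finset.sum_add_distrib, Finset.sum_ite_eq', Finset.sum_ite_eq', if_pos hi, if_pos hj] at this
  split_ifs at this ⊢ <;> omega

/-- The first vertex at which two weights differ. -/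
theorem exists_first_diff {F : Finset ℤ} {lam mu : Weight I}
    (hoff : ∀ i, i ∉ F → lam.label i = mu.label i) (hne : lam ≠ mu) :
    ∃ i ∈ F, lam.label i ≠ mu.label i ∧ ∀ k, k < i → lam.label k = mu.label k := by
  have hex : (F.filter fun i => lam.label i ≠ mu.label i).Nonempty := by
    by_contra h
    rw [Finset.not_nonempty_iff_eq_empty, Finset.filter_eq_empty_iff] at h
    apply hne
    ext i
    by_cases hi : i ∈ F
    · exact not_not.1 (h hi)
    · exact hoff i hi
  obtain ⟨i, hi, hmin⟩ := Finset.exists_min_image _ id hex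
  simp only [Finset.mem_filter, id] at hi hmin
  refine ⟨i, hi.1, hi.2, fun k hk => ?_⟩
  by_contra h
  have hkF : k ∈ F := by by_contra h'; exact h (hoff k h')
  exact absurd (hmin k ⟨hkF, h⟩) (not_le.2 hk)

/-- The Bruhat order is the dominance order. -/
theorem le_of_heightOn_le {F : Finset ℤ} {lam mu : Weight I} (h : SimilarOn F lam mu)
    (hle : ∀ x, heightOn F mu x ≤ heightOn F lam x) : lam ≤ mu := by
  have hfin : {t : Weight I | SimilarOn F t mu ∧ ∀ x, heightOn F mu x ≤ heightOn F t x}.Finite :=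
    (finite_agree mu F).subset fun t ht => ht.1.1
  -- Among the finitely many weights dominated by `mu` in this sense, take a maximal one above
  -- `lam`. If it were not `mu`, it could still be moved up.
  obtain ⟨t, hlt, ht⟩ := hfin.exists_le_maximal (a := lam) ⟨h, hle⟩
  suffices t = mu from this ▸ hlt
  by_contra hne
  obtain ⟨hs, hd⟩ := ht.prop
  obtain ⟨i, hiF, hi, hlow⟩ := exists_first_diff hs.1 hne
  have h0 : heightOn F t (i - 1) = heightOn F mu (i - 1) :=
    heightOn_eq_of_agree fun k _ hk => hlow k (by omega)
  have h1 := heightOn_succ F t i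
  have h2 := heightOn_succ F mu i
  rw [if_pos hiF] at h1 h2
  have h3 := hd i
  have h4 : mu.label i = Label.up ∧ t.label i = Label.down := by
    refine Label.sim_sign (Label.sim_equivalence.symm (hs.2.1 i)) (lt_of_le_of_ne (by omega) ?_)
    exact fun h => hi (Label.eq_of_sim (hs.2.1 i) h.symm)
  have hi2 : heightOn F mu i + 2 ≤ heightOn F t i := by
    rw [h4.1] at h2
    rw [h4.2] at h1
    simp only [Label.sign] at h1 h2
    omega
  -- At the first difference `i` the weight `t` has `∨` and `mu` has `∧`, so the gap between the
  -- heights is at least two there. It vanishes at the far right. Where it first falls below two,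
  -- `t` has `∧` and `mu` has `∨`, and swapping these two places of `t` uses up at most the gap of
  -- two in between.
  have hex : ∃ n : ℕ, heightOn F t (i + n) < heightOn F mu (i + n) + 2 := by
    obtain ⟨M, hM⟩ := F.bddAbove
    refine ⟨(M - i).toNat, ?_⟩
    have hb : ∀ k ∈ F, k ≤ i + ((M - i).toNat : ℤ) := fun k hk => by
      have := hM hk
      omega
    rw [heightOn_total t hb, heightOn_total mu hb, hs.2.2]
    omega
  have hspec := Nat.find_spec hex
  have hmin := fun m => Nat.find_min hex (m := m)
  set n := Nat.find hex
  have hn0 : n ≠ 0 := by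
    intro h
    rw [h, Nat.cast_zero, add_zero] at hspec
    omega
  have hprev := hmin (n - 1) (by omega)
  rw [not_lt, show i + ((n - 1 : ℕ) : ℤ) = i + n - 1 by omega] at hprev
  have h5 := heightOn_succ F t (i + n)
  have h6 := heightOn_succ F mu (i + n)
  have hjF : i + (n : ℤ) ∈ F := by
    by_contra h
    rw [if_neg h] at h5 h6
    omega
  rw [if_pos hjF] at h5 h6
  have h7 := Label.sim_sign (hs.2.1 (i + n)) (by omega)
  obtain ⟨t', hsw, h8, h9, h10⟩ := exists_swapUp t (show i < i + (n : ℤ) by omega) h4.2 h7.1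
  have hmem : t' ∈ {t : Weight I | SimilarOn F t mu ∧ ∀ x, heightOn F mu x ≤ heightOn F t x} := by
    have hst : SimilarOn F t' t := by
      refine ⟨fun k hk => h10 k (by rintro rfl; exact hk hiF) (by rintro rfl; exact hk hjF),
        fun k => ?_, ?_⟩
      · by_cases hki : k = i
        · subst hki; exact Or.inr ⟨Or.inr h8, Or.inl h4.2⟩
        · by_cases hkj : k = i + n
          · subst hkj; exact Or.inr ⟨Or.inl h9, Or.inr h7.1⟩
          · exact Or.inl (h10 k hki hkj)
      · obtain ⟨M, hM⟩ := F.bddAbove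
        have := heightOn_swap (by omega) hiF hjF h4.2 h7.1 h8 h9 h10 M
        have hjM := hM hjF
        rw [if_neg (by omega), sub_zero, heightOn_total _ hM, heightOn_total _ hM] at this
        exact this
    refine ⟨hst.trans hs, fun x => ?_⟩
    rw [heightOn_swap (by omega) hiF hjF h4.2 h7.1 h8 h9 h10]
    split_ifs with hx
    · have := hmin (x - i).toNat (by omega)
      rw [not_lt, show i + ((x - i).toNat : ℤ) = x by omega] at this
      omega
    · rw [sub_zero]; exact hd x
  exact hsw.lt.not_ge (ht.le_of_ge hmem hsw.lt.le)

/-- Two arrow sequences in which all `∧`'s come before all `∨`'s agree if they have the same number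
of arrows of each kind. -/
theorem eq_of_sorted {F : Finset ℤ} {f g : ℤ → Label} (hs : ∀ i ∈ F, (f i).Sim (g i))
    (hf : ∀ i ∈ F, ∀ j ∈ F, i < j → ¬ (f i = Label.down ∧ f j = Label.up))
    (hg : ∀ i ∈ F, ∀ j ∈ F, i < j → ¬ (g i = Label.down ∧ g j = Label.up))
    (hsum : ∑ i ∈ F, (f i).sign = ∑ i ∈ F, (g i).sign) : ∀ i ∈ F, f i = g i := by
  by_contra! hne
  obtain ⟨i, hiF, hi⟩ := hne
  -- If signs are smaller for `f` at `i`, then `f` has `∧` and `g` has `∨` there. A place where the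
  -- inequality is reversed has `∨` in `f` and `∧` in `g`, which breaks sortedness of `f` on one
  -- side of `i` and of `g` on the other. So the sums would differ.
  have key : ∀ (f g : ℤ → Label), (∀ i ∈ F, (f i).Sim (g i)) →
      (∀ i ∈ F, ∀ j ∈ F, i < j → ¬ (f i = Label.down ∧ f j = Label.up)) →
      (∀ i ∈ F, ∀ j ∈ F, i < j → ¬ (g i = Label.down ∧ g j = Label.up)) →
      ∑ i ∈ F, (f i).sign = ∑ i ∈ F, (g i).sign → ¬ (f i).sign < (g i).sign := by
    intro f g hs hf hg hsum hlt
    obtain ⟨h1, h2⟩ := Label.sim_sign (hs i hiF) hlt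
    refine absurd hsum (ne_of_lt (Finset.sum_lt_sum (fun k hk => ?_) ⟨i, hiF, hlt⟩))
    by_contra! hk'
    obtain ⟨h3, h4⟩ := Label.sim_sign (Label.sim_equivalence.symm (hs k hk)) hk'
    rcases lt_trichotomy k i with h | h | h
    · exact hf k hk i hiF h ⟨h4, h1⟩
    · subst h; rw [h1] at h4; cases h4
    · exact hg i hiF k hk h ⟨h2, h3⟩
  rcases lt_trichotomy (f i).sign (g i).sign with h | h | h
  · exact key f g hs hf hg hsum h
  · exact hi (Label.eq_of_sim (hs i hiF) h)
  · exact key g f (fun i hi => Label.sim_equivalence.symm (hs i hi)) hg hf hsum.symm h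

/-- Only finitely many weights are similar to `lam` on `F`. A maximal one above `lam` has no `∨`
before a `∧` in `F`, since these could be swapped. -/
theorem exists_sorted_ge (F : Finset ℤ) (lam : Weight I) : ∃ t, lam ≤ t ∧ SimilarOn F lam t ∧
    ∀ i ∈ F, ∀ j ∈ F, i < j → ¬ (t.label i = Label.down ∧ t.label j = Label.up) := by
  have hfin : {t : Weight I | SimilarOn F lam t}.Finite :=
    (finite_agree lam F).subset fun t ht i hi => (ht.1 i hi).symm
  obtain ⟨t, hle, ht⟩ := hfin.exists_le_maximal (a := lam) (SimilarOn.refl F lam)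
  refine ⟨t, hle, ht.prop, ?_⟩
  rintro i hi j hj hij ⟨h1, h2⟩
  obtain ⟨t', hsw, h3, h4, h5⟩ := exists_swapUp t hij h1 h2
  have hmem : SimilarOn F lam t' := by
    refine ht.prop.trans ⟨fun k hk => (h5 k (by rintro rfl; exact hk hi) (by rintro rfl; exact hk hj)).symm,
      fun k => ?_, ?_⟩
    · by_cases hki : k = i
      · subst hki; exact Or.inr ⟨Or.inl h1, Or.inr h3⟩
      · by_cases hkj : k = j
        · subst hkj; exact Or.inr ⟨Or.inr h2, Or.inl h4⟩
        · exact Or.inl (h5 k hki hkj).symm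
    · obtain ⟨M, hM⟩ := F.bddAbove
      have := heightOn_swap hij hi hj h1 h2 h3 h4 h5 M
      have hjM := hM hj
      rw [if_neg (by omega), sub_zero, heightOn_total _ hM, heightOn_total _ hM] at this
      exact this.symm
  exact hsw.lt.not_ge (ht.le_of_ge hmem hsw.lt.le)

/-- Both weights lie below the one in which the arrows in `F` are sorted. -/
theorem SimilarOn.linked {F : Finset ℤ} {lam mu : Weight I} (h : SimilarOn F lam mu) :
    Linked lam mu := by
  obtain ⟨t, h1, h2, h3⟩ := exists_sorted_ge F lam
  obtain ⟨t', h4, h5, h6⟩ := exists_sorted_ge F mu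
  have hs := h2.symm.trans (h.trans h5)
  have : t = t' := by
    ext i
    by_cases hi : i ∈ F
    · exact eq_of_sorted (fun i _ => hs.2.1 i) h3 h6 hs.2.2 i hi
    · exact hs.1 i hi
  exact ⟨t, h1, this ▸ h4⟩

theorem Linked.symm {lam mu : Weight I} (h : Linked lam mu) : Linked mu lam :=
  let ⟨nu, h1, h2⟩ := h
  ⟨nu, h2, h1⟩

/-- Two common upper bounds do not compose directly; similarity does, and it is equivalent to being
linked. -/
theorem Linked.trans {lam mu nu : Weight I} (h : Linked lam mu) (h' : Linked mu nu) :
    Linked lam nu := by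
  obtain ⟨F, hF⟩ := h.similarOn
  obtain ⟨F', hF'⟩ := h'.similarOn
  exact ((hF.mono (F' := F ∪ F') Finset.subset_union_left).trans
    (hF'.mono Finset.subset_union_right)).linked

theorem Linked.refl (lam : Weight I) : Linked lam lam := ⟨lam, le_rfl, le_rfl⟩

theorem SwapUp.linked {lam mu : Weight I} (h : SwapUp lam mu) : Linked lam mu :=
  ⟨mu, h.lt.le, le_rfl⟩

end Bruhat
end ArcAlgebra

namespace ArcAlgebra
open scoped Classical
open MvPolynomial

/-! ### Truncations and closures -/

section Truncation

variable {I : Set ℤ} {lam0 : Weight I}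

/-- If `I` is infinite, take an interval of `I` that contains, within `I`, the exceptional set of
`lam0` and the places where one of the finitely many weights of the block differs from `lam0`. -/
theorem exists_isTruncation (hI : I.OrdConnected) (hfin : Finite (Block lam0)) :
    ∃ J, IsTruncation lam0 J := by
  by_cases hfI : I.Finite
  · have hoff : ∀ (lam : Weight I) i, i ∉ hfI.toFinset → lam.label i = Label.nought :=
      fun lam i hi => lam.label_off i (by simpa using hi)
    refine ⟨hfI.toFinset, by simp, by simpa using hI, fun _ => by simp, ?_, ?_⟩
    · intro i j _ hi _ h
      rw [hoff lam0 i hi] at h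
      cases h.1
    · intro lam i hi
      rw [hoff _ i hi, hoff _ i hi]
  · obtain ⟨T, hT⟩ := lam0.tame
    choose F hF using fun lam : Block lam0 => lam.2.similarOn
    have : Fintype (Block lam0) := Fintype.ofFinite _
    set E : Finset ℤ := T ∪ Finset.univ.biUnion F
    obtain ⟨M, hM⟩ := E.bddAbove
    obtain ⟨m, hm⟩ := E.bddBelow
    have hmem : ∀ i, i ∈ (Finset.Icc m M).filter (· ∈ I) ↔ (m ≤ i ∧ i ≤ M) ∧ i ∈ I := by simp
    have hE : ∀ i ∈ I, i ∉ (Finset.Icc m M).filter (· ∈ I) → i ∉ E := fun i hi hi' hE =>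
      hi' ((hmem i).2 ⟨⟨hm hE, hM hE⟩, hi⟩)
    refine ⟨(Finset.Icc m M).filter (· ∈ I), fun i hi => ((hmem i).1 hi).2, ?_, fun h => absurd h hfI,
      ?_, ?_⟩
    · refine ⟨fun i hi j hj k hk => ?_⟩
      have hi' := (hmem i).1 hi
      have hj' := (hmem j).1 hj
      exact (hmem k).2 ⟨⟨hi'.1.1.trans hk.1, hk.2.trans hj'.1.2⟩, hI.out hi'.2 hj'.2 hk⟩
    · intro i j hij hi hj h
      have hi' := hE i (lam0.mem_of_label_ne (by rw [h.1]; simp)) hi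
      have hj' := hE j (lam0.mem_of_label_ne (by rw [h.2]; simp)) hj
      exact hT i j hij (fun h => hi' (Finset.mem_union_left _ h))
        (fun h => hj' (Finset.mem_union_left _ h)) h
    · intro lam i hi
      by_cases hiI : i ∈ I
      · refine ((hF lam).1 i fun h => hE i hiI hi ?_).symm
        exact Finset.mem_union_right _ (Finset.mem_biUnion.2 ⟨lam, Finset.mem_univ _, h⟩)
      · rw [lam.1.label_off i hiI, lam0.label_off i hiI]

theorem truncLine_spec (hI : I.OrdConnected) (hfin : Finite (Block lam0)) :
    IsTruncation lam0 (truncLine lam0) := by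
  have h := exists_isTruncation hI hfin
  rw [truncLine, dif_pos h]
  exact h.choose_spec

theorem SimilarOn.of_agree {F J : Finset ℤ} {lam mu : Weight I} (h : SimilarOn F lam mu)
    (hJ : ∀ i, i ∉ J → lam.label i = mu.label i) : SimilarOn J lam mu := by
  refine ⟨hJ, h.2.1, ?_⟩
  have := (h.mono (F' := F ∪ J) Finset.subset_union_left).2.2
  rw [← Finset.sum_sdiff Finset.subset_union_right,
    ← Finset.sum_sdiff (s₁ := J) (s₂ := F ∪ J) Finset.subset_union_right] at this
  rw [Finset.sum_congr rfl fun i hi => by rw [hJ i (Finset.mem_sdiff.1 hi).2]] at this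
  exact add_left_cancel this

theorem block_similarOn (hJ : IsTruncation lam0 (truncLine lam0)) (lam : Block lam0) :
    SimilarOn (truncLine lam0) lam0 lam.1 := by
  obtain ⟨F, hF⟩ := lam.2.similarOn
  exact hF.of_agree fun i hi => (hJ.2.2.2.2 lam i hi).symm

/-- Swappable arrows of a weight in the block lie in the truncation. -/
theorem mem_truncLine_of_swap (hJ : IsTruncation lam0 (truncLine lam0)) (lam : Block lam0) {i j : ℤ}
    (hij : i < j) (hi : lam.1.label i = Label.down) (hj : lam.1.label j = Label.up) :
    i ∈ truncLine lam0 ∧ j ∈ truncLine lam0 := by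
  -- The swapped weight belongs to the block too, and outside the truncation all weights of the
  -- block agree.
  obtain ⟨mu, hsw, h1, h2, -⟩ := exists_swapUp lam.1 hij hi hj
  have hmu := hJ.2.2.2.2 ⟨mu, lam.2.trans hsw.linked⟩
  have hl := hJ.2.2.2.2 lam
  constructor
  · by_contra h
    have := (hmu i h).trans (hl i h).symm
    simp only [h1, hi] at this
    cases this
  · by_contra h
    have := (hmu j h).trans (hl j h).symm
    simp only [h2, hj] at this
    cases this

end Truncation

/-! ### Ballot sequences and the closed number line. -/

section Closed

variable {L : Finset ℤ}

theorem excess_eq_heightOn (lam : Weight (L : Set ℤ)) {m : ℤ} (hm : ∀ k ∈ L, m ≤ k) (x : ℤ) :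
    lam.excess m x = heightOn L lam x := by
  unfold Weight.excess heightOn
  rw [← Finset.sum_filter]
  refine (Finset.sum_subset (fun k hk => ?_) fun k hk hk' => ?_).symm
  · rw [Finset.mem_filter] at hk
    exact Finset.mem_Icc.2 ⟨hm k hk.1, hk.2⟩
  · have : k ∉ L := fun h => hk' (Finset.mem_filter.2 ⟨h, (Finset.mem_Icc.1 hk).2⟩)
    rw [lam.label_off k (by simpa using this)]
    rfl

/-- In a ballot sequence every arrow is an end of a cup. -/
theorem cupPartner_ne_of_ballot {lam : Weight (L : Set ℤ)} (h0 : ∀ x, 0 ≤ heightOn L lam x)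
    (htot : ∑ k ∈ L, (lam.label k).sign = 0) {i : ℤ} (hi : (lam.label i).IsArrow) :
    lam.cupPartner i ≠ i := by
  have hiL : i ∈ L := by
    have := lam.mem_of_label_ne (i := i) (by rintro h; rw [h] at hi; rcases hi with h | h <;> cases h)
    simpa using this
  obtain ⟨M, hM⟩ := L.bddAbove
  obtain ⟨m, hm⟩ := L.bddBelow
  have hmi := hm hiL
  have hiM := hM hiL
  rcases hi with hi | hi
  · have h1 := lam.excess_split (i := m) (k := i - 1) (j := M) (by omega) (by omega)
    rw [excess_eq_heightOn lam hm, excess_eq_heightOn lam hm, heightOn_total lam hM, htot,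
      sub_add_cancel] at h1
    have h2 := h0 (i - 1)
    obtain ⟨j, -, hj⟩ := lam.exists_isCup_right hi hiM (by omega)
    rw [hj.partner_left]
    exact hj.1.ne'
  · obtain ⟨j, -, hj⟩ := lam.exists_isCup_left hi hmi (by rw [excess_eq_heightOn lam hm]; exact h0 i)
    rw [hj.partner_right]
    exact hj.1.ne

theorem cupPartner_isArrow {I : Set ℤ} {lam : Weight I} {i : ℤ} (h : lam.cupPartner i ≠ i) :
    (lam.label i).IsArrow := by
  rcases lam.cupPartner_cases i with h' | h' | h'
  · exact Or.inl h'.left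
  · exact Or.inr h'.right
  · exact absurd h'.1 h

theorem mem_newLeft {J : Finset ℤ} {p : ℕ} {i k : ℤ} (hi : i ∈ newLeft J p) (hk : k ∈ J) : i < k := by
  unfold newLeft at hi
  rw [dif_pos ⟨k, hk⟩, Finset.mem_Ico] at hi
  exact hi.2.trans_le (J.min'_le k hk)

theorem mem_newRight {J : Finset ℤ} {p : ℕ} {i k : ℤ} (hi : i ∈ newRight J p) (hk : k ∈ J) : k < i := by
  unfold newRight at hi
  rw [dif_pos ⟨k, hk⟩, Finset.mem_Ioc] at hi
  exact (J.le_max' k hk).trans_lt hi.1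

theorem newLeft_lt_newRight {J : Finset ℤ} {p q : ℕ} {i j : ℤ} (hi : i ∈ newLeft J p)
    (hj : j ∈ newRight J q) : i < j := by
  by_cases h : J.Nonempty
  · obtain ⟨k, hk⟩ := h
    exact (mem_newLeft hi hk).trans (mem_newRight hj hk)
  · rw [newLeft, dif_neg h] at hi
    simp at hi

/-- For empty `J` there are no new vertices by default. This is consistent because then there are no
arrows to be matched either. -/
theorem card_newLeft {J : Finset ℤ} {p : ℕ} (h : J.Nonempty ∨ p = 0) : (newLeft J p).card = p := by
  unfold newLeft
  split_ifs with hJ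
  · rw [Int.card_Ico]; omega
  · rw [Finset.card_empty]; tauto

theorem card_newRight {J : Finset ℤ} {p : ℕ} (h : J.Nonempty ∨ p = 0) : (newRight J p).card = p := by
  unfold newRight
  split_ifs with hJ
  · rw [Int.card_Ioc]; omega
  · rw [Finset.card_empty]; tauto

theorem sum_closedLine (J : Finset ℤ) (p q : ℕ) (f : ℤ → ℤ) :
    ∑ k ∈ closedLine J p q, f k = ∑ k ∈ newLeft J p, f k + ∑ k ∈ J, f k + ∑ k ∈ newRight J q, f k := by
  unfold closedLine
  rw [Finset.sum_union, Finset.sum_union]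
  · rw [Finset.disjoint_left]
    exact fun k hk hk' => lt_irrefl _ (mem_newLeft hk hk')
  · rw [Finset.disjoint_left]
    intro k hk hk'
    rcases Finset.mem_union.1 hk with hk | hk
    · exact lt_irrefl _ (newLeft_lt_newRight hk hk')
    · exact lt_irrefl _ (mem_newRight hk' hk)

end Closed

/-! ### Closures of the weights of a block. -/

section Closure

variable {I : Set ℤ} {lam0 : Weight I}

/-- The number line of the closures of the weights in the block. -/
noncomputable abbrev clLine (lam0 : Weight I) : Finset ℤ :=
  closedLine (truncLine lam0) (truncUp lam0) (truncDown lam0)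

theorem cl_of_mem (lam : Block lam0) {i : ℤ} (hi : i ∈ truncLine lam0) :
    (cl lam).label i = lam.1.label i := by
  simp [cl, Weight.closure, Weight.restrict, hi]

theorem cl_of_newLeft (lam : Block lam0) {i : ℤ} (hi : i ∈ newLeft (truncLine lam0) (truncUp lam0)) :
    (cl lam).label i = Label.down := by
  have : i ∉ truncLine lam0 := fun h => lt_irrefl _ (mem_newLeft hi h)
  simp [cl, Weight.closure, this, hi]

theorem cl_of_newRight (lam : Block lam0) {i : ℤ}
    (hi : i ∈ newRight (truncLine lam0) (truncDown lam0)) : (cl lam).label i = Label.up := by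
  have h1 : i ∉ truncLine lam0 := fun h => lt_irrefl _ (mem_newRight hi h)
  have h2 : i ∉ newLeft (truncLine lam0) (truncUp lam0) :=
    fun h => lt_irrefl _ (newLeft_lt_newRight h hi)
  simp [cl, Weight.closure, h1, h2, hi]

theorem cl_cases (i : ℤ) : i ∈ truncLine lam0 ∨ i ∈ newLeft (truncLine lam0) (truncUp lam0) ∨
    i ∈ newRight (truncLine lam0) (truncDown lam0) ∨ i ∉ clLine lam0 := by
  simp only [clLine, closedLine, Finset.mem_union]
  tauto

theorem cl_ext {lam : Block lam0} {kap : Weight (clLine lam0 : Set ℤ)}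
    (h1 : ∀ i ∈ truncLine lam0, kap.label i = lam.1.label i)
    (h2 : ∀ i ∈ newLeft (truncLine lam0) (truncUp lam0), kap.label i = Label.down)
    (h3 : ∀ i ∈ newRight (truncLine lam0) (truncDown lam0), kap.label i = Label.up) :
    kap = cl lam := by
  ext i
  rcases cl_cases (lam0 := lam0) i with h | h | h | h
  · rw [h1 i h, cl_of_mem lam h]
  · rw [h2 i h, cl_of_newLeft lam h]
  · rw [h3 i h, cl_of_newRight lam h]
  · rw [kap.label_off i (by exact_mod_cast h), (cl lam).label_off i (by exact_mod_cast h)]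

theorem cl_injective (hJ : IsTruncation lam0 (truncLine lam0)) :
    Function.Injective (cl : Block lam0 → _) := by
  intro lam mu h
  apply Subtype.ext
  ext i
  by_cases hi : i ∈ truncLine lam0
  · rw [← cl_of_mem lam hi, ← cl_of_mem mu hi, h]
  · rw [hJ.2.2.2.2 lam i hi, hJ.2.2.2.2 mu i hi]

/-- The weight `lam0` as an element of its block. -/
def baseWeight (lam0 : Weight I) : Block lam0 := ⟨lam0, Linked.refl lam0⟩

theorem cl_sim (hJ : IsTruncation lam0 (truncLine lam0)) (lam mu : Block lam0) (i : ℤ) :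
    ((cl lam).label i).Sim ((cl mu).label i) := by
  rcases cl_cases (lam0 := lam0) i with h | h | h | h
  · rw [cl_of_mem lam h, cl_of_mem mu h]
    exact Label.sim_equivalence.trans (Label.sim_equivalence.symm ((block_similarOn hJ lam).2.1 i))
      ((block_similarOn hJ mu).2.1 i)
  · rw [cl_of_newLeft lam h, cl_of_newLeft mu h]; exact Or.inl rfl
  · rw [cl_of_newRight lam h, cl_of_newRight mu h]; exact Or.inl rfl
  · rw [(cl lam).label_off i (by exact_mod_cast h), (cl mu).label_off i (by exact_mod_cast h)]
    exact Or.inl rfl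

/-- Turning a `∧` into a `∨` raises the sum of signs by two, so equal sums force equal numbers. -/
theorem numLabel_up_eq {F : Finset ℤ} {lam mu : Weight I} (h : SimilarOn F lam mu) :
    lam.numLabel F Label.up = mu.numLabel F Label.up := by
  have key : (lam.numLabel F Label.up : ℤ) * 2 - mu.numLabel F Label.up * 2 =
      ∑ i ∈ F, (mu.label i).sign - ∑ i ∈ F, (lam.label i).sign := by
    unfold Weight.numLabel
    rw [Finset.card_filter, Finset.card_filter, Nat.cast_sum, Nat.cast_sum, Finset.sum_mul,
      Finset.sum_mul, ← Finset.sum_sub_distrib, ← Finset.sum_sub_distrib]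
    refine Finset.sum_congr rfl fun i _ => ?_
    rcases h.2.1 i with h | ⟨h | h, h' | h'⟩
    · rw [h]; ring
    · rw [h, h']; rfl
    · rw [h, h']; rfl
    · rw [h, h']; rfl
    · rw [h, h']; rfl
  rw [h.2.2, sub_self] at key
  omega

theorem sum_sign_eq_sub (lam : Weight I) (F : Finset ℤ) : ∑ i ∈ F, (lam.label i).sign =
    lam.numLabel F Label.down - lam.numLabel F Label.up := by
  unfold Weight.numLabel
  rw [Finset.card_filter, Finset.card_filter, Nat.cast_sum, Nat.cast_sum, ← Finset.sum_sub_distrib]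
  refine Finset.sum_congr rfl fun i _ => ?_
  cases lam.label i <;> rfl

theorem sum_truncLine (hJ : IsTruncation lam0 (truncLine lam0)) (lam : Block lam0) :
    ∑ i ∈ truncLine lam0, (lam.1.label i).sign = truncDown lam0 - truncUp lam0 := by
  rw [← (block_similarOn hJ lam).2.2, sum_sign_eq_sub]
  rfl

theorem neg_le_heightOn {F : Finset ℤ} (lam : Weight I) (x : ℤ) :
    -(lam.numLabel F Label.up : ℤ) ≤ heightOn F lam x := by
  unfold Weight.numLabel heightOn
  rw [Finset.card_filter, Nat.cast_sum, ← Finset.sum_neg_distrib]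
  refine Finset.sum_le_sum fun i _ => ?_
  cases lam.label i <;> split_ifs <;> simp [Label.sign] at *

theorem nonempty_or (lam0 : Weight I) (l : Label) :
    (truncLine lam0).Nonempty ∨ lam0.numLabel (truncLine lam0) l = 0 := by
  rcases (truncLine lam0).eq_empty_or_nonempty with h | h
  · right; rw [h]; rfl
  · exact Or.inl h

theorem card_newLeft_truncLine (lam0 : Weight I) :
    (newLeft (truncLine lam0) (truncUp lam0)).card = truncUp lam0 :=
  card_newLeft (nonempty_or lam0 Label.up)

theorem card_newRight_truncLine (lam0 : Weight I) :
    (newRight (truncLine lam0) (truncDown lam0)).card = truncDown lam0 :=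
  card_newRight (nonempty_or lam0 Label.down)

theorem cl_total (hJ : IsTruncation lam0 (truncLine lam0)) (lam : Block lam0) :
    ∑ k ∈ clLine lam0, ((cl lam).label k).sign = 0 := by
  rw [clLine, sum_closedLine, Finset.sum_congr rfl fun k hk => by rw [cl_of_newLeft lam hk],
    Finset.sum_congr (s₁ := truncLine lam0) rfl fun k hk => by rw [cl_of_mem lam hk],
    Finset.sum_congr (s₁ := newRight _ _) rfl fun k hk => by rw [cl_of_newRight lam hk],
    sum_truncLine hJ lam]
  simp only [Label.sign, Finset.sum_const, nsmul_eq_mul]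
  rw [card_newLeft_truncLine, card_newRight_truncLine]
  ring

theorem heightOn_cl (lam : Block lam0) (x : ℤ) : heightOn (clLine lam0) (cl lam) x =
    ∑ k ∈ newLeft (truncLine lam0) (truncUp lam0), (if k ≤ x then 1 else 0) +
    heightOn (truncLine lam0) lam.1 x +
    ∑ k ∈ newRight (truncLine lam0) (truncDown lam0), if k ≤ x then -1 else 0 := by
  unfold heightOn
  rw [clLine, sum_closedLine]
  congr 1
  · congr 1
    · exact Finset.sum_congr rfl fun k hk => by rw [cl_of_newLeft lam hk]; rfl
    · exact Finset.sum_congr rfl fun k hk => by rw [cl_of_mem lam hk]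
  · exact Finset.sum_congr rfl fun k hk => by rw [cl_of_newRight lam hk]; rfl

/-- The new `∨`'s on the left outnumber or match the `∧`'s in the truncation. At its right end the
sum has become the number of `∨`'s in the truncation, which is the number of new `∧`'s. So the
closure is a ballot sequence. -/
theorem cl_heightOn_nonneg (hJ : IsTruncation lam0 (truncLine lam0)) (lam : Block lam0) (x : ℤ) :
    0 ≤ heightOn (clLine lam0) (cl lam) x := by
  rw [heightOn_cl]
  by_cases hlow : ∃ k ∈ truncLine lam0, k ≤ x
  · obtain ⟨k0, hk0, hk0x⟩ := hlow
    rw [Finset.sum_congr rfl fun k hk => if_pos ((mem_newLeft hk hk0).le.trans hk0x)]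
    rw [Finset.sum_const, card_newLeft_truncLine]
    by_cases hhigh : ∃ k ∈ truncLine lam0, x ≤ k
    · obtain ⟨k1, hk1, hk1x⟩ := hhigh
      rw [Finset.sum_congr (s₁ := newRight _ _) rfl fun k hk =>
        if_neg (not_le.2 (hk1x.trans_lt (mem_newRight hk hk1)))]
      have := neg_le_heightOn (F := truncLine lam0) lam.1 x
      rw [← numLabel_up_eq (block_similarOn hJ lam)] at this
      simp only [Finset.sum_const_zero, nsmul_eq_mul, mul_one, add_zero]
      have h2 : truncUp lam0 = lam0.numLabel (truncLine lam0) Label.up := rfl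
      omega
    · have h3 : ∀ k ∈ truncLine lam0, k ≤ x := fun k hk => by
        by_contra h; exact hhigh ⟨k, hk, (not_le.1 h).le⟩
      rw [heightOn_total _ h3, sum_truncLine hJ lam]
      have : -(truncDown lam0 : ℤ) ≤ ∑ k ∈ newRight (truncLine lam0) (truncDown lam0),
          if k ≤ x then -1 else 0 := by
        calc -(truncDown lam0 : ℤ) = ∑ k ∈ newRight (truncLine lam0) (truncDown lam0), (-1 : ℤ) := by
              rw [Finset.sum_const, card_newRight_truncLine]; simp
          _ ≤ _ := Finset.sum_le_sum fun k _ => by split_ifs <;> simp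
      simp only [nsmul_eq_mul, mul_one]
      omega
  · have h1 : heightOn (truncLine lam0) lam.1 x = 0 :=
      Finset.sum_eq_zero fun k hk => if_neg fun h => hlow ⟨k, hk, h⟩
    have h2 : ∑ k ∈ newRight (truncLine lam0) (truncDown lam0), (if k ≤ x then (-1 : ℤ) else 0) = 0 := by
      refine Finset.sum_eq_zero fun k hk => if_neg fun h => ?_
      by_cases hne : (truncLine lam0).Nonempty
      · obtain ⟨k0, hk0⟩ := hne
        exact hlow ⟨k0, hk0, (mem_newRight hk hk0).le.trans h⟩
      · rw [newRight, dif_neg hne] at hk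
        simp at hk
    rw [h1, h2, add_zero, add_zero]
    exact Finset.sum_nonneg fun k _ => by split_ifs <;> simp

/-- The vertices of the closed number line that are labelled by arrows. -/
def clSupp (lam0 : Weight I) : Set ℤ := {i | ((cl (baseWeight lam0)).label i).IsArrow}

theorem Label.Sim.isArrow_iff {l l' : Label} (h : l.Sim l') : l.IsArrow ↔ l'.IsArrow := by
  rcases h with rfl | h
  · rfl
  · exact ⟨fun _ => h.2, fun _ => h.1⟩

theorem cl_isArrow (hJ : IsTruncation lam0 (truncLine lam0)) (lam : Block lam0) (i : ℤ) :
    ((cl lam).label i).IsArrow ↔ i ∈ clSupp lam0 :=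
  (cl_sim hJ lam (baseWeight lam0) i).isArrow_iff

/-- In a ballot sequence with total zero all arrows are matched. Hence the cup diagrams of all
closures have no rays and the same support, as required for the results on closed diagrams. -/
theorem cl_cupPartner (hJ : IsTruncation lam0 (truncLine lam0)) (al : Block lam0) (i : ℤ) :
    (cl al).cupDiagram.arc i ≠ i ↔ i ∈ clSupp lam0 := by
  rw [← cl_isArrow hJ al]
  exact ⟨cupPartner_isArrow, cupPartner_ne_of_ballot (cl_heightOn_nonneg hJ al) (cl_total hJ al)⟩

/-- The cup diagram of the closure of a weight. -/
noncomputable def clArcs (hJ : IsTruncation lam0 (truncLine lam0)) (al : Block lam0) :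
    Arcs (clLine lam0) (clSupp lam0) := ⟨(cl al).cupDiagram, cl_cupPartner hJ al⟩

theorem clArcs_ray (hJ : IsTruncation lam0 (truncLine lam0)) (al : Block lam0) :
    (clArcs hJ al).1.ray = ∅ := by
  refine Set.eq_empty_iff_forall_notMem.2 fun i hi => ?_
  exact cupPartner_ne_of_ballot (cl_heightOn_nonneg hJ al) (cl_total hJ al) hi.2 hi.1

end Closure
end ArcAlgebra

namespace ArcAlgebra
open scoped Classical
open MvPolynomial

/-! ### Orientations of cup diagrams and of their closures. -/

section ClosureDiagrams

variable {I : Set ℤ} {lam0 : Weight I}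

/-- The labels are one `∨` and one `∧`. -/
def Label.Opp (l l' : Label) : Prop :=
  (l = Label.down ∧ l' = Label.up) ∨ (l = Label.up ∧ l' = Label.down)

theorem Label.Opp.symm {l l' : Label} (h : l.Opp l') : l'.Opp l :=
  h.elim (fun h => Or.inr ⟨h.2, h.1⟩) fun h => Or.inl ⟨h.2, h.1⟩

theorem Label.Opp.sign_add {l l' : Label} (h : l.Opp l') : l.sign + l'.sign = 0 := by
  rcases h with ⟨rfl, rfl⟩ | ⟨rfl, rfl⟩ <;> rfl

theorem Label.not_isArrow_iff {l : Label} : ¬ l.IsArrow ↔ l = Label.nought ∨ l = Label.cross := by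
  cases l <;> simp [Label.IsArrow]

theorem isOriented_cupDiagram_iff {al lam : Weight I} (hs : ∀ i, (al.label i).Sim (lam.label i)) :
    IsOriented al.cupDiagram lam ↔ (∀ i j, al.IsCup i j → (lam.label i).Opp (lam.label j)) ∧
      ∀ i j, i ∈ al.cupDiagram.ray → j ∈ al.cupDiagram.ray → i < j →
        ¬ (lam.label i = Label.down ∧ lam.label j = Label.up) := by
  constructor
  · rintro ⟨-, h2, -, h4⟩
    refine ⟨fun i j hij => ?_, h4⟩
    have hp : al.cupDiagram.arc i = j := hij.partner_left
    have := h2 i (by rw [hp]; exact hij.1.ne')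
    rwa [hp] at this
  · rintro ⟨h2, h4⟩
    refine ⟨fun i hi hray => ?_, fun i hi => ?_, fun i hi => ?_, h4⟩
    · rw [← Label.not_isArrow_iff, ← (hs i).isArrow_iff]
      exact fun h => hray ⟨hi, h⟩
    · rcases al.cupPartner_cases i with h | h | h
      · exact h2 _ _ h
      · exact (h2 _ _ h).symm
      · exact absurd h.1 hi
    · exact (hs i).isArrow_iff.1 hi.2

theorem block_sim (hJ : IsTruncation lam0 (truncLine lam0)) (al lam : Block lam0) (i : ℤ) :
    (al.1.label i).Sim (lam.1.label i) :=
  Label.sim_equivalence.trans (Label.sim_equivalence.symm ((block_similarOn hJ al).2.1 i))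
    ((block_similarOn hJ lam).2.1 i)

theorem mem_truncLine_of_isCup (hJ : IsTruncation lam0 (truncLine lam0)) (al : Block lam0) {i j : ℤ}
    (h : al.1.IsCup i j) : i ∈ truncLine lam0 ∧ j ∈ truncLine lam0 :=
  mem_truncLine_of_swap hJ al h.1 h.left h.right

/-- The truncation contains all integers between two of its vertices, so the running excess is the
same for the weight and its closure. -/
theorem isCup_cl_iff (hJ : IsTruncation lam0 (truncLine lam0)) (al : Block lam0) {i j : ℤ}
    (hi : i ∈ truncLine lam0) (hj : j ∈ truncLine lam0) : (cl al).IsCup i j ↔ al.1.IsCup i j := by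
  have hex : ∀ k, k ≤ j → (cl al).excess i k = al.1.excess i k := by
    intro k hk
    refine Finset.sum_congr rfl fun x hx => ?_
    rw [Finset.mem_Icc] at hx
    have : x ∈ (truncLine lam0 : Set ℤ) := hJ.2.1.out hi hj ⟨hx.1, hx.2.trans hk⟩
    rw [cl_of_mem al this]
  unfold Weight.IsCup
  rw [hex j le_rfl]
  refine and_congr_right fun _ => and_congr_right fun _ => ?_
  exact forall_congr' fun k => forall_congr' fun _ => forall_congr' fun hk => by rw [hex k hk.le]

theorem cl_isCup_left (al : Block lam0) {i j : ℤ} (h : (cl al).IsCup i j) :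
    i ∈ truncLine lam0 ∨ i ∈ newLeft (truncLine lam0) (truncUp lam0) := by
  have hl := h.left
  rcases cl_cases (lam0 := lam0) i with h' | h' | h' | h'
  · exact Or.inl h'
  · exact Or.inr h'
  · rw [cl_of_newRight al h'] at hl; cases hl
  · rw [(cl al).label_off i (by exact_mod_cast h')] at hl; cases hl

theorem cl_isCup_right (al : Block lam0) {i j : ℤ} (h : (cl al).IsCup i j) :
    j ∈ truncLine lam0 ∨ j ∈ newRight (truncLine lam0) (truncDown lam0) := by
  have hl := h.right
  rcases cl_cases (lam0 := lam0) j with h' | h' | h' | h'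
  · exact Or.inl h'
  · rw [cl_of_newLeft al h'] at hl; cases hl
  · exact Or.inr h'
  · rw [(cl al).label_off j (by exact_mod_cast h')] at hl; cases hl

/-- Weights orienting a cup diagram agree at its rays. -/
theorem label_eq_of_ray (hJ : IsTruncation lam0 (truncLine lam0)) {al lam : Block lam0}
    (h : IsOriented al.1.cupDiagram lam.1) {i : ℤ} (hi : i ∈ truncLine lam0)
    (hp : al.1.cupPartner i = i) : al.1.label i = lam.1.label i := by
  have hs := block_sim hJ al lam
  by_cases har : (al.1.label i).IsArrow
  swap
  · exact (hs i).resolve_right fun h => har h.1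
  -- The signs on the cups cancel, so all orientations have the same sum of signs on the rays. There
  -- the labels are sorted, which determines them by `eq_of_sorted`.
  set R := (truncLine lam0).filter fun i => al.1.cupPartner i = i ∧ (al.1.label i).IsArrow with hR
  have hzero : ∀ nu : Block lam0, IsOriented al.1.cupDiagram nu.1 →
      ∑ k ∈ truncLine lam0 \ R, (nu.1.label k).sign = 0 := by
    intro nu hnu
    have hnu' := ((isOriented_cupDiagram_iff (block_sim hJ al nu)).1 hnu).1
    have hcases : ∀ k ∈ truncLine lam0 \ R, al.1.cupPartner k ≠ k ∨
        (al.1.cupPartner k = k ∧ (nu.1.label k).sign = 0) := by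
      intro k hk
      by_cases h1 : al.1.cupPartner k = k
      · right
        refine ⟨h1, ?_⟩
        have h2 : ¬ (nu.1.label k).IsArrow := by
          rw [← (block_sim hJ al nu k).isArrow_iff]
          intro h2
          rw [Finset.mem_sdiff] at hk
          exact hk.2 (Finset.mem_filter.2 ⟨hk.1, h1, h2⟩)
        rcases Label.not_isArrow_iff.1 h2 with h2 | h2 <;> rw [h2] <;> rfl
      · exact Or.inl h1
    refine Finset.sum_involution (fun k _ => al.1.cupPartner k) ?_ ?_ ?_ ?_
    · intro k hk
      rcases hcases k hk with h1 | ⟨h1, h2⟩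
      · rcases al.1.cupPartner_cases k with h' | h' | h'
        · exact (hnu' _ _ h').sign_add
        · exact (hnu' _ _ h').symm.sign_add
        · exact absurd h'.1 h1
      · rw [h1, h2, add_zero]
    · intro k hk hne
      rcases hcases k hk with h1 | ⟨-, h2⟩
      · exact h1
      · exact absurd h2 hne
    · intro k hk
      rw [Finset.mem_sdiff] at hk ⊢
      refine ⟨?_, fun h' => ?_⟩
      · rcases al.1.cupPartner_cases k with h' | h' | h'
        · exact (mem_truncLine_of_isCup hJ al h').2
        · exact (mem_truncLine_of_isCup hJ al h').1
        · rw [h'.1]; exact hk.1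
      · have h1 := (Finset.mem_filter.1 h').2.1
        rw [al.1.cupPartner_cupPartner] at h1
        exact hk.2 (h1 ▸ h')
    · intro k _
      exact al.1.cupPartner_cupPartner k
  have hself := al.1.cupDiagram_spec.1
  have hRsub : R ⊆ truncLine lam0 := Finset.filter_subset _ _
  have hsum : ∀ nu : Block lam0, IsOriented al.1.cupDiagram nu.1 →
      ∑ k ∈ R, (nu.1.label k).sign = truncDown lam0 - truncUp lam0 := by
    intro nu hnu
    rw [← sum_truncLine hJ nu, ← Finset.sum_sdiff hRsub, hzero nu hnu, zero_add]
  refine eq_of_sorted (F := R) (f := al.1.label) (g := lam.1.label) (fun k _ => hs k) ?_ ?_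
    ((hsum al hself).trans (hsum lam h).symm) i (Finset.mem_filter.2 ⟨hi, hp, har⟩)
  · intro k hk l hl hkl
    exact hself.2.2.2 k l (Finset.mem_filter.1 hk).2 (Finset.mem_filter.1 hl).2 hkl
  · intro k hk l hl hkl
    exact h.2.2.2 k l (Finset.mem_filter.1 hk).2 (Finset.mem_filter.1 hl).2 hkl

/-- Orientations of a cup diagram are the orientations of its closure. -/
theorem sub_iff_cl (hJ : IsTruncation lam0 (truncLine lam0)) (al lam : Block lam0) :
    Sub al.1 lam.1 ↔ IsOriented (clArcs hJ al).1 (cl lam) := by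
  have hlink : Linked al.1 lam.1 := al.2.symm.trans lam.2
  unfold Sub
  rw [and_iff_right hlink]
  change _ ↔ IsOriented (cl al).cupDiagram (cl lam)
  have hray : ∀ i, i ∉ (cl al).cupDiagram.ray := by
    intro i hi
    have : i ∈ (clArcs hJ al).1.ray := hi
    rw [clArcs_ray] at this
    exact this
  constructor
  · intro h
    have h2 := ((isOriented_cupDiagram_iff (block_sim hJ al lam)).1 h).1
    refine (isOriented_cupDiagram_iff (cl_sim hJ al lam)).2 ⟨fun i j hij => ?_,
      fun i _ hi => absurd hi (hray i)⟩
    rcases cl_isCup_left al hij with hi | hi <;> rcases cl_isCup_right al hij with hj | hj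
    · rw [cl_of_mem lam hi, cl_of_mem lam hj]
      exact h2 i j ((isCup_cl_iff hJ al hi hj).1 hij)
    -- A vertex of the truncation joined to a new vertex was a ray of `al`. There `lam` agrees with
    -- `al`, so the new cup is oriented.
    · have hp : al.1.cupPartner i = i := by
        rcases al.1.cupPartner_cases i with h' | h' | h'
        · have hm := (mem_truncLine_of_isCup hJ al h').2
          have := ((isCup_cl_iff hJ al hi hm).2 h').right_unique _ hij
          rw [this] at hm
          exact absurd (mem_newRight hj hm) (lt_irrefl _)
        · have h3 := h'.right
          have h4 := hij.left
          rw [cl_of_mem al hi, h3] at h4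
          cases h4
        · exact h'.1
      have h5 := label_eq_of_ray hJ h hi hp
      have h6 := hij.left
      rw [cl_of_mem al hi] at h6
      rw [cl_of_mem lam hi, cl_of_newRight lam hj, ← h5, h6]
      exact Or.inl ⟨rfl, rfl⟩
    · have hp : al.1.cupPartner j = j := by
        rcases al.1.cupPartner_cases j with h' | h' | h'
        · have h3 := h'.left
          have h4 := hij.right
          rw [cl_of_mem al hj, h3] at h4
          cases h4
        · have hm := (mem_truncLine_of_isCup hJ al h').1
          have := ((isCup_cl_iff hJ al hm hj).2 h').left_unique _ hij
          rw [this] at hm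
          exact absurd (mem_newLeft hi hm) (lt_irrefl _)
        · exact h'.1
      have h5 := label_eq_of_ray hJ h hj hp
      have h6 := hij.right
      rw [cl_of_mem al hj] at h6
      rw [cl_of_mem lam hj, cl_of_newLeft lam hi, ← h5, h6]
      exact Or.inl ⟨rfl, rfl⟩
    · rw [cl_of_newLeft lam hi, cl_of_newRight lam hj]
      exact Or.inl ⟨rfl, rfl⟩
  · intro h
    have h2 := ((isOriented_cupDiagram_iff (cl_sim hJ al lam)).1 h).1
    refine (isOriented_cupDiagram_iff (block_sim hJ al lam)).2 ⟨fun i j hij => ?_, ?_⟩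
    · obtain ⟨hi, hj⟩ := mem_truncLine_of_isCup hJ al hij
      have := h2 i j ((isCup_cl_iff hJ al hi hj).2 hij)
      rwa [cl_of_mem lam hi, cl_of_mem lam hj] at this
    -- Suppose `lam` has `∨` and `∧` at rays `i < j`. In the closure `i` cannot be joined to a new
    -- vertex on the left, since both would be `∨`. So `i` starts a cup and `al` has `∨` there.
    -- Likewise `al` has `∧` at `j`, against the orientation of its own rays.
    · rintro i j hi hj hij ⟨hli, hlj⟩
      obtain ⟨hiJ, hjJ⟩ := mem_truncLine_of_swap hJ lam hij hli hlj
      have hcup : ∀ k, k ∈ truncLine lam0 → k ∈ al.1.cupDiagram.ray →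
          (cl al).IsCup k ((cl al).cupPartner k) ∨ (cl al).IsCup ((cl al).cupPartner k) k := by
        intro k hk hkr
        rcases (cl al).cupPartner_cases k with h' | h' | h'
        · exact Or.inl h'
        · exact Or.inr h'
        · refine absurd ⟨h'.1, ?_⟩ (hray k)
          rw [cl_of_mem al hk]
          exact hkr.2
      refine al.1.cupDiagram_spec.1.2.2.2 i j hi hj hij ⟨?_, ?_⟩
      · rcases hcup i hiJ hi with h' | h'
        · have := h'.left
          rwa [cl_of_mem al hiJ] at this
        · exfalso
          rcases cl_isCup_left al h' with h3 | h3
          · have h4 := ((isCup_cl_iff hJ al h3 hiJ).1 h')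
            have h5 := h4.partner_right
            rw [hi.1] at h5
            exact h4.1.ne h5.symm
          · have h4 := h2 _ _ h'
            rw [cl_of_newLeft lam h3, cl_of_mem lam hiJ, hli] at h4
            rcases h4 with h4 | h4
            · cases h4.2
            · cases h4.1
      · rcases hcup j hjJ hj with h' | h'
        · exfalso
          rcases cl_isCup_right al h' with h3 | h3
          · have h4 := ((isCup_cl_iff hJ al hjJ h3).1 h')
            have h5 := h4.partner_left
            rw [hj.1] at h5
            exact h4.1.ne h5
          · have h4 := h2 _ _ h'
            rw [cl_of_newRight lam h3, cl_of_mem lam hjJ, hlj] at h4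
            rcases h4 with h4 | h4
            · cases h4.1
            · cases h4.2
        · have := h'.right
          rwa [cl_of_mem al hjJ] at this

theorem weightHeight_eq {L : Finset ℤ} (lam : Weight (L : Set ℤ)) (x : ℤ) :
    weightHeight lam x = heightOn L lam x :=
  Finset.sum_coe_sort L fun k => if k ≤ x then (lam.label k).sign else 0

/-- The new vertices contribute the same amount to both closures, so the comparison reduces to the
truncation, where dominance is the Bruhat order. -/
theorem le_of_weightHeight_le (hJ : IsTruncation lam0 (truncLine lam0)) {lam mu : Block lam0}
    (h : ∀ x, weightHeight (cl mu) x ≤ weightHeight (cl lam) x) : lam ≤ mu := by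
  refine le_of_heightOn_le (F := truncLine lam0)
    ((block_similarOn hJ lam).symm.trans (block_similarOn hJ mu)) fun x => ?_
  have := h x
  rw [weightHeight_eq, weightHeight_eq, heightOn_cl, heightOn_cl] at this
  omega

theorem sum_sign_of_isOriented {L : Finset ℤ} {S : Set ℤ} {a : Arcs L S} (ha : a.1.ray = ∅)
    {nu : Weight (L : Set ℤ)} (h : IsOriented a.1 nu) : ∑ k ∈ L, (nu.label k).sign = 0 := by
  have hzero : ∀ k, a.1.arc k = k → (nu.label k).sign = 0 := by
    intro k hk
    rcases h.1 k hk (by simp [ha]) with h | h <;> rw [h] <;> rfl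
  refine Finset.sum_involution (fun k _ => a.1.arc k) ?_ ?_ ?_ ?_
  · intro k _
    by_cases hk : a.1.arc k = k
    · rw [hk, hzero k hk, add_zero]
    · exact Label.Opp.sign_add (h.2.1 k hk)
  · exact fun k _ hne hk => hne (hzero k hk)
  · exact fun k hk => arc_mem_line a.1 hk
  · exact fun k _ => a.1.arc_arc k

theorem sign_le_one (l : Label) : l.sign ≤ 1 := by cases l <;> decide

theorem neg_one_le_sign (l : Label) : -1 ≤ l.sign := by cases l <;> decide

theorem sum_clLine (lam0 : Weight I) (f : ℤ → ℤ) : ∑ k ∈ clLine lam0, f k =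
    ∑ k ∈ newLeft (truncLine lam0) (truncUp lam0), f k + ∑ k ∈ truncLine lam0, f k +
      ∑ k ∈ newRight (truncLine lam0) (truncDown lam0), f k := sum_closedLine _ _ _ _

/-- A closed weight below the closure of a weight in the block is itself such a closure. -/
theorem exists_cl_eq (hJ : IsTruncation lam0 (truncLine lam0)) {a d : Arcs (clLine lam0) (clSupp lam0)}
    (ha : a.1.ray = ∅) {kap : Weight (clLine lam0 : Set ℤ)}
    (hk : Compat (cl (baseWeight lam0)) a d kap) {nu : Block lam0}
    (hle : ∀ x, weightHeight (cl nu) x ≤ weightHeight kap x) : ∃ kap' : Block lam0, cl kap' = kap := by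
  have htot := sum_sign_of_isOriented ha hk.1
  have htot' := cl_total hJ nu
  have hheight : ∀ x, heightOn (clLine lam0) (cl nu) x ≤ heightOn (clLine lam0) kap x := fun x => by
    have := hle x
    rwa [weightHeight_eq, weightHeight_eq] at this
  have hsplit : ∀ (w : Weight (clLine lam0 : Set ℤ)) (x : ℤ), heightOn (clLine lam0) w x =
      ∑ k ∈ newLeft (truncLine lam0) (truncUp lam0), (if k ≤ x then (w.label k).sign else 0) +
      ∑ k ∈ truncLine lam0, (if k ≤ x then (w.label k).sign else 0) +
      ∑ k ∈ newRight (truncLine lam0) (truncDown lam0), (if k ≤ x then (w.label k).sign else 0) :=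
    fun w x => sum_closedLine _ _ _ _
  -- Just before the truncation the height of `cl nu` is as large as the number of new vertices
  -- permits. The height of `kap` is at least as large, so all these vertices carry `∨`.
  have hleft : ∀ i ∈ newLeft (truncLine lam0) (truncUp lam0), kap.label i = Label.down := by
    by_cases hne : (truncLine lam0).Nonempty
    · have hx : ∀ w : Weight (clLine lam0 : Set ℤ),
          heightOn (clLine lam0) w ((truncLine lam0).min' hne - 1) =
            ∑ k ∈ newLeft (truncLine lam0) (truncUp lam0), (w.label k).sign := by
        intro w
        rw [hsplit, Finset.sum_eq_zero (s := truncLine lam0), Finset.sum_eq_zero (s := newRight _ _),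
          add_zero, add_zero]
        · refine Finset.sum_congr rfl fun k hk => if_pos ?_
          have := mem_newLeft hk ((truncLine lam0).min'_mem hne)
          omega
        · intro k hk
          have := mem_newRight hk ((truncLine lam0).min'_mem hne)
          exact if_neg (by omega)
        · intro k hk
          have := (truncLine lam0).min'_le k hk
          exact if_neg (by omega)
      have h1 := hheight ((truncLine lam0).min' hne - 1)
      rw [hx, hx, Finset.sum_congr rfl fun k hk => by rw [cl_of_newLeft nu hk]] at h1
      have h2 : ∑ k ∈ newLeft (truncLine lam0) (truncUp lam0), (1 - (kap.label k).sign) = 0 := by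
        refine le_antisymm ?_ (Finset.sum_nonneg fun k _ => sub_nonneg.2 (sign_le_one _))
        rw [Finset.sum_sub_distrib]
        exact sub_nonpos.2 h1
      intro i hi
      have h3 := (Finset.sum_eq_zero_iff_of_nonneg fun k _ => sub_nonneg.2 (sign_le_one _)).1 h2 i hi
      cases hl : kap.label i <;> rw [hl] at h3 <;> first | rfl | exact absurd h3 (by decide)
    · intro i hi
      rw [newLeft, dif_neg hne] at hi
      simp at hi
  -- Both totals are zero, so after the truncation `kap` has to descend at least as far as `cl nu`,
  -- which already uses `∧` at every new vertex.
  have hright : ∀ i ∈ newRight (truncLine lam0) (truncDown lam0), kap.label i = Label.up := by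
    by_cases hne : (truncLine lam0).Nonempty
    · have hx : ∀ w : Weight (clLine lam0 : Set ℤ), ∑ k ∈ clLine lam0, (w.label k).sign =
          heightOn (clLine lam0) w ((truncLine lam0).max' hne) +
            ∑ k ∈ newRight (truncLine lam0) (truncDown lam0), (w.label k).sign := by
        intro w
        rw [hsplit, Finset.sum_eq_zero (s := newRight _ _), add_zero, sum_clLine]
        · congr 2
          · refine Finset.sum_congr rfl fun k hk => (if_pos ?_).symm
            exact (mem_newLeft hk ((truncLine lam0).max'_mem hne)).le
          · exact Finset.sum_congr rfl fun k hk => (if_pos ((truncLine lam0).le_max' k hk)).symm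
        · intro k hk
          have := mem_newRight hk ((truncLine lam0).max'_mem hne)
          exact if_neg (by omega)
      have h1 := hheight ((truncLine lam0).max' hne)
      rw [hx] at htot htot'
      rw [Finset.sum_congr rfl fun k hk => by rw [cl_of_newRight nu hk]] at htot'
      have h2 : ∑ k ∈ newRight (truncLine lam0) (truncDown lam0), ((kap.label k).sign - -1) = 0 := by
        refine le_antisymm ?_ (Finset.sum_nonneg fun k _ => sub_nonneg.2 (neg_one_le_sign _))
        rw [Finset.sum_sub_distrib]
        have h3 : ∑ k ∈ newRight (truncLine lam0) (truncDown lam0), Label.up.sign =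
          ∑ k ∈ newRight (truncLine lam0) (truncDown lam0), (-1 : ℤ) := rfl
        linarith
      intro i hi
      have h3 := (Finset.sum_eq_zero_iff_of_nonneg fun k _ => sub_nonneg.2 (neg_one_le_sign _)).1 h2 i hi
      cases hl : kap.label i <;> rw [hl] at h3 <;> first | rfl | exact absurd h3 (by decide)
    · intro i hi
      rw [newRight, dif_neg hne] at hi
      simp at hi
  -- The labels of `kap` on the truncation, extended by those of `lam0`, give a weight of the block:
  -- the numbers of arrows match because those on the new vertices do.
  obtain ⟨kap', h1, h2⟩ := exists_weight lam0 (truncLine lam0) kap.label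
    fun i hi hiI => absurd (hJ.1 hi) hiI
  have hsim : SimilarOn (truncLine lam0) lam0 kap' := by
    refine ⟨fun i hi => (h2 i hi).symm, fun i => ?_, ?_⟩
    · by_cases hi : i ∈ truncLine lam0
      · rw [h1 i hi]
        have h3 : lam0.label i = (cl (baseWeight lam0)).label i := (cl_of_mem (baseWeight lam0) hi).symm
        by_cases hS : i ∈ clSupp lam0
        · right
          refine ⟨by rw [h3]; exact hS, ?_⟩
          rcases isOriented_label hk.1 hS with h | h
          · exact Or.inl h.1
          · exact Or.inr h.1
        · left
          rw [h3, hk.2.2 i hS]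
      · rw [h2 i hi]; exact Or.inl rfl
    · have hb := cl_total hJ (baseWeight lam0)
      rw [sum_clLine] at htot hb
      rw [Finset.sum_congr rfl fun k hk => by rw [cl_of_newLeft (baseWeight lam0) hk],
        Finset.sum_congr (s₁ := truncLine lam0) rfl fun k hk => by rw [cl_of_mem (baseWeight lam0) hk],
        Finset.sum_congr (s₁ := newRight _ _) rfl fun k hk => by rw [cl_of_newRight (baseWeight lam0) hk]]
        at hb
      rw [Finset.sum_congr rfl fun k hk => by rw [hleft k hk],
        Finset.sum_congr (s₁ := truncLine lam0) rfl fun k hk => by rw [← h1 k hk],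
        Finset.sum_congr (s₁ := newRight _ _) rfl fun k hk => by rw [hright k hk]] at htot
      have hb' : (baseWeight lam0).1 = lam0 := rfl
      rw [hb'] at hb
      linarith
  exact ⟨⟨kap', hsim.linked⟩, (cl_ext (fun i hi => (h1 i hi).symm) hleft hright).symm⟩

end ClosureDiagrams
end ArcAlgebra

namespace ArcAlgebra
open scoped Classical
open MvPolynomial

/-! ### The structure constants of the algebra of a block -/

section Structure

variable {I : Set ℤ} {lam0 : Weight I}

theorem sub_refl (al : Weight I) : Sub al al := ⟨Linked.refl al, al.cupDiagram_spec.1⟩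

theorem compat_of_sub (hJ : IsTruncation lam0 (truncLine lam0)) {al lam be : Block lam0}
    (h1 : Sub al.1 lam.1) (h2 : Sub be.1 lam.1) :
    Compat (cl (baseWeight lam0)) (clArcs hJ al) (clArcs hJ be) (cl lam) := by
  refine ⟨(sub_iff_cl hJ al lam).1 h1, (sub_iff_cl hJ be lam).1 h2, fun i hi => ?_⟩
  exact ((cl_sim hJ lam (baseWeight lam0)) i).resolve_right fun h => hi h.2

/-- Every arrow of a closure is at an end of a cup and is `∨` exactly at left ends, so the cup
diagram determines the labels. The comparison of cup diagrams in `khovanovCoeff` is thus a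
comparison of weights of the block. -/
theorem cl_cupDiagram_injective (hJ : IsTruncation lam0 (truncLine lam0)) {al be : Block lam0}
    (h : (cl al).cupDiagram = (cl be).cupDiagram) : al = be := by
  apply cl_injective hJ
  ext i
  by_cases hi : i ∈ clSupp lam0
  · have hlab : ∀ ga : Block lam0, (cl ga).label i =
        if i < (cl ga).cupDiagram.arc i then Label.down else Label.up := by
      intro ga
      change (cl ga).label i = if i < (cl ga).cupPartner i then Label.down else Label.up
      rcases (cl ga).cupPartner_cases i with h' | h' | h'
      · rw [if_pos h'.1, h'.left]
      · rw [if_neg (not_lt.2 h'.1.le), h'.right]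
      · exact absurd h'.1 ((cl_cupPartner hJ ga i).2 hi)
    rw [hlab, hlab, h]
  · exact (cl_sim hJ al be i).resolve_right fun h => hi ((cl_isArrow hJ al i).1 h.1)

/-- The coefficient of `(a nu d)` in the product of `(a lam b)` and `(b mu d)`. -/
noncomputable def blockCoeff (a b d lam mu nu : Block lam0) : ℕ :=
  khovanovCoeff (cl a).cupDiagram (cl lam) (cl b).cupDiagram (cl b).cupDiagram (cl mu)
    (cl d).cupDiagram (cl nu)

variable {a b c d lam mu rho nu : Block lam0}

theorem closed_coeff_ne_zero (hJ : IsTruncation lam0 (truncLine lam0)) (h1 : Sub a.1 lam.1)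
    (h2 : Sub b.1 lam.1) (h3 : Sub b.1 mu.1) (h4 : Sub d.1 mu.1)
    {kap : Weight (clLine lam0 : Set ℤ)} (h : khovanovCoeff (cl a).cupDiagram (cl lam)
      (cl b).cupDiagram (cl b).cupDiagram (cl mu) (cl d).cupDiagram kap ≠ 0) :
    Compat (cl (baseWeight lam0)) (clArcs hJ a) (clArcs hJ d) kap :=
  compat_of_coeff_ne_zero (b := clArcs hJ b) (clArcs_ray hJ a) (clArcs_ray hJ d)
    (compat_of_sub hJ h1 h2) (compat_of_sub hJ h3 h4) h

/-- Heights do not increase under surgery, and lower heights mean larger weights. This is the source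
of triangularity. -/
theorem le_of_blockCoeff_ne_zero (hJ : IsTruncation lam0 (truncLine lam0)) (h1 : Sub a.1 lam.1)
    (h2 : Sub b.1 lam.1) (h3 : Sub b.1 mu.1) (h4 : Sub d.1 mu.1)
    (h : blockCoeff a b d lam mu nu ≠ 0) : lam ≤ nu ∧ mu ≤ nu := by
  have hc := compat_of_sub hJ h1 h2
  have hc' := compat_of_sub hJ h3 h4
  have := weightHeight_le_of_coeff (b := clArcs hJ b) (clArcs_ray hJ a) (clArcs_ray hJ d)
    hc.1 hc.2.1 hc'.1 hc'.2.1 h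
  exact ⟨le_of_weightHeight_le hJ fun x => (this x).1, le_of_weightHeight_le hJ fun x => (this x).2⟩

/-- Passes from sums over all closed weights to sums over the block when only closures of weights
satisfying `P` contribute. -/
theorem sum_cl [Fintype (Block lam0)] (hJ : IsTruncation lam0 (truncLine lam0))
    (n : Weight (clLine lam0 : Set ℤ) → ℕ) (P : Block lam0 → Prop)
    (h : ∀ kap, n kap ≠ 0 → ∃ kap', cl kap' = kap ∧ P kap') :
    ∑ kap, n kap = ∑ kap' : Block lam0, if P kap' then n (cl kap') else 0 := by
  rw [← Finset.sum_filter, ← Finset.sum_image (f := n) (g := cl) fun _ _ _ _ h => cl_injective hJ h]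
  refine (Finset.sum_subset (Finset.subset_univ _) fun kap _ hk => ?_).symm
  by_contra h0
  obtain ⟨kap', rfl, hP⟩ := h kap h0
  exact hk (Finset.mem_image_of_mem _ (by simpa using hP))

/-- A nonzero term of Khovanov's associativity law has an intermediate weight whose heights are at
least those of `cl nu`. By `exists_cl_eq` it is the closure of a weight of the block. So nothing is
lost by discarding the other diagrams. -/
theorem blockCoeff_assoc [Fintype (Block lam0)] (hJ : IsTruncation lam0 (truncLine lam0))
    (h1 : Sub a.1 lam.1) (h2 : Sub b.1 lam.1) (h3 : Sub b.1 mu.1) (h4 : Sub c.1 mu.1)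
    (h5 : Sub c.1 rho.1) (h6 : Sub d.1 rho.1) (h7 : Sub a.1 nu.1) (h8 : Sub d.1 nu.1) :
    (∑ kap : Block lam0, if Sub a.1 kap.1 ∧ Sub c.1 kap.1 then
      blockCoeff a b c lam mu kap * blockCoeff a c d kap rho nu else 0) =
    ∑ kap : Block lam0, if Sub b.1 kap.1 ∧ Sub d.1 kap.1 then
      blockCoeff b c d mu rho kap * blockCoeff a b d lam kap nu else 0 := by
  have hra := clArcs_ray hJ a
  have hrb := clArcs_ray hJ b
  have hrc := clArcs_ray hJ c
  have hrd := clArcs_ray hJ d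
  have hlam := compat_of_sub hJ h1 h2
  have hmu := compat_of_sub hJ h3 h4
  have hrho := compat_of_sub hJ h5 h6
  have key := khovanov_assoc hra hrb hrc hrd hlam hmu hrho (compat_of_sub hJ h7 h8)
  rw [sum_cl hJ _ (fun kap => Sub a.1 kap.1 ∧ Sub c.1 kap.1),
    sum_cl hJ _ (fun kap => Sub b.1 kap.1 ∧ Sub d.1 kap.1)] at key
  · refine Eq.trans (Finset.sum_congr rfl fun kap _ => ?_)
      (key.trans (Finset.sum_congr rfl fun kap _ => ?_)) <;> split_ifs <;> rfl
  · intro kap h0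
    have hk := closed_coeff_ne_zero hJ h3 h4 h5 h6 (left_ne_zero_of_mul h0)
    have hle := weightHeight_le_of_coeff hra hrd hlam.1 hlam.2.1 hk.1 hk.2.1 (right_ne_zero_of_mul h0)
    obtain ⟨kap', rfl⟩ := exists_cl_eq hJ hrb hk fun x => (hle x).2
    exact ⟨kap', rfl, (sub_iff_cl hJ _ _).2 hk.1, (sub_iff_cl hJ _ _).2 hk.2.1⟩
  · intro kap h0
    have hk := closed_coeff_ne_zero hJ h1 h2 h3 h4 (left_ne_zero_of_mul h0)
    have hle := weightHeight_le_of_coeff hra hrd hk.1 hk.2.1 hrho.1 hrho.2.1 (right_ne_zero_of_mul h0)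
    obtain ⟨kap', rfl⟩ := exists_cl_eq hJ hra hk fun x => (hle x).1
    exact ⟨kap', rfl, (sub_iff_cl hJ _ _).2 hk.1, (sub_iff_cl hJ _ _).2 hk.2.1⟩

theorem cl_left (hJ : IsTruncation lam0 (truncLine lam0)) (al : Block lam0) :
    ∀ i, i < (clArcs hJ al).1.arc i → (cl al).label i = Label.down :=
  (cl al).cupDiagram_spec.2

theorem blockCoeff_leading (hJ : IsTruncation lam0 (truncLine lam0)) (h1 : Sub a.1 mu.1)
    (h2 : Sub d.1 mu.1) : blockCoeff a mu d mu mu mu = 1 :=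
  khovanovCoeff_leading (b := clArcs hJ mu) (clArcs_ray hJ a) (clArcs_ray hJ d)
    ((sub_iff_cl hJ _ _).1 h1) ((sub_iff_cl hJ _ _).1 (sub_refl _)) ((sub_iff_cl hJ _ _).1 h2)
    (cl_left hJ mu)

theorem blockCoeff_unit_left (hJ : IsTruncation lam0 (truncLine lam0)) (h1 : Sub a.1 mu.1)
    (h2 : Sub d.1 mu.1) (h3 : Sub a.1 nu.1) (h4 : Sub d.1 nu.1) :
    blockCoeff a a d a mu nu = if nu = mu then 1 else 0 := by
  have := khovanovCoeff_unit_left (clArcs_ray hJ a) (clArcs_ray hJ d)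
    (compat_of_sub hJ (sub_refl a.1) (sub_refl a.1)) (cl_left hJ a) (compat_of_sub hJ h1 h2)
    (compat_of_sub hJ h3 h4)
  rw [if_congr ((cl_injective hJ).eq_iff) rfl rfl] at this
  exact this

theorem blockCoeff_unit_right (hJ : IsTruncation lam0 (truncLine lam0)) (h1 : Sub a.1 mu.1)
    (h2 : Sub d.1 mu.1) (h3 : Sub a.1 nu.1) (h4 : Sub d.1 nu.1) :
    blockCoeff a d d mu d nu = if nu = mu then 1 else 0 := by
  have := khovanovCoeff_unit_right (clArcs_ray hJ a) (clArcs_ray hJ d)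
    (compat_of_sub hJ (sub_refl d.1) (sub_refl d.1)) (cl_left hJ d) (compat_of_sub hJ h1 h2)
    (compat_of_sub hJ h3 h4)
  rw [if_congr ((cl_injective hJ).eq_iff) rfl rfl] at this
  exact this

/-- The leading coefficients do not depend on the cap diagram on top. -/
theorem blockCoeff_top [Fintype (Block lam0)] (hJ : IsTruncation lam0 (truncLine lam0))
    (h1 : Sub a.1 lam.1) (h2 : Sub b.1 lam.1) (h3 : Sub b.1 mu.1) (h4 : Sub a.1 mu.1)
    (h5 : Sub d.1 mu.1) : blockCoeff a b d lam mu mu = blockCoeff a b mu lam mu mu := by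
  have hr := sub_refl mu.1
  -- Associativity for `(a lam b)`, `(b mu mu)`, `(mu mu d)` at the weight `mu`. In both sums the
  -- intermediate weight is at least `mu` by the inner product and at most `mu` by the outer one,
  -- and one of the two remaining coefficients is a leading one, equal to one.
  have key := blockCoeff_assoc hJ h1 h2 h3 hr hr h5 h4 h5
  rw [Finset.sum_eq_single mu, Finset.sum_eq_single mu, if_pos ⟨h4, hr⟩, if_pos ⟨h3, h5⟩,
    blockCoeff_leading hJ h4 h5, blockCoeff_leading hJ h3 h5, mul_one, one_mul] at key
  · exact key.symm
  · intro kap _ hne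
    split_ifs with hs
    · by_contra h0
      have h6 := (le_of_blockCoeff_ne_zero hJ h3 hr hr h5 (left_ne_zero_of_mul h0)).1
      have h7 := (le_of_blockCoeff_ne_zero hJ h1 h2 hs.1 hs.2 (right_ne_zero_of_mul h0)).2
      exact hne (le_antisymm h7 h6)
    · rfl
  · simp
  · intro kap _ hne
    split_ifs with hs
    · by_contra h0
      have h6 := (le_of_blockCoeff_ne_zero hJ h1 h2 h3 hr (left_ne_zero_of_mul h0)).2
      have h7 := (le_of_blockCoeff_ne_zero hJ hs.1 hs.2 hr h5 (right_ne_zero_of_mul h0)).1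
      exact hne (le_antisymm h7 h6)
    · rfl
  · simp

end Structure

/-! ### The algebra of a block -/

section Algebra

variable (k : Type*) [Field k] {I : Set ℤ} {lam0 : Weight I}

theorem finite_basisIdx [Finite (Block lam0)] : Finite (BasisIdx lam0) :=
  Finite.of_injective (fun X : BasisIdx lam0 => (X.alpha, X.lam, X.beta)) fun X Y h => by
    simp only [Prod.mk.injEq] at h
    exact BasisIdx.ext h.1 h.2.1 h.2.2

theorem mulBasis_apply [Finite (Block lam0)] (X Y Z : BasisIdx lam0) : mulBasis k lam0 X Y Z =
    if Z.alpha = X.alpha ∧ Z.beta = Y.beta then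
      (khovanovCoeff (cl X.alpha).cupDiagram (cl X.lam) (cl X.beta).cupDiagram
          (cl Y.alpha).cupDiagram (cl Y.lam) (cl Y.beta).cupDiagram (cl Z.lam) : k) else 0 := by
  have := finite_basisIdx (lam0 := lam0)
  have : Fintype (BasisIdx lam0) := Fintype.ofFinite _
  rw [mulBasis, finsum_eq_sum_of_fintype, Finsupp.finsetSum_apply, Finset.sum_eq_single Z]
  · split_ifs
    · rw [Finsupp.single_eq_same]
    · rfl
  · intro W _ hW
    split_ifs
    · rw [Finsupp.single_eq_of_ne hW.symm]
    · rfl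
  · simp

theorem mulBasis_of_ne [Finite (Block lam0)] (hJ : IsTruncation lam0 (truncLine lam0))
    {X Y : BasisIdx lam0} (h : X.beta ≠ Y.alpha) : mulBasis k lam0 X Y = 0 := by
  ext Z
  rw [mulBasis_apply, khovanovCoeff, if_neg fun h' => h (cl_cupDiagram_injective hJ h')]
  simp

theorem mulBasis_apply_of_eq [Finite (Block lam0)] {X Y : BasisIdx lam0} (h : X.beta = Y.alpha)
    (Z : BasisIdx lam0) : mulBasis k lam0 X Y Z = if Z.alpha = X.alpha ∧ Z.beta = Y.beta then
      (blockCoeff X.alpha X.beta Y.beta X.lam Y.lam Z.lam : k) else 0 := by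
  rw [mulBasis_apply, ← h]
  rfl

theorem mul_single (X Y : BasisIdx lam0) (r s : k) :
    mul k lam0 (Finsupp.single X r) (Finsupp.single Y s) = (r * s) • mulBasis k lam0 X Y := by
  simp [mul, mul_smul]

theorem sum_basisIdx [Fintype (BasisIdx lam0)] [Fintype (Block lam0)] (a c : Block lam0)
    (f : Block lam0 → k) :
    (∑ W : BasisIdx lam0, if W.alpha = a ∧ W.beta = c then f W.lam else 0) =
      ∑ kap : Block lam0, if Sub a.1 kap.1 ∧ Sub c.1 kap.1 then f kap else 0 := by
  rw [← Finset.sum_filter, ← Finset.sum_filter]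
  refine Finset.sum_bij (fun W _ => W.lam) ?_ ?_ ?_ fun _ _ => rfl
  · intro W hW
    simp only [Finset.mem_filter, Finset.mem_univ, true_and] at hW ⊢
    rw [← hW.1, ← hW.2]
    exact ⟨W.alpha_sub, W.beta_sub⟩
  · intro W hW W' hW' h
    simp only [Finset.mem_filter, Finset.mem_univ, true_and] at hW hW'
    exact BasisIdx.ext (hW.1.trans hW'.1.symm) h (hW.2.trans hW'.2.symm)
  · intro kap hk
    simp only [Finset.mem_filter, Finset.mem_univ, true_and] at hk
    exact ⟨⟨a, kap, c, hk.1, hk.2⟩, by simp, rfl⟩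

theorem mul_mulBasis_left [Fintype (BasisIdx lam0)] (X Y Z : BasisIdx lam0) :
    mul k lam0 (mulBasis k lam0 X Y) (Finsupp.single Z 1) =
      ∑ W, mulBasis k lam0 X Y W • mulBasis k lam0 W Z := by
  conv_lhs => rw [← Finsupp.univ_sum_single (mulBasis k lam0 X Y)]
  rw [map_sum, LinearMap.sum_apply]
  exact Finset.sum_congr rfl fun W _ => by rw [mul_single, mul_one]

theorem mul_mulBasis_right [Fintype (BasisIdx lam0)] (X Y Z : BasisIdx lam0) :
    mul k lam0 (Finsupp.single X 1) (mulBasis k lam0 Y Z) =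
      ∑ W, mulBasis k lam0 Y Z W • mulBasis k lam0 X W := by
  conv_lhs => rw [← Finsupp.univ_sum_single (mulBasis k lam0 Y Z)]
  rw [map_sum]
  exact Finset.sum_congr rfl fun W _ => by rw [mul_single, one_mul]

theorem mulBasis_assoc [Finite (Block lam0)] (hJ : IsTruncation lam0 (truncLine lam0))
    (X Y Z : BasisIdx lam0) :
    mul k lam0 (mulBasis k lam0 X Y) (Finsupp.single Z 1) =
      mul k lam0 (Finsupp.single X 1) (mulBasis k lam0 Y Z) := by
  have := finite_basisIdx (lam0 := lam0)
  have : Fintype (BasisIdx lam0) := Fintype.ofFinite _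
  have : Fintype (Block lam0) := Fintype.ofFinite _
  rw [mul_mulBasis_left, mul_mulBasis_right]
  -- If the caps of one factor do not match the cups of the next, both bracketings vanish, since a
  -- product keeps its outer diagrams.
  by_cases hXY : X.beta = Y.alpha
  swap
  · rw [mulBasis_of_ne k hJ hXY]
    refine (Finset.sum_eq_zero fun W _ => by simp).trans (Finset.sum_eq_zero fun W _ => ?_).symm
    by_cases hYZ : Y.beta = Z.alpha
    · rw [mulBasis_apply_of_eq k hYZ]
      by_cases hW : W.alpha = Y.alpha
      · rw [mulBasis_of_ne k hJ (X := X) (Y := W) (by rwa [hW]), smul_zero]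
      · rw [if_neg fun h => hW h.1, zero_smul]
    · rw [mulBasis_of_ne k hJ hYZ]; simp
  by_cases hYZ : Y.beta = Z.alpha
  swap
  · rw [mulBasis_of_ne k hJ hYZ]
    refine (Finset.sum_eq_zero fun W _ => ?_).trans (Finset.sum_eq_zero fun W _ => by simp).symm
    rw [mulBasis_apply_of_eq k hXY]
    by_cases hW : W.beta = Y.beta
    · rw [mulBasis_of_ne k hJ (X := W) (Y := Z) (by rwa [hW]), smul_zero]
    · rw [if_neg fun h => hW h.2, zero_smul]
  ext V
  simp only [Finsupp.finsetSum_apply, Finsupp.smul_apply, smul_eq_mul]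
  by_cases hV : V.alpha = X.alpha ∧ V.beta = Z.beta
  · have hL : ∀ W : BasisIdx lam0, mulBasis k lam0 X Y W * mulBasis k lam0 W Z V =
        if W.alpha = X.alpha ∧ W.beta = Y.beta then
          ((blockCoeff X.alpha X.beta Y.beta X.lam Y.lam W.lam *
            blockCoeff X.alpha Y.beta Z.beta W.lam Z.lam V.lam : ℕ) : k) else 0 := by
      intro W
      rw [mulBasis_apply_of_eq k hXY]
      split_ifs with hW
      · rw [mulBasis_apply_of_eq k (hW.2.trans hYZ), hW.1, hW.2, if_pos hV, Nat.cast_mul]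
      · rw [zero_mul]
    have hR : ∀ W : BasisIdx lam0, mulBasis k lam0 Y Z W * mulBasis k lam0 X W V =
        if W.alpha = X.beta ∧ W.beta = Z.beta then
          ((blockCoeff X.beta Y.beta Z.beta Y.lam Z.lam W.lam *
            blockCoeff X.alpha X.beta Z.beta X.lam W.lam V.lam : ℕ) : k) else 0 := by
      intro W
      rw [mulBasis_apply_of_eq k hYZ, hXY]
      split_ifs with hW
      · rw [mulBasis_apply_of_eq k (hXY.trans hW.1.symm), hW.2, if_pos hV, Nat.cast_mul, hXY]
      · rw [zero_mul]
    simp only [hL, hR]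
    rw [sum_basisIdx k X.alpha Y.beta fun kap => ((blockCoeff X.alpha X.beta Y.beta X.lam Y.lam kap *
            blockCoeff X.alpha Y.beta Z.beta kap Z.lam V.lam : ℕ) : k),
      sum_basisIdx k X.beta Z.beta fun kap => ((blockCoeff X.beta Y.beta Z.beta Y.lam Z.lam kap *
            blockCoeff X.alpha X.beta Z.beta X.lam kap V.lam : ℕ) : k)]
    have key := blockCoeff_assoc (a := X.alpha) (b := X.beta) (c := Y.beta) (d := Z.beta) hJ X.alpha_sub
      X.beta_sub (mu := Y.lam) (hXY ▸ Y.alpha_sub) Y.beta_sub (rho := Z.lam) (hYZ ▸ Z.alpha_sub)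
      Z.beta_sub (nu := V.lam) (hV.1 ▸ V.alpha_sub) (hV.2 ▸ V.beta_sub)
    have := congrArg (Nat.cast : ℕ → k) key
    push_cast at this ⊢
    exact this
  · refine (Finset.sum_eq_zero fun W _ => ?_).trans (Finset.sum_eq_zero fun W _ => ?_).symm
    · rw [mulBasis_apply k X Y W]
      split_ifs with hW
      · rw [mulBasis_apply k W Z V, if_neg, mul_zero]
        rw [hW.1]; exact hV
      · rw [zero_mul]
    · rw [mulBasis_apply k Y Z W]
      split_ifs with hW
      · rw [mulBasis_apply k X W V, if_neg, mul_zero]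
        rw [hW.2]; exact hV
      · rw [zero_mul]

theorem mul_assoc_of_isTruncation [Finite (Block lam0)] (hJ : IsTruncation lam0 (truncLine lam0))
    (x y z : K k lam0) : mul k lam0 (mul k lam0 x y) z = mul k lam0 x (mul k lam0 y z) := by
  induction x using Finsupp.induction_linear with
  | zero => simp
  | add x x' hx hx' => simp only [map_add, LinearMap.add_apply, hx, hx']
  | single X r =>
    induction y using Finsupp.induction_linear with
    | zero => simp
    | add y y' hy hy' => simp only [map_add, LinearMap.add_apply, hy, hy']
    | single Y s =>
      induction z using Finsupp.induction_linear with
      | zero => simp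
      | add z z' hz hz' => simp only [map_add, hz, hz']
      | single Z t =>
        have h := mulBasis_assoc k hJ X Y Z
        have hX : Finsupp.single X r = r • Finsupp.single X (1 : k) := by simp
        have hZ : Finsupp.single Z t = t • Finsupp.single Z (1 : k) := by simp
        rw [mul_single, mul_single, hX, hZ]
        simp only [map_smul, LinearMap.smul_apply, h, smul_smul]
        congr 1
        ring

end Algebra
end ArcAlgebra

namespace ArcAlgebra
open scoped Classical
open MvPolynomial

/-! ### The cell datum -/

section Cellular

variable (k : Type*) [Field k] {I : Set ℤ} {lam0 : Weight I}

/-- The diagram `(al al al)` is the idempotent at `al`: it fixes the basis vectors with matching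
outer diagram and kills all others. -/
theorem mul_unit [Fintype (Block lam0)] (hJ : IsTruncation lam0 (truncLine lam0)) (x : K k lam0) :
    mul k lam0 (∑ al, C k lam0 al ⟨al, sub_refl al.1⟩ ⟨al, sub_refl al.1⟩) x = x ∧
      mul k lam0 x (∑ al, C k lam0 al ⟨al, sub_refl al.1⟩ ⟨al, sub_refl al.1⟩) = x := by
  induction x using Finsupp.induction_linear with
  | zero => simp
  | add x y hx hy => exact ⟨by rw [map_add, hx.1, hy.1], by rw [map_add, LinearMap.add_apply, hx.2, hy.2]⟩
  | single X r =>
    rw [map_sum, map_sum, LinearMap.sum_apply]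
    simp only [C, mul_single, one_mul, mul_one]
    constructor
    · rw [Finset.sum_eq_single X.alpha]
      · ext Z
        rw [Finsupp.smul_apply, mulBasis_apply_of_eq k rfl]
        by_cases hZ : Z.alpha = X.alpha ∧ Z.beta = X.beta
        · rw [if_pos hZ, blockCoeff_unit_left hJ X.alpha_sub X.beta_sub (hZ.1 ▸ Z.alpha_sub)
            (hZ.2 ▸ Z.beta_sub), Finsupp.single_apply]
          by_cases h : Z.lam = X.lam
          · rw [if_pos h, if_pos (BasisIdx.ext hZ.1 h hZ.2).symm]; simp
          · rw [if_neg h, if_neg fun h' => h (congrArg BasisIdx.lam h').symm]; simp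
        · rw [if_neg hZ, Finsupp.single_eq_of_ne, smul_zero]
          rintro rfl
          exact hZ ⟨rfl, rfl⟩
      · intro al _ hne
        rw [mulBasis_of_ne k hJ hne, smul_zero]
      · simp
    · rw [Finset.sum_eq_single X.beta]
      · ext Z
        rw [Finsupp.smul_apply, mulBasis_apply_of_eq k rfl]
        by_cases hZ : Z.alpha = X.alpha ∧ Z.beta = X.beta
        · rw [if_pos hZ, blockCoeff_unit_right hJ X.alpha_sub X.beta_sub (hZ.1 ▸ Z.alpha_sub)
            (hZ.2 ▸ Z.beta_sub), Finsupp.single_apply]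
          by_cases h : Z.lam = X.lam
          · rw [if_pos h, if_pos (BasisIdx.ext hZ.1 h hZ.2).symm]; simp
          · rw [if_neg h, if_neg fun h' => h (congrArg BasisIdx.lam h').symm]; simp
        · rw [if_neg hZ, Finsupp.single_eq_of_ne, smul_zero]
          rintro rfl
          exact hZ ⟨rfl, rfl⟩
      · intro al _ hne
        rw [mulBasis_of_ne k hJ hne.symm, smul_zero]
      · simp

/-- The pairs of elements of the sets `M lam` index the oriented circle diagrams. -/
def cellIdx (lam0 : Weight I) : (Σ lam, M lam0 lam × M lam0 lam) ≃ BasisIdx lam0 where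
  toFun t := ⟨t.2.1.1, t.1, t.2.2.1, t.2.1.2, t.2.2.2⟩
  invFun X := ⟨X.lam, ⟨X.alpha, X.alpha_sub⟩, ⟨X.beta, X.beta_sub⟩⟩
  left_inv _ := rfl
  right_inv _ := rfl

theorem C_eq_basis : (fun t : (Σ lam, M lam0 lam × M lam0 lam) => C k lam0 t.1 t.2.1 t.2.2) =
    (Finsupp.basisSingleOne (R := k)).reindex (cellIdx lam0).symm := by
  funext t
  simp [cellIdx, C]

theorem star_apply (x : K k lam0) (Z : BasisIdx lam0) :
    star k lam0 x Z = x (BasisIdx.flip lam0 Z) :=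
  Finsupp.mapDomain_equiv_apply (f := BasisIdx.flip lam0) x Z

theorem star_single (X : BasisIdx lam0) (r : k) :
    star k lam0 (Finsupp.single X r) = Finsupp.single (BasisIdx.flip lam0 X) r :=
  Finsupp.mapDomain_single

theorem star_star (x : K k lam0) : star k lam0 (star k lam0 x) = x := by
  ext Z
  rw [star_apply, star_apply]
  rfl

theorem star_mulBasis [Finite (Block lam0)] (hJ : IsTruncation lam0 (truncLine lam0))
    (X Y : BasisIdx lam0) : star k lam0 (mulBasis k lam0 X Y) =
      mulBasis k lam0 (BasisIdx.flip lam0 Y) (BasisIdx.flip lam0 X) := by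
  ext Z
  rw [star_apply, mulBasis_apply, mulBasis_apply]
  refine if_congr and_comm ?_ rfl
  exact congrArg Nat.cast (khovanovCoeff_flip (b := clArcs hJ X.beta) (c := clArcs hJ Y.alpha)
    (clArcs hJ Y.beta) (clArcs hJ X.alpha) (cl Y.lam) (cl X.lam) (cl Z.lam))

theorem star_mul_rev [Finite (Block lam0)] (hJ : IsTruncation lam0 (truncLine lam0))
    (x y : K k lam0) : star k lam0 (mul k lam0 x y) = mul k lam0 (star k lam0 y) (star k lam0 x) := by
  induction x using Finsupp.induction_linear with
  | zero => simp
  | add x x' hx hx' => simp only [map_add, LinearMap.add_apply, hx, hx']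
  | single X r =>
    induction y using Finsupp.induction_linear with
    | zero => simp
    | add y y' hy hy' => simp only [map_add, LinearMap.add_apply, hy, hy']
    | single Y s =>
      rw [mul_single, map_smul, star_single, star_single, mul_single, star_mulBasis k hJ, mul_comm]

/-- Multiplying from the left preserves the upper diagram and can only raise the weight. -/
theorem mul_C_eq_zero [Finite (Block lam0)] (hJ : IsTruncation lam0 (truncLine lam0)) (x : K k lam0)
    {mu : Block lam0} (ga de : M lam0 mu) {Z : BasisIdx lam0} (hZ : ¬ (Z.beta = de.1 ∧ mu ≤ Z.lam)) :
    mul k lam0 x (C k lam0 mu ga de) Z = 0 := by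
  induction x using Finsupp.induction_linear with
  | zero => simp
  | add x x' hx hx' => rw [map_add, LinearMap.add_apply, Finsupp.add_apply, hx, hx', add_zero]
  | single X r =>
    rw [C, mul_single, mul_one, Finsupp.smul_apply]
    by_cases hX : X.beta = ga.1
    · rw [mulBasis_apply_of_eq k hX]
      split_ifs with h
      · by_cases h0 : blockCoeff X.alpha X.beta de.1 X.lam mu Z.lam = 0
        · rw [h0]; simp
        · exact absurd ⟨h.2, (le_of_blockCoeff_ne_zero hJ X.alpha_sub X.beta_sub (hX ▸ ga.2) de.2 h0).2⟩ hZ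
      · rw [smul_zero]
    · rw [mulBasis_of_ne k hJ hX]; simp

/-- By `blockCoeff_top` the coefficient at weight `mu` may be computed with the cap diagram of `mu`
itself on top. It is therefore independent of `de`. -/
theorem mul_C_leading [Finite (Block lam0)] (hJ : IsTruncation lam0 (truncLine lam0)) (x : K k lam0)
    {mu : Block lam0} (ga ga' de : M lam0 mu) :
    mul k lam0 x (C k lam0 mu ga de) ⟨ga'.1, mu, de.1, ga'.2, de.2⟩ =
      mul k lam0 x (C k lam0 mu ga ⟨mu, sub_refl mu.1⟩) ⟨ga'.1, mu, mu, ga'.2, sub_refl mu.1⟩ := by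
  have : Fintype (Block lam0) := Fintype.ofFinite _
  induction x using Finsupp.induction_linear with
  | zero => simp
  | add x x' hx hx' => simp only [map_add, LinearMap.add_apply, Finsupp.add_apply, hx, hx']
  | single X r =>
    rw [C, C, mul_single, mul_single, Finsupp.smul_apply, Finsupp.smul_apply]
    by_cases hX : X.beta = ga.1
    · rw [mulBasis_apply_of_eq k hX, mulBasis_apply_of_eq k hX]
      by_cases h : ga'.1 = X.alpha
      · rw [if_pos ⟨h, rfl⟩, if_pos ⟨h, rfl⟩, blockCoeff_top hJ X.alpha_sub X.beta_sub (hX ▸ ga.2)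
          (h ▸ ga'.2) de.2]
      · rw [if_neg fun h' => h h'.1, if_neg fun h' => h h'.1]
    · rw [mulBasis_of_ne k hJ hX, mulBasis_of_ne k hJ hX]; simp

theorem mem_span_C {mu : Block lam0} {x : K k lam0} (h : ∀ Z, ¬ mu < Z.lam → x Z = 0) :
    x ∈ Submodule.span k {h : K k lam0 | ∃ nu : Block lam0, mu < nu ∧
      ∃ g d : M lam0 nu, h = C k lam0 nu g d} := by
  rw [← Finsupp.sum_single x]
  refine Submodule.sum_mem _ fun Z hZ => ?_
  rw [← mul_one (x Z), ← smul_eq_mul, ← Finsupp.smul_single]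
  refine Submodule.smul_mem _ _ (Submodule.subset_span ⟨Z.lam, ?_, ⟨Z.alpha, Z.alpha_sub⟩,
    ⟨Z.beta, Z.beta_sub⟩, rfl⟩)
  by_contra hlt
  exact Finsupp.mem_support_iff.1 hZ (h Z hlt)

theorem mul_C_sub_mem [Finite (Block lam0)] (hJ : IsTruncation lam0 (truncLine lam0)) (x : K k lam0)
    {mu : Block lam0} (ga de : M lam0 mu) :
    mul k lam0 x (C k lam0 mu ga de) - ∑ᶠ ga' : M lam0 mu,
        mul k lam0 x (C k lam0 mu ga ⟨mu, sub_refl mu.1⟩) ⟨ga'.1, mu, mu, ga'.2, sub_refl mu.1⟩ •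
          C k lam0 mu ga' de ∈
      Submodule.span k {h : K k lam0 | ∃ nu : Block lam0, mu < nu ∧
        ∃ g d : M lam0 nu, h = C k lam0 nu g d} := by
  have : Fintype (M lam0 mu) := Fintype.ofFinite _
  rw [finsum_eq_sum_of_fintype]
  refine mem_span_C k fun Z hZ => ?_
  rw [Finsupp.sub_apply, Finsupp.finsetSum_apply]
  simp only [C, Finsupp.smul_apply, Finsupp.single_apply, smul_eq_mul, mul_ite, mul_one, mul_zero]
  by_cases h : Z.beta = de.1 ∧ mu ≤ Z.lam
  -- A weight that is at least `mu` but not strictly larger is `mu`, and there the leading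
  -- coefficients cancel.
  · have hlam : mu = Z.lam := h.2.eq_of_not_lt hZ
    obtain ⟨al, lam, be, ha, hb⟩ := Z
    obtain ⟨de, hd⟩ := de
    dsimp only at h hlam ⊢
    subst hlam
    obtain rfl : be = de := h.1
    rw [Finset.sum_eq_single ⟨al, ha⟩, if_pos rfl]
    · exact sub_eq_zero.2 (mul_C_leading k hJ x ga ⟨al, ha⟩ ⟨be, hd⟩)
    · intro ga' _ hne
      rw [if_neg]
      intro h'
      exact hne (Subtype.ext (congrArg BasisIdx.alpha h'))
    · simp
  · rw [Finset.sum_eq_zero, sub_zero]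
    · exact mul_C_eq_zero k hJ x ga de h
    · intro ga' _
      rw [if_neg]
      rintro rfl
      exact h ⟨rfl, le_rfl⟩

theorem isCellular [Finite (Block lam0)] (hJ : IsTruncation lam0 (truncLine lam0)) :
    IsCellular (mul k lam0) (M lam0) (C k lam0) (star k lam0) where
  assoc := mul_assoc_of_isTruncation k hJ
  unital := by
    have : Fintype (Block lam0) := Fintype.ofFinite _
    exact ⟨_, mul_unit k hJ⟩
  finite _ := inferInstance
  injective := by
    rw [C_eq_basis]
    exact Module.Basis.injective _
  linearIndependent := by
    rw [C_eq_basis]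
    exact Module.Basis.linearIndependent _
  span := by
    rw [C_eq_basis]
    exact Module.Basis.span_eq _
  star_bijective := Function.Involutive.bijective (star_star k)
  star_mul := star_mul_rev k hJ
  star_C _ _ _ := star_single k _ _
  -- The scalars are the coefficients for the cap diagram of `mu` on top, as dictated by the
  -- statement of `mul_C_sub_mem`.
  mul_C mu x := ⟨fun ga' ga => _, fun ga de => mul_C_sub_mem k hJ x ga de⟩

end Cellular

end ArcAlgebra

theorem corollary4p6 (k : Type*) [Field k] (I : Set ℤ) (hI : I.OrdConnected)
    (lam0 : ArcAlgebra.Weight I) (hfin : Finite (ArcAlgebra.Block lam0)) :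
    ArcAlgebra.IsCellular (ArcAlgebra.mul k lam0) (ArcAlgebra.M lam0) (ArcAlgebra.C k lam0)
      (ArcAlgebra.star k lam0) := by
  exact ArcAlgebra.isCellular k (ArcAlgebra.truncLine_spec hI hfin)
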